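/- **Setting.** Let $m,n\ge 1$ be integers, $E_1<E_2$ and $y_0>0$. Write $D_x=-i\partial_x$, $D_y=-i\partial_y$, $\{A,B\}=AB+BA$, $\langle\xi,\zeta\rangle=(1+\xi^2+\zeta^2)^{1/2}$, and let $\mathrm{Op}$ be Weyl quantization. *The Hamiltonian on $\mathbb R^2$.* Let $\sigma(y,\xi,\zeta)=\sum_{i+j\le m}s_{ij}(y)\xi^i\zeta^j$ be a Hermitian $n\times n$ matrix-valued symbol with smooth coefficients $s_{ij}$, such that: * (ellipticity) for some $c>0$ every eigenvalue of $\sigma(y,\xi,\zeta)$ has absolute value at least $c\langle\xi,\zeta\rangle^m-1$, for all $(y,\xi,\zeta)$; * $\sigma=\sigma_+(\xi,\zeta)$ for $y\ge y_0$ and $\sigma=\sigma_-(\xi,\zeta)$ for $y\le -y_0$, where $\sigma_\pm(\xi,\zeta)$ has no eigenvalue in $(E_1,E_2)$ for any $(\xi,\zeta)$; * the differential operator $H=\mathrm{Op}(\sigma)$ has the form $$H=M_0D_y^m+M_mD_x^m+\sum_{j=0}^m a_j(y)D_x^jD_y^{m-j}+\sum_{i+j\le m-1}a_{ij}(y)D_x^iD_y^j$$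 with $M_0,M_m$ constant, Hermitian and nonsingular; $\{M_0,M_m\}$ is $0$ if $m$ is odd and $\ge 0$ if $m$ is even; and for $i\in\{0,m\}$, $0\le j\le m$ and all $y$, $\{M_i,a_j(y)\}$ is $0$ if $i+j$ is odd and $\ge0$ if $i+j$ is even. *The periodic Hamiltonian.* Let $\sigma'(y,\xi,\zeta)$ be a polynomial in $(\xi,\zeta)$ of degree at most $m$ with coefficients smooth in $y$, such that $\sigma'=\sigma_+$ for $y\le\pi-y_0$, $\sigma'=\sigma_-$ for $y\ge\pi+y_0$, and for every $y'$ there is $y$ with $\sigma'(y',\cdot,\cdot)=\sigma(y,\cdot,\cdot)$. Let $\lambda_0\in(0,1]$ with $\lambda_0y_0\le\pi/2$. For $\lambda\in(0,\lambda_0]$ let $H_\lambda$ be the differential operator in $L^2(\mathbb T^2)\otimes\mathbb C^n$, $\mathbb T=\mathbb R/2\pi\mathbb Z$, with domain the Sobolev space $\mathcal H^m(\mathbb T^2)$, whose (smooth) coefficients are those of $\mathrm{Op}(\sigma(y/\lambda,\lambda\xi,\lambda\zeta))$ for $-\pi/2\le y\le\pi/2$ and those of $\mathrm{Op}(\sigma'(\tfrac{y-\pi}{\lambda}+\pi,\lambda\xi,\lambda\zeta))$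 for $\pi/2\le y\le3\pi/2$. *The conductivity.* Let $\varphi$ be a smooth real function on $\mathbb R$ such that, for some $\delta>0$, $\varphi=0$ on $(-\infty,E_1+\delta]$ and $\varphi=1$ on $[E_2-\delta,\infty)$. Let $P=P(x)$ be smooth and real on $\mathbb T$ with $P=0$ on $[x_1,x_2]$ and $P=1$ on $[x_3,x_4]$, where $-\pi<x_1<-\frac{3\pi}4$, $-\frac\pi2<x_2<x_3<\frac\pi2$, $\frac{3\pi}4<x_4<\pi$. Let $Q(x,y)=Q_X(x)Q_Y(y)$ with $Q_X,Q_Y$ smooth and real on $\mathbb T$, equal to $1$ for $|\theta|\le\frac\pi2$ and to $0$ for $\frac\pi2+\delta_Q\le|\theta|\le\pi$, where $0<\delta_Q<\frac\pi4$. For a self-adjoint operator $A$ in $L^2(\mathbb T^2)\otimes\mathbb C^n$ put $$\tilde\sigma_I(A)=\mathrm{Tr}\; iQ\,[A,P]\,\varphi'(A).$$ *The perturbation.* For $\lambda\in(0,\lambda_0]$ let $$V_\lambda=\sum_{i+j\le m-1}\lambda^{i+j}v_{\lambda,ij}(x,y)D_x^iD_y^j$$ with $v_{\lambda,ij}$ smooth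 $n\times n$ matrix-valued functions on $\mathbb T^2$ such that $V_\lambda$ is symmetric, and assume $\|v_{\lambda,ij}\|_{L^\infty}\le C$ for all $i,j$, uniformly in $\lambda\in(0,\lambda_0]$. Assume that there is a closed set $S_1\subset\mathbb T^2$, independent of $\lambda$, with $\mathrm{supp}(v_{\lambda,ij})\subset S_1$ for all $i,j$ and all $\lambda\in(0,\lambda_0]$, and $\mathrm{supp}((1-Q)P')\cap S_1=\emptyset$. **Theorem 6.1.** For all $\lambda\in(0,\lambda_0]$ the operators $H_\lambda$ and $H_\lambda+V_\lambda$ (with domain $\mathcal H^m(\mathbb T^2)$) are self-adjoint, and for both $A=H_\lambda$ and $A=H_\lambda+V_\lambda$ the operator $iQ[A,P]\varphi'(A)$ is everywhere defined, bounded and trace-class, so that $\tilde\sigma_I(A)$ is well defined. For every $N\in\mathbb N$ there is a constant $C_N$, independent of $\lambda$, such that $$|\tilde\sigma_I(H_\lambda+V_\lambda)-\tilde\sigma_I(H_\lambda)|\le C_N\lambda^N\qquad\text{for all }\lambda\in(0,\lambda_0].$$ -/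

import Mathlib

open MeasureTheory Set
open scoped ContDiff Matrix.Norms.L2Operator

noncomputable section

namespace PeriodicConductivity

/-! ### The torus, its `L²` space and differential operators on it

The torus `𝕋²` is `[-π, π)²` with opposite sides identified.  Functions on `𝕋²` are functions on
`ℝ × ℝ` that are `2π`-periodic in each variable; points are `p = (x, y)`. -/

/-- Complex `n × n` matrices. -/
abbrev Mat (n : ℕ) := Matrix (Fin n) (Fin n) ℂ

/-- `ℂⁿ` with its Hermitian norm. -/
abbrev Cn (n : ℕ) := EuclideanSpace ℂ (Fin n)

/-- A matrix acting on a vector of `ℂⁿ`. -/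
def act {n : ℕ} (A : Mat n) (w : Cn n) : Cn n := Matrix.toEuclideanCLM (n := Fin n) (𝕜 := ℂ) A w

/-- The fundamental cell `[-π, π)²`. -/
def cell : Set (ℝ × ℝ) := Ico (-Real.pi) Real.pi ×ˢ Ico (-Real.pi) Real.pi

/-- Lebesgue measure on the torus. -/
def torusMeasure : Measure (ℝ × ℝ) := volume.restrict cell

/-- The Hilbert space `L²(𝕋²) ⊗ ℂⁿ`. -/
abbrev L2T (n : ℕ) := Lp (Cn n) 2 torusMeasure

/-- Smooth functions on `𝕋²`. -/
structure IsSmoothPeriodic {F : Type*} [NormedAddCommGroup F] [NormedSpace ℝ F]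
    (f : ℝ × ℝ → F) : Prop where
  smooth : ContDiff ℝ ∞ f
  periodic_x : ∀ x y : ℝ, f (x + 2 * Real.pi, y) = f (x, y)
  periodic_y : ∀ x y : ℝ, f (x, y + 2 * Real.pi) = f (x, y)

/-- `D_x = -i ∂_x`. -/
def Dx {n : ℕ} (f : ℝ × ℝ → Cn n) : ℝ × ℝ → Cn n :=
  fun p => (-Complex.I) • fderiv ℝ f p (1, 0)

/-- `D_y = -i ∂_y`. -/
def Dy {n : ℕ} (f : ℝ × ℝ → Cn n) : ℝ × ℝ → Cn n :=
  fun p => (-Complex.I) • fderiv ℝ f p (0, 1)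

/-- `D_x^i D_y^j`. -/
def DD {n : ℕ} (i j : ℕ) (f : ℝ × ℝ → Cn n) : ℝ × ℝ → Cn n := Dx^[i] (Dy^[j] f)

/-- The pairs `(i, j)` of natural numbers with `i + j ≤ m`. -/
def multiIdx (m : ℕ) : Finset (ℕ × ℕ) :=
  (Finset.range (m + 1) ×ˢ Finset.range (m + 1)).filter fun q => q.1 + q.2 ≤ m

/-- The differential expression `∑_{i+j≤m} c_{ij}(x,y) D_x^i D_y^j` applied to a smooth function. -/
def diffExpr {n : ℕ} (m : ℕ) (c : ℕ → ℕ → ℝ × ℝ → Mat n) (f : ℝ × ℝ → Cn n) : ℝ × ℝ → Cn n :=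
  fun p => ∑ q ∈ multiIdx m, act (c q.1 q.2 p) (DD q.1 q.2 f p)

/-- `∑_{i+j≤m} c_{ij} D_x^i D_y^j` is symmetric:
`⟨L f, g⟩ = ⟨f, L g⟩` for all smooth `f`, `g` on the torus. -/
def IsSymmetricDiff {n : ℕ} (m : ℕ) (c : ℕ → ℕ → ℝ × ℝ → Mat n) : Prop :=
  ∀ f g : ℝ × ℝ → Cn n, IsSmoothPeriodic f → IsSmoothPeriodic g →
    ∫ p, inner ℂ (diffExpr m c f p) (g p) ∂torusMeasure =
      ∫ p, inner ℂ (f p) (diffExpr m c g p) ∂torusMeasure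

/-- `g = D_x^i D_y^j u` in the weak sense on `𝕋²`. (`D_x`, `D_y` are formally self-adjoint, so no
sign appears.) -/
def IsWeakD {n : ℕ} (i j : ℕ) (u g : L2T n) : Prop :=
  ∀ f : ℝ × ℝ → Cn n, IsSmoothPeriodic f →
    ∫ p, inner ℂ (DD i j f p) (u p) ∂torusMeasure = ∫ p, inner ℂ (f p) (g p) ∂torusMeasure

lemma contDiff_DD {n : ℕ} (i j : ℕ) {f : ℝ × ℝ → Cn n} (hf : ContDiff ℝ ∞ f) :
    ContDiff ℝ ∞ (DD i j f) := by
  have key : ∀ (w : ℝ × ℝ) (g : ℝ × ℝ → Cn n), ContDiff ℝ ∞ g →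
      ContDiff ℝ ∞ (fun p => (-Complex.I) • fderiv ℝ g p w) := by
    intro w g hg
    exact ((hg.fderiv_right (m := ∞) (by simp)).clm_apply contDiff_const).const_smul _
  have hy : ContDiff ℝ ∞ (Dy^[j] f) := by
    induction j with
    | zero => simpa using hf
    | succ k ih => rw [Function.iterate_succ_apply']; exact key _ _ ih
  unfold DD
  induction i with
  | zero => simpa using hy
  | succ k ih => rw [Function.iterate_succ_apply']; exact key _ _ ih

lemma measurableSet_cell : MeasurableSet cell := measurableSet_Ico.prod measurableSet_Ico

lemma bounded_on_cell {F : Type*} [NormedAddCommGroup F] {f : ℝ × ℝ → F} (hf : Continuous f) :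
    ∃ C, ∀ᵐ p ∂torusMeasure, ‖f p‖ ≤ C := by
  have hK : IsCompact (Icc (-Real.pi) Real.pi ×ˢ Icc (-Real.pi) Real.pi) :=
    isCompact_Icc.prod isCompact_Icc
  obtain ⟨C, hC⟩ := hK.exists_bound_of_continuousOn hf.continuousOn
  refine ⟨C, (ae_restrict_iff' measurableSet_cell).2 (Filter.Eventually.of_forall fun p hp => ?_)⟩
  exact hC p ⟨Ico_subset_Icc_self hp.1, Ico_subset_Icc_self hp.2⟩

instance : IsFiniteMeasure torusMeasure := by
  refine ⟨?_⟩
  rw [torusMeasure, Measure.restrict_apply_univ]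
  refine lt_of_le_of_lt (measure_mono ?_)
    ((isCompact_Icc (a := -Real.pi) (b := Real.pi)).prod
      (isCompact_Icc (a := -Real.pi) (b := Real.pi))).measure_lt_top
  exact fun p hp => ⟨Ico_subset_Icc_self hp.1, Ico_subset_Icc_self hp.2⟩

lemma memLp_of_continuous {F : Type*} [NormedAddCommGroup F] [SecondCountableTopology F]
    {f : ℝ × ℝ → F} (hf : Continuous f) (r : ENNReal) : MemLp f r torusMeasure := by
  obtain ⟨C, hC⟩ := bounded_on_cell hf
  exact MemLp.of_bound hf.aestronglyMeasurable C hC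

lemma integrable_inner_of_continuous {n : ℕ} {f : ℝ × ℝ → Cn n} (hf : Continuous f) (u : L2T n) :
    Integrable (fun p => inner ℂ (f p) (u p)) torusMeasure := by
  have h := L2.integrable_inner (𝕜 := ℂ) ((memLp_of_continuous hf 2).toLp f) u
  refine h.congr ?_
  filter_upwards [(memLp_of_continuous hf 2).coeFn_toLp] with p hp
  rw [hp]

lemma IsWeakD.add {n i j : ℕ} {u u' g g' : L2T n} (h : IsWeakD i j u g) (h' : IsWeakD i j u' g') :
    IsWeakD i j (u + u') (g + g') := by
  intro f hf
  have aux : ∀ (k : ℝ × ℝ → Cn n), Continuous k → ∀ a b : L2T n,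
      ∫ p, inner ℂ (k p) ((a + b : L2T n) p) ∂torusMeasure =
        ∫ p, inner ℂ (k p) (a p) ∂torusMeasure + ∫ p, inner ℂ (k p) (b p) ∂torusMeasure := by
    intro k hk a b
    rw [← integral_add (integrable_inner_of_continuous hk a) (integrable_inner_of_continuous hk b)]
    refine integral_congr_ae ?_
    filter_upwards [Lp.coeFn_add a b] with p hp
    rw [hp, Pi.add_apply, inner_add_right]
  rw [aux _ (contDiff_DD i j hf.smooth).continuous, aux _ hf.smooth.continuous, h f hf, h' f hf]

lemma IsWeakD.smul {n i j : ℕ} {u g : L2T n} (r : ℂ) (h : IsWeakD i j u g) :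
    IsWeakD i j (r • u) (r • g) := by
  intro f hf
  have aux : ∀ (k : ℝ × ℝ → Cn n) (a : L2T n),
      ∫ p, inner ℂ (k p) ((r • a : L2T n) p) ∂torusMeasure =
        r * ∫ p, inner ℂ (k p) (a p) ∂torusMeasure := by
    intro k a
    rw [← integral_const_mul]
    refine integral_congr_ae ?_
    filter_upwards [Lp.coeFn_smul r a] with p hp
    rw [hp, Pi.smul_apply, inner_smul_right]
  rw [aux, aux, h f hf]

/-- The graph of `∑_{i+j≤m} c_{ij} D_x^i D_y^j` as an operator in `L²(𝕋²) ⊗ ℂⁿ` with domain the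
Sobolev space of order `m`: all pairs `(u, g)` such that `u` has weak derivatives
`d_{ij} = D_x^i D_y^j u` in `L²` for all `i + j ≤ m`, and `g = ∑ c_{ij} d_{ij}`. -/
def diffGraph {n : ℕ} (m : ℕ) (c : ℕ → ℕ → ℝ × ℝ → Mat n) : Submodule ℂ (L2T n × L2T n) where
  carrier := {z | ∃ d : ℕ → ℕ → L2T n,
    (∀ q ∈ multiIdx m, IsWeakD q.1 q.2 z.1 (d q.1 q.2)) ∧
    ∀ᵐ p ∂torusMeasure, z.2 p = ∑ q ∈ multiIdx m, act (c q.1 q.2 p) (d q.1 q.2 p)}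
  zero_mem' := by
    refine ⟨fun _ _ => 0, fun q _ f _ => ?_, ?_⟩
    · have : ∀ (k : ℝ × ℝ → Cn n),
          ∫ p, inner ℂ (k p) ((0 : L2T n) p) ∂torusMeasure = 0 := by
        intro k
        rw [integral_eq_zero_of_ae]
        filter_upwards [Lp.coeFn_zero (Cn n) 2 torusMeasure] with p hp
        rw [hp]; simp
      exact (this _).trans (this _).symm
    · filter_upwards [Lp.coeFn_zero (Cn n) 2 torusMeasure] with p hp
      change (0 : L2T n) p = _
      rw [hp]; simp [act]
  add_mem' := by
    rintro ⟨u, g⟩ ⟨u', g'⟩ ⟨d, hd, hg⟩ ⟨d', hd', hg'⟩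
    refine ⟨fun i j => d i j + d' i j, fun q hq => (hd q hq).add (hd' q hq), ?_⟩
    have hall : ∀ᵐ p ∂torusMeasure, ∀ q ∈ multiIdx m,
        (d q.1 q.2 + d' q.1 q.2 : L2T n) p = d q.1 q.2 p + d' q.1 q.2 p :=
      (Finset.eventually_all _).2 fun q _ => Lp.coeFn_add _ _
    filter_upwards [hg, hg', hall, Lp.coeFn_add g g'] with p h1 h2 h3 h4
    change (g + g' : L2T n) p = _
    change g p = _ at h1
    change g' p = _ at h2
    rw [h4, Pi.add_apply, h1, h2, ← Finset.sum_add_distrib]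
    refine Finset.sum_congr rfl fun q hq => ?_
    rw [h3 q hq, act, act, act, map_add]
  smul_mem' := by
    rintro r ⟨u, g⟩ ⟨d, hd, hg⟩
    refine ⟨fun i j => r • d i j, fun q hq => (hd q hq).smul r, ?_⟩
    have hall : ∀ᵐ p ∂torusMeasure, ∀ q ∈ multiIdx m,
        (r • d q.1 q.2 : L2T n) p = r • d q.1 q.2 p :=
      (Finset.eventually_all _).2 fun q _ => Lp.coeFn_smul _ _
    filter_upwards [hg, hall, Lp.coeFn_smul r g] with p h1 h3 h4
    change (r • g : L2T n) p = _
    change g p = _ at h1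
    rw [h4, Pi.smul_apply, h1, Finset.smul_sum]
    refine Finset.sum_congr rfl fun q hq => ?_
    rw [h3 q hq, act, act, map_smul]

/-- The unbounded operator `∑_{i+j≤m} c_{ij}(x,y) D_x^i D_y^j` in `L²(𝕋²) ⊗ ℂⁿ`, with domain the
Sobolev space of order `m`. -/
def diffOp {n : ℕ} (m : ℕ) (c : ℕ → ℕ → ℝ × ℝ → Mat n) : L2T n →ₗ.[ℂ] L2T n :=
  (diffGraph m c).toLinearPMap

/-- Pointwise multiplication by a bounded measurable real function (`0` for other functions). -/
def mulOp {n : ℕ} (w : ℝ × ℝ → ℝ) : L2T n →L[ℂ] L2T n :=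
  open Classical in
  if h : MemLp (fun p => (w p : ℂ)) ⊤ torusMeasure then
    (ContinuousLinearMap.lsmul ℂ ℂ).holderL torusMeasure ⊤ 2 2 (h.toLp _)
  else 0

lemma mulOp_apply {n : ℕ} {w : ℝ × ℝ → ℝ} (hw : Continuous w) (u : L2T n) :
    ∀ᵐ p ∂torusMeasure, mulOp w u p = (w p : ℂ) • u p := by
  have h : MemLp (fun p => (w p : ℂ)) ⊤ torusMeasure :=
    memLp_of_continuous (Complex.continuous_ofReal.comp hw) _
  rw [mulOp, dif_pos h]
  filter_upwards [(ContinuousLinearMap.lsmul ℂ ℂ).coeFn_holder (r := 2) (h.toLp _) u,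
    h.coeFn_toLp] with p h1 h2
  refine h1.trans ?_
  rw [h2]; rfl

/-! ### Resolvent, functional calculus, commutator and trace -/

section Hilbert

variable {E : Type*} [NormedAddCommGroup E] [InnerProductSpace ℂ E] [CompleteSpace E]

/-- `R = (z - A)⁻¹` for an unbounded operator `A`. -/
def IsResolvent (A : E →ₗ.[ℂ] E) (z : ℂ) (R : E →L[ℂ] E) : Prop :=
  (∀ u : E, ∃ h : R u ∈ A.domain, z • R u - A ⟨R u, h⟩ = u) ∧
    ∀ u : A.domain, R (z • (u : E) - A u) = u

/-- The resolvent `(z - A)⁻¹`; it exists for every nonreal `z` if `A` is self-adjoint. -/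
def resolventOp (A : E →ₗ.[ℂ] E) (z : ℂ) : E →L[ℂ] E :=
  open Classical in if h : ∃ R, IsResolvent A z R then h.choose else 0

/-- `f(A)` for a self-adjoint operator `A` and a continuous function `f` that vanishes at infinity:
the normal operator `R = (i - A)⁻¹` corresponds to the function `w = (i - x)⁻¹` of `x`, that is,
`x = i - 1/w`, so `f(A)` is `w ↦ f(i - 1/w)`, with value `0` at `w = 0` (that is, `x = ∞`), applied
to `R` in the continuous functional calculus. -/
def funcCalc (A : E →ₗ.[ℂ] E) (f : ℝ → ℝ) : E →L[ℂ] E :=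
  open Classical in
  cfc (fun w : ℂ => if w = 0 then 0 else ((f (Complex.I - w⁻¹).re : ℝ) : ℂ))
    (resolventOp A Complex.I)

/-- The commutator `[A, P] = A P - P A` on its natural domain `{u ∈ D(A) : P u ∈ D(A)}`. -/
def commOp (A : E →ₗ.[ℂ] E) (P : E →L[ℂ] E) : E →ₗ.[ℂ] E where
  domain := A.domain ⊓ A.domain.comap (P : E →ₗ[ℂ] E)
  toFun :=
    { toFun := fun u => A ⟨P u, u.2.2⟩ - P (A ⟨u, u.2.1⟩)
      map_add' := by
        intro u v
        have h1 : A ⟨P ((u + v : _) : E), (u + v).2.2⟩ = A ⟨P u, u.2.2⟩ + A ⟨P v, v.2.2⟩ := by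
          rw [← LinearPMap.map_add]; congr 1; ext; simp
        have h2 : A ⟨((u + v : _) : E), (u + v).2.1⟩ = A ⟨u, u.2.1⟩ + A ⟨v, v.2.1⟩ := by
          rw [← LinearPMap.map_add]; rfl
        rw [h1, h2, map_add]; abel
      map_smul' := by
        intro r u
        have h1 : A ⟨P ((r • u : _) : E), (r • u).2.2⟩ = r • A ⟨P u, u.2.2⟩ := by
          rw [← LinearPMap.map_smul]; congr 1; ext; simp
        have h2 : A ⟨((r • u : _) : E), (r • u).2.1⟩ = r • A ⟨u, u.2.1⟩ := by
          rw [← LinearPMap.map_smul]; rfl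
        rw [h1, h2, map_smul, RingHom.id_apply, smul_sub] }

/-- The bounded operator `T` is `i Q [A, P] F`: the range of `F` lies in the domain of `[A, P]`, and
`T u = i Q [A, P] F u` for all `u`. -/
def IsConductivityOp (A : E →ₗ.[ℂ] E) (P Q F T : E →L[ℂ] E) : Prop :=
  ∀ u : E, ∃ h : F u ∈ (commOp A P).domain, T u = Complex.I • Q (commOp A P ⟨F u, h⟩)

/-- The operator `i Q [A, P] F`, if it is everywhere defined and bounded (`0` otherwise). -/
def conductivityOp (A : E →ₗ.[ℂ] E) (P Q F : E →L[ℂ] E) : E →L[ℂ] E :=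
  open Classical in if h : ∃ T, IsConductivityOp A P Q F T then h.choose else 0

/-- `T` is trace-class: `∑_k ⟨ψ_k, |T| ψ_k⟩ < ∞` for every Hilbert basis `(ψ_k)`, where
`|T| = (T* T)^{1/2}`. -/
def IsTraceClass (T : E →L[ℂ] E) : Prop :=
  ∀ (s : Set E) (b : HilbertBasis s ℂ E), Summable fun k => (inner ℂ (b k) (CFC.abs T (b k))).re

/-- `Tr T = ∑_k ⟨ψ_k, T ψ_k⟩` for a Hilbert basis `(ψ_k)`. -/
def trace (T : E →L[ℂ] E) : ℂ :=
  ∑' k, inner ℂ ((exists_hilbertBasis ℂ E).choose_spec.choose k)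
    (T ((exists_hilbertBasis ℂ E).choose_spec.choose k))

end Hilbert

/-- The periodic interface conductivity `Tr i Q [A, P] φ'(A)`. -/
def conductivity {n : ℕ} (A : L2T n →ₗ.[ℂ] L2T n) (P Q : ℝ × ℝ → ℝ) (φ : ℝ → ℝ) : ℂ :=
  trace (conductivityOp A (mulOp P) (mulOp Q) (funcCalc A (deriv φ)))

/-- All objects in `Tr i Q [A, P] φ'(A)` make sense: `A` is self-adjoint, and `i Q [A, P] φ'(A)` is
everywhere defined, bounded and trace-class. -/
structure ConductivityWellDefined {n : ℕ} (A : L2T n →ₗ.[ℂ] L2T n) (P Q : ℝ × ℝ → ℝ)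
    (φ : ℝ → ℝ) : Prop where
  selfAdjoint : IsSelfAdjoint A
  isOp : IsConductivityOp A (mulOp P) (mulOp Q) (funcCalc A (deriv φ))
    (conductivityOp A (mulOp P) (mulOp Q) (funcCalc A (deriv φ)))
  traceClass : IsTraceClass (conductivityOp A (mulOp P) (mulOp Q) (funcCalc A (deriv φ)))

/-! ### Symbols and the periodic Hamiltonian -/

/-- The symbol `σ(y, ξ, ζ) = ∑_{i+j≤m} s_{ij}(y) ξ^i ζ^j`. -/
def symbol {n : ℕ} (m : ℕ) (s : ℕ → ℕ → ℝ → Mat n) (y ξ ζ : ℝ) : Mat n :=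
  ∑ q ∈ multiIdx m, ((ξ ^ q.1 * ζ ^ q.2 : ℝ) : ℂ) • s q.1 q.2 y

/-- The coefficients of the Weyl quantization of `∑_{i+j≤m} s_{ij}(y) ξ^i ζ^j`: one has
`Op(σ) = ∑_{i+j≤m} c_{ij}(y) D_x^i D_y^j` where `∑ c_{ij} ξ^i ζ^j = exp(-(i/2) ∂_y ∂_ζ) σ`, that is,
`c_{ij} = ∑_k (-i/2)^k (j+k choose k) ∂_y^k s_{i,j+k}`.
In particular `c_{ij} = s_{ij}` in the leading order `i + j = m`. -/
def weylCoeff {n : ℕ} (m : ℕ) (s : ℕ → ℕ → ℝ → Mat n) (i j : ℕ) (y : ℝ) : Mat n :=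
  ∑ k ∈ Finset.range (m + 1 - (i + j)),
    ((-Complex.I / 2) ^ k * ((j + k).choose k : ℂ)) • iteratedDeriv k (s i (j + k)) y

/-- The coefficient `a_j(y)` of `D_x^j D_y^{m-j}` in
`Op(σ) = M₀ D_y^m + M_m D_x^m + ∑_{j=0}^m a_j(y) D_x^j D_y^{m-j} + (lower order)`. -/
def leadCoeff {n : ℕ} (m : ℕ) (M₀ Mm : Mat n) (s : ℕ → ℕ → ℝ → Mat n) (j : ℕ) (y : ℝ) : Mat n :=
  s j (m - j) y - (if j = 0 then M₀ else 0) - (if j = m then Mm else 0)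

open scoped ComplexOrder in
/-- The condition that an anticommutator `{A, B} = A B + B A` vanishes when `k` is odd and is
positive semidefinite when `k` is even. -/
def AnticommCond {n : ℕ} (k : ℕ) (A B : Mat n) : Prop :=
  (Odd k → A * B + B * A = 0) ∧ (Even k → (A * B + B * A).PosSemidef)

/-- The assumptions on the infinite-space Hamiltonian `H = Op(σ)`,
`σ(y, ξ, ζ) = ∑_{i+j≤m} s_{ij}(y) ξ^i ζ^j`, a symmetric differential operator of order `m` on `ℝ²`.
Constant symbols `σ_±` have coefficients `sp`, `sm`. -/
structure IsBulkHamiltonian {n : ℕ} (m : ℕ) (E₁ E₂ y₀ : ℝ) (s : ℕ → ℕ → ℝ → Mat n)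
    (sp sm : ℕ → ℕ → Mat n) : Prop where
  smooth : ∀ q ∈ multiIdx m, ContDiff ℝ ∞ (s q.1 q.2)
  /-- the symbol is Hermitian-valued, i.e. `H` is symmetric -/
  hermitian : ∀ y ξ ζ, (symbol m s y ξ ζ).IsHermitian
  /-- ellipticity: `|σ_min(y, ξ, ζ)| ≥ c ⟨ξ, ζ⟩^m - 1`. The symbol estimates of order `m` are
  automatic, as the `s_{ij}` are smooth and constant on each side of `[-y₀, y₀]`. -/
  elliptic : ∃ c > 0, ∀ y ξ ζ : ℝ, ∀ w : Cn n,
    (c * Real.sqrt (1 + ξ ^ 2 + ζ ^ 2) ^ m - 1) * ‖w‖ ≤ ‖act (symbol m s y ξ ζ) w‖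
  eq_plus : ∀ q ∈ multiIdx m, ∀ y, y₀ ≤ y → s q.1 q.2 y = sp q.1 q.2
  eq_minus : ∀ q ∈ multiIdx m, ∀ y, y ≤ -y₀ → s q.1 q.2 y = sm q.1 q.2
  /-- `σ_±` have no spectrum in `(E₁, E₂)` -/
  gap_plus : ∀ ξ ζ,
    Disjoint (spectrum ℝ (symbol m (fun i j _ => sp i j) 0 ξ ζ)) (Ioo E₁ E₂)
  gap_minus : ∀ ξ ζ,
    Disjoint (spectrum ℝ (symbol m (fun i j _ => sm i j) 0 ξ ζ)) (Ioo E₁ E₂)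
  /-- structure of the leading-order terms -/
  leading : ∃ M₀ Mm : Mat n, M₀.IsHermitian ∧ Mm.IsHermitian ∧ IsUnit M₀ ∧ IsUnit Mm ∧
    AnticommCond m M₀ Mm ∧
    ∀ y, ∀ j ≤ m, AnticommCond j M₀ (leadCoeff m M₀ Mm s j y) ∧
      AnticommCond (m + j) Mm (leadCoeff m M₀ Mm s j y)

/-- `σ'`, with coefficients `s'`, describes a reversed domain wall at `y = π`: it is smooth, equals
`σ_+` for `y ≤ π - y₀` and `σ_-` for `y ≥ π + y₀`, and each `σ'(y', ·)` is some `σ(y, ·)`. -/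
structure IsReversedWall {n : ℕ} (m : ℕ) (y₀ : ℝ) (s s' : ℕ → ℕ → ℝ → Mat n)
    (sp sm : ℕ → ℕ → Mat n) : Prop where
  smooth : ∀ q ∈ multiIdx m, ContDiff ℝ ∞ (s' q.1 q.2)
  eq_plus : ∀ q ∈ multiIdx m, ∀ y, y ≤ Real.pi - y₀ → s' q.1 q.2 y = sp q.1 q.2
  eq_minus : ∀ q ∈ multiIdx m, ∀ y, Real.pi + y₀ ≤ y → s' q.1 q.2 y = sm q.1 q.2
  range : ∀ y', ∃ y, ∀ ξ ζ, symbol m s' y' ξ ζ = symbol m s y ξ ζ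

/-- The symbol coefficients of the periodic Hamiltonian, as `2π`-periodic functions of `y`: those of
`σ(y/λ, λξ, λζ)` for `-π/2 ≤ y ≤ π/2` and of `σ'((y-π)/λ + π, λξ, λζ)` for `π/2 < y < 3π/2`. -/
def gluedCoeff {n : ℕ} (s s' : ℕ → ℕ → ℝ → Mat n) (lam : ℝ) (i j : ℕ) (y : ℝ) : Mat n :=
  let t := toIcoMod Real.two_pi_pos (-(Real.pi / 2)) y
  if t ≤ Real.pi / 2 then ((lam ^ (i + j) : ℝ) : ℂ) • s i j (t / lam)
  else ((lam ^ (i + j) : ℝ) : ℂ) • s' i j ((t - Real.pi) / lam + Real.pi)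

/-- The periodic Hamiltonian `H_λ` in `L²(𝕋²) ⊗ ℂⁿ`. -/
def periodicH {n : ℕ} (m : ℕ) (s s' : ℕ → ℕ → ℝ → Mat n) (lam : ℝ) : L2T n →ₗ.[ℂ] L2T n :=
  diffOp m fun i j p => weylCoeff m (gluedCoeff s s' lam) i j p.2

/-- The perturbation `V_λ = ∑_{i+j≤m-1} λ^{i+j} v_{λ,ij}(x,y) D_x^i D_y^j`: its coefficients. -/
def scaledCoeff {n : ℕ} (lam : ℝ) (v : ℕ → ℕ → ℝ × ℝ → Mat n) (i j : ℕ) (p : ℝ × ℝ) : Mat n :=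
  ((lam ^ (i + j) : ℝ) : ℂ) • v i j p

/-! ### Switch functions, filters -/

/-- Smooth real functions equal to `c₁` for `x ≤ e₁ + δ` and to `c₂` for `x ≥ e₂ - δ`, for some
`δ > 0`. -/
def IsSwitch (c₁ c₂ e₁ e₂ : ℝ) (f : ℝ → ℝ) : Prop :=
  ContDiff ℝ ∞ f ∧ ∃ δ > 0, (∀ x ≤ e₁ + δ, f x = c₁) ∧ ∀ x, e₂ - δ ≤ x → f x = c₂

/-- The spatial switch `P` on `𝕋`. -/
def IsPeriodicSwitch (P : ℝ → ℝ) : Prop :=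
  ContDiff ℝ ∞ P ∧ Function.Periodic P (2 * Real.pi) ∧
  ∃ x₁ x₂ x₃ x₄ : ℝ, -Real.pi < x₁ ∧ x₁ < -(3 * Real.pi / 4) ∧ -(Real.pi / 2) < x₂ ∧ x₂ < x₃ ∧
    x₃ < Real.pi / 2 ∧ 3 * Real.pi / 4 < x₄ ∧ x₄ < Real.pi ∧
    (∀ x ∈ Icc x₁ x₂, P x = 0) ∧ ∀ x ∈ Icc x₃ x₄, P x = 1

/-- A cutoff `Q_Θ` on `𝕋`: `1` for `|θ| ≤ π/2` and `0` for `π/2 + δ ≤ |θ| ≤ π`. -/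
def IsFilter (δ : ℝ) (q : ℝ → ℝ) : Prop :=
  ContDiff ℝ ∞ q ∧ Function.Periodic q (2 * Real.pi) ∧
  (∀ θ, |θ| ≤ Real.pi / 2 → q θ = 1) ∧
  ∀ θ, Real.pi / 2 + δ ≤ |θ| → |θ| ≤ Real.pi → q θ = 0

end PeriodicConductivity

end

/-! Let `A` be either operator. Since `[A, P] φ'(A)` has finite rank, cyclicity gives it trace zero,
so the conductivity is `-i Tr (1 - Q) [A, P] φ'(A)` (`trace_commutator_eq_zero`,
`conductivity_spec`). The operator `B = (1 - Q) [A, P]` only sees the support of `(1 - Q) P'`, where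
the perturbed and unperturbed coefficients agree, so `B` is the same for both operators. It remains
to show two things: `B φ'(A)` changes in operator norm by `O(λ^r)` for every `r` under a
perturbation supported away from `B`, and both ranks are `O(λ⁻²)`. As `|Tr S|` is at most rank times
norm, the choice `r = N + 2` then suffices.

Locality. The function `(i - x) φ'(x)`, read on the circle through the Cayley transform `U = (A +
i)(A - i)⁻¹`, is smooth and vanishes near `1`. Its Fourier series expresses `φ'(A)` by powers of `U`
and `U*` with rapidly decreasing coefficients (`exists_cayley_series`, `hasSum_cfc_cayleyFun`). The
difference of the `k`-th powers for the two operators telescopes into terms with `B` on the left and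
the perturbation on the right. Between their supports there is room for arbitrarily many nested
cutoffs. Moving a cutoff through `U^k` costs at most `2k` commutators, each of size `O(λ)`. With `r`
cutoffs this gives `(2k + 1)^(r + 1) λ^r` (`CutoffChain.norm_sub_le`), which the coefficients absorb
(`norm_mul_weightCalc_sub_le`).

Uniformity. The unbounded operators are written `A = T J⁻¹` with `J = (1 + |λD_x|^m + |λD_y|^m)⁻¹`
and `T` bounded. All constants then come from a bound on `(±iJ - T)⁻¹` that is uniform in `λ`. It
follows from the elliptic estimate `‖w‖ ≤ C (‖T w‖ + ‖J w‖)` (`exists_a_priori_bound`). To get this,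
pair `H f` with `(M₀ Y^m + M_m X^m) f`, where `X = λD_x` and `Y = λD_y`. After integrating by parts,
the anticommutator conditions make every mixed term nonnegative up to terms of lower order, which
are absorbed by interpolation. The estimate holds along the segment from the constant-coefficient
operator to `T`, so invertibility propagates along it (`isUnit_of_path`); self-adjointness is a
consequence.

Rank. Put `w = N g(A) v` with `N = (iJ - T)⁻¹` and `g(x) = (i - x) φ'(x)`. A cutoff equal to `1` on
the support of `φ'` gives `‖w‖ ≤ C ‖J w‖`, so `w` is determined by its Fourier modes with `|λk|,
|λl| ≤ Λ`, of which there are `O(λ⁻²)` (`finrank_weightCalc_le`, `exists_low_modes`). -/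

noncomputable section

namespace PeriodicConductivity

set_option linter.unusedSectionVars false

/-! ### Finite-rank operators: trace, cyclicity and trace class. -/

section FiniteRank

variable {E : Type*} [NormedAddCommGroup E] [InnerProductSpace ℂ E] [CompleteSpace E]

/-- A bounded operator with finite-dimensional range. -/
def FiniteRank (T : E →L[ℂ] E) : Prop := FiniteDimensional ℂ T.range

lemma FiniteRank.mul_left {T : E →L[ℂ] E} (hT : FiniteRank T) (S : E →L[ℂ] E) :
    FiniteRank (S * T) := by
  have : FiniteDimensional ℂ T.range := hT
  have h : (S * T).range = T.range.map (S : E →ₗ[ℂ] E) := by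
    ext x; simp [LinearMap.mem_range]
  unfold FiniteRank
  rw [h]; infer_instance

lemma FiniteRank.mul_right {T : E →L[ℂ] E} (hT : FiniteRank T) (S : E →L[ℂ] E) :
    FiniteRank (T * S) := by
  have : FiniteDimensional ℂ T.range := hT
  refine Submodule.finiteDimensional_of_le (S₂ := T.range) ?_
  rintro _ ⟨x, rfl⟩; exact ⟨S x, rfl⟩

lemma range_sub_le (S T : E →L[ℂ] E) : (S - T).range ≤ S.range ⊔ T.range := by
  rintro _ ⟨x, rfl⟩
  exact Submodule.sub_mem _ (Submodule.mem_sup_left ⟨x, rfl⟩) (Submodule.mem_sup_right ⟨x, rfl⟩)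

lemma FiniteRank.sub {S T : E →L[ℂ] E} (hS : FiniteRank S) (hT : FiniteRank T) :
    FiniteRank (S - T) := by
  have : FiniteDimensional ℂ T.range := hT
  have : FiniteDimensional ℂ S.range := hS
  exact Submodule.finiteDimensional_of_le (range_sub_le S T)

lemma FiniteRank.eq_sum {T : E →L[ℂ] E} (hT : FiniteRank T) :
    ∃ e : Fin (Module.finrank ℂ T.range) → E, (∀ i, ‖e i‖ = 1) ∧
      ∀ u, T u = ∑ i, inner ℂ (ContinuousLinearMap.adjoint T (e i)) u • e i := by
  have : FiniteDimensional ℂ T.range := hT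
  let b := stdOrthonormalBasis ℂ T.range
  refine ⟨fun i => (b i : E), fun i => b.orthonormal.1 i, fun u => ?_⟩
  have h := congrArg (Subtype.val) (b.sum_repr' ⟨T u, ⟨u, rfl⟩⟩)
  refine h.symm.trans ?_
  simp [ContinuousLinearMap.adjoint_inner_left]

/-- Parseval's identity, term by term. It frees the trace from the particular basis in its
definition. -/
lemma trace_eq_of_eq_sum {ι : Type*} [Fintype ι] {T : E →L[ℂ] E} (x y : ι → E)
    (h : ∀ u, T u = ∑ i, inner ℂ (x i) u • y i) : trace T = ∑ i, inner ℂ (x i) (y i) := by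
  unfold trace
  refine HasSum.tsum_eq ?_
  simp_rw [h, inner_sum, inner_smul_right]
  exact hasSum_sum fun i _ => HilbertBasis.hasSum_inner_mul_inner _ _ _

/-- With an orthonormal basis of the range, the trace is a sum of as many terms as the rank, each at
most `‖T‖`. This takes the place of trace-norm estimates. -/
lemma norm_trace_le {T : E →L[ℂ] E} (hT : FiniteRank T) :
    ‖trace T‖ ≤ Module.finrank ℂ T.range * ‖T‖ := by
  obtain ⟨e, he, h⟩ := hT.eq_sum
  rw [trace_eq_of_eq_sum _ _ h]
  refine (norm_sum_le _ _).trans ?_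
  calc _ ≤ ∑ _i : Fin (Module.finrank ℂ T.range), ‖T‖ := by
        refine Finset.sum_le_sum fun i _ => ?_
        rw [ContinuousLinearMap.adjoint_inner_left]
        refine (norm_inner_le_norm _ _).trans ?_
        have := T.le_opNorm (e i)
        rw [he i] at *
        linarith
    _ = _ := by simp

/-- Only one factor needs finite rank: expanding `T` as a sum of rank-one operators turns both
traces into the same finite sum. -/
lemma trace_mul_comm {S T : E →L[ℂ] E} (hT : FiniteRank T) : trace (S * T) = trace (T * S) := by
  obtain ⟨e, he, h⟩ := hT.eq_sum
  rw [trace_eq_of_eq_sum (fun i => ContinuousLinearMap.adjoint T (e i)) (fun i => S (e i)),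
    trace_eq_of_eq_sum
      (fun i => ContinuousLinearMap.adjoint S (ContinuousLinearMap.adjoint T (e i))) e]
  · simp [ContinuousLinearMap.adjoint_inner_left]
  · intro u
    change T (S u) = _
    rw [h]; simp [ContinuousLinearMap.adjoint_inner_left]
  · intro u
    change S (T u) = _
    rw [h]; simp

lemma trace_smul (z : ℂ) (T : E →L[ℂ] E) : trace (z • T) = z * trace T := by
  unfold trace
  rw [← tsum_mul_left]
  simp

lemma FiniteRank.summable_inner {T : E →L[ℂ] E} (hT : FiniteRank T) {κ : Type*}
    (b : HilbertBasis κ ℂ E) : Summable fun k => inner ℂ (b k) (T (b k)) := by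
  obtain ⟨e, he, h⟩ := hT.eq_sum
  simp_rw [h, inner_sum, inner_smul_right]
  exact summable_sum fun i _ => (HilbertBasis.summable_inner_mul_inner _ _ _)

lemma trace_sub {S T : E →L[ℂ] E} (hS : FiniteRank S) (hT : FiniteRank T) :
    trace (S - T) = trace S - trace T := by
  unfold trace
  rw [← (hS.summable_inner _).tsum_sub (hT.summable_inner _)]
  simp

/-- For self-adjoint `G` the kernels of `G²` and `G` coincide, because `⟪G u, G u⟫ = ⟪G² u, u⟫`.
Hence `G` factors through the quotient by `ker G²`, which is isomorphic to the range of `G²`. -/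
lemma FiniteRank.of_mul_self {G : E →L[ℂ] E} (hsa : IsSelfAdjoint G) (h2 : FiniteRank (G * G)) :
    FiniteRank G := by
  have : FiniteDimensional ℂ (G * G).range := h2
  have hker : (G * G).ker ≤ G.ker := by
    intro u hu
    have hu' : G (G u) = 0 := hu
    have h3 : inner ℂ (G u) (G u) = 0 := by
      have := ContinuousLinearMap.adjoint_inner_left G u (G u)
      rw [← ContinuousLinearMap.star_eq_adjoint, hsa.star_eq, hu'] at this
      rw [← this]; simp
    exact inner_self_eq_zero.1 h3
  let q : (G * G).range →ₗ[ℂ] E :=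
    ((G * G).ker.liftQ (G : E →ₗ[ℂ] E) hker) ∘ₗ
      ((G * G : E →L[ℂ] E) : E →ₗ[ℂ] E).quotKerEquivRange.symm.toLinearMap
  refine Submodule.finiteDimensional_of_le (S₂ := LinearMap.range q) ?_
  rintro _ ⟨u, rfl⟩
  refine ⟨⟨(G * G) u, ⟨u, rfl⟩⟩, ?_⟩
  have : (((G * G : E →L[ℂ] E) : E →ₗ[ℂ] E).quotKerEquivRange.symm
      ⟨(G * G) u, ⟨u, rfl⟩⟩) = Submodule.Quotient.mk u := by
    rw [LinearEquiv.symm_apply_eq]; rfl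
  change ((G * G).ker.liftQ (G : E →ₗ[ℂ] E) hker) (_) = _
  erw [this]
  rfl

/-- `|T|² = T* T` has finite rank, hence so does `|T|`. -/
lemma FiniteRank.isTraceClass {T : E →L[ℂ] E} (hT : FiniteRank T) : IsTraceClass T := by
  intro s b
  have hfr : FiniteRank (CFC.abs T) := by
    refine FiniteRank.of_mul_self (CFC.abs_nonneg T).isSelfAdjoint ?_
    rw [CFC.abs_mul_abs]; exact hT.mul_left _
  exact Complex.reCLM.summable (hfr.summable_inner b)

end FiniteRank

/-! ### Rapid decay of the Fourier coefficients of smooth periodic functions. -/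

section FourierSeries

-- Integration by parts; the boundary term vanishes by periodicity.
open Real in
lemma fourierCoeffOn_two_pi_deriv {h : ℝ → ℂ} (hh : ContDiff ℝ ∞ h)
    (hp : Function.Periodic h (2 * π)) (n : ℤ) :
    ‖fourierCoeffOn Real.two_pi_pos h n‖ * |(n : ℝ)| ≤
      ‖fourierCoeffOn Real.two_pi_pos (deriv h) n‖ := by
  rcases eq_or_ne n 0 with rfl | hn
  · simp
  rw [fourierCoeffOn_of_hasDerivAt Real.two_pi_pos (f' := deriv h) hn
    (fun x _ => (hh.differentiable (by simp)).differentiableAt.hasDerivAt)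
    ((hh.continuous_deriv (by simp)).intervalIntegrable _ _)]
  have h0 : h (2 * π) = h 0 := by simpa using hp 0
  have hn' : (n : ℂ) ≠ 0 := by exact_mod_cast hn
  have hn'' : |(n : ℝ)| ≠ 0 := by simpa using hn
  have hpi : (π : ℂ) ≠ 0 := by exact_mod_cast pi_ne_zero
  rw [h0, sub_self, mul_zero, zero_sub]
  simp only [norm_mul, norm_neg, norm_div, norm_one, Complex.norm_I, Complex.norm_intCast]
  push_cast
  simp only [norm_mul, sub_zero, Complex.norm_real, Complex.norm_ofNat]
  rw [Real.norm_eq_abs, abs_of_pos pi_pos]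
  have := pi_pos
  apply le_of_eq
  field_simp

open Real in
lemma exists_fourierCoeffOn_bound (N : ℕ) : ∀ {h : ℝ → ℂ}, ContDiff ℝ ∞ h →
    Function.Periodic h (2 * π) →
    ∃ B, ∀ n : ℤ, ‖fourierCoeffOn Real.two_pi_pos h n‖ * |(n : ℝ)| ^ N ≤ B := by
  induction N with
  | zero =>
    intro h hh hp
    obtain ⟨C, hC⟩ := isCompact_Icc.exists_bound_of_continuousOn
      (s := Icc (0 : ℝ) (2 * π)) hh.continuous.continuousOn
    refine ⟨C, fun n => ?_⟩
    rw [pow_zero, mul_one, fourierCoeffOn_eq_integral]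
    rw [norm_smul]
    have : ‖∫ x in (0 : ℝ)..(2 * π), (fourier (-n)) (x : AddCircle (2 * π - 0)) • h x‖ ≤
        C * |2 * π - 0| := by
      refine intervalIntegral.norm_integral_le_of_norm_le_const fun x hx => ?_
      rw [uIoc_of_le two_pi_pos.le] at hx
      have h1 : ‖(fourier (-n)) (x : AddCircle (2 * π - 0))‖ ≤ 1 := by
        rw [fourier_apply, Circle.norm_coe]
      rw [norm_smul]
      have := hC x ⟨hx.1.le, hx.2⟩
      have h2 := norm_nonneg (h x)
      nlinarith
    rw [abs_of_pos (by simpa using two_pi_pos)] at this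
    rw [norm_of_nonneg (by simpa using pi_pos.le)]
    have h3 := pi_pos
    rw [sub_zero] at this ⊢
    calc _ ≤ 1 / (2 * π) * (C * (2 * π)) := by gcongr
      _ = C := by field_simp
  | succ N ih =>
    intro h hh hp
    have hd : ContDiff ℝ ∞ (deriv h) := hh.deriv'
    have hpd : Function.Periodic (deriv h) (2 * π) := by
      intro x
      have := congrArg (fun f => deriv f x) (funext hp : (fun x => h (x + 2 * π)) = h)
      simpa [deriv_comp_add_const] using this
    obtain ⟨B, hB⟩ := ih hd hpd
    refine ⟨B, fun n => le_trans ?_ (hB n)⟩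
    rw [pow_succ', ← mul_assoc]
    gcongr
    exact fourierCoeffOn_two_pi_deriv hh hp n

-- Decay of every order makes the coefficients summable, and a summable Fourier series converges
-- pointwise to the function.
open Real in
lemma exists_fourier_series {h : ℝ → ℂ} (hh : ContDiff ℝ ∞ h)
    (hp : Function.Periodic h (2 * π)) :
    ∃ c : ℤ → ℂ, (∀ N : ℕ, ∃ B, ∀ k, ‖c k‖ * |(k : ℝ)| ^ N ≤ B) ∧
      ∀ θ : ℝ, HasSum (fun k : ℤ => c k * Complex.exp (Complex.I * k * θ)) (h θ) := by
  have : Fact (0 < 2 * π) := ⟨two_pi_pos⟩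
  let f : C(AddCircle (2 * π), ℂ) := ⟨hp.lift, by
    exact continuous_coinduced_dom.2 (by exact hh.continuous)⟩
  have hc : ∀ k, fourierCoeff f k = fourierCoeffOn Real.two_pi_pos h k := by
    intro k
    rw [fourierCoeff_eq_intervalIntegral _ _ 0, fourierCoeffOn_eq_integral]
    simp only [zero_add, sub_zero, fourier_coe_apply]
    rfl
  have hb := fun N => exists_fourierCoeffOn_bound N hh hp
  refine ⟨fun k => fourierCoeff f k, fun N => ?_, fun θ => ?_⟩
  · obtain ⟨B, hB⟩ := hb N
    exact ⟨B, fun k => by simpa only [hc] using hB k⟩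
  · have hs : Summable (fourierCoeff f) := by
      obtain ⟨B, hB⟩ := hb 2
      obtain ⟨B0, hB0⟩ := hb 0
      have hsum : Summable fun k : ℤ => B * (1 / |(k : ℝ)| ^ 2) := by
        refine Summable.mul_left _ ?_
        have := Real.summable_one_div_int_pow (p := 2) |>.2 (by norm_num)
        simpa using this
      -- The mode `0` is set aside as a finite exception, since the bound `B / |k|²` reads `0`
      -- there.
      refine Summable.of_norm_bounded_eventually hsum ?_
      refine (Set.finite_singleton (0 : ℤ)).subset fun k hk => ?_
      by_contra hk0
      apply hk
      have hk1 : 0 < |(k : ℝ)| := by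
        rw [abs_pos]; exact_mod_cast hk0
      have := hB k
      rw [← hc] at this
      change ‖fourierCoeff f k‖ ≤ B * (1 / |(k : ℝ)| ^ 2)
      rw [mul_one_div, le_div_iff₀ (by positivity)]
      exact this
    have := has_pointwise_sum_fourier_series_of_summable hs (θ : AddCircle (2 * π))
    change HasSum _ (h θ) at this
    convert this using 2 with k
    rw [smul_eq_mul, fourier_coe_apply]
    congr 2
    have : (π : ℂ) ≠ 0 := by exact_mod_cast pi_ne_zero
    push_cast
    field_simp

end FourierSeries

/-! ### Functions of the Cayley transform and their power series. -/

section Cayley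

/-- The function `F` on the real line as a function of the Cayley transform
`u = (x + i) / (x - i)`. -/
def cayleyFun (F : ℝ → ℂ) (u : ℂ) : ℂ :=
  if u = 1 then 0 else F (2 * u.im / Complex.normSq (1 - u))

lemma normSq_one_sub_of_norm {u : ℂ} (hu : ‖u‖ = 1) : Complex.normSq (1 - u) = 2 * (1 - u.re) := by
  have h : Complex.normSq u = 1 := by rw [Complex.normSq_eq_norm_sq, hu]; norm_num
  rw [Complex.normSq_apply] at h ⊢
  simp only [Complex.sub_re, Complex.one_re, Complex.sub_im, Complex.one_im]
  linear_combination h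

/-- On the circle `x² = (1 + Re u) / (1 - Re u)`, so points close to `1` correspond to `|x|` beyond
the support of `F`. -/
lemma exists_cayleyFun_eq_zero {F : ℝ → ℂ} (hF : HasCompactSupport F) :
    ∃ ε > 0, ∀ u : ℂ, ‖u‖ = 1 → 1 - ε < u.re → cayleyFun F u = 0 := by
  obtain ⟨M, hM⟩ := hF.isCompact.isBounded.exists_norm_le
  refine ⟨min 1 (1 / (M ^ 2 + 1)), by positivity, fun u hu hre => ?_⟩
  unfold cayleyFun
  split_ifs with h1
  · rfl
  by_contra hne
  have hmem := hM _ (subset_tsupport _ (Function.mem_support.2 hne))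
  have hn := normSq_one_sub_of_norm hu
  have hpos : 0 < Complex.normSq (1 - u) :=
    Complex.normSq_pos.2 (sub_ne_zero.2 (Ne.symm h1))
  have hre1 : 0 < 1 - u.re := by linarith
  have h : Complex.normSq u = 1 := by rw [Complex.normSq_eq_norm_sq, hu]; norm_num
  rw [Complex.normSq_apply] at h
  have hsq : (2 * u.im / Complex.normSq (1 - u)) ^ 2 ≤ M ^ 2 := by
    rw [← sq_abs]; exact pow_le_pow_left₀ (abs_nonneg _) hmem 2
  rw [hn, div_pow, div_le_iff₀ (by positivity)] at hsq
  have h5 : (1 - u.re) * (1 + u.re) ≤ M ^ 2 * (1 - u.re) ^ 2 := by nlinarith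
  have h6 : 1 + u.re ≤ M ^ 2 * (1 - u.re) := by
    refine le_of_mul_le_mul_left ?_ hre1
    nlinarith
  have h7 : 1 - u.re < 1 / (M ^ 2 + 1) := by
    have := min_le_right 1 (1 / (M ^ 2 + 1)); linarith
  have h8 : 0 < u.re := by
    have := min_le_left 1 (1 / (M ^ 2 + 1)); linarith
  rw [lt_div_iff₀ (by positivity)] at h7
  nlinarith

/-- Where `cos θ ≠ 1` this is a composition of smooth maps; where `cos θ = 1` the function vanishes
in a neighbourhood. -/
lemma contDiff_cayleyFun_exp {F : ℝ → ℂ} (hF : ContDiff ℝ ∞ F) (hc : HasCompactSupport F) :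
    ContDiff ℝ ∞ fun θ : ℝ => cayleyFun F (Complex.exp (Complex.I * θ)) := by
  have hnorm : ∀ θ : ℝ, ‖Complex.exp (Complex.I * θ)‖ = 1 := fun θ => by
    rw [mul_comm]; exact Complex.norm_exp_ofReal_mul_I θ
  have hre : ∀ θ : ℝ, (Complex.exp (Complex.I * θ)).re = Real.cos θ := fun θ => by
    rw [mul_comm]; exact Complex.exp_ofReal_mul_I_re θ
  have him : ∀ θ : ℝ, (Complex.exp (Complex.I * θ)).im = Real.sin θ := fun θ => by
    rw [mul_comm]; exact Complex.exp_ofReal_mul_I_im θ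
  rw [contDiff_iff_contDiffAt]
  intro θ
  by_cases h1 : Real.cos θ = 1
  · obtain ⟨ε, hε, h0⟩ := exists_cayleyFun_eq_zero hc
    refine (contDiffAt_const (c := (0 : ℂ))).congr_of_eventuallyEq ?_
    have : ∀ᶠ t in nhds θ, 1 - ε < Real.cos t :=
      Real.continuous_cos.continuousAt.eventually (lt_mem_nhds (by rw [h1]; linarith))
    filter_upwards [this] with t ht
    exact h0 _ (hnorm t) (by rw [hre]; exact ht)
  · have hev : ∀ᶠ t in nhds θ, Real.cos t ≠ 1 :=
      Real.continuous_cos.continuousAt.eventually (isOpen_ne.mem_nhds h1)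
    have : ContDiffAt ℝ ∞ (fun t : ℝ => F (2 * Real.sin t / (2 * (1 - Real.cos t)))) θ := by
      refine hF.contDiffAt.comp θ ?_
      refine ContDiffAt.div (contDiffAt_const.mul Real.contDiff_sin.contDiffAt)
        (contDiffAt_const.mul (contDiffAt_const.sub Real.contDiff_cos.contDiffAt)) ?_
      have := sub_ne_zero.2 (Ne.symm h1)
      simpa using this
    refine this.congr_of_eventuallyEq ?_
    filter_upwards [hev] with t ht
    have hne : Complex.exp (Complex.I * t) ≠ 1 := fun h => ht (by rw [← hre, h]; simp)
    rw [cayleyFun, if_neg hne, normSq_one_sub_of_norm (hnorm t), him, hre]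

/-- On the circle `u⁻¹` is the conjugate of `u`, so this is the Fourier series of `cayleyFun F` with
negative modes written as powers of `star u`. These start at exponent `k + 1`: the extra factor
later turns `N` into `N'` (`inverse_mul_star_cayley`). The polynomial weights leave room for the
growth of the locality bounds in `k`. -/
lemma exists_cayley_series {F : ℝ → ℂ} (hF : ContDiff ℝ ∞ F) (hc : HasCompactSupport F) :
    ∃ a b : ℕ → ℂ, (∀ N : ℕ, Summable fun k => (‖a k‖ + ‖b k‖) * (2 * (k : ℝ) + 1) ^ N) ∧
      ∀ u : ℂ, ‖u‖ = 1 →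
        HasSum (fun k => a k * u ^ k + b k * (star u) ^ (k + 1)) (cayleyFun F u) := by
  obtain ⟨c, hcb, hcs⟩ := exists_fourier_series (contDiff_cayleyFun_exp hF hc) (by
    intro θ
    have : Complex.I * ((θ + 2 * Real.pi : ℝ) : ℂ) = Complex.I * θ + 2 * Real.pi * Complex.I := by
      push_cast; ring
    simp only [this, Complex.exp_add, Complex.exp_two_pi_mul_I, mul_one])
  refine ⟨fun k => c k, fun k => c (-(k + 1 : ℕ)), fun N => ?_, fun u hu => ?_⟩
  · obtain ⟨B, hB⟩ := hcb (N + 2)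
    obtain ⟨B0, hB0⟩ := hcb 0
    have hB00 : 0 ≤ B := by have := hB 0; simpa using this
    have key : ∀ k : ℤ, k ≠ 0 → ‖c k‖ ≤ B / |(k : ℝ)| ^ (N + 2) := fun k hk => by
      have : 0 < |(k : ℝ)| := by rw [abs_pos]; exact_mod_cast hk
      rw [le_div_iff₀ (by positivity)]; exact hB k
    have hsum : Summable fun k : ℕ => 2 * B * 3 ^ N * (1 / (k : ℝ) ^ 2) :=
      (Real.summable_one_div_nat_pow.2 (by norm_num)).mul_left _
    refine Summable.of_norm_bounded_eventually_nat hsum ?_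
    filter_upwards [Filter.eventually_ge_atTop 1] with k hk
    have hk0 : (1 : ℝ) ≤ k := by exact_mod_cast hk
    have h1 := key k (by positivity)
    have h2 := key (-(k + 1 : ℕ)) (by lia)
    push_cast at h1 h2
    have e1 : |-((k : ℝ) + 1)| = k + 1 := by
      rw [abs_neg, abs_of_pos (by linarith)]
    rw [abs_of_pos (by linarith)] at h1
    simp only [e1] at h2
    have h3 : B / ((k : ℝ) + 1) ^ (N + 2) ≤ B / (k : ℝ) ^ (N + 2) := by
      gcongr; linarith
    rw [Real.norm_of_nonneg (by positivity)]
    push_cast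
    calc (‖c k‖ + ‖c (-((k : ℤ) + 1))‖) * (2 * (k : ℝ) + 1) ^ N
        ≤ (B / (k : ℝ) ^ (N + 2) + B / (k : ℝ) ^ (N + 2)) * (3 * k) ^ N := by
          gcongr
          · exact h2.trans h3
          · linarith
      _ = _ := by
          rw [mul_pow, pow_add]; field_simp; ring
  · have harg : Complex.exp (Complex.I * (Complex.arg u : ℝ)) = u := by
      have := Complex.norm_mul_exp_arg_mul_I u
      rw [hu] at this
      rw [mul_comm]; simpa using this
    have h := (hcs (Complex.arg u)).nat_add_neg_add_one
    rw [harg] at h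
    have hstar : star u = u⁻¹ := by
      rw [Complex.inv_def, Complex.normSq_eq_norm_sq, hu]; simp
    convert h using 2 with k
    rw [hstar]
    have e1 : Complex.exp (Complex.I * ((k : ℤ) : ℂ) * (Complex.arg u : ℝ)) = u ^ k := by
      conv_rhs => rw [← harg]
      rw [← Complex.exp_nat_mul]; congr 1; push_cast; ring
    have e2 : Complex.exp (Complex.I * ((-((k : ℤ) + 1) : ℤ) : ℂ) * (Complex.arg u : ℝ)) =
        u⁻¹ ^ (k + 1) := by
      conv_rhs => rw [← harg]
      rw [← Complex.exp_neg, ← Complex.exp_nat_mul]; congr 1; push_cast; ring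
    rw [e1, e2]
    norm_cast

variable {E : Type*} [NormedAddCommGroup E] [InnerProductSpace ℂ E] [CompleteSpace E]

lemma isStarNormal_of_mem_unitary {U : E →L[ℂ] E} (hU : U ∈ unitary (E →L[ℂ] E)) :
    IsStarNormal U :=
  ⟨(Unitary.mem_iff.1 hU).1.trans (Unitary.mem_iff.1 hU).2.symm⟩

lemma cfc_pow_add_star_pow {U : E →L[ℂ] E} (hU : U ∈ unitary (E →L[ℂ] E)) (a b : ℂ) (k l : ℕ) :
    cfc (fun u : ℂ => a * u ^ k + b * (star u) ^ l) U = a • U ^ k + b • (star U) ^ l := by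
  have hn : IsStarNormal U := isStarNormal_of_mem_unitary hU
  rw [cfc_add (a := U) (fun u => a * u ^ k) (fun u => b * (star u) ^ l),
    cfc_const_mul a (fun u => u ^ k) U, cfc_const_mul b (fun u => (star u) ^ l) U, cfc_pow_id U,
    cfc_pow (fun u => star u) l U, cfc_star (fun u => u) U, cfc_id' ℂ U]

lemma spectrum_norm_eq_one {U : E →L[ℂ] E} (hU : U ∈ unitary (E →L[ℂ] E)) {u : ℂ}
    (hu : u ∈ spectrum ℂ U) : ‖u‖ = 1 := by
  simpa using spectrum.subset_circle_of_unitary hU hu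

lemma continuousOn_cayleyFun {F : ℝ → ℂ} (hF : ContDiff ℝ ∞ F) (hc : HasCompactSupport F) :
    ContinuousOn (cayleyFun F) {u | ‖u‖ = 1} := by
  obtain ⟨a, b, hab, hs⟩ := exists_cayley_series hF hc
  have h0 := hab 0
  simp only [pow_zero, mul_one] at h0
  have : ContinuousOn (fun u : ℂ => ∑' k, (a k * u ^ k + b k * (star u) ^ (k + 1)))
      {u | ‖u‖ = 1} := by
    refine continuousOn_tsum (fun k => by fun_prop) h0 fun k u hu => ?_
    refine (norm_add_le _ _).trans ?_
    have hu' : ‖u‖ = 1 := hu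
    simp [hu']
  exact this.congr fun u hu => (hs u hu).tsum_eq.symm

/-- The series converges uniformly on the circle, which contains the spectrum of a unitary, and the
functional calculus does not increase sup norms. -/
lemma hasSum_cfc_cayleyFun {F : ℝ → ℂ} (hF : ContDiff ℝ ∞ F) (hc : HasCompactSupport F)
    {a b : ℕ → ℂ} (hab : Summable fun k => ‖a k‖ + ‖b k‖)
    (hs : ∀ u : ℂ, ‖u‖ = 1 →
      HasSum (fun k => a k * u ^ k + b k * (star u) ^ (k + 1)) (cayleyFun F u))
    {U : E →L[ℂ] E} (hU : U ∈ unitary (E →L[ℂ] E)) :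
    HasSum (fun k => a k • U ^ k + b k • (star U) ^ (k + 1)) (cfc (cayleyFun F) U) := by
  have hn : IsStarNormal U := isStarNormal_of_mem_unitary hU
  have hcont := (continuousOn_cayleyFun hF hc).mono fun u hu => spectrum_norm_eq_one hU hu
  have hterm : ∀ (k : ℕ) (u : ℂ), ‖u‖ = 1 →
      ‖a k * u ^ k + b k * (star u) ^ (k + 1)‖ ≤ ‖a k‖ + ‖b k‖ := fun k u hu => by
    refine (norm_add_le _ _).trans ?_
    simp [hu]
  have hunif : TendstoUniformlyOn
      (fun N u => ∑ k ∈ Finset.range N, (a k * u ^ k + b k * (star u) ^ (k + 1)))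
      (cayleyFun F) Filter.atTop {u : ℂ | ‖u‖ = 1} :=
    (tendstoUniformlyOn_tsum_nat hab fun k u hu => hterm k u hu).congr_right
      fun u hu => (hs u hu).tsum_eq
  rw [hasSum_iff_tendsto_nat_of_summable_norm]
  · rw [Metric.tendsto_atTop]
    intro ε hε
    rw [Metric.tendstoUniformlyOn_iff] at hunif
    obtain ⟨N, hN⟩ := Filter.eventually_atTop.1 (hunif (ε / 2) (by positivity))
    refine ⟨N, fun M hM => ?_⟩
    have e : ∑ k ∈ Finset.range M, (a k • U ^ k + b k • (star U) ^ (k + 1)) =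
        cfc (fun u => ∑ k ∈ Finset.range M, (a k * u ^ k + b k * (star u) ^ (k + 1))) U := by
      have h := cfc_sum (fun k u => a k * u ^ k + b k * (star u) ^ (k + 1)) U (Finset.range M)
        (fun k _ => by fun_prop)
      rw [Finset.sum_fn] at h
      rw [h]
      exact Finset.sum_congr rfl fun k _ => (cfc_pow_add_star_pow hU _ _ _ _).symm
    rw [e, dist_comm, dist_eq_norm, ← cfc_sub (a := U) _ _ hcont (by fun_prop)]
    refine lt_of_le_of_lt (norm_cfc_le (by positivity : 0 ≤ ε / 2) fun u hu => ?_) (by linarith)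
    have := hN M hM u (spectrum_norm_eq_one hU hu)
    rw [dist_eq_norm] at this
    exact this.le
  · refine Summable.of_nonneg_of_le (fun _ => norm_nonneg _) (fun k => ?_) hab
    rw [← cfc_pow_add_star_pow hU]
    refine norm_cfc_le (by positivity) fun u hu => hterm k u (spectrum_norm_eq_one hU hu)

end Cayley

/-! ### Unbounded operators written as `T J⁻¹` with `T` and `J` bounded. -/

section Realization

variable {E : Type*} [NormedAddCommGroup E] [InnerProductSpace ℂ E] [CompleteSpace E]

/-- The unbounded operator `A` is `T J⁻¹` with domain the range of `J`; it is symmetric, and `N`, `N'`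
are the bounded inverses of `i J - T` and `-i J - T`. -/
structure Realization (A : E →ₗ.[ℂ] E) (J T N N' : E →L[ℂ] E) : Prop where
  mem_graph : ∀ u g, (u, g) ∈ A.graph ↔ ∃ w, J w = u ∧ T w = g
  dense : DenseRange J
  symm : ∀ w w', inner ℂ (T w) (J w') = inner ℂ (J w) (T w')
  left : N * (Complex.I • J - T) = 1
  right : (Complex.I • J - T) * N = 1
  left' : N' * (-Complex.I • J - T) = 1
  right' : (-Complex.I • J - T) * N' = 1

namespace Realization

variable {A : E →ₗ.[ℂ] E} {J T N N' : E →L[ℂ] E}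

lemma mem_domain (h : Realization A J T N N') (w : E) : J w ∈ A.domain :=
  LinearPMap.mem_domain_of_mem_graph ((h.mem_graph _ (T w)).2 ⟨w, rfl, rfl⟩)

lemma apply (h : Realization A J T N N') (w : E) (hw : J w ∈ A.domain) : A ⟨J w, hw⟩ = T w := by
  have h1 := (h.mem_graph _ (T w)).2 ⟨w, rfl, rfl⟩
  exact LinearPMap.mem_graph_snd_inj A (A.mem_graph ⟨J w, hw⟩) h1 rfl

lemma exists_of_mem_domain (h : Realization A J T N N') {u : E} (hu : u ∈ A.domain) :
    ∃ w, J w = u := by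
  obtain ⟨w, hw, -⟩ := (h.mem_graph _ _).1 (A.mem_graph ⟨u, hu⟩)
  exact ⟨w, hw⟩

lemma dense_domain (h : Realization A J T N N') : Dense (A.domain : Set E) :=
  Dense.mono (by rintro _ ⟨w, rfl⟩; exact h.mem_domain w) h.dense

lemma right'_apply (h : Realization A J T N N') (a : E) :
    -Complex.I • J (N' a) - T (N' a) = a := by
  simpa using congrArg (fun S : E →L[ℂ] E => S a) h.right'

lemma right_apply (h : Realization A J T N N') (a : E) :
    Complex.I • J (N a) - T (N a) = a := by
  simpa using congrArg (fun S : E →L[ℂ] E => S a) h.right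

lemma left_apply (h : Realization A J T N N') (a : E) :
    N (Complex.I • J a - T a) = a := by
  simpa using congrArg (fun S : E →L[ℂ] E => S a) h.left

lemma isSelfAdjoint (h : Realization A J T N N') : IsSelfAdjoint A := by
  rw [LinearPMap.isSelfAdjoint_def]
  have hd := h.dense_domain
  have hformal : A.IsFormalAdjoint A := by
    rintro ⟨x, hx⟩ ⟨y, hy⟩
    obtain ⟨w, rfl⟩ := h.exists_of_mem_domain hx
    obtain ⟨w', rfl⟩ := h.exists_of_mem_domain hy
    rw [h.apply, h.apply]
    exact h.symm w w'
  have hle := hformal.le_adjoint hd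
  refine le_antisymm ?_ hle
  refine ⟨fun v hv => ?_, fun x y hxy => ?_⟩
  rotate_left
  · exact (hle.2 hxy.symm).symm
  set g := A.adjoint ⟨v, hv⟩
  have hadj : ∀ w, inner ℂ g (J w) = inner ℂ v (T w) := fun w => by
    have := LinearPMap.adjoint_isFormalAdjoint hd ⟨v, hv⟩ ⟨J w, h.mem_domain w⟩
    rw [h.apply] at this
    exact this
  -- If `v` is in the domain of the adjoint, `J N a` is the solution of `(i - A) u = (i - A*) v`. It
  -- equals `v`, since their difference is orthogonal to the range of `-i J - T`, which is
  -- everything.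
  set a := Complex.I • v - g
  have key : v = J (N a) := by
    rw [← sub_eq_zero]
    have hz : ∀ b, inner ℂ (v - J (N a)) b = 0 := by
      intro b
      have e1 := h.right'_apply b
      have e2 := h.right_apply a
      set w := N' b
      set w' := N a
      rw [← e1, inner_sub_left, inner_sub_right, inner_sub_right, ← hadj w, ← h.symm]
      have e3 : T w' = Complex.I • J w' - Complex.I • v + g := by
        have : T w' = Complex.I • J w' - a := by rw [← e2]; abel
        rw [this]; simp only [a]; abel
      rw [e3]
      simp only [inner_smul_right, inner_smul_left, inner_add_left, inner_sub_left,
        Complex.conj_I]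
      ring
    exact inner_self_eq_zero.1 (hz _)
  rw [key]; exact h.mem_domain _

lemma isResolvent (h : Realization A J T N N') : IsResolvent A Complex.I (J * N) := by
  refine ⟨fun u => ⟨h.mem_domain _, ?_⟩, fun ⟨u, hu⟩ => ?_⟩
  · have := h.apply (N u) (h.mem_domain _)
    change Complex.I • J (N u) - A ⟨J (N u), _⟩ = u
    rw [this, h.right_apply]
  · obtain ⟨w, rfl⟩ := h.exists_of_mem_domain hu
    rw [h.apply]
    change J (N _) = _
    rw [h.left_apply]

lemma resolventOp_eq (h : Realization A J T N N') : resolventOp A Complex.I = J * N := by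
  have hex : ∃ R, IsResolvent A Complex.I R := ⟨_, h.isResolvent⟩
  rw [resolventOp, dif_pos hex]
  ext u
  obtain ⟨hu, e⟩ := hex.choose_spec.1 u
  have := h.isResolvent.2 ⟨_, hu⟩
  rw [e] at this
  exact this.symm

lemma star_resolvent (h : Realization A J T N N') : star (J * N) = J * N' := by
  rw [ContinuousLinearMap.star_eq_adjoint]
  symm
  rw [ContinuousLinearMap.eq_adjoint_iff]
  intro b a
  change inner ℂ (J (N' b)) a = inner ℂ b (J (N a))
  have e1 := h.right'_apply b
  have e2 := h.right_apply a
  set w := N' b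
  set w' := N a
  rw [← e1, ← e2, inner_sub_left, inner_sub_right, h.symm]
  simp only [inner_smul_right, inner_smul_left, map_neg, Complex.conj_I]
  ring

/-- The resolvent identity; in this form and its mirror image it yields the unitarity of the Cayley
transform. -/
lemma inverse_sub (h : Realization A J T N N') :
    N - N' = -(2 * Complex.I) • (N * J * N') := by
  calc N - N' = N * ((-Complex.I • J - T) * N') - (N * (Complex.I • J - T)) * N' := by
        rw [h.right', h.left, mul_one, one_mul]
    _ = N * ((-Complex.I • J - T) - (Complex.I • J - T)) * N' := by noncomm_ring
    _ = _ := by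
      rw [show (-Complex.I • J - T) - (Complex.I • J - T) = -(2 * Complex.I) • J by module]
      rw [mul_smul_comm, smul_mul_assoc]

lemma inverse_sub' (h : Realization A J T N N') :
    N - N' = -(2 * Complex.I) • (N' * J * N) := by
  calc N - N' = (N' * (-Complex.I • J - T)) * N - N' * ((Complex.I • J - T) * N) := by
        rw [h.right, h.left', mul_one, one_mul]
    _ = N' * ((-Complex.I • J - T) - (Complex.I • J - T)) * N := by noncomm_ring
    _ = _ := by
      rw [show (-Complex.I • J - T) - (Complex.I • J - T) = -(2 * Complex.I) • J by module]
      rw [mul_smul_comm, smul_mul_assoc]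

/-- The Cayley transform `(A + i) (A - i)⁻¹`. -/
def cayley (J N : E →L[ℂ] E) : E →L[ℂ] E := 1 - (2 * Complex.I) • (J * N)

lemma star_cayley (h : Realization A J T N N') :
    star (cayley J N) = 1 + (2 * Complex.I) • (J * N') := by
  rw [cayley, star_sub, star_smul, h.star_resolvent, star_one]
  simp [sub_eq_add_neg]

lemma cayley_mem_unitary (h : Realization A J T N N') :
    cayley J N ∈ unitary (E →L[ℂ] E) := by
  rw [Unitary.mem_iff, h.star_cayley, cayley]
  have e1 : J * N - J * N' = -(2 * Complex.I) • (J * N * (J * N')) := by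
    rw [← mul_sub, h.inverse_sub, mul_smul_comm]; simp only [mul_assoc]
  have e2 : J * N - J * N' = -(2 * Complex.I) • (J * N' * (J * N)) := by
    rw [← mul_sub, h.inverse_sub', mul_smul_comm]; simp only [mul_assoc]
  constructor
  · simp only [mul_sub, add_mul, mul_one, one_mul, smul_mul_smul_comm]
    have : (2 * Complex.I * (2 * Complex.I)) • (J * N' * (J * N)) =
        -(2 * Complex.I) • (J * N - J * N') := by
      rw [e2, smul_smul]; congr 1; ring
    rw [this]; module
  · simp only [sub_mul, mul_add, mul_one, one_mul, smul_mul_smul_comm]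
    have : (2 * Complex.I * (2 * Complex.I)) • (J * N * (J * N')) =
        -(2 * Complex.I) • (J * N - J * N') := by
      rw [e1, smul_smul]; congr 1; ring
    rw [this]; module

/-- Formally `U* = (A - i)(A + i)⁻¹`, which exchanges the points `i` and `-i` in the resolvent. -/
lemma inverse_mul_star_cayley (h : Realization A J T N N') : N * star (cayley J N) = N' := by
  have e : N' = N - -(2 * Complex.I) • (N * J * N') := by rw [← h.inverse_sub]; abel
  rw [h.star_cayley, mul_add, mul_one, mul_smul_comm, ← mul_assoc]
  calc _ = N - -(2 * Complex.I) • (N * J * N') := by module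
    _ = N' := e.symm

lemma norm_cayley_le (h : Realization A J T N N') : ‖cayley J N‖ ≤ 1 := by
  have h1 := (Unitary.mem_iff.1 h.cayley_mem_unitary).1
  have h2 : ‖cayley J N‖ * ‖cayley J N‖ ≤ 1 := by
    rw [← CStarRing.norm_star_mul_self, h1]; exact ContinuousLinearMap.norm_id_le
  nlinarith [norm_nonneg (cayley J N)]

lemma norm_star_cayley_le (h : Realization A J T N N') : ‖star (cayley J N)‖ ≤ 1 := by
  rw [norm_star]; exact h.norm_cayley_le

lemma resolvent_eq (J N : E →L[ℂ] E) : J * N = (1 / (2 * Complex.I)) • (1 - cayley J N) := by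
  rw [cayley, sub_sub_cancel, smul_smul, one_div, inv_mul_cancel₀ (by simp), one_smul]

lemma norm_resolvent_le (h : Realization A J T N N') : ‖J * N‖ ≤ 1 := by
  rw [resolvent_eq, norm_smul]
  have h1 : ‖(1 : E →L[ℂ] E) - cayley J N‖ ≤ 1 + 1 :=
    (norm_sub_le _ _).trans (add_le_add ContinuousLinearMap.norm_id_le h.norm_cayley_le)
  have h2 : ‖1 / (2 * Complex.I)‖ = 1 / 2 := by simp
  rw [h2]; linarith

lemma norm_resolvent_le' (h : Realization A J T N N') : ‖J * N'‖ ≤ 1 := by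
  rw [← h.star_resolvent, norm_star]; exact h.norm_resolvent_le

end Realization

end Realization

/-! ### Functional calculus, and the vanishing of `Tr [A, P] f(A)`. -/

section Calculus

variable {E : Type*} [NormedAddCommGroup E] [InnerProductSpace ℂ E] [CompleteSpace E]

lemma cayleyFun_mul (F G : ℝ → ℂ) (u : ℂ) :
    cayleyFun (fun x => F x * G x) u = cayleyFun F u * cayleyFun G u := by
  unfold cayleyFun; split_ifs <;> simp

/-- With `x` the inverse Cayley transform of `u`, one has `(1 - u)(i - x) = 2i`. -/
lemma cayleyFun_eq_resolvent_mul (F : ℝ → ℂ) {u : ℂ} (hu : ‖u‖ = 1) :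
    cayleyFun F u =
      (1 / (2 * Complex.I) * (1 - u)) * cayleyFun (fun x => (Complex.I - x) * F x) u := by
  unfold cayleyFun
  split_ifs with h1
  · simp
  have hn := normSq_one_sub_of_norm hu
  have hpos : 0 < Complex.normSq (1 - u) := Complex.normSq_pos.2 (sub_ne_zero.2 (Ne.symm h1))
  have hre : 1 - u.re ≠ 0 := by linarith
  have h : Complex.normSq u = 1 := by rw [Complex.normSq_eq_norm_sq, hu]; norm_num
  rw [Complex.normSq_apply] at h
  rw [hn]
  set x : ℝ := 2 * u.im / (2 * (1 - u.re)) with hx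
  have hx' : x * (1 - u.re) = u.im := by rw [hx]; field_simp
  have key : (1 - u) * (Complex.I - x) = 2 * Complex.I := by
    apply Complex.ext
    · simp; linear_combination -hx'
    · simp
      have : (1 - u.re) * (1 - u.re + u.im * x) = (1 - u.re) * 2 := by
        linear_combination u.im * hx' + h
      linarith [mul_left_cancel₀ hre this]
  calc F x = 1 / (2 * Complex.I) * (2 * Complex.I) * F x := by
        rw [one_div, inv_mul_cancel₀ (by simp), one_mul]
    _ = _ := by rw [← key]; ring

lemma norm_cayleyFun_le {F : ℝ → ℂ} {M : ℝ} (hM0 : 0 ≤ M) (hM : ∀ x, ‖F x‖ ≤ M) (u : ℂ) :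
    ‖cayleyFun F u‖ ≤ M := by
  unfold cayleyFun; split_ifs
  · simpa using hM0
  · exact hM _

namespace Realization

variable {A : E →ₗ.[ℂ] E} {J T N N' : E →L[ℂ] E}

lemma continuousOn_cayley {F : ℝ → ℂ} (h : Realization A J T N N') (hF : ContDiff ℝ ∞ F)
    (hc : HasCompactSupport F) : ContinuousOn (cayleyFun F) (spectrum ℂ (cayley J N)) :=
  (continuousOn_cayleyFun hF hc).mono fun _ hu => spectrum_norm_eq_one h.cayley_mem_unitary hu

lemma resolvent_eq_cfc (h : Realization A J T N N') :
    J * N = cfc (fun u : ℂ => 1 / (2 * Complex.I) * (1 - u)) (cayley J N) := by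
  have hn := isStarNormal_of_mem_unitary h.cayley_mem_unitary
  rw [cfc_const_mul _ (fun u : ℂ => 1 - u) (cayley J N),
    cfc_sub (a := cayley J N) (fun _ : ℂ => 1) (fun u => u), cfc_const_one ℂ (cayley J N),
    cfc_id' ℂ (cayley J N)]
  exact resolvent_eq J N

lemma cfc_mul_cayley (h : Realization A J T N N') {F G : ℝ → ℂ} (hF : ContDiff ℝ ∞ F)
    (hFc : HasCompactSupport F) (hG : ContDiff ℝ ∞ G) (hGc : HasCompactSupport G) :
    cfc (cayleyFun F) (cayley J N) * cfc (cayleyFun G) (cayley J N) =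
      cfc (cayleyFun fun x => F x * G x) (cayley J N) := by
  rw [← cfc_mul _ _ _ (h.continuousOn_cayley hF hFc) (h.continuousOn_cayley hG hGc)]
  exact congrArg (fun g => cfc g _) (funext fun u => (cayleyFun_mul F G u).symm)

lemma resolvent_commute (h : Realization A J T N N') (g : ℂ → ℂ) :
    J * N * cfc g (cayley J N) = cfc g (cayley J N) * (J * N) := by
  rw [h.resolvent_eq_cfc]; exact cfc_commute_cfc _ _ _

lemma cfc_cayleyFun_eq (h : Realization A J T N N') {F : ℝ → ℂ} (hF : ContDiff ℝ ∞ F)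
    (hc : HasCompactSupport F) :
    cfc (cayleyFun F) (cayley J N) =
      J * N * cfc (cayleyFun fun x => (Complex.I - x) * F x) (cayley J N) := by
  have hF1 : ContDiff ℝ ∞ fun x : ℝ => (Complex.I - x) * F x :=
    (contDiff_const.sub Complex.ofRealCLM.contDiff).mul hF
  rw [h.resolvent_eq_cfc, ← cfc_mul _ _ _ (by fun_prop) (h.continuousOn_cayley hF1 hc.mul_left)]
  exact cfc_congr fun u hu =>
    cayleyFun_eq_resolvent_mul F (spectrum_norm_eq_one h.cayley_mem_unitary hu)

/-- The resolvent is `(1 - U) / (2i)`, so the composition rule of the continuous functional calculus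
passes from functions of the resolvent to functions of `U`. -/
lemma funcCalc_eq (h : Realization A J T N N') {f : ℝ → ℝ}
    (hf : ContDiff ℝ ∞ fun x => (f x : ℂ)) (hc : HasCompactSupport fun x => (f x : ℂ)) :
    funcCalc A f = cfc (cayleyFun fun x => (f x : ℂ)) (cayley J N) := by
  have hn := isStarNormal_of_mem_unitary h.cayley_mem_unitary
  have hcomp : ∀ u : ℂ,
      (if 1 / (2 * Complex.I) * (1 - u) = 0 then (0 : ℂ)
        else ((f (Complex.I - (1 / (2 * Complex.I) * (1 - u))⁻¹).re : ℝ) : ℂ)) =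
      cayleyFun (fun x => (f x : ℂ)) u := by
    intro u
    unfold cayleyFun
    have : 1 / (2 * Complex.I) * (1 - u) = 0 ↔ u = 1 := by
      rw [mul_eq_zero, or_iff_right (by simp), sub_eq_zero, eq_comm]
    simp only [this]
    split_ifs with h1
    · rfl
    · congr 2
      have hpos : 0 < Complex.normSq (1 - u) := Complex.normSq_pos.2 (sub_ne_zero.2 (Ne.symm h1))
      rw [mul_inv, Complex.inv_def (1 - u)]
      simp
      field_simp
  -- Continuity at `w = 0`, the point at infinity of the real line, is inherited from the continuity
  -- of `cayleyFun` at `u = 1`.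
  have hcont : ContinuousOn
      (fun w : ℂ => if w = 0 then (0 : ℂ) else ((f (Complex.I - w⁻¹).re : ℝ) : ℂ))
      ((fun u : ℂ => 1 / (2 * Complex.I) * (1 - u)) '' spectrum ℂ (cayley J N)) := by
    have hinv : ∀ w : ℂ, 1 / (2 * Complex.I) * (1 - (1 - 2 * Complex.I * w)) = w := fun w => by
      rw [sub_sub_cancel, ← mul_assoc, one_div, inv_mul_cancel₀ (by simp), one_mul]
    have h1 : ContinuousOn (fun w : ℂ => cayleyFun (fun x => (f x : ℂ)) (1 - 2 * Complex.I * w))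
        ((fun u : ℂ => 1 / (2 * Complex.I) * (1 - u)) '' spectrum ℂ (cayley J N)) := by
      refine (h.continuousOn_cayley hf hc).comp (by fun_prop) ?_
      rintro _ ⟨u, hu, rfl⟩
      have : 1 - 2 * Complex.I * (1 / (2 * Complex.I) * (1 - u)) = u := by
        rw [← mul_assoc, one_div, mul_inv_cancel₀ (by simp)]; ring
      change 1 - 2 * Complex.I * (1 / (2 * Complex.I) * (1 - u)) ∈ _
      rwa [this]
    refine h1.congr fun w _ => ?_
    have := hcomp (1 - 2 * Complex.I * w)
    rwa [hinv] at this
  rw [funcCalc, h.resolventOp_eq, h.resolvent_eq_cfc, ← cfc_comp' _ _ _ hcont (by fun_prop)]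
  exact congrArg (fun g => cfc g _) (funext hcomp)

/-- The relation `P J = J K` says that `P` preserves the domain. On `J w` the commutator is `T K w -
P T w`, and `f(A) u = J (N a u)`. -/
lemma isConductivityOp (h : Realization A J T N N') {P Q K F a : E →L[ℂ] E}
    (hK : P * J = J * K) (hF : F = J * N * a) :
    IsConductivityOp A P Q F (Complex.I • (Q * (T * K - P * T) * N * a)) := by
  intro u
  have hPJ : ∀ w, P (J w) = J (K w) := fun w => congrArg (fun S : E →L[ℂ] E => S w) hK
  have e : F u = J (N (a u)) := by rw [hF]; rfl
  have hu : F u ∈ (commOp A P).domain := by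
    rw [e]
    refine ⟨h.mem_domain _, ?_⟩
    change P (J (N (a u))) ∈ A.domain
    rw [hPJ]; exact h.mem_domain _
  refine ⟨hu, ?_⟩
  have key : ∀ (x : E) (hx : x ∈ (commOp A P).domain) (w : E), x = J w →
      commOp A P ⟨x, hx⟩ = T (K w) - P (T w) := by
    rintro x hx w rfl
    change A ⟨P (J w), hx.2⟩ - P (A ⟨J w, hx.1⟩) = _
    rw [h.apply]
    have : ∀ (y : E) (hy : y ∈ A.domain), y = J (K w) → A ⟨y, hy⟩ = T (K w) := by
      rintro y hy rfl; exact h.apply _ _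
    rw [this _ _ (hPJ w)]
  rw [key _ hu _ e]
  rfl

lemma conductivityOp_eq {P Q F S : E →L[ℂ] E} (hS : IsConductivityOp A P Q F S) :
    conductivityOp A P Q F = S := by
  have hex : ∃ S, IsConductivityOp A P Q F S := ⟨S, hS⟩
  rw [conductivityOp, dif_pos hex]
  ext u
  obtain ⟨h1, e1⟩ := hex.choose_spec u
  obtain ⟨h2, e2⟩ := hS u
  rw [e1, e2]

/-- `Tr [A, P] f(A) = 0` if `f(A)` has finite rank. -/
lemma trace_commutator_eq_zero (h : Realization A J T N N') {P K a c : E →L[ℂ] E}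
    (hK : P * J = J * K) (ha : J * N * a = a * (J * N)) (hcRa : c * (J * N) * a = a)
    (hc : J * N * c = c * (J * N)) (hfr : FiniteRank (J * N * a)) :
    trace ((T * K - P * T) * N * a) = 0 := by
  set R := J * N with hR
  have hTN : T * N = Complex.I • R - 1 := by
    have := h.right
    rw [sub_mul, smul_mul_assoc] at this
    rw [← this]; abel
  have hNT : N * T = Complex.I • (N * J) - 1 := by
    have := h.left
    rw [mul_sub, mul_smul_comm] at this
    rw [← this]; abel
  have hRT : R * T = (Complex.I • R - 1) * J := by
    rw [hR, mul_assoc, hNT, mul_sub, mul_one, sub_mul, one_mul, mul_smul_comm, smul_mul_assoc,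
      mul_assoc]
  have hJKN : J * (K * N) = P * R := by rw [← mul_assoc, ← hK, mul_assoc]
  have hafr : FiniteRank a := by
    rw [← hcRa, mul_assoc]; exact hfr.mul_left _
  have hcRa' : c * (R * a) = a := by rw [← mul_assoc]; exact hcRa
  -- This is `Tr A P f(A) = Tr P A f(A)`. As `A` is unbounded, the factor `c R`, which acts as the
  -- identity on the range of `a`, is inserted first; cyclicity then places `R` in front of `T`,
  -- where `R T = (i R - 1) J` is bounded, and a second rotation restores the order.
  have h1 : trace (T * K * N * a) = trace (P * T * N * a) := by
    calc trace (T * K * N * a) = trace ((T * K * N * c) * (R * a)) := by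
          congr 1
          rw [mul_assoc (T * K * N), hcRa']
      _ = trace ((R * a) * (T * K * N * c)) := trace_mul_comm hfr
      _ = trace ((a * (Complex.I • R - 1)) * (P * R * c)) := by
          congr 1
          calc R * a * (T * K * N * c) = a * (R * T) * (K * N) * c := by
                rw [ha]; simp only [mul_assoc]
            _ = a * (Complex.I • R - 1) * (J * (K * N)) * c := by
                rw [hRT]; simp only [mul_assoc]
            _ = _ := by rw [hJKN]; simp only [mul_assoc]
      _ = trace ((P * R * c) * (a * (Complex.I • R - 1))) :=
          (trace_mul_comm (hafr.mul_right _)).symm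
      _ = trace (P * T * N * a) := by
          congr 1
          have e1 : R * c * a = a := by rw [hc]; exact hcRa
          have e2 : a * (Complex.I • R - 1) = (Complex.I • R - 1) * a := by
            rw [mul_sub, sub_mul, mul_smul_comm, smul_mul_assoc, ha, mul_one, one_mul]
          calc P * R * c * (a * (Complex.I • R - 1)) = P * (R * c * a) * (Complex.I • R - 1) := by
                simp only [mul_assoc]
            _ = P * ((Complex.I • R - 1) * a) := by rw [e1, mul_assoc, e2]
            _ = _ := by rw [← hTN]; simp only [mul_assoc]
  have hb : FiniteRank (N * a) := hafr.mul_left _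
  rw [mul_assoc, sub_mul, trace_sub (hb.mul_left _) (hb.mul_left _)]
  rw [← mul_assoc, ← mul_assoc, h1, sub_self]

end Realization

end Calculus

/-! ### Abstract locality: propagation through a chain of cutoffs. -/

section Locality

variable {E : Type*} [NormedAddCommGroup E] [InnerProductSpace ℂ E] [CompleteSpace E]

lemma norm_mul_le_of_le_one {S T : E →L[ℂ] E} (hS : ‖S‖ ≤ 1) : ‖S * T‖ ≤ ‖T‖ :=
  (norm_mul_le _ _).trans (by nlinarith [norm_nonneg T])

lemma norm_mul_le_of_le_one' {S T : E →L[ℂ] E} (hS : ‖S‖ ≤ 1) : ‖T * S‖ ≤ ‖T‖ :=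
  (norm_mul_le _ _).trans (by nlinarith [norm_nonneg T])

lemma norm_pow_le_one {S : E →L[ℂ] E} (hS : ‖S‖ ≤ 1) (k : ℕ) : ‖S ^ k‖ ≤ 1 := by
  induction k with
  | zero => exact ContinuousLinearMap.norm_id_le
  | succ k ih => rw [pow_succ]; exact (norm_mul_le_of_le_one ih).trans hS

/-- Move `χ` through one factor `U` at a time until it meets `Z`, where it vanishes. Each move
leaves one commutator `α R C`, and `|α| = 2`. -/
lemma norm_cutoff_mul_pow_le {R U χ C Z : E →L[ℂ] E} {α : ℂ} (hα : ‖α‖ = 2) (hU : U = 1 + α • R)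
    (hU1 : ‖U‖ ≤ 1) (hR : ‖R‖ ≤ 1) (hcomm : χ * R - R * χ = -(R * C)) (hZ : χ * Z = 0) (j : ℕ) :
    ‖χ * (U ^ j * Z)‖ ≤ 2 * ∑ b ∈ Finset.range j, ‖C * (U ^ b * Z)‖ := by
  induction j with
  | zero => simp [hZ]
  | succ j ih =>
    have e : χ * (U ^ (j + 1) * Z) = U * (χ * (U ^ j * Z)) - α • (R * (C * (U ^ j * Z))) := by
      have hc : χ * U - U * χ = -(α • (R * C)) := by
        rw [hU, mul_add, add_mul, mul_smul_comm, smul_mul_assoc, mul_one, one_mul,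
          add_sub_add_left_eq_sub, ← smul_sub, hcomm, smul_neg]
      rw [pow_succ', mul_assoc, ← mul_assoc χ U, eq_add_of_sub_eq hc, add_mul, neg_mul,
        smul_mul_assoc]
      simp only [mul_assoc]
      abel
    rw [e, Finset.sum_range_succ, mul_add]
    refine (norm_sub_le _ _).trans (add_le_add ((norm_mul_le_of_le_one hU1).trans ih) ?_)
    rw [norm_smul, hα]
    gcongr
    exact norm_mul_le_of_le_one hR

/-- Here `C (i + 1)` stands for `[A, χ i] (z - A)⁻¹`. Since `χ i` is `1` where `C i` acts, it can be
inserted after `C i` at the price of a term with `C (i + 1)`; `norm_cutoff_mul_pow_le` then produces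
`C (i + 1)` in the main term as well. Each round gains one commutator and costs `2j + 1`: `2j` from
the moves and `1` from the insertion. -/
lemma norm_mul_pow_mul_le {R U Z : E →L[ℂ] E} {χ C : ℕ → E →L[ℂ] E} {α : ℂ} (hα : ‖α‖ = 2)
    (hU : U = 1 + α • R) (hU1 : ‖U‖ ≤ 1) (hR : ‖R‖ ≤ 1)
    (hcomm : ∀ i, χ i * R - R * χ i = -(R * C (i + 1)))
    (hC : ∀ i, C i = C i * χ i - C i * C (i + 1)) (hZ : ∀ i, χ i * Z = 0) (r : ℕ) :
    ∀ i j : ℕ, ‖C i * (U ^ j * Z)‖ ≤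
      (2 * (j : ℝ) + 1) ^ r * ((∏ s ∈ Finset.range (r + 1), ‖C (i + s)‖) * ‖Z‖) := by
  induction r with
  | zero =>
    intro i j
    simp only [pow_zero, one_mul, zero_add, Finset.range_one, Finset.prod_singleton, add_zero]
    refine (norm_mul_le _ _).trans ?_
    gcongr
    exact norm_mul_le_of_le_one (norm_pow_le_one hU1 j)
  | succ r ih =>
    intro i j
    set p := (∏ s ∈ Finset.range (r + 1), ‖C (i + 1 + s)‖) * ‖Z‖ with hp
    have hp0 : 0 ≤ p := by positivity
    have e : C i * (U ^ j * Z) =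
        C i * (χ i * (U ^ j * Z)) - C i * (C (i + 1) * (U ^ j * Z)) := by
      conv_lhs => rw [hC i]
      rw [sub_mul]; simp only [mul_assoc]
    have h1 : ‖χ i * (U ^ j * Z)‖ ≤ 2 * (j * ((2 * (j : ℝ) + 1) ^ r * p)) := by
      refine (norm_cutoff_mul_pow_le hα hU hU1 hR (hcomm i) (hZ i) j).trans ?_
      gcongr
      refine (Finset.sum_le_card_nsmul _ _ ((2 * (j : ℝ) + 1) ^ r * p) fun b hb => ?_).trans ?_
      · refine (ih (i + 1) b).trans ?_
        have : (b : ℝ) ≤ j := by exact_mod_cast (Finset.mem_range.1 hb).le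
        gcongr
      · simp
    have h2 := ih (i + 1) j
    have e3 : (∏ s ∈ Finset.range (r + 1 + 1), ‖C (i + s)‖) * ‖Z‖ = ‖C i‖ * p := by
      rw [Finset.prod_range_succ', hp, add_zero, mul_comm _ ‖C i‖, mul_assoc]
      simp only [add_assoc, add_comm 1]
    rw [e, e3]
    calc _ ≤ ‖C i‖ * (2 * (j * ((2 * (j : ℝ) + 1) ^ r * p))) +
          ‖C i‖ * ((2 * (j : ℝ) + 1) ^ r * p) := by
          refine (norm_sub_le _ _).trans (add_le_add ?_ ?_)
          · exact (norm_mul_le _ _).trans (by gcongr)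
          · exact (norm_mul_le _ _).trans (by gcongr)
      _ = _ := by ring

/-- Telescoping: one step of the difference is `D U^k (U - U₀) = D U^(k + 1) Z - D U^k Z`, so only
vectors `D U^j Z` have to be estimated. The `2k + 1` terms raise the exponent by one. -/
lemma norm_mul_pow_sub_le {D D₀ U U₀ Z : E →L[ℂ] E} (hD : D - D₀ = D * Z)
    (hU : U - U₀ = (U - 1) * Z) (hU₀ : ‖U₀‖ ≤ 1) {r : ℕ} {a : ℝ}
    (ha : ∀ j : ℕ, ‖D * (U ^ j * Z)‖ ≤ (2 * (j : ℝ) + 1) ^ r * a) (k : ℕ) :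
    ‖D * U ^ k - D₀ * U₀ ^ k‖ ≤ (2 * (k : ℝ) + 1) ^ (r + 1) * a := by
  have ha0 : 0 ≤ a := by simpa using (norm_nonneg _).trans (ha 0)
  have key : ‖D * U ^ k - D * U₀ ^ k‖ ≤ 2 * k * ((2 * (k : ℝ) + 1) ^ r * a) := by
    induction k with
    | zero => simp
    | succ k ih =>
      have e : D * U ^ (k + 1) - D * U₀ ^ (k + 1) =
          (D * (U ^ (k + 1) * Z) - D * (U ^ k * Z)) + (D * U ^ k - D * U₀ ^ k) * U₀ := by
        have e1 : D * (U ^ (k + 1) * Z) - D * (U ^ k * Z) = D * U ^ k * (U - U₀) := by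
          rw [hU, pow_succ]; noncomm_ring
        rw [e1, pow_succ, pow_succ]; noncomm_ring
      rw [e]
      have h1 := ha (k + 1)
      have h2 : ‖D * (U ^ k * Z)‖ ≤ (2 * ((k + 1 : ℕ) : ℝ) + 1) ^ r * a := by
        refine (ha k).trans ?_
        gcongr; simp
      have h3 : ‖(D * U ^ k - D * U₀ ^ k) * U₀‖ ≤
          2 * k * ((2 * ((k + 1 : ℕ) : ℝ) + 1) ^ r * a) := by
        refine (norm_mul_le_of_le_one' hU₀).trans (ih.trans ?_)
        gcongr; simp
      refine (norm_add_le _ _).trans ((add_le_add (norm_sub_le _ _) le_rfl).trans ?_)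
      push_cast at *
      linarith
  have e : D * U ^ k - D₀ * U₀ ^ k = (D * U ^ k - D * U₀ ^ k) + D * Z * U₀ ^ k := by
    rw [← hD]; noncomm_ring
  have h4 : ‖D * Z * U₀ ^ k‖ ≤ (2 * (k : ℝ) + 1) ^ r * a := by
    refine (norm_mul_le_of_le_one' (norm_pow_le_one hU₀ k)).trans ?_
    have := ha 0
    simp only [pow_zero, one_mul, CharP.cast_eq_zero, mul_zero, zero_add, one_pow] at this
    refine this.trans (le_mul_of_one_le_left ha0 (one_le_pow₀ ?_))
    have : (0 : ℝ) ≤ k := by positivity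
    linarith
  rw [e]
  refine (norm_add_le _ _).trans ((add_le_add key h4).trans (le_of_eq ?_))
  ring

/-- A chain of nested cutoffs `χ i`, acting as `K i` on the domain, that separates `B` from `V`. -/
structure CutoffChain (J T V B : E →L[ℂ] E) (χ K : ℕ → E →L[ℂ] E) : Prop where
  intertwine : ∀ i, χ i * J = J * K i
  start : B * K 0 = B
  next : ∀ i, (T * K i - χ i * T) * K (i + 1) = T * K i - χ i * T
  vanish : ∀ i, χ i * V = 0

/-- The commutators `[A, χ i]` on the domain, preceded by `B`. -/
def chainOp (T B : E →L[ℂ] E) (χ K : ℕ → E →L[ℂ] E) : ℕ → E →L[ℂ] E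
  | 0 => B
  | i + 1 => T * K i - χ i * T

lemma CutoffChain.norm_sub_le {J T T₀ B N N₀ : E →L[ℂ] E} {χ K : ℕ → E →L[ℂ] E}
    (hc : CutoffChain J T (T - T₀) B χ K) {z α : ℂ} (hα : ‖α‖ = 2)
    (hl : N * (z • J - T) = 1) (hr : (z • J - T) * N = 1)
    (hr₀ : (z • J - T₀) * N₀ = 1) (hR : ‖J * N‖ ≤ 1)
    (hU : ‖1 + α • (J * N)‖ ≤ 1) (hU₀ : ‖1 + α • (J * N₀)‖ ≤ 1) (r k : ℕ) :
    ‖B * N * (1 + α • (J * N)) ^ k - B * N₀ * (1 + α • (J * N₀)) ^ k‖ ≤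
      (2 * (k : ℝ) + 1) ^ (r + 1) *
        ((∏ s ∈ Finset.range (r + 1), ‖chainOp T B χ K s * N‖) * ‖(T - T₀) * N₀‖) := by
  set Z := (T - T₀) * N₀ with hZ
  have hN : N - N₀ = N * Z := by
    calc N - N₀ = N * ((z • J - T₀) * N₀) - (N * (z • J - T)) * N₀ := by
          rw [hr₀, hl, mul_one, one_mul]
      _ = N * Z := by rw [hZ]; noncomm_ring
  -- The identity `[χ, R] = -R [A, χ] R`, written without the leftmost factor `J`.
  have hKN : ∀ i, K i * N - N * χ i = -(N * (chainOp T B χ K (i + 1) * N)) := fun i => by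
    calc K i * N - N * χ i = (N * (z • J - T)) * K i * N - N * χ i * ((z • J - T) * N) := by
          rw [hl, hr, mul_one, one_mul]
      _ = N * (z • (J * K i - χ i * J)) * N - N * (T * K i - χ i * T) * N := by
          simp only [smul_sub, sub_mul, mul_sub, smul_mul_assoc, mul_smul_comm, mul_assoc]
          abel
      _ = _ := by
          rw [hc.intertwine i, sub_self, smul_zero, mul_zero, zero_mul, zero_sub, mul_assoc]
          rfl
  have hCK : ∀ i, chainOp T B χ K i * K i = chainOp T B χ K i := by
    rintro (_ | i)
    · exact hc.start
    · exact hc.next i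
  refine norm_mul_pow_sub_le (Z := Z) ?_ ?_ hU₀ ?_ k
  · rw [← mul_sub, hN, mul_assoc]
  · rw [add_sub_add_left_eq_sub, ← smul_sub, ← mul_sub, hN, add_sub_cancel_left, smul_mul_assoc,
      mul_assoc]
  · intro j
    have := norm_mul_pow_mul_le (R := J * N) (U := 1 + α • (J * N)) (Z := Z) (χ := χ)
      (C := fun i => chainOp T B χ K i * N) hα rfl hU hR ?_ ?_ ?_ r 0 j
    · simp only [zero_add] at this
      exact this
    · intro i
      rw [← mul_assoc, hc.intertwine, mul_assoc, mul_assoc, ← mul_sub, hKN, mul_neg, mul_assoc]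
    · intro i
      conv_lhs => rw [← hCK i, mul_assoc, eq_add_of_sub_eq (hKN i)]
      rw [mul_add, mul_neg]
      simp only [mul_assoc]
      abel
    · intro i
      rw [hZ, ← mul_assoc, hc.vanish, zero_mul]

/-- A vector of the range killed by `ev` satisfies `‖w‖ ≤ M ‖J w‖ ≤ M ε ‖w‖`, hence is zero: `ev` is
injective on the range. -/
lemma finrank_range_le_card {ι : Type*} [Fintype ι] {J G : E →L[ℂ] E} {M ε : ℝ} (hM : 0 ≤ M)
    (hMε : M * ε < 1) (hG : ∀ v, ‖G v‖ ≤ M * ‖J (G v)‖) (ev : E →ₗ[ℂ] (ι → ℂ))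
    (hev : ∀ w, ev w = 0 → ‖J w‖ ≤ ε * ‖w‖) :
    FiniteRank G ∧ Module.finrank ℂ G.range ≤ Fintype.card ι := by
  have hinj : Function.Injective (ev.domRestrict G.range) := by
    rw [← LinearMap.ker_eq_bot, LinearMap.ker_eq_bot']
    rintro ⟨_, v, rfl⟩ h0
    have h1 := hev _ h0
    have h2 := hG v
    change ‖J (G v)‖ ≤ ε * ‖G v‖ at h1
    have h3 : ‖G v‖ ≤ 0 := by
      have h4 : ‖G v‖ ≤ M * ε * ‖G v‖ := by nlinarith
      nlinarith [norm_nonneg (G v)]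
    have : G v = 0 := norm_le_zero_iff.1 h3
    exact Subtype.ext this
  refine ⟨FiniteDimensional.of_injective _ hinj, ?_⟩
  simpa using LinearMap.finrank_le_finrank_of_injective hinj

lemma finrank_range_mul_le {G : E →L[ℂ] E} (hG : FiniteRank G) (S : E →L[ℂ] E) :
    Module.finrank ℂ (S * G).range ≤ Module.finrank ℂ G.range := by
  have : FiniteDimensional ℂ G.range := hG
  have h : (S * G).range = G.range.map (S : E →ₗ[ℂ] E) := by
    ext x; simp [LinearMap.mem_range]
  rw [h]; exact Submodule.finrank_map_le _ _

lemma norm_trace_sub_le {S T : E →L[ℂ] E} (hS : FiniteRank S) (hT : FiniteRank T) {ρ : ℝ}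
    (hSρ : Module.finrank ℂ S.range ≤ ρ) (hTρ : Module.finrank ℂ T.range ≤ ρ) :
    ‖trace S - trace T‖ ≤ 2 * ρ * ‖S - T‖ := by
  have : FiniteDimensional ℂ S.range := hS
  have : FiniteDimensional ℂ T.range := hT
  rw [← trace_sub hS hT]
  refine (norm_trace_le (hS.sub hT)).trans ?_
  gcongr
  have h1 := Submodule.finrank_mono (range_sub_le S T)
  have h2 := Submodule.finrank_add_le_finrank_add_finrank S.range T.range
  have h3 : (Module.finrank ℂ (S - T).range : ℝ) ≤
      Module.finrank ℂ S.range + Module.finrank ℂ T.range := by exact_mod_cast h1.trans h2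
  linarith

end Locality

/-! ### The conductivity of a realization and its stability. -/

section Conductivity

variable {E : Type*} [NormedAddCommGroup E] [InnerProductSpace ℂ E] [CompleteSpace E]

/-- `(i - x) f(x)`; thus `f(A) = (i - A)⁻¹ ((i - x) f)(A)`. -/
def resolventWeight (f : ℝ → ℝ) (x : ℝ) : ℂ := (Complex.I - x) * f x

lemma contDiff_resolventWeight {f : ℝ → ℝ} (hf : ContDiff ℝ ∞ f) :
    ContDiff ℝ ∞ (resolventWeight f) :=
  (contDiff_const.sub Complex.ofRealCLM.contDiff).mul (Complex.ofRealCLM.contDiff.comp hf)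

lemma hasCompactSupport_ofReal {f : ℝ → ℝ} (hc : HasCompactSupport f) :
    HasCompactSupport fun x => (f x : ℂ) := hc.comp_left (g := fun x : ℝ => (x : ℂ)) (by simp)

lemma hasCompactSupport_resolventWeight {f : ℝ → ℝ} (hc : HasCompactSupport f) :
    HasCompactSupport (resolventWeight f) := (hasCompactSupport_ofReal hc).mul_left

/-- `((i - x) f)(A)`, as a function of the Cayley transform of `A`. -/
def weightCalc (f : ℝ → ℝ) (J N : E →L[ℂ] E) : E →L[ℂ] E :=
  cfc (cayleyFun (resolventWeight f)) (Realization.cayley J N)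

namespace Realization

variable {A : E →ₗ.[ℂ] E} {J T N N' : E →L[ℂ] E}

lemma funcCalc_eq_mul (h : Realization A J T N N') {f : ℝ → ℝ} (hf : ContDiff ℝ ∞ f)
    (hc : HasCompactSupport f) : funcCalc A f = J * N * weightCalc f J N := by
  have hf' : ContDiff ℝ ∞ fun x => (f x : ℂ) := Complex.ofRealCLM.contDiff.comp hf
  rw [h.funcCalc_eq hf' (hasCompactSupport_ofReal hc),
    h.cfc_cayleyFun_eq hf' (hasCompactSupport_ofReal hc)]
  rfl

/-- Since `χ f = f`, the function `(i - x) f` equals `(i - x) χ · (i - x)⁻¹ · (i - x) f`. The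
resolvent thus exposed serves both the cyclicity argument and the rank bound. -/
lemma weightCalc_eq_mul (h : Realization A J T N N') {f χ : ℝ → ℝ} (hf : ContDiff ℝ ∞ f)
    (hc : HasCompactSupport f) (hχ : ContDiff ℝ ∞ χ) (hχc : HasCompactSupport χ)
    (hχf : ∀ x, χ x * f x = f x) :
    weightCalc f J N = weightCalc χ J N * (J * N) * weightCalc f J N := by
  have hf' : ContDiff ℝ ∞ fun x => (f x : ℂ) := Complex.ofRealCLM.contDiff.comp hf
  have h1 := h.cfc_cayleyFun_eq hf' (hasCompactSupport_ofReal hc)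
  have h2 : weightCalc χ J N * cfc (cayleyFun fun x => (f x : ℂ)) (cayley J N) =
      weightCalc f J N := by
    rw [weightCalc, h.cfc_mul_cayley (contDiff_resolventWeight hχ)
      (hasCompactSupport_resolventWeight hχc) hf' (hasCompactSupport_ofReal hc)]
    congr 2
    ext x
    simp only [resolventWeight]
    rw [mul_assoc, ← Complex.ofReal_mul, hχf]
  conv_lhs => rw [← h2, h1]
  rw [mul_assoc]
  rfl

lemma norm_weightCalc_le {χ : ℝ → ℝ} {M : ℝ} (hM0 : 0 ≤ M)
    (hM : ∀ x, ‖resolventWeight χ x‖ ≤ M) (J N : E →L[ℂ] E) : ‖weightCalc χ J N‖ ≤ M :=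
  norm_cfc_le hM0 fun u _ => norm_cayleyFun_le hM0 hM u

/-- A Bernstein inequality: for `w` in the range, `w = N χ̃(A) J w` with `χ̃(x) = (i - x) χ(x)`, so
`‖w‖ ≤ L M ‖J w‖`. Together with smallness of `J` on high modes, the low modes determine `w`. -/
lemma finrank_weightCalc_le (h : Realization A J T N N') {f χ : ℝ → ℝ} (hf : ContDiff ℝ ∞ f)
    (hc : HasCompactSupport f) (hχ : ContDiff ℝ ∞ χ) (hχc : HasCompactSupport χ)
    (hχf : ∀ x, χ x * f x = f x) {M L ε : ℝ} (hM0 : 0 ≤ M)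
    (hM : ∀ x, ‖resolventWeight χ x‖ ≤ M) (hL : ‖N‖ ≤ L) (hε : L * M * ε < 1)
    {ι : Type*} [Fintype ι] (ev : E →ₗ[ℂ] (ι → ℂ)) (hev : ∀ w, ev w = 0 → ‖J w‖ ≤ ε * ‖w‖) :
    FiniteRank (N * weightCalc f J N) ∧
      Module.finrank ℂ (N * weightCalc f J N).range ≤ Fintype.card ι := by
  have hL0 : 0 ≤ L := (norm_nonneg _).trans hL
  refine finrank_range_le_card (M := L * M) (by positivity) hε (fun v => ?_) ev hev
  have e : (N * weightCalc f J N) v =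
      N (weightCalc χ J N (J ((N * weightCalc f J N) v))) := by
    conv_lhs => rw [h.weightCalc_eq_mul hf hc hχ hχc hχf]
    rfl
  rw [mul_assoc]
  conv_lhs => rw [e]
  refine (N.le_of_opNorm_le hL _).trans ?_
  gcongr
  exact (weightCalc χ J N).le_of_opNorm_le (norm_weightCalc_le hM0 hM J N) _

/-- The conductivity operator exists, is trace class, and its trace is that of the part of the
commutator away from the filter. -/
lemma conductivity_spec (h : Realization A J T N N') {f χ : ℝ → ℝ} (hf : ContDiff ℝ ∞ f)
    (hc : HasCompactSupport f) (hχ : ContDiff ℝ ∞ χ) (hχc : HasCompactSupport χ)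
    (hχf : ∀ x, χ x * f x = f x) (hfr : FiniteRank (N * weightCalc f J N))
    {P Q K : E →L[ℂ] E} (hK : P * J = J * K) :
    IsConductivityOp A P Q (funcCalc A f) (conductivityOp A P Q (funcCalc A f)) ∧
    IsTraceClass (conductivityOp A P Q (funcCalc A f)) ∧
    trace (conductivityOp A P Q (funcCalc A f)) =
      -Complex.I * trace ((1 - Q) * (T * K - P * T) * (N * weightCalc f J N)) := by
  set a := weightCalc f J N with ha
  have h1 := h.isConductivityOp (Q := Q) hK (h.funcCalc_eq_mul hf hc)
  have h2 := conductivityOp_eq h1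
  rw [h2]
  have e : Complex.I • (Q * (T * K - P * T) * N * a) =
      Complex.I • (Q * (T * K - P * T)) * (N * a) := by
    rw [smul_mul_assoc]; simp only [mul_assoc]
  refine ⟨h1, ?_, ?_⟩
  · rw [e]
    exact (hfr.mul_left _).isTraceClass
  · have hz : trace ((T * K - P * T) * N * a) = 0 :=
      h.trace_commutator_eq_zero hK (h.resolvent_commute _)
        (h.weightCalc_eq_mul hf hc hχ hχc hχf).symm (h.resolvent_commute _)
        (by rw [mul_assoc]; exact hfr.mul_left _)
    rw [trace_smul]
    have e2 : Q * (T * K - P * T) * N * a = (T * K - P * T) * (N * a) -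
        (1 - Q) * (T * K - P * T) * (N * a) := by noncomm_ring
    rw [e2, trace_sub (hfr.mul_left _) (hfr.mul_left _), ← mul_assoc, hz]
    ring

/-- Rewriting `N U*^(k + 1)` as `N' U*^k` gives both halves of the series the same shape, with `i`
and `-i` exchanged, so that one locality bound covers both. -/
lemma hasSum_mul_weightCalc (h : Realization A J T N N') {f : ℝ → ℝ} (hf : ContDiff ℝ ∞ f)
    (hc : HasCompactSupport f) {a b : ℕ → ℂ} (hab : Summable fun k => ‖a k‖ + ‖b k‖)
    (hs : ∀ u : ℂ, ‖u‖ = 1 → HasSum (fun k => a k * u ^ k + b k * (star u) ^ (k + 1))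
      (cayleyFun (resolventWeight f) u)) (B : E →L[ℂ] E) :
    HasSum (fun k => a k • (B * N * cayley J N ^ k) + b k • (B * N' * star (cayley J N) ^ k))
      (B * (N * weightCalc f J N)) := by
  have h1 := hasSum_cfc_cayleyFun (contDiff_resolventWeight hf)
    (hasCompactSupport_resolventWeight hc) hab hs h.cayley_mem_unitary
  have h2 := h1.mul_left (B * N)
  rw [mul_assoc] at h2
  refine h2.congr_fun fun k => ?_
  rw [mul_add, mul_smul_comm, mul_smul_comm, pow_succ', ← mul_assoc (B * N), mul_assoc B N (star _),
    h.inverse_mul_star_cayley]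

/-- If a perturbation is separated from `B` by a chain of cutoffs whose commutators with `A` are of
size `ε`, then `B f(A)` changes by `O(ε ^ r)` for every `r`. -/
lemma norm_mul_weightCalc_sub_le (h : Realization A J T N N') {A₀ : E →ₗ.[ℂ] E}
    {T₀ N₀ N₀' : E →L[ℂ] E} (h₀ : Realization A₀ J T₀ N₀ N₀') {f : ℝ → ℝ} (hf : ContDiff ℝ ∞ f)
    (hc : HasCompactSupport f) {a b : ℕ → ℂ} (hab : Summable fun k => ‖a k‖ + ‖b k‖)
    (hs : ∀ u : ℂ, ‖u‖ = 1 → HasSum (fun k => a k * u ^ k + b k * (star u) ^ (k + 1))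
      (cayleyFun (resolventWeight f) u)) {r : ℕ}
    (habr : Summable fun k => (‖a k‖ + ‖b k‖) * (2 * (k : ℝ) + 1) ^ (r + 1))
    {B : E →L[ℂ] E} {χ K : ℕ → E →L[ℂ] E} (hch : CutoffChain J T (T - T₀) B χ K)
    {L ν β ε : ℝ} {γ : ℕ → ℝ} (hL : ‖N‖ ≤ L) (hL' : ‖N'‖ ≤ L) (hL₀ : ‖N₀‖ ≤ L) (hL₀' : ‖N₀'‖ ≤ L)
    (hν : ‖T - T₀‖ ≤ ν) (hβ : ‖B‖ ≤ β) (hγ : ∀ i, ‖T * K i - χ i * T‖ ≤ γ i * ε) :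
    ‖B * (N * weightCalc f J N) - B * (N₀ * weightCalc f J N₀)‖ ≤
      (∑' k, (‖a k‖ + ‖b k‖) * (2 * (k : ℝ) + 1) ^ (r + 1)) *
        (β * L * (∏ s ∈ Finset.range r, γ s * L) * (ν * L)) * ε ^ r := by
  have hL0 : 0 ≤ L := (norm_nonneg _).trans hL
  set c := β * L * (∏ s ∈ Finset.range r, γ s * L) * (ν * L) * ε ^ r with hcdef
  have hα : ‖-(2 * Complex.I)‖ = 2 := by simp
  have hα' : ‖2 * Complex.I‖ = 2 := by simp
  have hU : ∀ M : E →L[ℂ] E, cayley J M = 1 + -(2 * Complex.I) • (J * M) := fun M => by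
    rw [cayley, neg_smul, sub_eq_add_neg]
  have hprod : ∀ M M₀ : E →L[ℂ] E, ‖M‖ ≤ L → ‖M₀‖ ≤ L →
      (∏ s ∈ Finset.range (r + 1), ‖chainOp T B χ K s * M‖) * ‖(T - T₀) * M₀‖ ≤ c := by
    intro M M₀ hM hM₀
    have hp : ∏ s ∈ Finset.range (r + 1), ‖chainOp T B χ K s * M‖ ≤
        (∏ s ∈ Finset.range r, γ s * ε * L) * (β * L) := by
      -- The factor with index `0` is `B N`, which is only bounded; the other `r` factors are
      -- commutators and carry the powers of `ε`.
      rw [Finset.prod_range_succ']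
      have hγ0 : ∀ s, 0 ≤ γ s * ε := fun s => (norm_nonneg _).trans (hγ s)
      refine mul_le_mul (Finset.prod_le_prod (fun _ _ => norm_nonneg _) fun s _ => ?_) ?_
        (norm_nonneg _) (Finset.prod_nonneg fun s _ => mul_nonneg (hγ0 s) hL0)
      · exact (norm_mul_le _ _).trans (mul_le_mul (hγ s) hM (norm_nonneg _) (hγ0 s))
      · exact (norm_mul_le _ _).trans
          (mul_le_mul hβ hM (norm_nonneg _) ((norm_nonneg _).trans hβ))
    refine (mul_le_mul hp ((norm_mul_le _ _).trans
      (mul_le_mul hν hM₀ (norm_nonneg _) ((norm_nonneg _).trans hν))) (norm_nonneg _)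
      ((Finset.prod_nonneg fun _ _ => norm_nonneg _).trans hp)).trans (le_of_eq ?_)
    have : ∏ s ∈ Finset.range r, γ s * ε * L = (∏ s ∈ Finset.range r, γ s * L) * ε ^ r := by
      rw [show ε ^ r = ∏ _s ∈ Finset.range r, ε by simp, ← Finset.prod_mul_distrib]
      exact Finset.prod_congr rfl fun s _ => by ring
    rw [hcdef, this]; ring
  have h1 := h.hasSum_mul_weightCalc hf hc hab hs B
  have h2 := h₀.hasSum_mul_weightCalc hf hc hab hs B
  have h3 := h1.sub h2
  have hbound : ∀ k, ‖(a k • (B * N * cayley J N ^ k) + b k • (B * N' * star (cayley J N) ^ k)) -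
      (a k • (B * N₀ * cayley J N₀ ^ k) + b k • (B * N₀' * star (cayley J N₀) ^ k))‖ ≤
      (‖a k‖ + ‖b k‖) * (2 * (k : ℝ) + 1) ^ (r + 1) * c := by
    intro k
    rw [add_sub_add_comm, ← smul_sub, ← smul_sub]
    have e1 : ‖B * N * cayley J N ^ k - B * N₀ * cayley J N₀ ^ k‖ ≤
        (2 * (k : ℝ) + 1) ^ (r + 1) * c := by
      rw [hU, hU]
      refine (hch.norm_sub_le hα h.left h.right h₀.right h.norm_resolvent_le
        (by rw [← hU]; exact h.norm_cayley_le) (by rw [← hU]; exact h₀.norm_cayley_le) r k).trans ?_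
      gcongr
      exact hprod _ _ hL hL₀
    have e2 : ‖B * N' * star (cayley J N) ^ k - B * N₀' * star (cayley J N₀) ^ k‖ ≤
        (2 * (k : ℝ) + 1) ^ (r + 1) * c := by
      rw [h.star_cayley, h₀.star_cayley]
      refine (hch.norm_sub_le hα' h.left' h.right' h₀.right' h.norm_resolvent_le'
        (by rw [← h.star_cayley]; exact h.norm_star_cayley_le)
        (by rw [← h₀.star_cayley]; exact h₀.norm_star_cayley_le) r k).trans ?_
      gcongr
      exact hprod _ _ hL' hL₀'
    refine (norm_add_le _ _).trans ?_
    rw [norm_smul, norm_smul]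
    calc _ ≤ ‖a k‖ * ((2 * (k : ℝ) + 1) ^ (r + 1) * c) +
          ‖b k‖ * ((2 * (k : ℝ) + 1) ^ (r + 1) * c) := by gcongr
      _ = _ := by ring
  rw [← h3.tsum_eq]
  refine (tsum_of_norm_bounded (habr.mul_right c).hasSum hbound).trans (le_of_eq ?_)
  rw [tsum_mul_right, hcdef]; ring

end Realization

end Conductivity

/-! ### Completeness of the exponentials on the circle and the torus. -/

section FourierUniqueness

/-- Lebesgue measure on the circle `[-π, π)`. -/
def circleMeasure : Measure ℝ := volume.restrict (Ico (-Real.pi) Real.pi)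

instance : IsFiniteMeasure circleMeasure := by
  unfold circleMeasure; infer_instance

lemma torusMeasure_eq_prod : torusMeasure = circleMeasure.prod circleMeasure := by
  rw [torusMeasure, circleMeasure, cell, Measure.prod_restrict]; rfl

lemma integral_circleMeasure {F : Type*} [NormedAddCommGroup F] [NormedSpace ℝ F] (f : ℝ → F) :
    ∫ x, f x ∂circleMeasure = ∫ x in (-Real.pi)..Real.pi, f x := by
  rw [circleMeasure, intervalIntegral.integral_of_le (by linarith [Real.pi_pos]),
    integral_Ico_eq_integral_Ioc]

/-- The character `exp (i k x)`. -/
def char (k : ℤ) (x : ℝ) : ℂ := Complex.exp (Complex.I * k * x)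

lemma norm_char (k : ℤ) (x : ℝ) : ‖char k x‖ = 1 := by
  rw [char, show Complex.I * k * x = ((k * x : ℝ) : ℂ) * Complex.I by push_cast; ring]
  exact Complex.norm_exp_ofReal_mul_I _

lemma contDiff_char (k : ℤ) : ContDiff ℝ ∞ (char k) := by
  unfold char
  exact (contDiff_const.mul Complex.ofRealCLM.contDiff).cexp

lemma char_periodic (k : ℤ) (x : ℝ) : char k (x + 2 * Real.pi) = char k x := by
  rw [char, char, show Complex.I * k * ((x + 2 * Real.pi : ℝ) : ℂ) =
    Complex.I * k * x + k * (2 * Real.pi * Complex.I) by push_cast; ring, Complex.exp_add,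
    Complex.exp_int_mul_two_pi_mul_I, mul_one]

lemma hasDerivAt_char (k : ℤ) (x : ℝ) : HasDerivAt (char k) (Complex.I * k * char k x) x := by
  have h : HasDerivAt (fun y : ℝ => Complex.I * k * (y : ℂ)) (Complex.I * k) x := by
    simpa using (Complex.ofRealCLM.hasDerivAt (x := x)).const_mul (Complex.I * k)
  have := h.cexp
  rw [mul_comm (Complex.exp _)] at this
  exact this

lemma conj_char (k : ℤ) (x : ℝ) : (starRingEnd ℂ) (char k x) = char (-k) x := by
  rw [char, char, ← Complex.exp_conj]
  simp

lemma char_mul (k l : ℤ) (x : ℝ) : char k x * char l x = char (k + l) x := by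
  rw [char, char, char, ← Complex.exp_add]; congr 1; push_cast; ring

lemma integral_char (k : ℤ) :
    ∫ x, char k x ∂circleMeasure = if k = 0 then (2 * Real.pi : ℂ) else 0 := by
  rw [integral_circleMeasure]
  split_ifs with hk
  · subst hk
    simp [char]; ring
  · have hk' : Complex.I * k ≠ 0 := mul_ne_zero Complex.I_ne_zero (by exact_mod_cast hk)
    have hd : ∀ x : ℝ, HasDerivAt (fun y => (Complex.I * k)⁻¹ * char k y) (char k x) x := fun x => by
      have := (hasDerivAt_char k x).const_mul (Complex.I * k)⁻¹
      rwa [← mul_assoc, inv_mul_cancel₀ hk', one_mul] at this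
    rw [intervalIntegral.integral_eq_sub_of_hasDerivAt (fun x _ => hd x)
      ((contDiff_char k).continuous.intervalIntegrable _ _)]
    have := char_periodic k (-Real.pi)
    rw [show -Real.pi + 2 * Real.pi = Real.pi by ring] at this
    rw [this, sub_self]

/-- Trigonometric polynomials are uniformly dense in the continuous functions on the circle, so `g`
integrates to zero against all of these, in particular against test functions supported inside the
period. -/
lemma ae_eq_zero_of_integral_char {g : ℝ → ℂ} (hg : Integrable g circleMeasure)
    (h : ∀ k : ℤ, ∫ x, char k x * g x ∂circleMeasure = 0) : g =ᵐ[circleMeasure] 0 := by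
  have hpi := Real.pi_pos
  have hT : Fact (0 < 2 * Real.pi) := ⟨Real.two_pi_pos⟩
  have hmul : ∀ p : C(AddCircle (2 * Real.pi), ℂ),
      Integrable (fun x : ℝ => p (x : AddCircle (2 * Real.pi)) * g x) circleMeasure := fun p => by
    refine hg.bdd_mul (c := ‖p‖) ?_ (Filter.Eventually.of_forall fun x => p.norm_coe_le_norm _)
    exact (p.continuous.comp (AddCircle.continuous_mk' _)).aestronglyMeasurable
  have hspan : ∀ p ∈ Submodule.span ℂ (range (@fourier (2 * Real.pi))),
      ∫ x : ℝ, p (x : AddCircle (2 * Real.pi)) * g x ∂circleMeasure = 0 := by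
    intro p hp
    induction hp using Submodule.span_induction with
    | mem p hp =>
      obtain ⟨k, rfl⟩ := hp
      rw [← h k]
      refine integral_congr_ae (Filter.Eventually.of_forall fun x => ?_)
      simp only [fourier_coe_apply, char]
      congr 2
      have : (Real.pi : ℂ) ≠ 0 := by exact_mod_cast Real.pi_ne_zero
      push_cast; field_simp
    | zero => simp
    | add p q _ _ hp hq =>
      simp only [ContinuousMap.add_apply, add_mul]
      rw [integral_add (hmul p) (hmul q), hp, hq, add_zero]
    | smul c p _ hp =>
      simp only [ContinuousMap.smul_apply, smul_eq_mul, mul_assoc]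
      rw [integral_const_mul, hp, mul_zero]
  have hall : ∀ p : C(AddCircle (2 * Real.pi), ℂ),
      ∫ x : ℝ, p (x : AddCircle (2 * Real.pi)) * g x ∂circleMeasure = 0 := by
    intro p
    have hp : p ∈ (Submodule.span ℂ (range (@fourier (2 * Real.pi)))).topologicalClosure := by
      rw [span_fourier_closure_eq_top]; trivial
    rw [← norm_le_zero_iff]
    refine le_of_forall_pos_le_add fun ε hε => ?_
    set I := ∫ x, ‖g x‖ ∂circleMeasure
    have hI : 0 ≤ I := integral_nonneg fun _ => norm_nonneg _
    obtain ⟨q, hq, hpq⟩ := Metric.mem_closure_iff.1 hp (ε / (I + 1)) (by positivity)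
    have e : ∫ x : ℝ, p (x : AddCircle (2 * Real.pi)) * g x ∂circleMeasure =
        ∫ x : ℝ, (p - q) (x : AddCircle (2 * Real.pi)) * g x ∂circleMeasure := by
      simp only [ContinuousMap.sub_apply, sub_mul]
      rw [integral_sub (hmul p) (hmul q), hspan q hq, sub_zero]
    rw [e]
    calc _ ≤ ∫ x, ε / (I + 1) * ‖g x‖ ∂circleMeasure := by
          refine norm_integral_le_of_norm_le (hg.norm.const_mul _)
            (Filter.Eventually.of_forall fun x => ?_)
          rw [norm_mul]
          gcongr
          rw [dist_eq_norm] at hpq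
          exact ((p - q).norm_coe_le_norm _).trans hpq.le
      _ = ε / (I + 1) * I := integral_const_mul _ _
      _ ≤ 0 + ε := by
          rw [zero_add, div_mul_eq_mul_div, div_le_iff₀ (by positivity)]; nlinarith
  have hopen : ∀ᵐ x ∂volume, x ∈ Ioo (-Real.pi) Real.pi → g x = 0 := by
    refine IsOpen.ae_eq_zero_of_integral_contDiff_smul_eq_zero isOpen_Ioo ?_ ?_
    · refine IntegrableOn.locallyIntegrableOn ?_
      exact IntegrableOn.mono_set hg Ioo_subset_Ico_self
    · intro φ hφ hφc hφs
      have hφ0 : ∀ x ∉ Ioo (-Real.pi) Real.pi, φ x = 0 := fun x hx => by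
        by_contra hne
        exact hx (hφs (subset_tsupport _ hne))
      -- A test function vanishes at both endpoints, so its periodic extension is continuous.
      let p : C(AddCircle (2 * Real.pi), ℂ) :=
        ⟨AddCircle.liftIco (2 * Real.pi) (-Real.pi) (fun x => (φ x : ℂ)),
          AddCircle.liftIco_continuous (by
            rw [hφ0 (-Real.pi) (by simp), hφ0 (-Real.pi + 2 * Real.pi) (fun h => by linarith [h.2])])
            (Complex.continuous_ofReal.comp hφ.continuous).continuousOn⟩
      have hp := hall p
      have e : ∫ x : ℝ, p (x : AddCircle (2 * Real.pi)) * g x ∂circleMeasure =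
          ∫ x, φ x • g x ∂circleMeasure := by
        refine setIntegral_congr_fun measurableSet_Ico fun x hx => ?_
        have : p (x : AddCircle (2 * Real.pi)) = φ x :=
          AddCircle.liftIco_coe_apply (f := fun x => (φ x : ℂ)) (by
            rwa [show -Real.pi + 2 * Real.pi = Real.pi by ring])
        simp only [this, Complex.real_smul]
      rw [e, circleMeasure] at hp
      rw [← hp, ← integral_indicator measurableSet_Ico]
      congr 1
      ext x
      by_cases hx : x ∈ Ico (-Real.pi) Real.pi
      · rw [indicator_of_mem hx]
      · rw [indicator_of_notMem hx, hφ0 x (fun h => hx (Ioo_subset_Ico_self h)), zero_smul]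
  rw [Filter.EventuallyEq, circleMeasure, ← Measure.restrict_congr_set Ioo_ae_eq_Ico,
    ae_restrict_iff' measurableSet_Ioo]
  exact hopen

/-- Fubini: uniqueness in `x` kills each Fourier coefficient in `y` for almost every `x`, and
uniqueness in `y` then applies to almost every slice. -/
lemma ae_eq_zero_of_integral_char_mul_char {u : ℝ × ℝ → ℂ} (hu : Integrable u torusMeasure)
    (h : ∀ k l : ℤ, ∫ p, char k p.1 * char l p.2 * u p ∂torusMeasure = 0) :
    u =ᵐ[torusMeasure] 0 := by
  rw [torusMeasure_eq_prod] at *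
  have hint : ∀ k l : ℤ, Integrable (fun p : ℝ × ℝ => char k p.1 * char l p.2 * u p)
      (circleMeasure.prod circleMeasure) := fun k l => by
    refine hu.bdd_mul (c := 1) ?_ (Filter.Eventually.of_forall fun p => ?_)
    · exact (((contDiff_char k).continuous.comp continuous_fst).mul
        ((contDiff_char l).continuous.comp continuous_snd)).aestronglyMeasurable
    · rw [norm_mul, norm_char, norm_char, one_mul]
  have h1 : ∀ l : ℤ, (fun x => ∫ y, char l y * u (x, y) ∂circleMeasure) =ᵐ[circleMeasure] 0 := by
    intro l
    refine ae_eq_zero_of_integral_char ?_ fun k => ?_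
    · have := (hint 0 l).integral_prod_left
      simpa [char] using this
    · rw [← h k l, integral_prod _ (hint k l)]
      refine integral_congr_ae (Filter.Eventually.of_forall fun x => ?_)
      simp only [mul_assoc]
      rw [integral_const_mul]
  have h2 : ∀ᵐ x ∂circleMeasure, ∀ᵐ y ∂circleMeasure, u (x, y) = 0 := by
    filter_upwards [ae_all_iff.2 h1, hu.prod_right_ae] with x hx hxi
    exact ae_eq_zero_of_integral_char hxi hx
  obtain ⟨u', hu', huu'⟩ := hu.aestronglyMeasurable
  refine huu'.trans ?_
  rw [Filter.EventuallyEq, Measure.ae_prod_iff_ae_ae]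
  · filter_upwards [h2, Measure.ae_ae_of_ae_prod huu'] with x hx hx'
    filter_upwards [hx, hx'] with y hy hy'
    rw [← hy', hy]; rfl
  · exact hu'.measurable (measurableSet_singleton 0)

end FourierUniqueness

/-! ### Smooth functions on the torus and the symmetry of `D_x`, `D_y`. -/

section SmoothFunctions

variable {n : ℕ}

lemma contDiff_fderiv_apply {F : Type*} [NormedAddCommGroup F] [NormedSpace ℝ F]
    {f : ℝ × ℝ → F} (hf : ContDiff ℝ ∞ f) (w : ℝ × ℝ) : ContDiff ℝ ∞ fun p => fderiv ℝ f p w :=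
  (hf.fderiv_right (m := ∞) (by simp)).clm_apply contDiff_const

lemma fderiv_periodic {F : Type*} [NormedAddCommGroup F] [NormedSpace ℝ F] {f : ℝ × ℝ → F}
    {c : ℝ × ℝ} (h : ∀ p, f (p + c) = f p) (p : ℝ × ℝ) : fderiv ℝ f (p + c) = fderiv ℝ f p := by
  rw [← fderiv_comp_add_right]
  congr 1
  exact funext h

lemma IsSmoothPeriodic.add_x {F : Type*} [NormedAddCommGroup F] [NormedSpace ℝ F]
    {f : ℝ × ℝ → F} (hf : IsSmoothPeriodic f) (p : ℝ × ℝ) : f (p + (2 * Real.pi, 0)) = f p := by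
  rcases p with ⟨x, y⟩
  simpa using hf.periodic_x x y

lemma IsSmoothPeriodic.add_y {F : Type*} [NormedAddCommGroup F] [NormedSpace ℝ F]
    {f : ℝ × ℝ → F} (hf : IsSmoothPeriodic f) (p : ℝ × ℝ) : f (p + (0, 2 * Real.pi)) = f p := by
  rcases p with ⟨x, y⟩
  simpa using hf.periodic_y x y

lemma IsSmoothPeriodic.fderiv_apply {F : Type*} [NormedAddCommGroup F] [NormedSpace ℝ F]
    {f : ℝ × ℝ → F} (hf : IsSmoothPeriodic f) (w : ℝ × ℝ) :
    IsSmoothPeriodic fun p => fderiv ℝ f p w := by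
  refine ⟨contDiff_fderiv_apply hf.smooth w, fun x y => ?_, fun x y => ?_⟩
  · have := fderiv_periodic hf.add_x (x, y)
    rw [Prod.mk_add_mk, add_zero] at this
    simp only [this]
  · have := fderiv_periodic hf.add_y (x, y)
    rw [Prod.mk_add_mk, add_zero] at this
    simp only [this]

lemma IsSmoothPeriodic.Dx {f : ℝ × ℝ → Cn n} (hf : IsSmoothPeriodic f) :
    IsSmoothPeriodic (Dx f) := by
  have h := hf.fderiv_apply (1, 0)
  exact ⟨h.smooth.const_smul _, fun x y => congrArg (fun z => (-Complex.I) • z) (h.periodic_x x y),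
    fun x y => congrArg (fun z => (-Complex.I) • z) (h.periodic_y x y)⟩

lemma IsSmoothPeriodic.Dy {f : ℝ × ℝ → Cn n} (hf : IsSmoothPeriodic f) :
    IsSmoothPeriodic (Dy f) := by
  have h := hf.fderiv_apply (0, 1)
  exact ⟨h.smooth.const_smul _, fun x y => congrArg (fun z => (-Complex.I) • z) (h.periodic_x x y),
    fun x y => congrArg (fun z => (-Complex.I) • z) (h.periodic_y x y)⟩

variable (n) in
/-- Smooth `ℂⁿ`-valued functions on the torus. -/
def SP : Submodule ℂ (ℝ × ℝ → Cn n) where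
  carrier := {f | IsSmoothPeriodic f}
  zero_mem' := ⟨contDiff_const, fun _ _ => rfl, fun _ _ => rfl⟩
  add_mem' := fun hf hg => ⟨hf.smooth.add hg.smooth,
    fun x y => congrArg₂ (· + ·) (hf.periodic_x x y) (hg.periodic_x x y),
    fun x y => congrArg₂ (· + ·) (hf.periodic_y x y) (hg.periodic_y x y)⟩
  smul_mem' := fun c _ hf => ⟨hf.smooth.const_smul c,
    fun x y => congrArg (c • ·) (hf.periodic_x x y), fun x y => congrArg (c • ·) (hf.periodic_y x y)⟩

lemma sp_continuous (f : SP n) : Continuous (f : ℝ × ℝ → Cn n) := f.2.smooth.continuous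

lemma sp_differentiable (f : SP n) : Differentiable ℝ (f : ℝ × ℝ → Cn n) :=
  f.2.smooth.differentiable (by simp)

/-- The class in `L²` of a smooth function. -/
def toL2 : SP n →ₗ[ℂ] L2T n where
  toFun f := (memLp_of_continuous (sp_continuous f) 2).toLp f
  map_add' _ _ := MemLp.toLp_add _ _
  map_smul' _ _ := MemLp.toLp_const_smul _ _

lemma coeFn_toL2 (f : SP n) : ∀ᵐ p ∂torusMeasure, toL2 f p = (f : ℝ × ℝ → Cn n) p :=
  (memLp_of_continuous (sp_continuous f) 2).coeFn_toLp

lemma inner_toL2 (f : SP n) (u : L2T n) :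
    inner ℂ (toL2 f) u = ∫ p, inner ℂ ((f : ℝ × ℝ → Cn n) p) (u p) ∂torusMeasure := by
  rw [L2.inner_def]
  refine integral_congr_ae ?_
  filter_upwards [coeFn_toL2 f] with p hp
  rw [hp]

lemma inner_toL2_toL2 (f g : SP n) : inner ℂ (toL2 f) (toL2 g) =
    ∫ p, inner ℂ ((f : ℝ × ℝ → Cn n) p) ((g : ℝ × ℝ → Cn n) p) ∂torusMeasure := by
  rw [inner_toL2]
  refine integral_congr_ae ?_
  filter_upwards [coeFn_toL2 g] with p hp
  rw [hp]

/-- `D_x` on smooth functions. -/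
def dx : Module.End ℂ (SP n) where
  toFun f := ⟨Dx f, f.2.Dx⟩
  map_add' f g := by
    ext1; funext p
    change (-Complex.I) • fderiv ℝ ((f : ℝ × ℝ → Cn n) + (g : ℝ × ℝ → Cn n)) p (1, 0) = _
    rw [fderiv_add (sp_differentiable f p) (sp_differentiable g p)]
    simp [Dx]
  map_smul' c f := by
    ext1; funext p
    change (-Complex.I) • fderiv ℝ (c • (f : ℝ × ℝ → Cn n)) p (1, 0) = _
    rw [fderiv_const_smul (sp_differentiable f p)]
    rw [smul_apply, smul_comm]
    rfl

/-- `D_y` on smooth functions. -/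
def dy : Module.End ℂ (SP n) where
  toFun f := ⟨Dy f, f.2.Dy⟩
  map_add' f g := by
    ext1; funext p
    change (-Complex.I) • fderiv ℝ ((f : ℝ × ℝ → Cn n) + (g : ℝ × ℝ → Cn n)) p (0, 1) = _
    rw [fderiv_add (sp_differentiable f p) (sp_differentiable g p)]
    simp [Dy]
  map_smul' c f := by
    ext1; funext p
    change (-Complex.I) • fderiv ℝ (c • (f : ℝ × ℝ → Cn n)) p (0, 1) = _
    rw [fderiv_const_smul (sp_differentiable f p)]
    rw [smul_apply, smul_comm]
    rfl

lemma coe_dx_pow_dy_pow (i j : ℕ) (f : SP n) :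
    ((dx ^ i * dy ^ j : Module.End ℂ (SP n)) f : ℝ × ℝ → Cn n) = DD i j f := by
  have hy : ∀ j, ((dy ^ j : Module.End ℂ (SP n)) f : ℝ × ℝ → Cn n) = Dy^[j] f := by
    intro j
    induction j with
    | zero => rfl
    | succ j ih => rw [pow_succ', Function.iterate_succ_apply', ← ih]; rfl
  unfold DD
  rw [← hy]
  induction i with
  | zero => simp
  | succ i ih =>
    rw [Function.iterate_succ_apply', ← ih, pow_succ', mul_assoc]; rfl

lemma Dx_Dy_comm {f : ℝ × ℝ → Cn n} (hf : ContDiff ℝ ∞ f) : Dx (Dy f) = Dy (Dx f) := by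
  funext p
  have h2 : ∀ (w : ℝ × ℝ), DifferentiableAt ℝ (fun q => fderiv ℝ f q w) p :=
    fun w => (contDiff_fderiv_apply hf w).differentiable (by simp) p
  have hd : DifferentiableAt ℝ (fderiv ℝ f) p :=
    (hf.fderiv_right (m := ∞) (by simp)).differentiable (by simp) p
  have hs : IsSymmSndFDerivAt ℝ f p :=
    hf.contDiffAt.isSymmSndFDerivAt (by simp; exact WithTop.coe_le_coe.2 le_top)
  have e : ∀ v w : ℝ × ℝ, fderiv ℝ (fun q => fderiv ℝ f q w) p v =
      fderiv ℝ (fderiv ℝ f) p v w := fun v w => by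
    rw [fderiv_clm_apply hd (differentiableAt_const _)]
    simp
  unfold Dx Dy
  rw [fderiv_fun_const_smul (h2 _), fderiv_fun_const_smul (h2 _)]
  simp only [smul_apply]
  rw [e, e, hs.eq]

lemma dx_comm_dy : Commute (dx : Module.End ℂ (SP n)) dy := by
  refine LinearMap.ext fun f => Subtype.ext ?_
  exact Dx_Dy_comm f.2.smooth

lemma integral_fderiv_x {h : ℝ × ℝ → ℂ} (hh : IsSmoothPeriodic h) :
    ∫ p, fderiv ℝ h p (1, 0) ∂torusMeasure = 0 := by
  have hc := (contDiff_fderiv_apply hh.smooth (1, 0)).continuous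
  have hint : Integrable (fun p => fderiv ℝ h p (1, 0)) torusMeasure :=
    memLp_one_iff_integrable.1 (memLp_of_continuous hc 1)
  rw [torusMeasure_eq_prod] at hint ⊢
  rw [integral_prod_symm _ hint]
  have : ∀ y, ∫ x, fderiv ℝ h (x, y) (1, 0) ∂circleMeasure = 0 := by
    intro y
    rw [integral_circleMeasure]
    have hd : ∀ x : ℝ, HasDerivAt (fun x => h (x, y)) (fderiv ℝ h (x, y) (1, 0)) x := fun x => by
      have h1 : HasDerivAt (fun x : ℝ => (x, y)) ((1 : ℝ), (0 : ℝ)) x :=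
        (hasDerivAt_id x).prodMk (hasDerivAt_const x y)
      exact ((hh.smooth.differentiable (by simp) (x, y)).hasFDerivAt).comp_hasDerivAt x h1
    rw [intervalIntegral.integral_eq_sub_of_hasDerivAt (fun x _ => hd x)
      ((hc.comp (continuous_id.prodMk continuous_const)).intervalIntegrable _ _)]
    have := hh.periodic_x (-Real.pi) y
    rw [show -Real.pi + 2 * Real.pi = Real.pi by ring] at this
    rw [this, sub_self]
  simp [this]

lemma integral_fderiv_y {h : ℝ × ℝ → ℂ} (hh : IsSmoothPeriodic h) :
    ∫ p, fderiv ℝ h p (0, 1) ∂torusMeasure = 0 := by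
  have hc := (contDiff_fderiv_apply hh.smooth (0, 1)).continuous
  have hint : Integrable (fun p => fderiv ℝ h p (0, 1)) torusMeasure :=
    memLp_one_iff_integrable.1 (memLp_of_continuous hc 1)
  rw [torusMeasure_eq_prod] at hint ⊢
  rw [integral_prod _ hint]
  have : ∀ x, ∫ y, fderiv ℝ h (x, y) (0, 1) ∂circleMeasure = 0 := by
    intro x
    rw [integral_circleMeasure]
    have hd : ∀ y : ℝ, HasDerivAt (fun y => h (x, y)) (fderiv ℝ h (x, y) (0, 1)) y := fun y => by
      have h1 : HasDerivAt (fun y : ℝ => (x, y)) ((0 : ℝ), (1 : ℝ)) y :=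
        (hasDerivAt_const y x).prodMk (hasDerivAt_id y)
      exact ((hh.smooth.differentiable (by simp) (x, y)).hasFDerivAt).comp_hasDerivAt y h1
    rw [intervalIntegral.integral_eq_sub_of_hasDerivAt (fun y _ => hd y)
      ((hc.comp (continuous_const.prodMk continuous_id)).intervalIntegrable _ _)]
    have := hh.periodic_y x (-Real.pi)
    rw [show -Real.pi + 2 * Real.pi = Real.pi by ring] at this
    rw [this, sub_self]
  simp [this]

lemma isSmoothPeriodic_inner (f g : SP n) :
    IsSmoothPeriodic fun p => (inner ℂ ((f : ℝ × ℝ → Cn n) p) ((g : ℝ × ℝ → Cn n) p) : ℂ) :=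
  ⟨f.2.smooth.inner ℂ g.2.smooth, fun x y => by rw [f.2.periodic_x, g.2.periodic_x],
    fun x y => by rw [f.2.periodic_y, g.2.periodic_y]⟩

/-- The product rule, with the factor `-i` turning antisymmetry into symmetry. -/
lemma integral_inner_fderiv {w : ℝ × ℝ} (f g : SP n)
    (h0 : ∫ p, fderiv ℝ (fun p => (inner ℂ ((f : ℝ × ℝ → Cn n) p) ((g : ℝ × ℝ → Cn n) p) : ℂ)) p w
      ∂torusMeasure = 0) :
    ∫ p, inner ℂ ((-Complex.I) • fderiv ℝ (f : ℝ × ℝ → Cn n) p w) ((g : ℝ × ℝ → Cn n) p)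
      ∂torusMeasure =
    ∫ p, inner ℂ ((f : ℝ × ℝ → Cn n) p) ((-Complex.I) • fderiv ℝ (g : ℝ × ℝ → Cn n) p w)
      ∂torusMeasure := by
  have hi : ∀ a b : ℝ × ℝ → Cn n, Continuous a → Continuous b →
      Integrable (fun p => (inner ℂ (a p) (b p) : ℂ)) torusMeasure := fun a b ha hb =>
    memLp_one_iff_integrable.1 (memLp_of_continuous (ha.inner hb) 1)
  have hcf := (contDiff_fderiv_apply f.2.smooth w).continuous
  have hcg := (contDiff_fderiv_apply g.2.smooth w).continuous
  have e : ∀ p, fderiv ℝ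
      (fun p => (inner ℂ ((f : ℝ × ℝ → Cn n) p) ((g : ℝ × ℝ → Cn n) p) : ℂ)) p w =
      inner ℂ ((f : ℝ × ℝ → Cn n) p) (fderiv ℝ (g : ℝ × ℝ → Cn n) p w) +
      inner ℂ (fderiv ℝ (f : ℝ × ℝ → Cn n) p w) ((g : ℝ × ℝ → Cn n) p) := fun p =>
    fderiv_inner_apply ℂ (sp_differentiable f p) (sp_differentiable g p) w
  simp only [e] at h0
  rw [integral_add (hi _ _ (sp_continuous f) hcg) (hi _ _ hcf (sp_continuous g))] at h0
  simp only [inner_smul_left, inner_smul_right, map_neg, Complex.conj_I, neg_neg]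
  rw [integral_const_mul, integral_const_mul]
  linear_combination Complex.I * h0

lemma inner_dx (f g : SP n) :
    inner ℂ (toL2 (dx f)) (toL2 g) = inner ℂ (toL2 f) (toL2 (dx g)) := by
  rw [inner_toL2_toL2, inner_toL2_toL2]
  exact integral_inner_fderiv f g (integral_fderiv_x (isSmoothPeriodic_inner f g))

lemma inner_dy (f g : SP n) :
    inner ℂ (toL2 (dy f)) (toL2 g) = inner ℂ (toL2 f) (toL2 (dy g)) := by
  rw [inner_toL2_toL2, inner_toL2_toL2]
  exact integral_inner_fderiv f g (integral_fderiv_y (isSmoothPeriodic_inner f g))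

/-- The exponential `exp (i (k x + l y)) v`. -/
def expSP (k l : ℤ) (v : Cn n) : SP n :=
  ⟨fun p => (char k p.1 * char l p.2) • v,
    ((((contDiff_char k).comp contDiff_fst).mul ((contDiff_char l).comp contDiff_snd)).smul
      contDiff_const),
    fun x y => by simp only [char_periodic], fun x y => by simp only [char_periodic]⟩

lemma hasFDerivAt_expSP (k l : ℤ) (v : Cn n) (p w : ℝ × ℝ) :
    fderiv ℝ (expSP k l v : ℝ × ℝ → Cn n) p w =
      (Complex.I * (k * w.1 + l * w.2)) • (expSP k l v : ℝ × ℝ → Cn n) p := by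
  have h1 : HasFDerivAt (fun p : ℝ × ℝ => char k p.1) _ p :=
    (hasDerivAt_char k p.1).hasFDerivAt.comp p hasFDerivAt_fst
  have h2 : HasFDerivAt (fun p : ℝ × ℝ => char l p.2) _ p :=
    (hasDerivAt_char l p.2).hasFDerivAt.comp p hasFDerivAt_snd
  have h3 : HasFDerivAt (fun p : ℝ × ℝ => (char k p.1 * char l p.2) • v) _ p :=
    (h1.mul h2).smul_const v
  change fderiv ℝ (fun p : ℝ × ℝ => (char k p.1 * char l p.2) • v) p w = _
  rw [HasFDerivAt.fderiv h3]
  simp only [expSP]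
  simp [smul_smul]
  congr 1
  ring

lemma dx_expSP (k l : ℤ) (v : Cn n) : dx (expSP k l v) = (k : ℂ) • expSP k l v := by
  ext1; funext p
  change (-Complex.I) • fderiv ℝ (expSP k l v : ℝ × ℝ → Cn n) p (1, 0) = _
  rw [hasFDerivAt_expSP, smul_smul, ← mul_assoc]
  simp

lemma dy_expSP (k l : ℤ) (v : Cn n) : dy (expSP k l v) = (l : ℂ) • expSP k l v := by
  ext1; funext p
  change (-Complex.I) • fderiv ℝ (expSP k l v : ℝ × ℝ → Cn n) p (0, 1) = _
  rw [hasFDerivAt_expSP, smul_smul, ← mul_assoc]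
  simp

end SmoothFunctions

/-! ### Bounded diagonal operators in a Hilbert basis. -/

section Diagonal

variable {E : Type*} [NormedAddCommGroup E] [InnerProductSpace ℂ E] [CompleteSpace E]
  {ι : Type*} (b : HilbertBasis ι ℂ E)

lemma hasSum_sq_norm_inner (u : E) : HasSum (fun i => ‖inner ℂ (b i) u‖ ^ 2) (‖u‖ ^ 2) := by
  have h := Complex.reCLM.hasSum (b.hasSum_inner_mul_inner u u)
  have e : Complex.reCLM (inner ℂ u u : ℂ) = ‖u‖ ^ 2 := by
    have := @inner_self_eq_norm_sq ℂ E _ _ _ u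
    simpa using this
  rw [e] at h
  refine h.congr_fun fun i => ?_
  rw [← inner_conj_symm u (b i), mul_comm, Complex.mul_conj, Complex.normSq_eq_norm_sq]
  exact (Complex.ofReal_re _).symm

lemma ext_inner_basis {u v : E} (h : ∀ i, inner ℂ (b i) u = inner ℂ (b i) v) : u = v := by
  have := hasSum_sq_norm_inner b (u - v)
  simp only [inner_sub_right, h, sub_self, norm_zero] at this
  have h0 : ‖u - v‖ ^ 2 = 0 := this.unique (by simp [hasSum_zero])
  rw [← sub_eq_zero, ← norm_eq_zero]
  simpa using h0

/-- By Parseval's identity, norm inequalities between Fourier multipliers reduce to pointwise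
inequalities between their symbols. -/
lemma norm_sq_le_of_inner_le {u v w : E} {α β : ℝ}
    (h : ∀ i, ‖inner ℂ (b i) u‖ ^ 2 ≤ α * ‖inner ℂ (b i) v‖ ^ 2 + β * ‖inner ℂ (b i) w‖ ^ 2) :
    ‖u‖ ^ 2 ≤ α * ‖v‖ ^ 2 + β * ‖w‖ ^ 2 :=
  hasSum_le h (hasSum_sq_norm_inner b u)
    (((hasSum_sq_norm_inner b v).mul_left α).add ((hasSum_sq_norm_inner b w).mul_left β))

lemma exists_diag {g : ι → ℂ} {C : ℝ} (hg : ∀ i, ‖g i‖ ≤ C) (u : E) :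
    ∃ v : E, ∀ i, inner ℂ (b i) v = g i * inner ℂ (b i) u := by
  have hmem : Memℓp (fun i => g i * inner ℂ (b i) u) 2 := by
    refine memℓp_gen ?_
    have h := (hasSum_sq_norm_inner b u).summable.mul_left (C ^ 2)
    refine Summable.of_nonneg_of_le (fun i => by positivity) (fun i => ?_) h
    simp only [ENNReal.toReal_ofNat, Real.rpow_ofNat, norm_mul, mul_pow]
    have := hg i
    gcongr
  refine ⟨b.repr.symm ⟨_, hmem⟩, fun i => ?_⟩
  rw [← b.repr_apply_apply, LinearIsometryEquiv.apply_symm_apply]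

open Classical in
/-- The operator with diagonal matrix `g` in the Hilbert basis `b` (`0` if `g` is unbounded). -/
def diagOp (g : ι → ℂ) : E →L[ℂ] E :=
  if h : ∃ C, ∀ i, ‖g i‖ ≤ C then
    LinearMap.mkContinuous
      { toFun := fun u => (exists_diag b h.choose_spec u).choose
        map_add' := fun u v => ext_inner_basis b fun i => by
          rw [inner_add_right, (exists_diag b h.choose_spec _).choose_spec i,
            (exists_diag b h.choose_spec _).choose_spec i,
            (exists_diag b h.choose_spec _).choose_spec i, inner_add_right, mul_add]
        map_smul' := fun c u => ext_inner_basis b fun i => by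
          rw [RingHom.id_apply, inner_smul_right, (exists_diag b h.choose_spec _).choose_spec i,
            (exists_diag b h.choose_spec _).choose_spec i, inner_smul_right]
          ring }
      |h.choose| fun u => by
        refine abs_le_of_sq_le_sq' ?_ (by positivity) |>.2
        have := norm_sq_le_of_inner_le b (u := (exists_diag b h.choose_spec u).choose) (v := u)
          (w := 0) (α := h.choose ^ 2) (β := 0) fun i => by
            rw [(exists_diag b h.choose_spec _).choose_spec i, norm_mul, mul_pow]
            have := h.choose_spec i
            have h0 := norm_nonneg (g i)
            simp only [zero_mul, add_zero]
            gcongr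
        simpa [mul_pow] using this
  else 0

lemma inner_diagOp {g : ι → ℂ} {C : ℝ} (hg : ∀ i, ‖g i‖ ≤ C) (u : E) (i : ι) :
    inner ℂ (b i) (diagOp b g u) = g i * inner ℂ (b i) u := by
  have h : ∃ C, ∀ i, ‖g i‖ ≤ C := ⟨C, hg⟩
  rw [diagOp, dif_pos h]
  exact (exists_diag b h.choose_spec u).choose_spec i

lemma norm_diagOp_apply_sq_le {g : ι → ℂ} {C : ℝ} (hg : ∀ i, ‖g i‖ ≤ C) (u : E) :
    ‖diagOp b g u‖ ^ 2 ≤ C ^ 2 * ‖u‖ ^ 2 := by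
  have := norm_sq_le_of_inner_le b (u := diagOp b g u) (v := u)
    (w := 0) (α := C ^ 2) (β := 0) fun i => by
      rw [inner_diagOp b hg, norm_mul, mul_pow]
      have := hg i
      simp only [zero_mul, add_zero]
      gcongr
  simpa using this

lemma norm_diagOp_apply_le {g : ι → ℂ} {C : ℝ} (hC : 0 ≤ C) (hg : ∀ i, ‖g i‖ ≤ C) (u : E) :
    ‖diagOp b g u‖ ≤ C * ‖u‖ := by
  refine abs_le_of_sq_le_sq' ?_ (by positivity) |>.2
  rw [mul_pow]
  exact norm_diagOp_apply_sq_le b hg u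

end Diagonal

/-! ### The Fourier basis of `L²` and weak derivatives. -/

section FourierBasis

variable {n : ℕ}

lemma integral_char_mul_char (k l : ℤ) :
    ∫ p, char k p.1 * char l p.2 ∂torusMeasure =
      if k = 0 ∧ l = 0 then ((2 * Real.pi) ^ 2 : ℂ) else 0 := by
  rw [torusMeasure_eq_prod, integral_prod_mul (char k) (char l), integral_char, integral_char]
  by_cases hk : k = 0 <;> by_cases hl : l = 0 <;> simp [hk, hl, sq]

lemma inner_expSP (k l k' l' : ℤ) (v v' : Cn n) :
    inner ℂ (toL2 (expSP k l v)) (toL2 (expSP k' l' v')) =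
      if k = k' ∧ l = l' then ((2 * Real.pi) ^ 2 : ℂ) * inner ℂ v v' else 0 := by
  rw [inner_toL2_toL2]
  have e : ∀ p : ℝ × ℝ, inner ℂ ((expSP k l v : ℝ × ℝ → Cn n) p) ((expSP k' l' v' : ℝ × ℝ → Cn n) p)
      = char (k' - k) p.1 * char (l' - l) p.2 * inner ℂ v v' := fun p => by
    change inner ℂ ((char k p.1 * char l p.2) • v) ((char k' p.1 * char l' p.2) • v') = _
    rw [inner_smul_left, inner_smul_right, map_mul, conj_char, conj_char, sub_eq_add_neg,
      sub_eq_add_neg, ← char_mul, ← char_mul]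
    ring
  simp only [e]
  rw [integral_mul_const, integral_char_mul_char]
  simp only [sub_eq_zero, eq_comm (a := k'), eq_comm (a := l')]
  split_ifs <;> simp

/-- The smooth functions `(2π)⁻¹ exp (i (k x + l y)) ε_a`. -/
def expBasis (κ : ℤ × ℤ × Fin n) : SP n :=
  ((2 * Real.pi)⁻¹ : ℂ) • expSP κ.1 κ.2.1 (EuclideanSpace.single κ.2.2 1)

lemma orthonormal_expBasis : Orthonormal ℂ fun κ : ℤ × ℤ × Fin n => toL2 (expBasis κ) := by
  rw [orthonormal_iff_ite]
  rintro ⟨k, l, a⟩ ⟨k', l', a'⟩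
  have hpi : (Real.pi : ℂ) ≠ 0 := by exact_mod_cast Real.pi_ne_zero
  simp only [expBasis, map_smul, inner_smul_left, inner_smul_right, inner_expSP,
    EuclideanSpace.inner_single_left, Prod.mk.injEq]
  by_cases hk : k = k' <;> by_cases hl : l = l' <;> by_cases ha : a = a' <;>
    simp [hk, hl, ha]
  rw [Complex.conj_ofNat]
  field_simp

lemma expBasis_complete : (Submodule.span ℂ (range fun κ : ℤ × ℤ × Fin n =>
    toL2 (expBasis κ)))ᗮ = ⊥ := by
  rw [Submodule.eq_bot_iff]
  intro u hu
  have h0 : ∀ k l a, ∫ p, inner ℂ ((expSP k l (EuclideanSpace.single a 1 : Cn n) : ℝ × ℝ → Cn n) p) (u p)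
      ∂torusMeasure = 0 := by
    intro k l a
    have h1 := (Submodule.mem_orthogonal _ _).1 hu _ (Submodule.subset_span ⟨(k, l, a), rfl⟩)
    have hpi : (Real.pi : ℂ) ≠ 0 := by exact_mod_cast Real.pi_ne_zero
    simp only [expBasis, map_smul, inner_smul_left] at h1
    rw [mul_eq_zero, or_iff_right (by simp [hpi]), inner_toL2] at h1
    exact h1
  have hint : ∀ a, Integrable (fun p => (u p) a) torusMeasure := fun a => by
    have hu1 : Integrable (fun p => u p) torusMeasure :=
      (Lp.memLp u).integrable (by norm_num)
    exact (EuclideanSpace.proj (𝕜 := ℂ) a).integrable_comp hu1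
  have hz : ∀ a, (fun p => (u p) a) =ᵐ[torusMeasure] 0 := by
    intro a
    refine ae_eq_zero_of_integral_char_mul_char (hint a) fun k l => ?_
    rw [← h0 (-k) (-l) a]
    refine integral_congr_ae (Filter.Eventually.of_forall fun p => ?_)
    change _ = inner ℂ ((char (-k) p.1 * char (-l) p.2) • _) (u p)
    rw [inner_smul_left, map_mul, conj_char, conj_char, neg_neg, neg_neg,
      EuclideanSpace.inner_single_left]
    simp
  refine Lp.ext ?_
  filter_upwards [(ae_all_iff (ι := Fin n)).2 hz, Lp.coeFn_zero (Cn n) 2 torusMeasure] with p hp h0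
  rw [h0]
  ext a
  exact hp a

variable (n) in
/-- The Fourier basis of `L²(𝕋²) ⊗ ℂⁿ`. -/
def fb : HilbertBasis (ℤ × ℤ × Fin n) ℂ (L2T n) :=
  HilbertBasis.mkOfOrthogonalEqBot orthonormal_expBasis expBasis_complete

lemma fb_apply (κ : ℤ × ℤ × Fin n) : fb n κ = toL2 (expBasis κ) := by
  rw [fb, HilbertBasis.coe_mkOfOrthogonalEqBot]

lemma inner_dx_pow_dy_pow (i j : ℕ) (f g : SP n) :
    inner ℂ (toL2 ((dx ^ i * dy ^ j : Module.End ℂ (SP n)) f)) (toL2 g) =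
      inner ℂ (toL2 f) (toL2 ((dx ^ i * dy ^ j : Module.End ℂ (SP n)) g)) := by
  have hx : ∀ (i : ℕ) (f g : SP n), inner ℂ (toL2 ((dx ^ i : Module.End ℂ (SP n)) f)) (toL2 g) =
      inner ℂ (toL2 f) (toL2 ((dx ^ i : Module.End ℂ (SP n)) g)) := by
    intro i
    induction i with
    | zero => intro f g; rfl
    | succ i ih =>
      intro f g
      rw [pow_succ', Module.End.mul_apply, inner_dx, ih, ← Module.End.mul_apply, ← pow_succ,
        pow_succ']
  have hy : ∀ (i : ℕ) (f g : SP n), inner ℂ (toL2 ((dy ^ i : Module.End ℂ (SP n)) f)) (toL2 g) =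
      inner ℂ (toL2 f) (toL2 ((dy ^ i : Module.End ℂ (SP n)) g)) := by
    intro i
    induction i with
    | zero => intro f g; rfl
    | succ i ih =>
      intro f g
      rw [pow_succ', Module.End.mul_apply, inner_dy, ih, ← Module.End.mul_apply, ← pow_succ,
        pow_succ']
  rw [Module.End.mul_apply, hx, hy, ← Module.End.mul_apply, (dx_comm_dy.pow_pow i j).eq]

lemma dx_pow_dy_pow_expSP (i j : ℕ) (k l : ℤ) (v : Cn n) :
    (dx ^ i * dy ^ j : Module.End ℂ (SP n)) (expSP k l v) =
      ((k : ℂ) ^ i * (l : ℂ) ^ j) • expSP k l v := by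
  have hy : ∀ j : ℕ, (dy ^ j : Module.End ℂ (SP n)) (expSP k l v) = (l : ℂ) ^ j • expSP k l v := by
    intro j
    induction j with
    | zero => simp
    | succ j ih => rw [pow_succ', Module.End.mul_apply, ih, map_smul, dy_expSP, smul_smul, pow_succ]
  rw [Module.End.mul_apply, hy, map_smul]
  induction i with
  | zero => simp
  | succ i ih =>
    rw [pow_succ', Module.End.mul_apply, ← map_smul, ih, map_smul, dx_expSP, smul_smul]
    congr 1; ring

lemma dx_pow_dy_pow_expBasis (i j : ℕ) (κ : ℤ × ℤ × Fin n) :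
    (dx ^ i * dy ^ j : Module.End ℂ (SP n)) (expBasis κ) =
      ((κ.1 : ℂ) ^ i * (κ.2.1 : ℂ) ^ j) • expBasis κ := by
  rw [expBasis, map_smul, dx_pow_dy_pow_expSP, smul_comm]

lemma inner_fb_deriv (i j : ℕ) (f : SP n) (κ : ℤ × ℤ × Fin n) :
    inner ℂ (fb n κ) (toL2 ((dx ^ i * dy ^ j : Module.End ℂ (SP n)) f)) =
      ((κ.1 : ℂ) ^ i * (κ.2.1 : ℂ) ^ j) * inner ℂ (fb n κ) (toL2 f) := by
  rw [fb_apply, ← inner_dx_pow_dy_pow, dx_pow_dy_pow_expBasis, map_smul, inner_smul_left]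
  simp

/-- One direction tests against basis functions. In the other, both pairings with a smooth function
are expanded by Parseval, and the derivative acts on its Fourier coefficients by multiplication. -/
lemma isWeakD_iff {i j : ℕ} {u g : L2T n} : IsWeakD i j u g ↔
    ∀ κ, inner ℂ (fb n κ) g = ((κ.1 : ℂ) ^ i * (κ.2.1 : ℂ) ^ j) * inner ℂ (fb n κ) u := by
  have key : ∀ f : SP n, ((∫ p, inner ℂ (DD i j (f : ℝ × ℝ → Cn n) p) (u p) ∂torusMeasure =
      ∫ p, inner ℂ ((f : ℝ × ℝ → Cn n) p) (g p) ∂torusMeasure) ↔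
      inner ℂ (toL2 ((dx ^ i * dy ^ j : Module.End ℂ (SP n)) f)) u = inner ℂ (toL2 f) g) := by
    intro f
    rw [inner_toL2, inner_toL2, coe_dx_pow_dy_pow]
  constructor
  · intro h κ
    have := (key (expBasis κ)).1 (h _ (expBasis κ).2)
    rw [dx_pow_dy_pow_expBasis, map_smul, inner_smul_left, ← fb_apply] at this
    rw [← this]; simp
  · intro h f hf
    obtain ⟨f, rfl⟩ : ∃ f' : SP n, f = f' := ⟨⟨f, hf⟩, rfl⟩
    refine (key f).2 ?_
    rw [← (fb n).tsum_inner_mul_inner, ← (fb n).tsum_inner_mul_inner]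
    refine tsum_congr fun κ => ?_
    rw [h κ, ← inner_conj_symm _ (fb n κ), inner_fb_deriv, map_mul, inner_conj_symm]
    simp only [map_mul, map_pow, map_intCast]
    ring

end FourierBasis

/-! ### Inequalities between monomials and the Sobolev weight. -/

section Weights

lemma pow_mul_pow_le_weight (m i j : ℕ) (hij : i + j ≤ m) (a b : ℝ) :
    |a| ^ i * |b| ^ j ≤ 1 + |a| ^ m + |b| ^ m := by
  have ha := abs_nonneg a
  have hb := abs_nonneg b
  set M := max 1 (max |a| |b|) with hM
  have h1 : 1 ≤ M := le_max_left _ _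
  have hMa : |a| ≤ M := (le_max_left _ _).trans (le_max_right _ _)
  have hMb : |b| ≤ M := (le_max_right _ _).trans (le_max_right _ _)
  have h2 : |a| ^ i * |b| ^ j ≤ M ^ m :=
    calc |a| ^ i * |b| ^ j ≤ M ^ i * M ^ j := by gcongr
      _ = M ^ (i + j) := (pow_add _ _ _).symm
      _ ≤ M ^ m := pow_le_pow_right₀ h1 hij
  refine h2.trans ?_
  have pa : 0 ≤ |a| ^ m := by positivity
  have pb : 0 ≤ |b| ^ m := by positivity
  rcases max_choice 1 (max |a| |b|) with h | h
  · rw [hM, h, one_pow]; linarith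
  · rcases max_choice |a| |b| with h' | h' <;> rw [hM, h, h'] <;> linarith

/-- With `M = max(1, |a|, |b|)`, the left side is at most `M^(2(m-1))`. If `M² ≥ 1/ε`, this is at
most `ε M^(2m)`; otherwise it is at most `ε^(-(m-1))`. This is the interpolation that makes terms of
lower order absorbable. -/
lemma sq_pow_mul_pow_le_weight (m i j : ℕ) (hij : i + j < m) (a b ε : ℝ) (hε : 0 < ε) :
    (|a| ^ i * |b| ^ j) ^ 2 ≤ ε * (1 + |a| ^ m + |b| ^ m) ^ 2 + (1 + (ε⁻¹) ^ (m - 1)) := by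
  have ha := abs_nonneg a
  have hb := abs_nonneg b
  set M := max 1 (max |a| |b|) with hM
  have h1 : 1 ≤ M := le_max_left _ _
  have hMa : |a| ≤ M := (le_max_left _ _).trans (le_max_right _ _)
  have hMb : |b| ≤ M := (le_max_right _ _).trans (le_max_right _ _)
  have hMm : M ^ m ≤ 1 + |a| ^ m + |b| ^ m := by
    have pa : 0 ≤ |a| ^ m := by positivity
    have pb : 0 ≤ |b| ^ m := by positivity
    rcases max_choice 1 (max |a| |b|) with h | h
    · rw [hM, h, one_pow]; linarith
    · rcases max_choice |a| |b| with h' | h' <;> rw [hM, h, h'] <;> linarith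
  obtain ⟨k, rfl⟩ : ∃ k, m = k + 1 := ⟨m - 1, by omega⟩
  have h2 : |a| ^ i * |b| ^ j ≤ M ^ k :=
    calc |a| ^ i * |b| ^ j ≤ M ^ i * M ^ j := by gcongr
      _ = M ^ (i + j) := (pow_add _ _ _).symm
      _ ≤ M ^ k := pow_le_pow_right₀ h1 (by omega)
  have h3 : (|a| ^ i * |b| ^ j) ^ 2 ≤ (M ^ k) ^ 2 := by gcongr
  refine h3.trans ?_
  have hw : (M ^ (k + 1)) ^ 2 ≤ (1 + |a| ^ (k + 1) + |b| ^ (k + 1)) ^ 2 := by gcongr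
  by_cases hc : ε⁻¹ ≤ M ^ 2
  · have : 1 ≤ ε * M ^ 2 := by
      have := mul_le_mul_of_nonneg_left hc hε.le
      rwa [mul_inv_cancel₀ hε.ne'] at this
    have e : (M ^ k) ^ 2 ≤ ε * (M ^ (k + 1)) ^ 2 := by
      have := mul_le_mul_of_nonneg_right this (by positivity : 0 ≤ (M ^ k) ^ 2)
      calc (M ^ k) ^ 2 = 1 * (M ^ k) ^ 2 := (one_mul _).symm
        _ ≤ _ := this
        _ = _ := by ring
    have := mul_le_mul_of_nonneg_left hw hε.le
    have : 0 ≤ (ε⁻¹) ^ (k + 1 - 1) := by positivity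
    linarith
  · push Not at hc
    have e : (M ^ k) ^ 2 ≤ (ε⁻¹) ^ k := by
      rw [← pow_mul, mul_comm, pow_mul]
      gcongr
    have : 0 ≤ ε * (1 + |a| ^ (k + 1) + |b| ^ (k + 1)) ^ 2 := by positivity
    simp only [Nat.add_sub_cancel]
    linarith

/-- The weight `1 + |λk|^m + |λl|^m` of a Fourier mode. -/
def modeWeight {n : ℕ} (m : ℕ) (lam : ℝ) (κ : ℤ × ℤ × Fin n) : ℝ :=
  1 + |lam * κ.1| ^ m + |lam * κ.2.1| ^ m

lemma one_le_modeWeight {n : ℕ} (m : ℕ) (lam : ℝ) (κ : ℤ × ℤ × Fin n) :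
    1 ≤ modeWeight m lam κ := by
  unfold modeWeight
  have : 0 ≤ |lam * κ.1| ^ m := by positivity
  have : 0 ≤ |lam * κ.2.1| ^ m := by positivity
  linarith

lemma modeWeight_pos {n : ℕ} (m : ℕ) (lam : ℝ) (κ : ℤ × ℤ × Fin n) :
    0 < modeWeight m lam κ := lt_of_lt_of_le one_pos (one_le_modeWeight m lam κ)

lemma modeWeight_ne_zero {n : ℕ} (m : ℕ) (lam : ℝ) (κ : ℤ × ℤ × Fin n) :
    (modeWeight m lam κ : ℂ) ≠ 0 := by exact_mod_cast (modeWeight_pos m lam κ).ne'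

/-- The Fourier multiplier of `(λ D_x)^i (λ D_y)^j J`. -/
def modeMul {n : ℕ} (m : ℕ) (lam : ℝ) (i j : ℕ) (κ : ℤ × ℤ × Fin n) : ℂ :=
  (lam * κ.1) ^ i * (lam * κ.2.1) ^ j / modeWeight m lam κ

lemma norm_modeMul {n : ℕ} (m : ℕ) (lam : ℝ) (i j : ℕ) (κ : ℤ × ℤ × Fin n) :
    ‖modeMul m lam i j κ‖ = |lam * κ.1| ^ i * |lam * κ.2.1| ^ j / modeWeight m lam κ := by
  rw [modeMul, norm_div, norm_mul, norm_pow, norm_pow, ← Complex.ofReal_intCast,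
    ← Complex.ofReal_intCast, ← Complex.ofReal_mul, ← Complex.ofReal_mul, Complex.norm_real,
    Complex.norm_real, Complex.norm_real, Real.norm_eq_abs, Real.norm_eq_abs, Real.norm_eq_abs,
    abs_of_pos (modeWeight_pos m lam κ)]

lemma norm_modeMul_le {n : ℕ} {m : ℕ} (lam : ℝ) {i j : ℕ} (hij : i + j ≤ m)
    (κ : ℤ × ℤ × Fin n) : ‖modeMul m lam i j κ‖ ≤ 1 := by
  rw [norm_modeMul, div_le_one (modeWeight_pos m lam κ)]
  exact pow_mul_pow_le_weight m i j hij _ _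

end Weights

/-! ### The Sobolev space as the range of `J`, and operators on it. -/

section Sobolev

variable {n : ℕ}

variable (n) in
/-- `(λ D_x)^i (λ D_y)^j J` where `J = (1 + |λ D_x|^m + |λ D_y|^m)⁻¹`. -/
def symbG (m : ℕ) (lam : ℝ) (i j : ℕ) : L2T n →L[ℂ] L2T n := diagOp (fb n) (modeMul m lam i j)

variable (n) in
/-- `J = (1 + |λ D_x|^m + |λ D_y|^m)⁻¹`, whose range is the Sobolev space of order `m`. -/
def symbJ (m : ℕ) (lam : ℝ) : L2T n →L[ℂ] L2T n := symbG n m lam 0 0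

lemma inner_symbG {m : ℕ} (lam : ℝ) {i j : ℕ} (hij : i + j ≤ m) (w : L2T n) (κ) :
    inner ℂ (fb n κ) (symbG n m lam i j w) = modeMul m lam i j κ * inner ℂ (fb n κ) w :=
  inner_diagOp (fb n) (fun κ => norm_modeMul_le lam hij κ) w κ

lemma inner_symbJ (m : ℕ) (lam : ℝ) (w : L2T n) (κ) :
    inner ℂ (fb n κ) (symbJ n m lam w) = (modeWeight m lam κ : ℂ)⁻¹ * inner ℂ (fb n κ) w := by
  rw [symbJ, inner_symbG lam (Nat.zero_le _)]
  simp [modeMul]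

lemma norm_symbG_apply_le {m : ℕ} (lam : ℝ) {i j : ℕ} (hij : i + j ≤ m) (w : L2T n) :
    ‖symbG n m lam i j w‖ ≤ ‖w‖ := by
  simpa [symbG] using norm_diagOp_apply_le (fb n) zero_le_one (fun κ => norm_modeMul_le lam hij κ) w

lemma norm_symbG_apply_sq_le {m : ℕ} (lam : ℝ) {i j : ℕ} (hij : i + j < m) {ε : ℝ} (hε : 0 < ε)
    (w : L2T n) : ‖symbG n m lam i j w‖ ^ 2 ≤
      ε * ‖w‖ ^ 2 + (1 + ε⁻¹ ^ (m - 1)) * ‖symbJ n m lam w‖ ^ 2 := by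
  refine norm_sq_le_of_inner_le (fb n) fun κ => ?_
  rw [inner_symbG lam hij.le, inner_symbJ, norm_mul, norm_mul, norm_modeMul, norm_inv,
    Complex.norm_real, Real.norm_eq_abs, abs_of_pos (modeWeight_pos m lam κ), mul_pow, mul_pow,
    ← mul_assoc, ← add_mul]
  gcongr
  rw [div_pow, div_le_iff₀ (by have := modeWeight_pos m lam κ; positivity)]
  refine (sq_pow_mul_pow_le_weight m i j hij (lam * κ.1) (lam * κ.2.1) ε hε).trans (le_of_eq ?_)
  have := (modeWeight_pos m lam κ).ne'
  rw [← modeWeight.eq_def]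
  field_simp

lemma symbJ_injective (m : ℕ) (lam : ℝ) {w : L2T n} (hw : symbJ n m lam w = 0) : w = 0 := by
  refine ext_inner_basis (fb n) fun κ => ?_
  have := inner_symbJ m lam w κ
  rw [hw, inner_zero_right] at this
  have h := modeWeight_ne_zero m lam κ
  rw [inner_zero_right]
  simpa [h] using this.symm

lemma norm_symbJ_le_of_low_modes (m : ℕ) (lam : ℝ) {Λ : ℝ} (hΛ : 0 < Λ) {w : L2T n}
    (hw : ∀ κ, modeWeight m lam κ ≤ Λ → inner ℂ (fb n κ) w = 0) :
    ‖symbJ n m lam w‖ ≤ Λ⁻¹ * ‖w‖ := by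
  refine abs_le_of_sq_le_sq' ?_ (by positivity) |>.2
  rw [mul_pow]
  have := norm_sq_le_of_inner_le (fb n) (u := symbJ n m lam w) (v := w) (w := 0)
    (α := Λ⁻¹ ^ 2) (β := 0) fun κ => by
      rw [inner_symbJ, zero_mul, add_zero]
      by_cases h : modeWeight m lam κ ≤ Λ
      · rw [hw κ h]; simp
      · push Not at h
        rw [norm_mul, mul_pow, norm_inv, Complex.norm_real, Real.norm_eq_abs,
          abs_of_pos (modeWeight_pos m lam κ)]
        have := modeWeight_pos m lam κ
        gcongr
  simpa using this

/-- Membership in the Sobolev space needs only the two pure derivatives of order `m`, because the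
weight contains only those. -/
lemma exists_symbJ_eq {m : ℕ} {lam : ℝ} {u a b : L2T n}
    (ha : ∀ κ, inner ℂ (fb n κ) a = (lam * κ.1 : ℂ) ^ m * inner ℂ (fb n κ) u)
    (hb : ∀ κ, inner ℂ (fb n κ) b = (lam * κ.2.1 : ℂ) ^ m * inner ℂ (fb n κ) u) :
    ∃ w, symbJ n m lam w = u ∧ ‖w‖ ≤ ‖u‖ + ‖a‖ + ‖b‖ := by
  -- The sign converting `t^m` into `|t|^m`; it matters for odd `m`.
  let ph : ℝ → ℂ := fun t => if 0 ≤ t ^ m then 1 else -1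
  have hph : ∀ t : ℝ, ‖ph t‖ ≤ 1 := fun t => by
    simp only [ph]; split_ifs <;> simp
  have hpm : ∀ t : ℝ, ph t * (t : ℂ) ^ m = ((|t| ^ m : ℝ) : ℂ) := fun t => by
    rw [← abs_pow, ← Complex.ofReal_pow]
    simp only [ph]
    split_ifs with h
    · rw [abs_of_nonneg h, one_mul]
    · rw [abs_of_neg (not_le.1 h)]; push_cast; ring
  refine ⟨u + diagOp (fb n) (fun κ => ph (lam * κ.1)) a + diagOp (fb n) (fun κ => ph (lam * κ.2.1)) b,
    ext_inner_basis (fb n) fun κ => ?_, ?_⟩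
  · have h1 := hpm (lam * κ.1)
    have h2 := hpm (lam * κ.2.1)
    have h := modeWeight_ne_zero m lam κ
    rw [inner_symbJ, inner_add_right, inner_add_right, inner_diagOp (fb n) (fun κ => hph _),
      inner_diagOp (fb n) (fun κ => hph _), ha, hb, inv_mul_eq_iff_eq_mul₀ h]
    push_cast at h1 h2
    rw [← mul_assoc, ← mul_assoc, h1, h2, modeWeight]
    push_cast
    ring
  · refine (norm_add_le _ _).trans (add_le_add ((norm_add_le _ _).trans (add_le_add le_rfl ?_)) ?_)
    · simpa using norm_diagOp_apply_le (fb n) zero_le_one (fun κ => hph _) a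
    · simpa using norm_diagOp_apply_le (fb n) zero_le_one (fun κ => hph _) b

/-- The action of a matrix as a continuous bilinear map. -/
def actL : Mat n →L[ℂ] Cn n →L[ℂ] Cn n :=
  LinearMap.toContinuousLinearMap
    ((Matrix.toEuclideanCLM (n := Fin n) (𝕜 := ℂ)).toAlgEquiv.toLinearMap)

lemma actL_apply (A : Mat n) (w : Cn n) : actL A w = act A w := rfl

lemma norm_act_le (A : Mat n) (w : Cn n) : ‖act A w‖ ≤ ‖A‖ * ‖w‖ :=
  ContinuousLinearMap.le_opNorm (Matrix.toEuclideanCLM (n := Fin n) (𝕜 := ℂ) A) w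

/-- Multiplication by a continuous matrix-valued function (`0` for other functions). -/
def matMul (c : ℝ × ℝ → Mat n) : L2T n →L[ℂ] L2T n :=
  open Classical in
  if h : Continuous c then
    actL.holderL torusMeasure ⊤ 2 2 ((memLp_of_continuous h ⊤).toLp c)
  else 0

lemma matMul_apply {c : ℝ × ℝ → Mat n} (hc : Continuous c) (u : L2T n) :
    ∀ᵐ p ∂torusMeasure, matMul c u p = act (c p) (u p) := by
  rw [matMul, dif_pos hc]
  filter_upwards [actL.coeFn_holder (r := 2) ((memLp_of_continuous hc ⊤).toLp c) u,
    (memLp_of_continuous hc ⊤).coeFn_toLp] with p h1 h2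
  refine h1.trans ?_
  rw [h2]; rfl

lemma norm_matMul_apply_le {c : ℝ × ℝ → Mat n} (hc : Continuous c) {C : ℝ}
    (hC : ∀ p, ‖c p‖ ≤ C) (u : L2T n) : ‖matMul c u‖ ≤ C * ‖u‖ := by
  refine Lp.norm_le_mul_norm_of_ae_le_mul ?_
  filter_upwards [matMul_apply hc u] with p hp
  rw [hp]
  exact (norm_act_le _ _).trans (mul_le_mul_of_nonneg_right (hC p) (norm_nonneg _))

/-- `∑_{i+j≤m} c_{ij} (λ D_x)^i (λ D_y)^j J`. -/
def diffT (m : ℕ) (lam : ℝ) (c : ℕ → ℕ → ℝ × ℝ → Mat n) : L2T n →L[ℂ] L2T n :=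
  ∑ q ∈ multiIdx m, (matMul (c q.1 q.2)).comp (symbG n m lam q.1 q.2)

lemma mem_multiIdx {m : ℕ} {q : ℕ × ℕ} : q ∈ multiIdx m ↔ q.1 + q.2 ≤ m := by
  simp only [multiIdx, Finset.mem_filter, Finset.mem_product, Finset.mem_range]
  omega

lemma diffT_apply {m : ℕ} {lam : ℝ} {c : ℕ → ℕ → ℝ × ℝ → Mat n}
    (hc : ∀ q ∈ multiIdx m, Continuous (c q.1 q.2)) (w : L2T n) :
    ∀ᵐ p ∂torusMeasure, diffT m lam c w p =
      ∑ q ∈ multiIdx m, act (c q.1 q.2 p) (symbG n m lam q.1 q.2 w p) := by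
  have h1 : diffT m lam c w = ∑ q ∈ multiIdx m, matMul (c q.1 q.2) (symbG n m lam q.1 q.2 w) := by
    simp [diffT]
  have h2 := (Finset.eventually_all (multiIdx m) (l := ae torusMeasure)
    (p := fun q p => matMul (c q.1 q.2) (symbG n m lam q.1 q.2 w) p =
      act (c q.1 q.2 p) (symbG n m lam q.1 q.2 w p))).2
    fun q hq => matMul_apply (hc q hq) _
  rw [h1]
  filter_upwards [h2, Lp.coeFn_finsetSum (multiIdx m)
    fun q => matMul (c q.1 q.2) (symbG n m lam q.1 q.2 w)] with p h2 h3
  rw [h3, Finset.sum_apply]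
  exact Finset.sum_congr rfl h2

/-- `J⁻¹ u` exists in `L²` exactly when `u` has the required weak derivatives, and then `(λD_x)^i
(λD_y)^j u` is a bounded multiplier applied to `J⁻¹ u`. -/
lemma mem_diffGraph_iff {m : ℕ} {lam : ℝ} (hlam : lam ≠ 0) {c ch : ℕ → ℕ → ℝ × ℝ → Mat n}
    (hch : ∀ q ∈ multiIdx m, Continuous (ch q.1 q.2))
    (hcc : ∀ q ∈ multiIdx m, ∀ p, c q.1 q.2 p = ((lam ^ (q.1 + q.2) : ℝ) : ℂ) • ch q.1 q.2 p)
    (u g : L2T n) :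
    (u, g) ∈ diffGraph m c ↔ ∃ w, symbJ n m lam w = u ∧ diffT m lam ch w = g := by
  have hl : (lam : ℂ) ≠ 0 := by exact_mod_cast hlam
  have hact : ∀ (r : ℂ) (A : Mat n) (w : Cn n), act (r • A) w = act A (r • w) := fun r A w => by
    rw [← actL_apply, ← actL_apply, map_smul, map_smul]; rfl
  constructor
  · rintro ⟨d, hd, hg⟩
    obtain ⟨w, hw, -⟩ := exists_symbJ_eq (m := m) (lam := lam) (u := u)
      (a := (lam : ℂ) ^ m • d m 0) (b := (lam : ℂ) ^ m • d 0 m)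
      (fun κ => by
        rw [inner_smul_right, isWeakD_iff.1 (hd (m, 0) (mem_multiIdx.2 (by simp))) κ]; ring)
      (fun κ => by
        rw [inner_smul_right, isWeakD_iff.1 (hd (0, m) (mem_multiIdx.2 (by simp))) κ]; ring)
    refine ⟨w, hw, ?_⟩
    have hG : ∀ q ∈ multiIdx m, symbG n m lam q.1 q.2 w = (lam : ℂ) ^ (q.1 + q.2) • d q.1 q.2 := by
      intro q hq
      refine ext_inner_basis (fb n) fun κ => ?_
      rw [inner_symbG lam (mem_multiIdx.1 hq), inner_smul_right, isWeakD_iff.1 (hd q hq) κ]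
      change _ = _ * (_ * inner ℂ (fb n κ) u)
      rw [← hw, inner_symbJ, modeMul]
      ring
    refine Lp.ext ?_
    have hall := (Finset.eventually_all (multiIdx m) (l := ae torusMeasure)
      (p := fun q p => ((lam : ℂ) ^ (q.1 + q.2) • d q.1 q.2 : L2T n) p =
        (lam : ℂ) ^ (q.1 + q.2) • d q.1 q.2 p)).2 fun q _ => Lp.coeFn_smul _ _
    filter_upwards [diffT_apply hch w, hg, hall] with p h1 h2 h3
    rw [h1]
    refine Eq.trans ?_ h2.symm
    refine Finset.sum_congr rfl fun q hq => ?_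
    rw [hG q hq, h3 q hq, hcc q hq, hact]
    push_cast; rfl
  · rintro ⟨w, rfl, rfl⟩
    refine ⟨fun i j => ((lam : ℂ) ^ (i + j))⁻¹ • symbG n m lam i j w, fun q hq => ?_, ?_⟩
    · refine isWeakD_iff.2 fun κ => ?_
      rw [inner_smul_right, inner_symbG lam (mem_multiIdx.1 hq)]
      change _ = _ * inner ℂ (fb n κ) (symbJ n m lam w)
      rw [inner_symbJ, modeMul]
      field_simp
      ring
    · have hall := (Finset.eventually_all (multiIdx m) (l := ae torusMeasure)
        (p := fun q p => (((lam : ℂ) ^ (q.1 + q.2))⁻¹ • symbG n m lam q.1 q.2 w : L2T n) p =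
          ((lam : ℂ) ^ (q.1 + q.2))⁻¹ • symbG n m lam q.1 q.2 w p)).2 fun q _ => Lp.coeFn_smul _ _
      filter_upwards [diffT_apply hch w, hall] with p h1 h3
      refine h1.trans (Finset.sum_congr rfl fun q hq => ?_)
      rw [h3 q hq, hcc q hq, hact, smul_smul]
      push_cast
      rw [mul_inv_cancel₀ (pow_ne_zero _ hl), one_smul]

lemma mem_diffOp_graph_iff {m : ℕ} {lam : ℝ} (hlam : lam ≠ 0) {c ch : ℕ → ℕ → ℝ × ℝ → Mat n}
    (hch : ∀ q ∈ multiIdx m, Continuous (ch q.1 q.2))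
    (hcc : ∀ q ∈ multiIdx m, ∀ p, c q.1 q.2 p = ((lam ^ (q.1 + q.2) : ℝ) : ℂ) • ch q.1 q.2 p)
    (u g : L2T n) :
    (u, g) ∈ (diffOp m c).graph ↔ ∃ w, symbJ n m lam w = u ∧ diffT m lam ch w = g := by
  rw [← mem_diffGraph_iff hlam hch hcc, diffOp, Submodule.toLinearPMap_graph_eq]
  -- The graph is single-valued because `J` is injective.
  rintro ⟨u, g⟩ hx (rfl : u = 0)
  obtain ⟨w, hw, rfl⟩ := (mem_diffGraph_iff hlam hch hcc _ _).1 hx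
  rw [symbJ_injective m lam hw, map_zero]

/-- `λ D_x` on smooth functions. -/
def lx (lam : ℝ) : Module.End ℂ (SP n) := (lam : ℂ) • dx

/-- `λ D_y` on smooth functions. -/
def ly (lam : ℝ) : Module.End ℂ (SP n) := (lam : ℂ) • dy

lemma lx_comm_ly (lam : ℝ) : Commute (lx lam : Module.End ℂ (SP n)) (ly lam) :=
  (dx_comm_dy.smul_left _).smul_right _

lemma inner_lx (lam : ℝ) (f g : SP n) :
    inner ℂ (toL2 (lx lam f)) (toL2 g) = inner ℂ (toL2 f) (toL2 (lx lam g)) := by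
  simp only [lx, LinearMap.smul_apply, map_smul, inner_smul_left, inner_smul_right, inner_dx]
  simp

lemma inner_ly (lam : ℝ) (f g : SP n) :
    inner ℂ (toL2 (ly lam f)) (toL2 g) = inner ℂ (toL2 f) (toL2 (ly lam g)) := by
  simp only [ly, LinearMap.smul_apply, map_smul, inner_smul_left, inner_smul_right, inner_dy]
  simp

lemma lx_pow_mul_ly_pow (lam : ℝ) (i j : ℕ) : (lx lam ^ i * ly lam ^ j : Module.End ℂ (SP n)) =
    ((lam : ℂ) ^ i * (lam : ℂ) ^ j) • (dx ^ i * dy ^ j) := by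
  rw [lx, ly, smul_pow, smul_pow, smul_mul_smul_comm]

lemma inner_fb_lx_ly (lam : ℝ) (i j : ℕ) (f : SP n) (κ : ℤ × ℤ × Fin n) :
    inner ℂ (fb n κ) (toL2 ((lx lam ^ i * ly lam ^ j : Module.End ℂ (SP n)) f)) =
      ((lam * κ.1 : ℂ) ^ i * (lam * κ.2.1 : ℂ) ^ j) * inner ℂ (fb n κ) (toL2 f) := by
  rw [lx_pow_mul_ly_pow, LinearMap.smul_apply, map_smul, inner_smul_right, inner_fb_deriv]
  ring

lemma symbG_of_symbJ_eq {m : ℕ} {lam : ℝ} {w : L2T n} {f : SP n} (h : symbJ n m lam w = toL2 f)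
    {i j : ℕ} (hij : i + j ≤ m) :
    symbG n m lam i j w = toL2 ((lx lam ^ i * ly lam ^ j : Module.End ℂ (SP n)) f) := by
  refine ext_inner_basis (fb n) fun κ => ?_
  rw [inner_symbG lam hij, inner_fb_lx_ly, ← h, inner_symbJ, modeMul]
  ring

lemma exists_symbJ_eq_toL2 (m : ℕ) (lam : ℝ) (f : SP n) : ∃ w, symbJ n m lam w = toL2 f ∧
    ‖w‖ ≤ ‖toL2 f‖ + ‖toL2 ((lx lam ^ m * ly lam ^ 0 : Module.End ℂ (SP n)) f)‖ +
      ‖toL2 ((lx lam ^ 0 * ly lam ^ m : Module.End ℂ (SP n)) f)‖ :=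
  exists_symbJ_eq (fun κ => by rw [inner_fb_lx_ly]; ring) (fun κ => by rw [inner_fb_lx_ly]; ring)

/-- Each basis vector is an eigenvector of `J`, so finite combinations of exponentials are sent to
smooth functions. Integrations by parts can therefore be done on smooth functions only. -/
lemma dense_symbJ_smooth (m : ℕ) (lam : ℝ) :
    Dense {w : L2T n | ∃ f : SP n, symbJ n m lam w = toL2 f} := by
  have h := (fb n).dense_span
  rw [← Submodule.dense_iff_topologicalClosure_eq_top] at h
  refine h.mono ?_
  have : Submodule.span ℂ (range (fb n)) ≤
      (LinearMap.range (toL2 (n := n))).comap (symbJ n m lam : L2T n →ₗ[ℂ] L2T n) := by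
    rw [Submodule.span_le]
    rintro _ ⟨κ, rfl⟩
    refine ⟨((modeWeight m lam κ : ℂ)⁻¹) • expBasis κ, ?_⟩
    rw [map_smul, ← fb_apply]
    refine ext_inner_basis (fb n) fun κ' => ?_
    change _ = inner ℂ _ (symbJ n m lam (fb n κ))
    rw [inner_symbJ, inner_smul_right]
    by_cases hk : κ' = κ
    · rw [hk]
    · rw [(fb n).orthonormal.2 hk]; simp
  intro w hw
  obtain ⟨f, hf⟩ := this hw
  exact ⟨f, hf.symm⟩

lemma denseRange_symbJ (m : ℕ) (lam : ℝ) : DenseRange (symbJ n m lam) := by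
  have h := (fb n).dense_span
  rw [← Submodule.dense_iff_topologicalClosure_eq_top] at h
  refine h.mono ?_
  have : Submodule.span ℂ (range (fb n)) ≤
      LinearMap.range (symbJ n m lam : L2T n →ₗ[ℂ] L2T n) := by
    rw [Submodule.span_le]
    rintro _ ⟨κ, rfl⟩
    refine ⟨(modeWeight m lam κ : ℂ) • fb n κ, ?_⟩
    rw [map_smul]
    refine ext_inner_basis (fb n) fun κ' => ?_
    change inner ℂ _ ((modeWeight m lam κ : ℂ) • symbJ n m lam (fb n κ)) = _
    rw [inner_smul_right, inner_symbJ]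
    by_cases hk : κ' = κ
    · rw [hk, ← mul_assoc, mul_inv_cancel₀ (modeWeight_ne_zero m lam κ), one_mul]
    · rw [(fb n).orthonormal.2 hk]; simp
  intro w hw
  obtain ⟨f, hf⟩ := this hw
  exact ⟨f, hf⟩

end Sobolev

/-! ### Multiplication by smooth matrix functions and the Leibniz rule. -/

section Multiplication

variable {n : ℕ}

lemma act_mul (A B : Mat n) (w : Cn n) : act (A * B) w = act A (act B w) := by
  unfold act; rw [map_mul]; rfl

lemma act_add (A B : Mat n) (w : Cn n) : act (A + B) w = act A w + act B w := by
  unfold act; rw [map_add]; rfl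

lemma act_smul (r : ℂ) (A : Mat n) (w : Cn n) : act (r • A) w = r • act A w := by
  unfold act; rw [map_smul]; rfl

lemma act_zero (w : Cn n) : act (0 : Mat n) w = 0 := by
  unfold act; rw [map_zero]; rfl

lemma act_one (w : Cn n) : act (1 : Mat n) w = w := by
  unfold act; rw [map_one]; rfl

lemma inner_act_left (A : Mat n) (v w : Cn n) :
    inner ℂ (act A v) w = inner ℂ v (act A.conjTranspose w) := by
  have h : Matrix.toEuclideanCLM (n := Fin n) (𝕜 := ℂ) A.conjTranspose =
      ContinuousLinearMap.adjoint (Matrix.toEuclideanCLM (n := Fin n) (𝕜 := ℂ) A) := by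
    rw [← Matrix.star_eq_conjTranspose, map_star, ContinuousLinearMap.star_eq_adjoint]
  unfold act
  rw [h, ContinuousLinearMap.adjoint_inner_right]

/-- The action of a matrix as a continuous real bilinear map. -/
def actR : Mat n →L[ℝ] Cn n →L[ℝ] Cn n :=
  LinearMap.mkContinuous₂
    (LinearMap.mk₂ ℝ (fun A w => act A w) (fun A B w => act_add A B w)
      (fun c A w => by
        change act ((c : ℂ) • A) w = (c : ℂ) • act A w
        exact act_smul _ _ _)
      (fun A v w => by unfold act; rw [map_add])
      (fun c A w => by
        change act A ((c : ℂ) • w) = (c : ℂ) • act A w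
        unfold act; rw [map_smul])) 1
    (fun A w => by rw [one_mul]; exact norm_act_le A w)

lemma actR_apply (A : Mat n) (w : Cn n) : actR A w = act A w := rfl

lemma contDiff_act {c : ℝ × ℝ → Mat n} {f : ℝ × ℝ → Cn n} (hc : ContDiff ℝ ∞ c)
    (hf : ContDiff ℝ ∞ f) : ContDiff ℝ ∞ fun p => act (c p) (f p) := by
  have h : ContDiff ℝ ∞ fun p => actR (c p) := (actR (n := n)).contDiff.comp hc
  simp only [← actR_apply]
  exact h.clm_apply hf

/-- Multiplication by a smooth matrix-valued function on smooth functions. -/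
def mulSP (c : ℝ × ℝ → Mat n) (hc : IsSmoothPeriodic c) : Module.End ℂ (SP n) where
  toFun f := ⟨fun p => act (c p) ((f : ℝ × ℝ → Cn n) p),
    contDiff_act hc.smooth f.2.smooth,
    fun x y => by rw [hc.periodic_x, f.2.periodic_x],
    fun x y => by rw [hc.periodic_y, f.2.periodic_y]⟩
  map_add' f g := by
    ext1; funext p
    change act (c p) (_ + _) = act (c p) _ + act (c p) _
    unfold act; rw [map_add]
  map_smul' r f := by
    ext1; funext p
    change act (c p) (r • _) = r • act (c p) _
    unfold act; rw [map_smul]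

lemma coe_mulSP (c : ℝ × ℝ → Mat n) (hc : IsSmoothPeriodic c) (f : SP n) (p : ℝ × ℝ) :
    (mulSP c hc f : ℝ × ℝ → Cn n) p = act (c p) ((f : ℝ × ℝ → Cn n) p) := rfl

lemma toL2_mulSP {c : ℝ × ℝ → Mat n} (hc : IsSmoothPeriodic c) (f : SP n) :
    toL2 (mulSP c hc f) = matMul c (toL2 f) := by
  refine Lp.ext ?_
  filter_upwards [coeFn_toL2 (mulSP c hc f), matMul_apply hc.smooth.continuous (toL2 f),
    coeFn_toL2 f] with p h1 h2 h3
  rw [h1, h2, h3, coe_mulSP]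

lemma norm_toL2_mulSP_le {c : ℝ × ℝ → Mat n} (hc : IsSmoothPeriodic c) {C : ℝ}
    (hC : ∀ p, ‖c p‖ ≤ C) (f : SP n) : ‖toL2 (mulSP c hc f)‖ ≤ C * ‖toL2 f‖ := by
  rw [toL2_mulSP]
  exact norm_matMul_apply_le hc.smooth.continuous hC _

lemma IsSmoothPeriodic.const {F : Type*} [NormedAddCommGroup F] [NormedSpace ℝ F] (a : F) :
    IsSmoothPeriodic fun _ : ℝ × ℝ => a := ⟨contDiff_const, fun _ _ => rfl, fun _ _ => rfl⟩

lemma IsSmoothPeriodic.conjTranspose {c : ℝ × ℝ → Mat n} (hc : IsSmoothPeriodic c) :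
    IsSmoothPeriodic fun p => (c p).conjTranspose :=
  ⟨(starL' ℝ : Mat n ≃L[ℝ] Mat n).contDiff.comp hc.smooth, fun x y => by rw [hc.periodic_x],
    fun x y => by rw [hc.periodic_y]⟩

lemma IsSmoothPeriodic.mul {c d : ℝ × ℝ → Mat n} (hc : IsSmoothPeriodic c)
    (hd : IsSmoothPeriodic d) : IsSmoothPeriodic fun p => c p * d p :=
  ⟨hc.smooth.mul hd.smooth, fun x y => by rw [hc.periodic_x, hd.periodic_x],
    fun x y => by rw [hc.periodic_y, hd.periodic_y]⟩

lemma IsSmoothPeriodic.add {F : Type*} [NormedAddCommGroup F] [NormedSpace ℝ F]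
    {c d : ℝ × ℝ → F} (hc : IsSmoothPeriodic c)
    (hd : IsSmoothPeriodic d) : IsSmoothPeriodic fun p => c p + d p :=
  ⟨hc.smooth.add hd.smooth, fun x y => by rw [hc.periodic_x, hd.periodic_x],
    fun x y => by rw [hc.periodic_y, hd.periodic_y]⟩

lemma IsSmoothPeriodic.smul {c : ℝ × ℝ → Mat n} (hc : IsSmoothPeriodic c) (r : ℂ) :
    IsSmoothPeriodic fun p => r • c p :=
  ⟨hc.smooth.const_smul r, fun x y => by rw [hc.periodic_x],
    fun x y => by rw [hc.periodic_y]⟩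

lemma inner_mulSP_left {c : ℝ × ℝ → Mat n} (hc : IsSmoothPeriodic c) (f g : SP n) :
    inner ℂ (toL2 (mulSP c hc f)) (toL2 g) =
      inner ℂ (toL2 f) (toL2 (mulSP (fun p => (c p).conjTranspose) hc.conjTranspose g)) := by
  rw [inner_toL2_toL2, inner_toL2_toL2]
  refine integral_congr_ae (Filter.Eventually.of_forall fun p => ?_)
  exact inner_act_left _ _ _

/-- The derivative `-i λ ∂_w c`. -/
def dcoef {F : Type*} [NormedAddCommGroup F] [NormedSpace ℂ F] (lam : ℝ) (w : ℝ × ℝ)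
    (c : ℝ × ℝ → F) : ℝ × ℝ → F :=
  fun p => (-(Complex.I * lam)) • fderiv ℝ c p w

lemma IsSmoothPeriodic.dcoef {c : ℝ × ℝ → Mat n} (hc : IsSmoothPeriodic c) (lam : ℝ) (w : ℝ × ℝ) :
    IsSmoothPeriodic (dcoef lam w c) := (hc.fderiv_apply w).smul _

lemma fderiv_act {c : ℝ × ℝ → Mat n} (hc : IsSmoothPeriodic c) (f : SP n) (p w : ℝ × ℝ) :
    fderiv ℝ (fun p => act (c p) ((f : ℝ × ℝ → Cn n) p)) p w =
      act (c p) (fderiv ℝ (f : ℝ × ℝ → Cn n) p w) +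
      act (fderiv ℝ c p w) ((f : ℝ × ℝ → Cn n) p) := by
  have h1 := ((hc.smooth.differentiable (by simp)) p).hasFDerivAt
  have h2 := (sp_differentiable f p).hasFDerivAt
  have h3 := (actR (n := n)).isBoundedBilinearMap.hasFDerivAt (c p, (f : ℝ × ℝ → Cn n) p)
  have h4 := h3.comp p (h1.prodMk h2)
  have h5 : HasFDerivAt (fun p => act (c p) ((f : ℝ × ℝ → Cn n) p)) _ p := h4
  rw [h5.fderiv]
  rfl

lemma lx_mulSP (lam : ℝ) {c : ℝ × ℝ → Mat n} (hc : IsSmoothPeriodic c) (f : SP n) :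
    lx lam (mulSP c hc f) = mulSP c hc (lx lam f) + mulSP _ (hc.dcoef lam (1, 0)) f := by
  ext1; funext p
  change (lam : ℂ) • ((-Complex.I) • fderiv ℝ (fun p => act (c p) ((f : ℝ × ℝ → Cn n) p)) p (1, 0)) =
    act (c p) ((lam : ℂ) • ((-Complex.I) • fderiv ℝ (f : ℝ × ℝ → Cn n) p (1, 0))) +
      act ((-(Complex.I * lam)) • fderiv ℝ c p (1, 0)) ((f : ℝ × ℝ → Cn n) p)
  rw [fderiv_act hc, act_smul, smul_add, smul_add]
  congr 1
  · unfold act; rw [map_smul, map_smul]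
  · rw [smul_smul]; congr 1; ring

lemma ly_mulSP (lam : ℝ) {c : ℝ × ℝ → Mat n} (hc : IsSmoothPeriodic c) (f : SP n) :
    ly lam (mulSP c hc f) = mulSP c hc (ly lam f) + mulSP _ (hc.dcoef lam (0, 1)) f := by
  ext1; funext p
  change (lam : ℂ) • ((-Complex.I) • fderiv ℝ (fun p => act (c p) ((f : ℝ × ℝ → Cn n) p)) p (0, 1)) =
    act (c p) ((lam : ℂ) • ((-Complex.I) • fderiv ℝ (f : ℝ × ℝ → Cn n) p (0, 1))) +
      act ((-(Complex.I * lam)) • fderiv ℝ c p (0, 1)) ((f : ℝ × ℝ → Cn n) p)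
  rw [fderiv_act hc, act_smul, smul_add, smul_add]
  congr 1
  · unfold act; rw [map_smul, map_smul]
  · rw [smul_smul]; congr 1; ring

end Multiplication

/-! ### Signs of the mixed terms of leading order, by integration by parts. -/

section Swap

/-- In the application `F p q` pairs two derivatives of order `m` with `p` and `q` factors `Y`. One
swap moves a `Y` to the right and an `X` to the left, with an error of lower order `K`. -/
lemma norm_swap_iterate_le {m : ℕ} {F : ℕ → ℕ → ℂ} {K : ℝ}
    (h : ∀ p < m, ∀ q < m, ‖F (p + 1) q - F p (q + 1)‖ ≤ K) (k : ℕ) :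
    ∀ p q, p + k ≤ m → q + k ≤ m → ‖F (p + k) q - F p (q + k)‖ ≤ k * K := by
  induction k with
  | zero => intro p q _ _; simp
  | succ k ih =>
    intro p q hp hq
    have h1 := ih (p + 1) q (by omega) (by omega)
    have h2 := h p (by omega) (q + k) (by omega)
    have e : F (p + (k + 1)) q - F p (q + (k + 1)) =
        (F (p + 1 + k) q - F (p + 1) (q + k)) + (F (p + 1) (q + k) - F p (q + k + 1)) := by
      rw [show p + (k + 1) = p + 1 + k by ring]; ring_nf
    rw [e]
    refine (norm_add_le _ _).trans ((add_le_add h1 h2).trans (le_of_eq ?_))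
    push_cast; ring

/-- `F` and `Fs` belong to the products `AB` and `BA`, and `Re F p q = Re Fs q p`. If `p + q` is
even, swapping both to the middle index `r` compares `2 Re F p q` with `Re (F r r + Fs r r) ≥ 0`. If
it is odd, `F = -Fs` everywhere, and swapping `Fs q p` to `Fs p q` shows that `Re F p q` is close to
its own negative. -/
lemma neg_le_re_of_swap_of_le {m : ℕ} {F Fs : ℕ → ℕ → ℂ} {K : ℝ} (hK : 0 ≤ K)
    (h : ∀ p < m, ∀ q < m, ‖F (p + 1) q - F p (q + 1)‖ ≤ K)
    (hs : ∀ p < m, ∀ q < m, ‖Fs (p + 1) q - Fs p (q + 1)‖ ≤ K)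
    (hconj : ∀ p q, star (F p q) = Fs q p) {p q : ℕ} (hpq : p ≤ q) (hq : q ≤ m)
    (hodd : Odd (p + q) → ∀ p q, F p q + Fs p q = 0)
    (heven : Even (p + q) → ∀ r, 0 ≤ (F r r + Fs r r).re) : -(m * K) ≤ (F p q).re := by
  have hre : (F p q).re = (Fs q p).re := by rw [← hconj]; simp
  obtain ⟨k, rfl⟩ := Nat.exists_eq_add_of_le hpq
  rcases Nat.even_or_odd k with ⟨l, rfl⟩ | ho
  · have e := heven (by use p + l; ring) (p + l)
    have h1 := norm_swap_iterate_le h l p (p + l) (by omega) (by omega)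
    have h2 := norm_swap_iterate_le hs l (p + l) p (by omega) (by omega)
    have r1 := (Complex.re_le_norm _).trans h1
    have r2 := (Complex.re_le_norm _).trans ((norm_sub_rev _ _).trans_le h2)
    rw [← add_assoc] at hre ⊢
    simp only [Complex.sub_re, Complex.add_re] at r1 r2 e
    have : (l : ℝ) * K ≤ m * K := by
      have : (l : ℝ) ≤ m := by exact_mod_cast (by omega : l ≤ m)
      gcongr
    linarith
  · have e := hodd (by
      rw [← add_assoc, Nat.odd_add]
      exact ⟨fun h => absurd (⟨p, rfl⟩ : Even (p + p)) (Nat.not_even_iff_odd.2 h),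
        fun h => absurd h (Nat.not_even_iff_odd.2 ho)⟩) p (p + k)
    have h2 := norm_swap_iterate_le hs k p p (by omega) (by omega)
    have r2 := (Complex.re_le_norm _).trans ((norm_sub_rev _ _).trans_le h2)
    have e' := congrArg Complex.re e
    simp only [Complex.sub_re, Complex.add_re, Complex.zero_re] at r2 e'
    have : (k : ℝ) * K ≤ m * K := by
      have : (k : ℝ) ≤ m := by exact_mod_cast (by omega : k ≤ m)
      gcongr
    have : 0 ≤ (m : ℝ) * K := by positivity
    linarith

lemma neg_le_re_of_swap {m : ℕ} {F Fs : ℕ → ℕ → ℂ} {K : ℝ} (hK : 0 ≤ K)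
    (h : ∀ p < m, ∀ q < m, ‖F (p + 1) q - F p (q + 1)‖ ≤ K)
    (hs : ∀ p < m, ∀ q < m, ‖Fs (p + 1) q - Fs p (q + 1)‖ ≤ K)
    (hconj : ∀ p q, star (F p q) = Fs q p) {p q : ℕ} (hp : p ≤ m) (hq : q ≤ m)
    (hodd : Odd (p + q) → ∀ p q, F p q + Fs p q = 0)
    (heven : Even (p + q) → ∀ r, 0 ≤ (F r r + Fs r r).re) : -(m * K) ≤ (F p q).re := by
  rcases le_total p q with hpq | hpq
  · exact neg_le_re_of_swap_of_le hK h hs hconj hpq hq hodd heven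
  · have hre : (F p q).re = (Fs q p).re := by rw [← hconj]; simp
    rw [hre]
    refine neg_le_re_of_swap_of_le hK hs h (fun p q => by rw [← hconj, star_star]) hpq hp
      (fun ho p q => ?_) (fun he r => ?_)
    · rw [add_comm]; exact hodd (by rwa [add_comm]) p q
    · rw [add_comm]; exact heven (by rwa [add_comm]) r

variable {n : ℕ}

/-- The derivatives `X^{m-p} Y^p f` of order `m`, with `X = λ D_x` and `Y = λ D_y`. -/
def topD (m : ℕ) (lam : ℝ) (f : SP n) (p : ℕ) : SP n :=
  (lx lam ^ (m - p) * ly lam ^ p : Module.End ℂ (SP n)) f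

/-- Write the four derivatives as `Yg`, `Xg`, `Xh`, `Yh`. Since `X` and `Y` commute and `B` does not
depend on `x`, the difference is the single term `⟪g, (λD_y B) X h⟫`, where `g` is a derivative of
order `m - 1`. -/
lemma norm_swap_topD_le {m : ℕ} {lam : ℝ} {B : ℝ × ℝ → Mat n} (hB : IsSmoothPeriodic B)
    (hBx : ∀ p, fderiv ℝ B p (1, 0) = 0) {b : ℝ} (hBy : ∀ p, ‖dcoef lam (0, 1) B p‖ ≤ b) (hb : 0 ≤ b)
    {f : SP n} {L M : ℝ} (hL0 : 0 ≤ L)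
    (hL : ∀ i j, i + j < m → ‖toL2 ((lx lam ^ i * ly lam ^ j : Module.End ℂ (SP n)) f)‖ ≤ L)
    (hM : ∀ p ≤ m, ‖toL2 (topD m lam f p)‖ ≤ M) :
    ∀ p < m, ∀ q < m, ‖inner ℂ (toL2 (topD m lam f (p + 1))) (toL2 (mulSP B hB (topD m lam f q))) -
      inner ℂ (toL2 (topD m lam f p)) (toL2 (mulSP B hB (topD m lam f (q + 1))))‖ ≤ b * (L * M) := by
  intro p hp q hq
  set g := (lx lam ^ (m - 1 - p) * ly lam ^ p : Module.End ℂ (SP n)) f with hg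
  set h := (lx lam ^ (m - 1 - q) * ly lam ^ q : Module.End ℂ (SP n)) f with hh
  have e1 : ∀ r < m, topD m lam f (r + 1) =
      ly lam ((lx lam ^ (m - 1 - r) * ly lam ^ r : Module.End ℂ (SP n)) f) := fun r hr => by
    rw [topD, ← Module.End.mul_apply, ← mul_assoc, ← ((lx_comm_ly lam).pow_left _).eq, mul_assoc,
      ← pow_succ', show m - (r + 1) = m - 1 - r by omega]
  have e2 : ∀ r < m, topD m lam f r =
      lx lam ((lx lam ^ (m - 1 - r) * ly lam ^ r : Module.End ℂ (SP n)) f) := fun r hr => by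
    rw [topD, ← Module.End.mul_apply, ← mul_assoc, ← pow_succ',
      show m - r = m - 1 - r + 1 by omega]
  rw [e1 p hp, e1 q hq, ← hg, ← hh, e2 p hp, e2 q hq, ← hg, ← hh]
  have hBx' : mulSP _ (hB.dcoef lam (1, 0)) = 0 := by
    refine LinearMap.ext fun k => Subtype.ext (funext fun z => ?_)
    change act (_ • fderiv ℝ B z (1, 0)) _ = 0
    rw [hBx, smul_zero, act_zero]
  have hcom : lx lam (ly lam h) = ly lam (lx lam h) :=
    LinearMap.congr_fun (lx_comm_ly lam).eq h
  rw [inner_ly, inner_lx, ly_mulSP, lx_mulSP, hBx', hcom, LinearMap.zero_apply, add_zero, map_add,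
    inner_add_right, add_sub_cancel_left]
  refine (norm_inner_le_norm _ _).trans ?_
  have h1 := hL (m - 1 - p) p (by omega)
  have h2 := norm_toL2_mulSP_le (hB.dcoef lam (0, 1)) hBy (lx lam h)
  have h3 := hM q hq.le
  rw [e2 q hq] at h3
  have h4 : b * ‖toL2 (lx lam h)‖ ≤ b * M := by gcongr
  refine (mul_le_mul h1 (h2.trans h4) (norm_nonneg _) hL0).trans (le_of_eq (by ring))

open scoped ComplexOrder in
lemma re_inner_mulSP_nonneg {B : ℝ × ℝ → Mat n} (hB : IsSmoothPeriodic B)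
    (hpos : ∀ p, (B p).PosSemidef) (f : SP n) : 0 ≤ (inner ℂ (toL2 f) (toL2 (mulSP B hB f))).re := by
  rw [inner_toL2_toL2]
  have hi : Integrable (fun p => (inner ℂ ((f : ℝ × ℝ → Cn n) p)
      ((mulSP B hB f : ℝ × ℝ → Cn n) p) : ℂ)) torusMeasure :=
    memLp_one_iff_integrable.1
      (memLp_of_continuous ((sp_continuous f).inner (sp_continuous (mulSP B hB f))) 1)
  have := Complex.reCLM.integral_comp_comm hi
  change 0 ≤ Complex.reCLM _
  rw [← this]
  refine integral_nonneg fun p => ?_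
  have h := (hpos p).re_dotProduct_nonneg (((f : ℝ × ℝ → Cn n) p).ofLp)
  refine h.trans (le_of_eq ?_)
  change _ = (inner ℂ ((f : ℝ × ℝ → Cn n) p) (act (B p) ((f : ℝ × ℝ → Cn n) p))).re
  rw [EuclideanSpace.inner_eq_star_dotProduct, dotProduct_comm]
  rfl

/-- Sign of the mixed leading-order terms. -/
lemma neg_le_re_inner_topD {m : ℕ} {lam : ℝ} {A B : ℝ × ℝ → Mat n} (hA : IsSmoothPeriodic A)
    (hB : IsSmoothPeriodic B) (hAh : ∀ p, (A p).IsHermitian) (hBh : ∀ p, (B p).IsHermitian)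
    (hAx : ∀ p, fderiv ℝ A p (1, 0) = 0) (hBx : ∀ p, fderiv ℝ B p (1, 0) = 0) {b : ℝ} (hb : 0 ≤ b)
    (hAB : ∀ p, ‖dcoef lam (0, 1) (fun p => A p * B p) p‖ ≤ b)
    (hBA : ∀ p, ‖dcoef lam (0, 1) (fun p => B p * A p) p‖ ≤ b)
    {f : SP n} {L M : ℝ} (hL0 : 0 ≤ L) (hM0 : 0 ≤ M)
    (hL : ∀ i j, i + j < m → ‖toL2 ((lx lam ^ i * ly lam ^ j : Module.End ℂ (SP n)) f)‖ ≤ L)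
    (hM : ∀ p ≤ m, ‖toL2 (topD m lam f p)‖ ≤ M) {p q : ℕ} (hp : p ≤ m) (hq : q ≤ m)
    (hcond : ∀ z, AnticommCond (p + q) (A z) (B z)) :
    -(m * (b * (L * M))) ≤ (inner ℂ (toL2 (mulSP A hA (topD m lam f p)))
      (toL2 (mulSP B hB (topD m lam f q)))).re := by
  have hd : ∀ {A B : ℝ × ℝ → Mat n}, IsSmoothPeriodic A → IsSmoothPeriodic B →
      (∀ p, fderiv ℝ A p (1, 0) = 0) → (∀ p, fderiv ℝ B p (1, 0) = 0) →
      ∀ p, fderiv ℝ (fun p => A p * B p) p (1, 0) = 0 := fun {A B} hA hB hAx hBx p => by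
    rw [fderiv_fun_mul' (hA.smooth.differentiable (by simp) p) (hB.smooth.differentiable (by simp) p)]
    simp [hAx, hBx]
  have key := neg_le_re_of_swap (m := m)
    (F := fun p q => inner ℂ (toL2 (topD m lam f p)) (toL2 (mulSP _ (hA.mul hB) (topD m lam f q))))
    (Fs := fun p q => inner ℂ (toL2 (topD m lam f p)) (toL2 (mulSP _ (hB.mul hA) (topD m lam f q))))
    (K := b * (L * M)) (by positivity)
    (norm_swap_topD_le (hA.mul hB) (hd hA hB hAx hBx) hAB hb hL0 hL hM)
    (norm_swap_topD_le (hB.mul hA) (hd hB hA hBx hAx) hBA hb hL0 hL hM)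
    (fun p q => by
      rw [← starRingEnd_apply, inner_conj_symm, inner_mulSP_left]
      refine congrArg (fun z => inner ℂ (toL2 (topD m lam f q)) (toL2 z))
        (Subtype.ext (funext fun z => ?_))
      rw [coe_mulSP, coe_mulSP, Matrix.conjTranspose_mul, (hAh z).eq, (hBh z).eq])
    hp hq
    (fun ho p q => by
      rw [← inner_add_right, ← map_add]
      have : mulSP _ (hA.mul hB) (topD m lam f q) + mulSP _ (hB.mul hA) (topD m lam f q) = 0 := by
        ext1; funext z
        change act (A z * B z) _ + act (B z * A z) _ = 0
        rw [← act_add, (hcond z).1 ho, act_zero]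
      rw [this, map_zero, inner_zero_right])
    (fun he r => by
      rw [← inner_add_right, ← map_add]
      have : mulSP _ (hA.mul hB) (topD m lam f r) + mulSP _ (hB.mul hA) (topD m lam f r) =
          mulSP _ ((hA.mul hB).add (hB.mul hA)) (topD m lam f r) := by
        ext1; funext z
        change act (A z * B z) _ + act (B z * A z) _ = act (A z * B z + B z * A z) _
        rw [← act_add]
      rw [this]
      exact re_inner_mulSP_nonneg _ (fun z => (hcond z).2 he) _)
  refine key.trans (le_of_eq ?_)
  rw [inner_mulSP_left]
  refine congrArg (fun z => (inner ℂ (toL2 (topD m lam f p)) (toL2 z)).re)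
    (Subtype.ext (funext fun z => ?_))
  change act (A z * B z) _ = act (A z).conjTranspose (act (B z) _)
  rw [(hAh z).eq, act_mul]

end Swap

/-! ### The elliptic a priori estimate, uniform in `λ`. -/

section APriori

variable {n : ℕ}

lemma sum_multiIdx {M : Type*} [AddCommMonoid M] {m : ℕ} (hm : 1 ≤ m) (F : ℕ × ℕ → M) :
    ∑ q ∈ multiIdx m, F q =
      ∑ q ∈ multiIdx (m - 1), F q + ∑ j ∈ Finset.range (m + 1), F (j, m - j) := by
  rw [← Finset.Nat.sum_antidiagonal_eq_sum_range_succ_mk, ← Finset.sum_union]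
  · congr 1
    ext q
    rw [Finset.mem_union, mem_multiIdx, mem_multiIdx, Finset.HasAntidiagonal.mem_antidiagonal]
    omega
  · rw [Finset.disjoint_left]
    intro q h1 h2
    rw [mem_multiIdx] at h1
    rw [Finset.HasAntidiagonal.mem_antidiagonal] at h2
    omega

/-- The part of the coefficient of `D_x^j D_y^{m-j}` that remains after removing the constant
coefficients `M₀` of `D_y^m` and `Mm` of `D_x^m`. -/
def remCoef (m : ℕ) (M₀ Mm : Mat n) (c : ℕ → ℕ → ℝ × ℝ → Mat n) (j : ℕ) (p : ℝ × ℝ) : Mat n :=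
  c j (m - j) p - (if j = 0 then M₀ else 0) - (if j = m then Mm else 0)

/-- Constant matrices `M₀`, `Mm` that can serve as dominant coefficients. -/
structure IsDominant (m : ℕ) (M₀ Mm : Mat n) : Prop where
  herm₀ : M₀.IsHermitian
  herm : Mm.IsHermitian
  unit₀ : IsUnit M₀
  unit : IsUnit Mm
  cond : AnticommCond m M₀ Mm

/-- Smooth coefficients whose leading part is dominated by `M₀` and `Mm`, with bounds `Γ` in terms
of the semiclassical parameter. -/
structure HasDominantPart (m : ℕ) (lam : ℝ) (M₀ Mm : Mat n) (Γ : ℝ)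
    (c : ℕ → ℕ → ℝ × ℝ → Mat n) : Prop where
  smooth : ∀ q ∈ multiIdx m, IsSmoothPeriodic (c q.1 q.2)
  bound : ∀ q ∈ multiIdx m, ∀ p, ‖c q.1 q.2 p‖ ≤ Γ
  lead_x : ∀ j ≤ m, ∀ p, fderiv ℝ (c j (m - j)) p (1, 0) = 0
  lead_y : ∀ j ≤ m, ∀ p, ‖dcoef lam (0, 1) (c j (m - j)) p‖ ≤ Γ
  lead_herm : ∀ j ≤ m, ∀ p, (c j (m - j) p).IsHermitian
  cond : ∀ j ≤ m, ∀ p, AnticommCond j M₀ (remCoef m M₀ Mm c j p) ∧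
    AnticommCond (m + j) Mm (remCoef m M₀ Mm c j p)

variable (n) in
/-- `(M₀ (λ D_y)^m + Mm (λ D_x)^m) J`. -/
def freeT (m : ℕ) (lam : ℝ) (M₀ Mm : Mat n) : L2T n →L[ℂ] L2T n :=
  (matMul fun _ => M₀).comp (symbG n m lam 0 m) + (matMul fun _ => Mm).comp (symbG n m lam m 0)

lemma dcoef_const_mul (lam : ℝ) (w : ℝ × ℝ) (M : Mat n) {c : ℝ × ℝ → Mat n}
    (hc : IsSmoothPeriodic c) (p : ℝ × ℝ) :
    dcoef lam w (fun p => M * c p) p = M * dcoef lam w c p := by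
  unfold dcoef
  rw [fderiv_const_mul (hc.smooth.differentiable (by simp) p)]
  rw [mul_smul_comm]
  rfl

lemma dcoef_mul_const (lam : ℝ) (w : ℝ × ℝ) (M : Mat n) {c : ℝ × ℝ → Mat n}
    (hc : IsSmoothPeriodic c) (p : ℝ × ℝ) :
    dcoef lam w (fun p => c p * M) p = dcoef lam w c p * M := by
  unfold dcoef
  rw [fderiv_mul_const' (hc.smooth.differentiable (by simp) p)]
  rw [smul_mul_assoc]
  rfl

lemma remCoef_eq (m : ℕ) (M₀ Mm : Mat n) (c : ℕ → ℕ → ℝ × ℝ → Mat n) (j : ℕ) :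
    remCoef m M₀ Mm c j = fun p => c j (m - j) p -
      ((if j = 0 then M₀ else 0) + (if j = m then Mm else 0)) :=
  funext fun _ => sub_sub _ _ _

namespace HasDominantPart

variable {m : ℕ} {lam Γ : ℝ} {M₀ Mm : Mat n} {c : ℕ → ℕ → ℝ × ℝ → Mat n}

lemma lead_smooth (h : HasDominantPart m lam M₀ Mm Γ c) {j : ℕ} (hj : j ≤ m) :
    IsSmoothPeriodic (c j (m - j)) := h.smooth (j, m - j) (mem_multiIdx.2 (by simp; omega))

lemma rem_smooth (h : HasDominantPart m lam M₀ Mm Γ c) {j : ℕ} (hj : j ≤ m) :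
    IsSmoothPeriodic (remCoef m M₀ Mm c j) := by
  rw [remCoef_eq]
  have := (h.lead_smooth hj).add (IsSmoothPeriodic.const
    (-((if j = 0 then M₀ else 0) + (if j = m then Mm else 0))))
  simpa only [← sub_eq_add_neg] using this

lemma rem_herm (hd : IsDominant m M₀ Mm) (h : HasDominantPart m lam M₀ Mm Γ c) {j : ℕ}
    (hj : j ≤ m) (p : ℝ × ℝ) : (remCoef m M₀ Mm c j p).IsHermitian := by
  refine ((h.lead_herm j hj p).sub ?_).sub ?_ <;> split_ifs
  · exact hd.herm₀
  · exact Matrix.isHermitian_zero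
  · exact hd.herm
  · exact Matrix.isHermitian_zero

lemma fderiv_rem (j : ℕ) (p : ℝ × ℝ) :
    fderiv ℝ (remCoef m M₀ Mm c j) p = fderiv ℝ (c j (m - j)) p := by
  rw [remCoef_eq, fderiv_sub_const]

lemma dcoef_rem (j : ℕ) (p : ℝ × ℝ) :
    dcoef lam (0, 1) (remCoef m M₀ Mm c j) p = dcoef lam (0, 1) (c j (m - j)) p := by
  unfold dcoef; rw [fderiv_rem]

end HasDominantPart

lemma norm_act_inv_le {M : Mat n} (hM : IsUnit M) (w : Cn n) : ‖w‖ ≤ ‖M⁻¹‖ * ‖act M w‖ := by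
  have h : M⁻¹ * M = 1 := Matrix.nonsing_inv_mul M ((Matrix.isUnit_iff_isUnit_det M).1 hM)
  calc ‖w‖ = ‖act M⁻¹ (act M w)‖ := by rw [← act_mul, h, act_one]
    _ ≤ _ := norm_act_le _ _

lemma norm_le_of_isUnit {M : Mat n} (hM : IsUnit M) (u : L2T n) :
    ‖u‖ ≤ ‖M⁻¹‖ * ‖matMul (fun _ => M) u‖ := by
  refine Lp.norm_le_mul_norm_of_ae_le_mul ?_
  filter_upwards [matMul_apply (c := fun _ => M) continuous_const u] with p hp
  rw [hp]
  exact norm_act_inv_le hM _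

lemma matMul_add_apply {c d : ℝ × ℝ → Mat n} (hc : Continuous c) (hd : Continuous d) (u : L2T n) :
    matMul (fun p => c p + d p) u = matMul c u + matMul d u := by
  refine Lp.ext ?_
  filter_upwards [matMul_apply (c := fun p => c p + d p) (hc.add hd) u, matMul_apply hc u, matMul_apply hd u,
    Lp.coeFn_add (matMul c u) (matMul d u)] with p h1 h2 h3 h4
  rw [h4, Pi.add_apply, h2, h3, ← act_add, ← h1]

lemma matMul_zero_apply (u : L2T n) : matMul (fun _ => (0 : Mat n)) u = 0 := by
  refine Lp.ext ?_
  filter_upwards [matMul_apply (c := fun _ => (0 : Mat n)) continuous_const u,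
    Lp.coeFn_zero (Cn n) 2 torusMeasure] with p h1 h2
  rw [h1, h2, act_zero]; rfl

lemma diffT_eq_freeT_add {m : ℕ} (hm : 1 ≤ m) {lam Γ : ℝ} {M₀ Mm : Mat n}
    {c : ℕ → ℕ → ℝ × ℝ → Mat n} (h : HasDominantPart m lam M₀ Mm Γ c) (w : L2T n) :
    diffT m lam c w = freeT n m lam M₀ Mm w +
      (∑ j ∈ Finset.range (m + 1), matMul (remCoef m M₀ Mm c j) (symbG n m lam j (m - j) w) +
        ∑ q ∈ multiIdx (m - 1), matMul (c q.1 q.2) (symbG n m lam q.1 q.2 w)) := by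
  have e1 : diffT m lam c w = ∑ q ∈ multiIdx m, matMul (c q.1 q.2) (symbG n m lam q.1 q.2 w) := by
    simp [diffT]
  have e2 : ∀ j ∈ Finset.range (m + 1), matMul (c j (m - j)) (symbG n m lam j (m - j) w) =
      matMul (remCoef m M₀ Mm c j) (symbG n m lam j (m - j) w) +
      ((if j = 0 then matMul (fun _ => M₀) (symbG n m lam j (m - j) w) else 0) +
        (if j = m then matMul (fun _ => Mm) (symbG n m lam j (m - j) w) else 0)) := fun j hj => by
    have hj' : j ≤ m := by simpa [Nat.lt_succ_iff] using hj
    have : c j (m - j) = fun p => remCoef m M₀ Mm c j p +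
        ((if j = 0 then M₀ else 0) + (if j = m then Mm else 0)) := by
      rw [remCoef_eq]; funext p; simp
    conv_lhs => rw [this]
    rw [matMul_add_apply (h.rem_smooth hj').smooth.continuous continuous_const,
      matMul_add_apply continuous_const continuous_const]
    congr 2 <;> split_ifs <;> first | rfl | exact matMul_zero_apply _
  rw [e1, sum_multiIdx hm, Finset.sum_congr rfl e2, Finset.sum_add_distrib, Finset.sum_add_distrib,
    Finset.sum_ite_eq', Finset.sum_ite_eq', if_pos (by simp), if_pos (by simp), freeT]
  simp only [Nat.sub_zero, Nat.sub_self, add_apply, ContinuousLinearMap.comp_apply]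
  abel

set_option maxHeartbeats 1000000 in
/-- Positivity of the leading part, up to terms of lower order. -/
lemma sq_norm_le_of_smooth {m : ℕ} (hm : 1 ≤ m) {lam Γ : ℝ} {M₀ Mm : Mat n}
    {c : ℕ → ℕ → ℝ × ℝ → Mat n} (hd : IsDominant m M₀ Mm) (h : HasDominantPart m lam M₀ Mm Γ c)
    (hΓ : 0 ≤ Γ) {t : ℝ} (ht0 : 0 ≤ t) (ht1 : t ≤ 1) {w : L2T n} {f : SP n}
    (hw : symbJ n m lam w = toL2 f) :
    ‖matMul (fun _ => M₀) (symbG n m lam 0 m w)‖ ^ 2 +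
      ‖matMul (fun _ => Mm) (symbG n m lam m 0 w)‖ ^ 2 ≤
    (‖M₀‖ + ‖Mm‖) * ‖w‖ * ‖freeT n m lam M₀ Mm w +
      (t : ℂ) • (diffT m lam c w - freeT n m lam M₀ Mm w)‖ +
    (2 * m + 3) ^ 2 * ((‖M₀‖ + ‖Mm‖) * Γ *
      ((∑ q ∈ multiIdx (m - 1), ‖symbG n m lam q.1 q.2 w‖) * ‖w‖)) := by
  set L := ∑ q ∈ multiIdx (m - 1), ‖symbG n m lam q.1 q.2 w‖ with hLdef
  set μ := ‖M₀‖ + ‖Mm‖ with hμ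
  have hL0 : 0 ≤ L := Finset.sum_nonneg fun _ _ => norm_nonneg _
  have hμ0 : 0 ≤ μ := by positivity
  have hL : ∀ i j, i + j < m → ‖toL2 ((lx lam ^ i * ly lam ^ j : Module.End ℂ (SP n)) f)‖ ≤ L := by
    intro i j hij
    rw [← symbG_of_symbJ_eq hw hij.le]
    have hmem : (i, j) ∈ multiIdx (m - 1) := mem_multiIdx.2 (by simp only; omega)
    have := Finset.single_le_sum (s := multiIdx (m - 1))
      (f := fun q : ℕ × ℕ => ‖symbG n m lam q.1 q.2 w‖) (fun q _ => norm_nonneg _) hmem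
    exact this
  have htop : ∀ p ≤ m, symbG n m lam (m - p) p w = toL2 (topD m lam f p) := fun p hp =>
    symbG_of_symbJ_eq hw (by omega)
  have hM : ∀ p ≤ m, ‖toL2 (topD m lam f p)‖ ≤ ‖w‖ := fun p hp => by
    rw [← htop p hp]; exact norm_symbG_apply_le lam (by omega) w
  have c0 := IsSmoothPeriodic.const M₀
  have c1 := IsSmoothPeriodic.const Mm
  have hx0 : ∀ (A : Mat n) (p : ℝ × ℝ), fderiv ℝ (fun _ : ℝ × ℝ => A) p (1, 0) = 0 := fun A p => by
    simp
  have n0 : ‖M₀‖ ≤ μ := by rw [hμ]; have := norm_nonneg Mm; linarith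
  have n1 : ‖Mm‖ ≤ μ := by rw [hμ]; have := norm_nonneg M₀; linarith
  set a := matMul (fun _ => M₀) (symbG n m lam 0 m w) with ha
  set b := matMul (fun _ => Mm) (symbG n m lam m 0 w) with hb
  have ha' : a = toL2 (mulSP _ c0 (topD m lam f m)) := by
    rw [toL2_mulSP, ← htop m le_rfl, Nat.sub_self]
  have hb' : b = toL2 (mulSP _ c1 (topD m lam f 0)) := by
    rw [toL2_mulSP, ← htop 0 (Nat.zero_le _), Nat.sub_zero]
  have hab : freeT n m lam M₀ Mm w = a + b := rfl
  set r : ℕ → L2T n := fun j => matMul (remCoef m M₀ Mm c j) (symbG n m lam j (m - j) w) with hr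
  set R := ∑ q ∈ multiIdx (m - 1), matMul (c q.1 q.2) (symbG n m lam q.1 q.2 w) with hR
  have hr' : ∀ j (hj : j ≤ m), r j = toL2 (mulSP _ (h.rem_smooth hj) (topD m lam f (m - j))) :=
    fun j hj => by
      rw [toL2_mulSP, ← htop (m - j) (by omega), show m - (m - j) = j by omega]
  -- The mixed term of `‖a + b‖²`, with `p = m` and `q = 0`, so that the parity in question is that
  -- of `m`.
  have hcross : -(m * (μ * Γ * (L * ‖w‖))) ≤ (inner ℂ a b).re := by
    rw [ha', hb']
    refine neg_le_re_inner_topD c0 c1 (fun _ => hd.herm₀) (fun _ => hd.herm) (hx0 _) (hx0 _)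
      (by positivity) (fun p => ?_) (fun p => ?_) hL0 (norm_nonneg _) hL hM le_rfl (Nat.zero_le _)
      (fun _ => hd.cond)
    · rw [dcoef]; simp; positivity
    · rw [dcoef]; simp; positivity
  have har : ∀ j ∈ Finset.range (m + 1),
      -(m * (μ * Γ * (L * ‖w‖))) ≤ (inner ℂ a (r j)).re := fun j hj => by
    have hj' : j ≤ m := by simpa [Nat.lt_succ_iff] using hj
    rw [ha', hr' j hj']
    refine neg_le_re_inner_topD c0 (h.rem_smooth hj') (fun _ => hd.herm₀) (h.rem_herm hd hj')
      (hx0 _) (fun p => by rw [HasDominantPart.fderiv_rem, h.lead_x j hj']) (by positivity) (fun p => ?_)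
      (fun p => ?_) hL0 (norm_nonneg _) hL hM le_rfl (Nat.sub_le _ _) (fun p => ?_)
    · rw [dcoef_const_mul _ _ _ (h.rem_smooth hj'), HasDominantPart.dcoef_rem]
      exact (norm_mul_le _ _).trans (mul_le_mul n0 (h.lead_y j hj' p) (norm_nonneg _) hμ0)
    · rw [dcoef_mul_const _ _ _ (h.rem_smooth hj'), HasDominantPart.dcoef_rem, mul_comm μ]
      exact (norm_mul_le _ _).trans (mul_le_mul (h.lead_y j hj' p) n0 (norm_nonneg _) hΓ)
    · have e := (h.cond j hj' p).1
      -- Here `p = m` and `q = m - j`, and `p + q` has the parity of `j`.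
      refine ⟨fun ho => e.1 ?_, fun he => e.2 ?_⟩
      · rw [Nat.odd_iff] at ho ⊢; omega
      · rw [Nat.even_iff] at he ⊢; omega
  have hbr : ∀ j ∈ Finset.range (m + 1),
      -(m * (μ * Γ * (L * ‖w‖))) ≤ (inner ℂ b (r j)).re := fun j hj => by
    have hj' : j ≤ m := by simpa [Nat.lt_succ_iff] using hj
    rw [hb', hr' j hj']
    refine neg_le_re_inner_topD c1 (h.rem_smooth hj') (fun _ => hd.herm) (h.rem_herm hd hj')
      (hx0 _) (fun p => by rw [HasDominantPart.fderiv_rem, h.lead_x j hj']) (by positivity) (fun p => ?_)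
      (fun p => ?_) hL0 (norm_nonneg _) hL hM (Nat.zero_le _) (Nat.sub_le _ _) (fun p => ?_)
    · rw [dcoef_const_mul _ _ _ (h.rem_smooth hj'), HasDominantPart.dcoef_rem]
      exact (norm_mul_le _ _).trans (mul_le_mul n1 (h.lead_y j hj' p) (norm_nonneg _) hμ0)
    · rw [dcoef_mul_const _ _ _ (h.rem_smooth hj'), HasDominantPart.dcoef_rem, mul_comm μ]
      exact (norm_mul_le _ _).trans (mul_le_mul (h.lead_y j hj' p) n1 (norm_nonneg _) hΓ)
    · have e := (h.cond j hj' p).2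
      -- Here `p = 0` and `q = m - j`, and `p + q` has the parity of `m + j`.
      refine ⟨fun ho => e.1 ?_, fun he => e.2 ?_⟩
      · rw [Nat.odd_iff] at ho ⊢; omega
      · rw [Nat.even_iff] at he ⊢; omega
  have hRn : ‖R‖ ≤ Γ * L := by
    rw [hR, hLdef, Finset.mul_sum]
    refine (norm_sum_le _ _).trans (Finset.sum_le_sum fun q hq => ?_)
    have hq' : q ∈ multiIdx m := by rw [mem_multiIdx] at hq ⊢; omega
    exact norm_matMul_apply_le (h.smooth q hq').smooth.continuous (h.bound q hq') _
  have habn : ‖a + b‖ ≤ μ * ‖w‖ := by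
    rw [hμ, add_mul]
    refine (norm_add_le _ _).trans (add_le_add ?_ ?_)
    · refine (norm_matMul_apply_le continuous_const (fun _ => le_rfl) _).trans ?_
      gcongr; exact norm_symbG_apply_le lam (by omega) w
    · refine (norm_matMul_apply_le continuous_const (fun _ => le_rfl) _).trans ?_
      gcongr; exact norm_symbG_apply_le lam (by omega) w
  have hT : freeT n m lam M₀ Mm w + (t : ℂ) • (diffT m lam c w - freeT n m lam M₀ Mm w) =
      (a + b) + (t : ℂ) • (∑ j ∈ Finset.range (m + 1), r j + R) := by
    rw [diffT_eq_freeT_add hm h w, add_sub_cancel_left, hab]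
  rw [hT]
  set Z := (a + b) + (t : ℂ) • (∑ j ∈ Finset.range (m + 1), r j + R) with hZ
  set K := μ * Γ * (L * ‖w‖) with hK
  have hK0 : 0 ≤ K := by positivity
  have hsum : -(2 * m * (m + 1) * K) ≤ (inner ℂ (a + b) (∑ j ∈ Finset.range (m + 1), r j)).re := by
    rw [inner_sum, Complex.re_sum]
    have : ∑ j ∈ Finset.range (m + 1), (-(2 * m * K)) ≤
        ∑ j ∈ Finset.range (m + 1), (inner ℂ (a + b) (r j)).re := by
      refine Finset.sum_le_sum fun j hj => ?_
      rw [inner_add_left, Complex.add_re]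
      have := har j hj
      have := hbr j hj
      linarith
    refine le_trans (le_of_eq ?_) this
    rw [Finset.sum_const, Finset.card_range, nsmul_eq_mul]
    push_cast; ring
  have hRR : -K ≤ (inner ℂ (a + b) R).re := by
    have h1 := (abs_le.1 (Complex.abs_re_le_norm (inner ℂ (a + b) R))).1
    have h2 : ‖(inner ℂ (a + b) R : ℂ)‖ ≤ (μ * ‖w‖) * (Γ * L) :=
      (norm_inner_le_norm _ _).trans (mul_le_mul habn hRn (norm_nonneg _) (by positivity))
    have h3 : (μ * ‖w‖) * (Γ * L) = K := by rw [hK]; ring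
    linarith
  -- Pairing with the dominant part itself: every contribution besides `‖a‖² + ‖b‖²` is bounded
  -- below by a multiple of `-K`, uniformly for `t` in `[0, 1]`.
  have hin : (inner ℂ (a + b) Z).re = ‖a + b‖ ^ 2 +
      t * ((inner ℂ (a + b) (∑ j ∈ Finset.range (m + 1), r j)).re + (inner ℂ (a + b) R).re) := by
    have hself : (inner ℂ (a + b) (a + b) : ℂ).re = ‖a + b‖ ^ 2 :=
      @inner_self_eq_norm_sq ℂ _ _ _ _ (a + b)
    rw [hZ, inner_add_right (a + b) (a + b), Complex.add_re, inner_smul_right,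
      inner_add_right (a + b) _ R, Complex.re_ofReal_mul, Complex.add_re, hself]
  have hnorm : ‖a + b‖ ^ 2 = ‖a‖ ^ 2 + 2 * (inner ℂ a b).re + ‖b‖ ^ 2 := by
    exact @norm_add_sq ℂ _ _ _ _ a b
  have hup : (inner ℂ (a + b) Z).re ≤ μ * ‖w‖ * ‖Z‖ :=
    (Complex.re_le_norm _).trans ((norm_inner_le_norm _ _).trans
      (mul_le_mul_of_nonneg_right habn (norm_nonneg _)))
  have hm0 : (0 : ℝ) ≤ m := Nat.cast_nonneg m
  have hlow : -((2 * m * (m + 1) + 1) * K) ≤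
      t * ((inner ℂ (a + b) (∑ j ∈ Finset.range (m + 1), r j)).re + (inner ℂ (a + b) R).re) := by
    have h1 : -((2 * m * (m + 1) + 1) * K) ≤
        (inner ℂ (a + b) (∑ j ∈ Finset.range (m + 1), r j)).re + (inner ℂ (a + b) R).re := by
      linarith
    have h2 := mul_le_mul_of_nonneg_left h1 ht0
    have h3 : 0 ≤ (2 * m * (m + 1) + 1) * K := by positivity
    have h4 := mul_le_mul_of_nonneg_right ht1 h3
    linarith
  have hpoly : (2 * m * (m + 1) + 1) * K + 2 * (m * K) ≤ (2 * (m : ℝ) + 3) ^ 2 * K := by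
    have : 0 ≤ (m : ℝ) ^ 2 * K := by positivity
    have : 0 ≤ (m : ℝ) * K := by positivity
    linarith
  linarith

lemma le_add_of_sq_le {g η W D j : ℝ} (hη : 0 ≤ η) (hD : 1 ≤ D) (hW : 0 ≤ W) (hj : 0 ≤ j)
    (h : g ^ 2 ≤ η ^ 2 * W ^ 2 + D * j ^ 2) : g ≤ η * W + D * j := by
  refine abs_le_of_sq_le_sq' (h.trans ?_) (by positivity) |>.2
  have : 0 ≤ 2 * (η * W) * (D * j) := by positivity
  have : D * j ^ 2 ≤ D ^ 2 * j ^ 2 := by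
    gcongr; nlinarith
  nlinarith

/-- The terms are `W = ‖w‖`, `j = ‖J w‖`, `τ` the norm of the operator applied to `w`, and `L` the
derivatives of lower order. Dividing by `W` makes the estimate linear, and `η` is such that the
interpolated part of `L` contributes at most `W / 2`, which goes to the left side. -/
lemma le_of_sq_le_aux {W j τ L α μ k s η D a b : ℝ} (hj0 : 0 ≤ j) (hτ0 : 0 ≤ τ) 
    (hμ0 : 0 ≤ μ) (hk0 : 0 ≤ k) (hD0 : 0 ≤ D)
    (hη : η = (2 * (3 * α ^ 2 * k * s + 1))⁻¹) (hjw : j ≤ W) (hn : W ≤ j + α * b + α * a)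
    (h1 : a ^ 2 + b ^ 2 ≤ W * (μ * τ + k * L)) (hLb : L ≤ s * (η * W + D * j)) (hs0 : 0 ≤ s)
    (hw0 : 0 ≤ W) :
    W ≤ 2 * (3 * α ^ 2 * μ + (3 + 3 * α ^ 2 * k * (s * D))) * (τ + j) := by
  rcases hw0.eq_or_lt with h0 | hpos
  · rw [← h0]; positivity
  have hmain : W ^ 2 ≤ W * (3 * j + 3 * α ^ 2 * (μ * τ + k * L)) := by
    have hsq : W ^ 2 ≤ 3 * (j ^ 2 + (α * b) ^ 2 + (α * a) ^ 2) := by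
      have h2 : W ^ 2 ≤ (j + α * b + α * a) ^ 2 := by gcongr
      nlinarith [sq_nonneg (j - α * b), sq_nonneg (j - α * a), sq_nonneg (α * a - α * b)]
    have h3 : α ^ 2 * (a ^ 2 + b ^ 2) ≤ α ^ 2 * (W * (μ * τ + k * L)) :=
      mul_le_mul_of_nonneg_left h1 (by positivity)
    have h4 : j ^ 2 ≤ W * j := by rw [sq]; gcongr
    linarith
  have hmain' : W ≤ 3 * j + 3 * α ^ 2 * (μ * τ + k * L) := by
    rw [sq] at hmain
    exact le_of_mul_le_mul_left hmain hpos
  have hkL : 3 * α ^ 2 * (k * L) ≤ W / 2 + 3 * α ^ 2 * k * (s * D) * j := by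
    have h5 : 3 * α ^ 2 * (k * L) ≤ 3 * α ^ 2 * (k * (s * (η * W + D * j))) := by gcongr
    have h6 : 3 * α ^ 2 * k * s * η ≤ 1 / 2 := by
      rw [hη, ← div_eq_mul_inv, div_le_div_iff₀ (by positivity) (by norm_num)]
      linarith
    have h7 := mul_le_mul_of_nonneg_right h6 hw0
    linarith
  have p1 : 0 ≤ α ^ 2 * μ * j := by positivity
  have p2 : 0 ≤ α ^ 2 * k * (s * D) * τ := by positivity
  linarith

set_option maxHeartbeats 1000000 in
/-- The elliptic a priori estimate, uniformly in the semiclassical parameter. -/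
theorem exists_a_priori_bound (n : ℕ) {m : ℕ} (hm : 1 ≤ m) {M₀ Mm : Mat n} (hd : IsDominant m M₀ Mm)
    {Γ : ℝ} (hΓ : 0 ≤ Γ) : ∃ C : ℝ, 0 ≤ C ∧ ∀ (lam : ℝ) (c : ℕ → ℕ → ℝ × ℝ → Mat n),
      HasDominantPart m lam M₀ Mm Γ c → ∀ t : ℝ, 0 ≤ t → t ≤ 1 → ∀ w : L2T n,
      ‖w‖ ≤ C * (‖freeT n m lam M₀ Mm w + (t : ℂ) • (diffT m lam c w - freeT n m lam M₀ Mm w)‖ +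
        ‖symbJ n m lam w‖) := by
  set μ := ‖M₀‖ + ‖Mm‖ with hμ
  set α := ‖M₀⁻¹‖ + ‖Mm⁻¹‖ with hα
  have hμ0 : 0 ≤ μ := by positivity
  have hα0 : 0 ≤ α := by positivity
  set k := (2 * (m : ℝ) + 3) ^ 2 * (μ * Γ) with hk
  have hk0 : 0 ≤ k := by positivity
  set s : ℝ := (Finset.card (multiIdx (m - 1)) : ℝ) with hs
  have hs0 : 0 ≤ s := Nat.cast_nonneg _
  -- The interpolation parameter; the summand `1` keeps the denominator positive.
  set η : ℝ := (2 * (3 * α ^ 2 * k * s + 1))⁻¹ with hη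
  have hη0 : 0 < η := by positivity
  set D : ℝ := 1 + (η ^ 2)⁻¹ ^ (m - 1) with hD
  have hD0 : 1 ≤ D := by
    have : 0 ≤ (η ^ 2)⁻¹ ^ (m - 1) := by positivity
    linarith
  clear_value D η s k α μ
  refine ⟨2 * (3 * α ^ 2 * μ + (3 + 3 * α ^ 2 * k * (s * D))), by positivity,
    fun lam c h t ht0 ht1 w => ?_⟩
  -- Both sides are continuous in `w`, so the dense set of `w` with `J w` smooth is enough.
  suffices hsm : ∀ w ∈ {w : L2T n | ∃ f : SP n, symbJ n m lam w = toL2 f},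
      ‖w‖ ≤ 2 * (3 * α ^ 2 * μ + (3 + 3 * α ^ 2 * k * (s * D))) *
      (‖freeT n m lam M₀ Mm w + (t : ℂ) • (diffT m lam c w - freeT n m lam M₀ Mm w)‖ +
        ‖symbJ n m lam w‖) by
    have hcl : IsClosed {w : L2T n | ‖w‖ ≤ 2 * (3 * α ^ 2 * μ + (3 + 3 * α ^ 2 * k * (s * D))) *
      (‖freeT n m lam M₀ Mm w + (t : ℂ) • (diffT m lam c w - freeT n m lam M₀ Mm w)‖ +
        ‖symbJ n m lam w‖)} := isClosed_le (by fun_prop) (by fun_prop)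
    have := closure_minimal hsm hcl
    rw [(dense_symbJ_smooth m lam).closure_eq] at this
    exact this (mem_univ w)
  rintro w ⟨f, hw⟩
  have h1 := sq_norm_le_of_smooth hm hd h hΓ ht0 ht1 hw
  set τ := ‖freeT n m lam M₀ Mm w + (t : ℂ) • (diffT m lam c w - freeT n m lam M₀ Mm w)‖
  set L := ∑ q ∈ multiIdx (m - 1), ‖symbG n m lam q.1 q.2 w‖ with hL
  obtain ⟨w', hw', hn⟩ := exists_symbJ_eq_toL2 m lam f
  have hww : w' = w := by
    rw [← sub_eq_zero]
    refine symbJ_injective m lam ?_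
    rw [map_sub, hw, hw', sub_self]
  rw [hww, ← symbG_of_symbJ_eq hw (by omega), ← symbG_of_symbJ_eq hw (by omega), ← hw] at hn
  have e0 := norm_le_of_isUnit hd.unit₀ (symbG n m lam 0 m w)
  have e1 := norm_le_of_isUnit hd.unit (symbG n m lam m 0 w)
  set a := ‖matMul (fun _ => M₀) (symbG n m lam 0 m w)‖
  set b := ‖matMul (fun _ => Mm) (symbG n m lam m 0 w)‖
  have ha0 : 0 ≤ a := norm_nonneg _
  have hb0 : 0 ≤ b := norm_nonneg _
  have e0' : ‖symbG n m lam 0 m w‖ ≤ α * a := e0.trans (by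
    rw [hα]; have := norm_nonneg Mm⁻¹; gcongr; linarith)
  have e1' : ‖symbG n m lam m 0 w‖ ≤ α * b := e1.trans (by
    rw [hα]; have := norm_nonneg M₀⁻¹; gcongr; linarith)
  set j := ‖symbJ n m lam w‖ with hj
  have hj0 : 0 ≤ j := norm_nonneg _
  have hjw : j ≤ ‖w‖ := norm_symbG_apply_le lam (Nat.zero_le _) w
  have hLb : L ≤ s * (η * ‖w‖ + D * j) := by
    rw [hL, hs, ← nsmul_eq_mul, ← Finset.sum_const]
    refine Finset.sum_le_sum fun q hq => ?_
    have hq' : q.1 + q.2 < m := by rw [mem_multiIdx] at hq; omega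
    have e := norm_symbG_apply_sq_le lam hq' (by positivity : 0 < η ^ 2) w
    rw [← hD] at e
    exact le_add_of_sq_le hη0.le hD0 (norm_nonneg _) (norm_nonneg _) e
  have hw0 : 0 ≤ ‖w‖ := norm_nonneg w
  have hτ0 : 0 ≤ τ := norm_nonneg _
  exact le_of_sq_le_aux hj0 hτ0 hμ0 hk0 (zero_le_one.trans hD0) hη hjw
    (hn.trans (add_le_add (add_le_add le_rfl e1') e0')) (h1.trans (le_of_eq (by rw [hk, hμ]; ring))) hLb hs0 hw0

end APriori

/-! ### Invertibility by the method of continuity. -/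

section Inverse

variable {E : Type*} [NormedAddCommGroup E] [InnerProductSpace ℂ E] [CompleteSpace E]

lemma norm_sq_smul_sub {z : ℂ} (hz : z = Complex.I ∨ z = -Complex.I) {a b : E}
    (h : (inner ℂ b a : ℂ) = inner ℂ a b) : ‖z • a - b‖ ^ 2 = ‖a‖ ^ 2 + ‖b‖ ^ 2 := by
  have hz1 : ‖z‖ = 1 := by rcases hz with rfl | rfl <;> simp
  have him : (inner ℂ a b : ℂ).im = 0 := by
    have h2 := inner_conj_symm (𝕜 := ℂ) a b
    rw [h] at h2
    exact Complex.conj_eq_iff_im.1 h2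
  have hre : (inner ℂ (z • a) b : ℂ).re = 0 := by
    rw [inner_smul_left]
    rcases hz with rfl | rfl <;> simp [him]
  have h3 := @norm_sub_sq ℂ _ _ _ _ (z • a) b
  rw [h3]
  change _ - 2 * (inner ℂ (z • a) b : ℂ).re + _ = _
  rw [hre, norm_smul, hz1]
  ring

/-- By symmetry the cross term drops out at `z = ±i`, so `‖(z J - T) w‖² = ‖J w‖² + ‖T w‖²` controls
both terms of the estimate. -/
lemma norm_le_of_symm {z : ℂ} (hz : z = Complex.I ∨ z = -Complex.I) {J T : E →L[ℂ] E} {C : ℝ}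
    (hC : 0 ≤ C) (hsymm : ∀ w w', inner ℂ (T w) (J w') = inner ℂ (J w) (T w'))
    (hest : ∀ w, ‖w‖ ≤ C * (‖T w‖ + ‖J w‖)) (w : E) : ‖w‖ ≤ 2 * C * ‖(z • J - T) w‖ := by
  have h := norm_sq_smul_sub hz (hsymm w w)
  have e : (z • J - T) w = z • J w - T w := rfl
  rw [e]
  have h1 : ‖J w‖ ≤ ‖z • J w - T w‖ :=
    abs_le_of_sq_le_sq' (by rw [h]; have := sq_nonneg ‖T w‖; linarith) (norm_nonneg _) |>.2
  have h2 : ‖T w‖ ≤ ‖z • J w - T w‖ :=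
    abs_le_of_sq_le_sq' (by rw [h]; have := sq_nonneg ‖J w‖; linarith) (norm_nonneg _) |>.2
  refine (hest w).trans ?_
  rw [mul_comm 2 C, mul_assoc]
  gcongr
  linarith

/-- A lower bound gives injectivity and closed range; density then gives surjectivity. -/
lemma isUnit_of_norm_le {S : E →L[ℂ] E} {C : ℝ} (hC : 0 ≤ C) (h : ∀ w, ‖w‖ ≤ C * ‖S w‖)
    (hd : DenseRange S) : IsUnit S := by
  have ha : AntilipschitzWith ⟨C, hC⟩ S := S.antilipschitz_of_bound h
  rw [ContinuousLinearMap.isUnit_iff_bijective]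
  refine ⟨ha.injective, ?_⟩
  have hc := ha.isClosed_range S.uniformContinuous
  rw [← Set.range_eq_univ, ← hc.closure_eq]
  exact hd.closure_range

lemma norm_inv_le_of_norm_le {S N : E →L[ℂ] E} {C : ℝ} (hC : 0 ≤ C) (h : ∀ w, ‖w‖ ≤ C * ‖S w‖)
    (hN : S * N = 1) : ‖N‖ ≤ C := by
  refine N.opNorm_le_bound hC fun a => ?_
  have : S (N a) = a := congrArg (fun S : E →L[ℂ] E => S a) hN
  simpa [this] using h (N a)

/-- The lower bound keeps every inverse on the path below `C`, so a Neumann series advances by a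
step whose length does not shrink. -/
lemma isUnit_of_path {S D : E →L[ℂ] E} {C : ℝ} (hC : 0 ≤ C)
    (h : ∀ t : ℝ, 0 ≤ t → t ≤ 1 → ∀ w, ‖w‖ ≤ C * ‖(S + (t : ℂ) • D) w‖) (h0 : IsUnit S) :
    IsUnit (S + D) := by
  -- Steps of length `1 / K` perturb by less than `1 / C`.
  obtain ⟨K, hK⟩ := exists_nat_gt (C * ‖D‖)
  have hK0 : (0 : ℝ) < K := lt_of_le_of_lt (by positivity) hK
  have key : ∀ k : ℕ, k ≤ K → IsUnit (S + (((k / K : ℝ)) : ℂ) • D) := by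
    intro k
    induction k with
    | zero => intro _; simpa using h0
    | succ k ih =>
      intro hk
      obtain ⟨u, hu⟩ := ih (by omega)
      have hkK : (k : ℝ) ≤ K := by exact_mod_cast (by omega : k ≤ K)
      have hN := norm_inv_le_of_norm_le hC (h (k / K) (by positivity)
        (div_le_one_of_le₀ hkK hK0.le)) (N := (↑u⁻¹ : E →L[ℂ] E)) (by rw [← hu]; exact u.mul_inv)
      have e : S + (((k + 1 : ℕ) / K : ℝ) : ℂ) • D =
          u * (1 - (-((K : ℂ)⁻¹ • (↑u⁻¹ * D)))) := by
        rw [sub_neg_eq_add, mul_add, mul_one, mul_smul_comm, ← mul_assoc, u.mul_inv, one_mul, hu]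
        push_cast
        rw [add_div, add_smul, one_div, add_assoc]
      rw [e]
      refine u.isUnit.mul (isUnit_one_sub_of_norm_lt_one ?_)
      rw [norm_neg, norm_smul, norm_inv, Complex.norm_natCast, inv_mul_lt_iff₀ hK0, mul_one]
      refine lt_of_le_of_lt (norm_mul_le _ _) (lt_of_le_of_lt ?_ hK)
      gcongr
  have := key K le_rfl
  rwa [div_self hK0.ne', Complex.ofReal_one, one_smul] at this

end Inverse

/-! ### The constant-coefficient operator and the inverse of `±iJ - T`. -/

section Free

variable {n : ℕ}

lemma symm_of_smooth {m : ℕ} {lam : ℝ} {T : L2T n →L[ℂ] L2T n}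
    (h : ∀ (f g : SP n) w w', symbJ n m lam w = toL2 f → symbJ n m lam w' = toL2 g →
      inner ℂ (T w) (symbJ n m lam w') = inner ℂ (symbJ n m lam w) (T w')) (w w' : L2T n) :
    inner ℂ (T w) (symbJ n m lam w') = inner ℂ (symbJ n m lam w) (T w') := by
  have hd := dense_symbJ_smooth (n := n) m lam
  have h1 : ∀ w ∈ {w : L2T n | ∃ f : SP n, symbJ n m lam w = toL2 f}, ∀ w',
      inner ℂ (T w) (symbJ n m lam w') = inner ℂ (symbJ n m lam w) (T w') := by
    rintro w ⟨f, hf⟩ w'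
    have hcl : IsClosed {w' : L2T n |
      inner ℂ (T w) (symbJ n m lam w') = inner ℂ (symbJ n m lam w) (T w')} :=
      isClosed_eq (by fun_prop) (by fun_prop)
    have hsub : {w : L2T n | ∃ f : SP n, symbJ n m lam w = toL2 f} ⊆ {w' : L2T n |
      inner ℂ (T w) (symbJ n m lam w') = inner ℂ (symbJ n m lam w) (T w')} := by
      rintro w' ⟨g, hg⟩
      exact h f g w w' hf hg
    have := closure_minimal hsub hcl
    rw [hd.closure_eq] at this
    exact this (mem_univ w')
  have hcl : IsClosed {w : L2T n |
    inner ℂ (T w) (symbJ n m lam w') = inner ℂ (symbJ n m lam w) (T w')} :=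
    isClosed_eq (by fun_prop) (by fun_prop)
  have := closure_minimal (fun w hw => h1 w hw w') hcl
  rw [hd.closure_eq] at this
  exact this (mem_univ w)

lemma mulSP_const_comm (lam : ℝ) (M : Mat n) (i j : ℕ) (f : SP n) :
    (lx lam ^ i * ly lam ^ j : Module.End ℂ (SP n)) (mulSP _ (IsSmoothPeriodic.const M) f) =
      mulSP _ (IsSmoothPeriodic.const M) ((lx lam ^ i * ly lam ^ j : Module.End ℂ (SP n)) f) := by
  have hz : ∀ (w : ℝ × ℝ) (f : SP n),
      mulSP _ ((IsSmoothPeriodic.const M).dcoef lam w) f = 0 := fun w f => by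
    ext1; funext z
    change act (_ • fderiv ℝ (fun _ : ℝ × ℝ => M) z w) _ = 0
    simp [act_zero]
  have cx : Commute (lx lam) (mulSP _ (IsSmoothPeriodic.const M)) := LinearMap.ext fun f => by
    simpa [hz] using lx_mulSP lam (IsSmoothPeriodic.const M) f
  have cy : Commute (ly lam) (mulSP _ (IsSmoothPeriodic.const M)) := LinearMap.ext fun f => by
    simpa [hz] using ly_mulSP lam (IsSmoothPeriodic.const M) f
  exact LinearMap.congr_fun (((cx.pow_left i).mul_left (cy.pow_left j)).eq) f

lemma inner_lx_pow_ly_pow (lam : ℝ) (i j : ℕ) (f g : SP n) :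
    inner ℂ (toL2 ((lx lam ^ i * ly lam ^ j : Module.End ℂ (SP n)) f)) (toL2 g) =
      inner ℂ (toL2 f) (toL2 ((lx lam ^ i * ly lam ^ j : Module.End ℂ (SP n)) g)) := by
  simp only [lx_pow_mul_ly_pow, LinearMap.smul_apply, map_smul, inner_smul_left, inner_smul_right,
    inner_dx_pow_dy_pow]
  simp

lemma inner_const_mul {lam : ℝ} {M : Mat n} (hM : M.IsHermitian) (i j : ℕ) (f g : SP n) :
    inner ℂ (toL2 (mulSP _ (IsSmoothPeriodic.const M)
      ((lx lam ^ i * ly lam ^ j : Module.End ℂ (SP n)) f))) (toL2 g) =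
    inner ℂ (toL2 f) (toL2 (mulSP _ (IsSmoothPeriodic.const M)
      ((lx lam ^ i * ly lam ^ j : Module.End ℂ (SP n)) g))) := by
  rw [← mulSP_const_comm, inner_lx_pow_ly_pow, inner_mulSP_left]
  refine congrArg (fun z => inner ℂ (toL2 f) (toL2 z)) (Subtype.ext (funext fun z => ?_))
  rw [coe_mulSP, coe_mulSP, hM.eq]

lemma freeT_symm {m : ℕ} {lam : ℝ} {M₀ Mm : Mat n} (hd : IsDominant m M₀ Mm) (w w' : L2T n) :
    inner ℂ (freeT n m lam M₀ Mm w) (symbJ n m lam w') =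
      inner ℂ (symbJ n m lam w) (freeT n m lam M₀ Mm w') := by
  refine symm_of_smooth (fun f g w w' hf hg => ?_) w w'
  have e : ∀ {w : L2T n} {f : SP n}, symbJ n m lam w = toL2 f → freeT n m lam M₀ Mm w =
      toL2 (mulSP _ (IsSmoothPeriodic.const M₀)
        ((lx lam ^ 0 * ly lam ^ m : Module.End ℂ (SP n)) f)) +
      toL2 (mulSP _ (IsSmoothPeriodic.const Mm)
        ((lx lam ^ m * ly lam ^ 0 : Module.End ℂ (SP n)) f)) := fun {w f} h => by
    rw [toL2_mulSP, toL2_mulSP, ← symbG_of_symbJ_eq h (by omega), ← symbG_of_symbJ_eq h (by omega)]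
    rfl
  rw [e hf, e hg, hf, hg, inner_add_left, inner_add_right, inner_const_mul hd.herm₀,
    inner_const_mul hd.herm]

lemma expSP_smul (k l : ℤ) (r : ℂ) (v : Cn n) : expSP k l (r • v) = r • expSP k l v :=
  Subtype.ext (funext fun _ => smul_comm _ _ _)

lemma expSP_add (k l : ℤ) (v w : Cn n) : expSP k l (v + w) = expSP k l v + expSP k l w :=
  Subtype.ext (funext fun _ => smul_add _ _ _)

lemma expSP_sub (k l : ℤ) (v w : Cn n) : expSP k l (v - w) = expSP k l v - expSP k l w :=
  Subtype.ext (funext fun _ => smul_sub _ _ _)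

lemma mulSP_const_expSP (M : Mat n) (k l : ℤ) (v : Cn n) :
    mulSP _ (IsSmoothPeriodic.const M) (expSP k l v) = expSP k l (act M v) :=
  Subtype.ext (funext fun p => by
    rw [coe_mulSP]
    exact map_smul (actL M) _ v)

lemma symbJ_expSP (m : ℕ) (lam : ℝ) (k l : ℤ) (v : Cn n) (a : Fin n) :
    symbJ n m lam (toL2 (expSP k l v)) =
      toL2 ((modeWeight m lam ((k, l, a) : ℤ × ℤ × Fin n) : ℂ)⁻¹ • expSP k l v) := by
  refine ext_inner_basis (fb n) fun κ => ?_
  rw [inner_symbJ, map_smul, inner_smul_right, fb_apply, expBasis, map_smul, inner_smul_left,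
    inner_expSP]
  by_cases h : κ.1 = k ∧ κ.2.1 = l
  · rw [if_pos h]
    have : modeWeight m lam κ = modeWeight m lam (k, l, a) := by
      unfold modeWeight; rw [h.1, h.2]
    rw [this]
  · rw [if_neg h]; simp

lemma injective_of_isHermitian {B : Mat n} (hB : B.IsHermitian) {z : ℂ} (hz : z.im ≠ 0) {v : Cn n}
    (h : z • v - act B v = 0) : v = 0 := by
  have h1 : (inner ℂ v (act B v) : ℂ) = inner ℂ (act B v) v := by rw [inner_act_left, hB.eq]
  have h2 : (inner ℂ v (act B v) : ℂ).im = 0 := by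
    have h2 := inner_conj_symm (𝕜 := ℂ) v (act B v)
    rw [← h1] at h2
    exact Complex.conj_eq_iff_im.1 h2
  have h3 : act B v = z • v := (sub_eq_zero.1 h).symm
  have h4 : (inner ℂ v v : ℂ) = ((‖v‖ ^ 2 : ℝ) : ℂ) := by
    rw [inner_self_eq_norm_sq_to_K]; norm_cast
  rw [h3, inner_smul_right, h4, Complex.mul_im, Complex.ofReal_re, Complex.ofReal_im, mul_zero,
    zero_add, mul_eq_zero, or_iff_right hz] at h2
  simpa using h2

/-- The operator acts on each Fourier mode by a matrix, namely a nonreal scalar minus a Hermitian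
matrix, which is invertible; hence all basis vectors are in the range. -/
lemma freeT_denseRange {m : ℕ} {lam : ℝ} {M₀ Mm : Mat n} (hd : IsDominant m M₀ Mm) {z : ℂ}
    (hz : z = Complex.I ∨ z = -Complex.I) :
    DenseRange (z • symbJ n m lam - freeT n m lam M₀ Mm) := by
  have h := (fb n).dense_span
  rw [← Submodule.dense_iff_topologicalClosure_eq_top] at h
  refine h.mono ?_
  have : Submodule.span ℂ (range (fb n)) ≤
      LinearMap.range ((z • symbJ n m lam - freeT n m lam M₀ Mm : L2T n →L[ℂ] L2T n) :
        L2T n →ₗ[ℂ] L2T n) := by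
    rw [Submodule.span_le]
    rintro _ ⟨⟨k, l, a⟩, rfl⟩
    set om : ℝ := modeWeight m lam ((k, l, a) : ℤ × ℤ × Fin n) with hom
    have hom0 : 0 < om := modeWeight_pos _ _ _
    set B : Mat n := ((om⁻¹ * (lam * l) ^ m : ℝ) : ℂ) • M₀ + ((om⁻¹ * (lam * k) ^ m : ℝ) : ℂ) • Mm
      with hB
    have hBh : B.IsHermitian := by
      refine Matrix.IsHermitian.add ?_ ?_
      · rw [Matrix.IsHermitian, Matrix.conjTranspose_smul, hd.herm₀.eq]; simp
      · rw [Matrix.IsHermitian, Matrix.conjTranspose_smul, hd.herm.eq]; simp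
    have hsurj : Function.Surjective
        ((z * (om⁻¹ : ℝ)) • (LinearMap.id : Cn n →ₗ[ℂ] Cn n) -
          (Matrix.toEuclideanCLM (n := Fin n) (𝕜 := ℂ) B : Cn n →ₗ[ℂ] Cn n)) := by
      rw [← LinearMap.injective_iff_surjective, ← LinearMap.ker_eq_bot, LinearMap.ker_eq_bot']
      intro v hv
      refine injective_of_isHermitian hBh (z := z * (om⁻¹ : ℝ)) ?_ hv
      rcases hz with rfl | rfl <;> simp [hom0.ne']
    obtain ⟨v, hv⟩ := hsurj (((2 * Real.pi)⁻¹ : ℂ) • EuclideanSpace.single a 1)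
    refine ⟨toL2 (expSP k l v), ?_⟩
    have hJ := symbJ_expSP m lam k l v a
    rw [← hom] at hJ
    have hG0 := symbG_of_symbJ_eq hJ (i := 0) (j := m) (by omega)
    have hGm := symbG_of_symbJ_eq hJ (i := m) (j := 0) (by omega)
    change z • symbJ n m lam _ - (matMul (fun _ => M₀) (symbG n m lam 0 m _) +
      matMul (fun _ => Mm) (symbG n m lam m 0 _)) = _
    rw [hJ, hG0, hGm, ← toL2_mulSP (IsSmoothPeriodic.const M₀),
      ← toL2_mulSP (IsSmoothPeriodic.const Mm), fb_apply, ← map_smul, ← map_add, ← map_sub]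
    congr 1
    have hexp : ∀ i j, (lx lam ^ i * ly lam ^ j : Module.End ℂ (SP n)) ((om : ℂ)⁻¹ • expSP k l v) =
        ((lam : ℂ) ^ i * (lam : ℂ) ^ j * (om : ℂ)⁻¹ * ((k : ℂ) ^ i * (l : ℂ) ^ j)) • expSP k l v :=
      fun i j => by
        rw [lx_pow_mul_ly_pow, LinearMap.smul_apply, map_smul, dx_pow_dy_pow_expSP, smul_smul,
          smul_smul]
    have hv' : (z * (om⁻¹ : ℝ)) • v - act B v =
        ((2 * Real.pi)⁻¹ : ℂ) • EuclideanSpace.single a 1 := hv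
    rw [hexp, hexp, map_smul, map_smul, mulSP_const_expSP, mulSP_const_expSP, ← expSP_smul,
      ← expSP_smul, ← expSP_smul, ← expSP_smul, ← expSP_add, ← expSP_sub, expBasis, ← expSP_smul]
    congr 1
    rw [← hv', hB, act_add, act_smul, act_smul]
    simp only [smul_smul]
    push_cast
    congr 2
    · congr 1; ring
    · congr 1; ring
  intro w hw
  obtain ⟨f, hf⟩ := this hw
  exact ⟨f, hf⟩

/-- The continuity method from the constant-coefficient operator to `T`. All operators on the
segment are symmetric and satisfy the a priori estimate with the same `C`. -/
lemma exists_inverse {m : ℕ} {lam C : ℝ} {M₀ Mm : Mat n} (hC : 0 ≤ C)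
    (hd : IsDominant m M₀ Mm) {c : ℕ → ℕ → ℝ × ℝ → Mat n}
    (hest : ∀ t : ℝ, 0 ≤ t → t ≤ 1 → ∀ w : L2T n,
      ‖w‖ ≤ C * (‖freeT n m lam M₀ Mm w + (t : ℂ) • (diffT m lam c w - freeT n m lam M₀ Mm w)‖ +
        ‖symbJ n m lam w‖))
    (hsymm : ∀ w w', inner ℂ (diffT m lam c w) (symbJ n m lam w') =
      inner ℂ (symbJ n m lam w) (diffT m lam c w'))
    {z : ℂ} (hz : z = Complex.I ∨ z = -Complex.I) :
    ∃ N : L2T n →L[ℂ] L2T n, N * (z • symbJ n m lam - diffT m lam c) = 1 ∧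
      (z • symbJ n m lam - diffT m lam c) * N = 1 ∧ ‖N‖ ≤ 2 * C := by
  set J := symbJ n m lam
  set T₀ := freeT n m lam M₀ Mm
  set T := diffT m lam c
  have hb : ∀ t : ℝ, 0 ≤ t → t ≤ 1 → ∀ w : L2T n,
      ‖w‖ ≤ 2 * C * ‖((z • J - T₀) + (t : ℂ) • (T₀ - T)) w‖ := fun t ht0 ht1 w => by
    have := norm_le_of_symm hz hC (J := J) (T := T₀ + (t : ℂ) • (T - T₀)) (fun w w' => by
      simp only [add_apply, sub_apply, smul_apply, inner_add_left, inner_add_right, inner_sub_left,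
        inner_sub_right, inner_smul_left, inner_smul_right, Complex.conj_ofReal]
      rw [freeT_symm hd, hsymm]) (fun w => hest t ht0 ht1 w) w
    have e : (z • J - T₀) + (t : ℂ) • (T₀ - T) = z • J - (T₀ + (t : ℂ) • (T - T₀)) := by module
    rw [e]
    exact this
  have h0 : IsUnit (z • J - T₀) := isUnit_of_norm_le (C := 2 * C) (by positivity)
    (fun w => by simpa using hb 0 le_rfl zero_le_one w) (freeT_denseRange hd hz)
  have h1 := isUnit_of_path (by positivity) hb h0
  rw [sub_add_sub_cancel] at h1
  obtain ⟨u, hu⟩ := h1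
  refine ⟨(↑u⁻¹ : L2T n →L[ℂ] L2T n), by rw [← hu]; exact u.inv_mul, by rw [← hu]; exact u.mul_inv, ?_⟩
  refine norm_inv_le_of_norm_le (S := z • J - T) (by positivity) (fun w => ?_)
    (by rw [← hu]; exact u.mul_inv)
  simpa using hb 1 zero_le_one le_rfl w

end Free

/-! ### Commutators with smooth functions are `O(λ)`. -/

section Commutator

variable {n : ℕ}

/-- The semiclassical Sobolev norm of order `k` of a smooth function. -/
def sobNorm (lam : ℝ) (k : ℕ) (f : SP n) : ℝ :=
  ∑ q ∈ multiIdx k, ‖toL2 ((lx lam ^ q.1 * ly lam ^ q.2 : Module.End ℂ (SP n)) f)‖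

lemma sobNorm_nonneg (lam : ℝ) (k : ℕ) (f : SP n) : 0 ≤ sobNorm lam k f :=
  Finset.sum_nonneg fun _ _ => norm_nonneg _

lemma norm_le_sobNorm (lam : ℝ) {i j k : ℕ} (h : i + j ≤ k) (f : SP n) :
    ‖toL2 ((lx lam ^ i * ly lam ^ j : Module.End ℂ (SP n)) f)‖ ≤ sobNorm lam k f := by
  have := Finset.single_le_sum (s := multiIdx k)
    (f := fun q : ℕ × ℕ => ‖toL2 ((lx lam ^ q.1 * ly lam ^ q.2 : Module.End ℂ (SP n)) f)‖)
    (fun _ _ => norm_nonneg _) (mem_multiIdx.2 h : (i, j) ∈ multiIdx k)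
  exact this

lemma sobNorm_mono (lam : ℝ) {k l : ℕ} (h : k ≤ l) (f : SP n) :
    sobNorm lam k f ≤ sobNorm lam l f :=
  Finset.sum_le_sum_of_subset_of_nonneg
    (fun _ hq => mem_multiIdx.2 ((mem_multiIdx.1 hq).trans h)) fun _ _ _ => norm_nonneg _

/-- Composition with `D` shifts the exponents injectively and raises their sum by one, so the left
sum consists of some of the terms of the right sum. -/
lemma sobNorm_comp_le {lam : ℝ} {D : Module.End ℂ (SP n)} (s : ℕ × ℕ → ℕ × ℕ)
    (hs : Function.Injective s) (hs1 : ∀ q, (s q).1 + (s q).2 = q.1 + q.2 + 1)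
    (hD : ∀ q : ℕ × ℕ, (lx lam ^ q.1 * ly lam ^ q.2 : Module.End ℂ (SP n)) * D =
      lx lam ^ (s q).1 * ly lam ^ (s q).2) (k : ℕ) (f : SP n) :
    sobNorm lam k (D f) ≤ sobNorm lam (k + 1) f := by
  unfold sobNorm
  simp only [← Module.End.mul_apply, hD]
  rw [← Finset.sum_image (f := fun q : ℕ × ℕ =>
    ‖toL2 ((lx lam ^ q.1 * ly lam ^ q.2 : Module.End ℂ (SP n)) f)‖) (g := s) hs.injOn]
  refine Finset.sum_le_sum_of_subset_of_nonneg ?_ fun _ _ _ => norm_nonneg _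
  intro q hq
  obtain ⟨q', hq', rfl⟩ := Finset.mem_image.1 hq
  rw [mem_multiIdx] at hq' ⊢
  rw [hs1]; omega

lemma sobNorm_lx_le (lam : ℝ) (k : ℕ) (f : SP n) :
    sobNorm lam k (lx lam f) ≤ sobNorm lam (k + 1) f :=
  sobNorm_comp_le (fun q => (q.1 + 1, q.2)) (fun a b h => by
    simp only [Prod.mk.injEq] at h; ext <;> omega) (fun q => by simp only; ring)
    (fun q => by
      rw [mul_assoc, ← ((lx_comm_ly lam).pow_right _).eq, ← mul_assoc, ← pow_succ]) k f

lemma sobNorm_ly_le (lam : ℝ) (k : ℕ) (f : SP n) :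
    sobNorm lam k (ly lam f) ≤ sobNorm lam (k + 1) f :=
  sobNorm_comp_le (fun q => (q.1, q.2 + 1)) (fun a b h => by
    simp only [Prod.mk.injEq] at h; ext <;> omega) (fun q => by simp only; ring)
    (fun q => by rw [mul_assoc, ← pow_succ]) k f

/-- `A` is of order `k`, and its commutators with smooth functions are `O(λ)` of order `k`. -/
def HasSmallCommutators (k : ℕ) (A : ℝ → Module.End ℂ (SP n)) : Prop :=
  (∀ lam f, ‖toL2 (A lam f)‖ ≤ sobNorm lam k f) ∧
  ∀ (c : ℝ × ℝ → Mat n) (hc : IsSmoothPeriodic c), ∃ C, 0 ≤ C ∧ ∀ lam, 0 ≤ lam → lam ≤ 1 →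
    ∀ f, ‖toL2 (A lam (mulSP c hc f)) - toL2 (mulSP c hc (A lam f))‖ ≤ lam * (C * sobNorm lam k f)

lemma exists_norm_bound {F : Type*} [NormedAddCommGroup F] [NormedSpace ℝ F] {c : ℝ × ℝ → F}
    (hc : IsSmoothPeriodic c) : ∃ C, 0 ≤ C ∧ ∀ p, ‖c p‖ ≤ C := by
  have hK : IsCompact (Icc 0 (2 * Real.pi) ×ˢ Icc 0 (2 * Real.pi)) :=
    isCompact_Icc.prod isCompact_Icc
  obtain ⟨C, hC⟩ := hK.exists_bound_of_continuousOn hc.smooth.continuous.continuousOn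
  refine ⟨max C 0, le_max_right _ _, fun p => (le_trans ?_ (le_max_left _ _))⟩
  have hx : ∀ y, Function.Periodic (fun x => c (x, y)) (2 * Real.pi) := fun y x => hc.periodic_x x y
  have hy : ∀ x, Function.Periodic (fun y => c (x, y)) (2 * Real.pi) := fun x y => hc.periodic_y x y
  obtain ⟨x', hx', ex⟩ := (hx p.2).exists_mem_Ico₀ Real.two_pi_pos p.1
  obtain ⟨y', hy', ey⟩ := (hy x').exists_mem_Ico₀ Real.two_pi_pos p.2
  have e : c p = c (x', y') := by
    rw [← ey, ← ex]
  rw [e]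
  exact hC _ ⟨Ico_subset_Icc_self hx', Ico_subset_Icc_self hy'⟩

lemma mulSP_dcoef (lam : ℝ) (w : ℝ × ℝ) {c : ℝ × ℝ → Mat n} (hc : IsSmoothPeriodic c) (f : SP n) :
    mulSP _ (hc.dcoef lam w) f = (lam : ℂ) • mulSP _ (hc.dcoef 1 w) f := by
  ext1; funext p
  change act ((-(Complex.I * lam)) • fderiv ℝ c p w) _ =
    (lam : ℂ) • act ((-(Complex.I * (1 : ℝ))) • fderiv ℝ c p w) _
  rw [act_smul, act_smul, smul_smul]
  congr 1; push_cast; ring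

/-- `[A D, c] = [A, c] D + A [D, c]`, where `[D, c] = λ c'` with `c'` smooth and independent of `λ`.
Moving `A` past `c'` again uses the hypothesis on `A`. -/
lemma HasSmallCommutators.mul {k : ℕ} {A D : ℝ → Module.End ℂ (SP n)} {w : ℝ × ℝ}
    (hA : HasSmallCommutators k A) (hA' : ∀ lam f, ‖toL2 (A lam (D lam f))‖ ≤ sobNorm lam (k + 1) f)
    (hD : ∀ lam (c : ℝ × ℝ → Mat n) (hc : IsSmoothPeriodic c) f,
      D lam (mulSP c hc f) = mulSP c hc (D lam f) + mulSP _ (hc.dcoef lam w) f)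
    (hs : ∀ lam f, sobNorm lam k (D lam f) ≤ sobNorm lam (k + 1) f) :
    HasSmallCommutators (k + 1) fun lam => A lam * D lam := by
  refine ⟨hA', fun c hc => ?_⟩
  obtain ⟨C₁, hC₁, h₁⟩ := hA.2 c hc
  obtain ⟨C₂, hC₂, h₂⟩ := hA.2 _ (hc.dcoef 1 w)
  obtain ⟨b, hb, hb'⟩ := exists_norm_bound (hc.dcoef 1 w)
  refine ⟨C₁ + (C₂ + b), by positivity, fun lam hl0 hl1 f => ?_⟩
  have e : toL2 ((A lam * D lam) (mulSP c hc f)) - toL2 (mulSP c hc ((A lam * D lam) f)) =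
      (toL2 (A lam (mulSP c hc (D lam f))) - toL2 (mulSP c hc (A lam (D lam f)))) +
      (lam : ℂ) • ((toL2 (A lam (mulSP _ (hc.dcoef 1 w) f)) -
        toL2 (mulSP _ (hc.dcoef 1 w) (A lam f))) + toL2 (mulSP _ (hc.dcoef 1 w) (A lam f))) := by
    rw [Module.End.mul_apply, Module.End.mul_apply, hD, mulSP_dcoef lam w hc]
    simp only [map_add, map_smul]
    module
  rw [e]
  have g1 := h₁ lam hl0 hl1 (D lam f)
  have g2 := h₂ lam hl0 hl1 f
  have g3 := norm_toL2_mulSP_le (hc.dcoef 1 w) hb' (A lam f)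
  have s1 := hs lam f
  have s2 := sobNorm_mono lam (Nat.le_succ k) f
  have s3 := hA.1 lam f
  have s0 := sobNorm_nonneg lam k f
  set S := sobNorm lam (k + 1) f
  have hS0 : 0 ≤ S := s0.trans s2
  have k1 : lam * (C₁ * sobNorm lam k (D lam f)) ≤ lam * (C₁ * S) := by gcongr
  have k2 : lam * (C₂ * sobNorm lam k f) ≤ C₂ * S :=
    calc lam * (C₂ * sobNorm lam k f) ≤ 1 * (C₂ * sobNorm lam k f) := by gcongr
      _ = C₂ * sobNorm lam k f := one_mul _
      _ ≤ C₂ * S := by gcongr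
  have k3 : b * ‖toL2 (A lam f)‖ ≤ b * S := by gcongr; exact s3.trans s2
  refine (norm_add_le _ _).trans ?_
  rw [norm_smul, Complex.norm_real, Real.norm_eq_abs, abs_of_nonneg hl0]
  have k4 := (norm_add_le (toL2 (A lam (mulSP _ (hc.dcoef 1 w) f)) -
        toL2 (mulSP _ (hc.dcoef 1 w) (A lam f))) (toL2 (mulSP _ (hc.dcoef 1 w) (A lam f)))).trans
    (add_le_add (g2.trans k2) (g3.trans k3))
  have k5 := mul_le_mul_of_nonneg_left k4 hl0
  calc _ ≤ lam * (C₁ * S) + lam * (C₂ * S + b * S) := add_le_add (g1.trans k1) k5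
    _ = _ := by ring

lemma hasSmallCommutators (i j : ℕ) : HasSmallCommutators (n := n) (i + j)
    fun lam => lx lam ^ i * ly lam ^ j := by
  induction i with
  | zero =>
    induction j with
    | zero =>
      refine ⟨fun lam f => norm_le_sobNorm lam (by omega) f, fun c hc => ⟨0, le_rfl, ?_⟩⟩
      intro lam _ _ f
      simp
    | succ j ih =>
      have := ih.mul (D := ly) (w := (0, 1)) (fun lam f => ?_) (fun lam c hc f => ly_mulSP lam hc f)
        (fun lam f => sobNorm_ly_le lam _ f)
      · rw [← add_assoc]
        have e : (fun lam => lx lam ^ 0 * ly lam ^ (j + 1) : ℝ → Module.End ℂ (SP n)) =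
            fun lam => lx lam ^ 0 * ly lam ^ j * ly lam := funext fun lam => by
          rw [mul_assoc, ← pow_succ]
        rw [e]
        exact this
      · rw [← Module.End.mul_apply, mul_assoc, ← pow_succ]
        exact norm_le_sobNorm lam (by omega) f
  | succ i ih =>
    have hc : ∀ lam : ℝ, (lx lam ^ i * ly lam ^ j : Module.End ℂ (SP n)) * lx lam =
        lx lam ^ (i + 1) * ly lam ^ j := fun lam => by
      rw [mul_assoc, ← ((lx_comm_ly lam).pow_right _).eq, ← mul_assoc, ← pow_succ]
    have := ih.mul (D := lx) (w := (1, 0)) (fun lam f => ?_) (fun lam c hc f => lx_mulSP lam hc f)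
      (fun lam f => sobNorm_lx_le lam _ f)
    · rw [show i + 1 + j = i + j + 1 by ring]
      simp only [hc] at this
      exact this
    · rw [← Module.End.mul_apply, hc]
      exact norm_le_sobNorm lam (by omega) f

/-- The preimage under `J` of a smooth function. -/
def lift (m : ℕ) (lam : ℝ) : SP n →ₗ[ℂ] L2T n where
  toFun f := (exists_symbJ_eq_toL2 m lam f).choose
  map_add' f g := by
    rw [← sub_eq_zero]
    refine symbJ_injective m lam ?_
    rw [map_sub, sub_eq_zero]
    refine (exists_symbJ_eq_toL2 m lam (f + g)).choose_spec.1.trans ?_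
    rw [map_add, map_add, (exists_symbJ_eq_toL2 m lam f).choose_spec.1,
      (exists_symbJ_eq_toL2 m lam g).choose_spec.1]
  map_smul' r f := by
    rw [← sub_eq_zero]
    refine symbJ_injective m lam ?_
    rw [map_sub, sub_eq_zero]
    refine (exists_symbJ_eq_toL2 m lam (r • f)).choose_spec.1.trans ?_
    rw [RingHom.id_apply, map_smul, map_smul, (exists_symbJ_eq_toL2 m lam f).choose_spec.1]

lemma symbJ_lift (m : ℕ) (lam : ℝ) (f : SP n) : symbJ n m lam (lift m lam f) = toL2 f :=
  (exists_symbJ_eq_toL2 m lam f).choose_spec.1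

lemma norm_lift_le {m : ℕ} {lam : ℝ} (f : SP n) : ‖lift m lam f‖ ≤ 3 * sobNorm lam m f := by
  have h := (exists_symbJ_eq_toL2 m lam f).choose_spec.2
  have h0 := norm_le_sobNorm lam (by omega : 0 + 0 ≤ m) f
  have h1 := norm_le_sobNorm lam (by omega : m + 0 ≤ m) f
  have h2 := norm_le_sobNorm lam (by omega : 0 + m ≤ m) f
  have h3 : toL2 ((lx lam ^ 0 * ly lam ^ 0 : Module.End ℂ (SP n)) f) = toL2 f := by simp
  rw [h3] at h0
  refine h.trans ?_
  linarith

lemma symbG_lift {m : ℕ} (lam : ℝ) {i j : ℕ} (hij : i + j ≤ m) (f : SP n) :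
    symbG n m lam i j (lift m lam f) =
      toL2 ((lx lam ^ i * ly lam ^ j : Module.End ℂ (SP n)) f) :=
  symbG_of_symbJ_eq (symbJ_lift m lam f) hij

/-- With `norm_lift_le`, this makes `‖J⁻¹ f‖` equivalent to the semiclassical Sobolev norm, with
constants independent of `λ`. -/
lemma sobNorm_le_norm_lift (m : ℕ) (lam : ℝ) (f : SP n) :
    sobNorm lam m f ≤ Finset.card (multiIdx m) * ‖lift m lam f‖ := by
  rw [← nsmul_eq_mul, ← Finset.sum_const]
  refine Finset.sum_le_sum fun q hq => ?_
  rw [← symbG_lift lam (mem_multiIdx.1 hq)]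
  exact norm_symbG_apply_le lam (mem_multiIdx.1 hq) _

lemma denseRange_lift (m : ℕ) (lam : ℝ) : DenseRange (lift (n := n) m lam) := by
  refine (dense_symbJ_smooth m lam).mono ?_
  rintro w ⟨f, hf⟩
  refine ⟨f, ?_⟩
  rw [← sub_eq_zero]
  refine symbJ_injective m lam ?_
  rw [map_sub, symbJ_lift, hf, sub_self]

lemma eq_of_eq_lift {m : ℕ} {lam : ℝ} {S T : L2T n →L[ℂ] L2T n}
    (h : ∀ f, S (lift m lam f) = T (lift m lam f)) : S = T :=
  ContinuousLinearMap.ext fun w => (denseRange_lift m lam).induction_on w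
    (isClosed_eq S.continuous T.continuous) h

lemma opNorm_le_of_lift {m : ℕ} {lam : ℝ} {S : L2T n →L[ℂ] L2T n} {C : ℝ} (hC : 0 ≤ C)
    (h : ∀ f, ‖S (lift m lam f)‖ ≤ C * ‖lift m lam f‖) : ‖S‖ ≤ C :=
  S.opNorm_le_bound hC fun w => (denseRange_lift m lam).induction_on
    (p := fun w => ‖S w‖ ≤ C * ‖w‖) w (isClosed_le (by fun_prop) (by fun_prop)) h

/-- The operator `K` with `c J = J K`. -/
def intertwiner (m : ℕ) (lam : ℝ) (c : ℝ × ℝ → Mat n) (hc : IsSmoothPeriodic c) :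
    L2T n →L[ℂ] L2T n :=
  (lift m lam ∘ₗ mulSP c hc).extendOfNorm (lift m lam)

lemma exists_norm_mulSP_le (m : ℕ) {c : ℝ × ℝ → Mat n} (hc : IsSmoothPeriodic c) :
    ∃ C, 0 ≤ C ∧ ∀ lam, 0 ≤ lam → lam ≤ 1 → ∀ q ∈ multiIdx m, ∀ f,
      ‖toL2 ((lx lam ^ q.1 * ly lam ^ q.2 : Module.End ℂ (SP n)) (mulSP c hc f)) -
        toL2 (mulSP c hc ((lx lam ^ q.1 * ly lam ^ q.2 : Module.End ℂ (SP n)) f))‖ ≤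
          lam * (C * ‖lift m lam f‖) := by
  choose C hC h using fun q : ℕ × ℕ => (hasSmallCommutators (n := n) q.1 q.2).2 c hc
  refine ⟨(∑ q ∈ multiIdx m, C q) * Finset.card (multiIdx m), mul_nonneg
    (Finset.sum_nonneg fun q _ => hC q) (Nat.cast_nonneg _), fun lam h0 h1 q hq f => ?_⟩
  refine (h q lam h0 h1 f).trans ?_
  have e1 : C q ≤ ∑ q ∈ multiIdx m, C q := Finset.single_le_sum (fun q _ => hC q) hq
  have e2 := (sobNorm_mono lam (mem_multiIdx.1 hq) f).trans (sobNorm_le_norm_lift m lam f)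
  have := (hC q).trans e1
  rw [mul_assoc (∑ q ∈ multiIdx m, C q)]
  have e3 := sobNorm_nonneg lam (q.1 + q.2) f
  gcongr

/-- Multiplication by a fixed smooth function is bounded on the Sobolev space uniformly in `λ`; this
is what lets `intertwiner` extend by density. -/
lemma exists_norm_lift_mulSP_le (m : ℕ) {c : ℝ × ℝ → Mat n} (hc : IsSmoothPeriodic c) :
    ∃ C, 0 ≤ C ∧ ∀ lam, 0 ≤ lam → lam ≤ 1 → ∀ f,
      ‖lift m lam (mulSP c hc f)‖ ≤ C * ‖lift m lam f‖ := by
  obtain ⟨C, hC, h⟩ := exists_norm_mulSP_le m hc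
  obtain ⟨b, hb, hb'⟩ := exists_norm_bound hc
  refine ⟨3 * (Finset.card (multiIdx m) * (C + b)), by positivity, fun lam h0 h1 f => ?_⟩
  refine (norm_lift_le _).trans ?_
  rw [mul_assoc 3, mul_assoc (Finset.card (multiIdx m) : ℝ)]
  refine mul_le_mul_of_nonneg_left ?_ (by norm_num)
  rw [← nsmul_eq_mul, ← Finset.sum_const]
  refine Finset.sum_le_sum fun q hq => ?_
  have e1 := h lam h0 h1 q hq f
  have e2 := norm_toL2_mulSP_le hc hb' ((lx lam ^ q.1 * ly lam ^ q.2 : Module.End ℂ (SP n)) f)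
  rw [← symbG_lift lam (mem_multiIdx.1 hq)] at e2
  have e3 := mul_le_mul_of_nonneg_left (norm_symbG_apply_le lam (mem_multiIdx.1 hq)
    (lift m lam f)) hb
  have e4 : lam * (C * ‖lift m lam f‖) ≤ 1 * (C * ‖lift m lam f‖) := by gcongr
  have e5 := norm_le_norm_add_norm_sub'
    (toL2 ((lx lam ^ q.1 * ly lam ^ q.2 : Module.End ℂ (SP n)) (mulSP c hc f)))
    (toL2 (mulSP c hc ((lx lam ^ q.1 * ly lam ^ q.2 : Module.End ℂ (SP n)) f)))
  linarith

lemma intertwiner_lift (m : ℕ) {lam : ℝ} (h0 : 0 ≤ lam) (h1 : lam ≤ 1) {c : ℝ × ℝ → Mat n}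
    (hc : IsSmoothPeriodic c) (f : SP n) :
    intertwiner m lam c hc (lift m lam f) = lift m lam (mulSP c hc f) := by
  obtain ⟨C, -, h⟩ := exists_norm_lift_mulSP_le m hc
  exact LinearMap.extendOfNorm_eq (denseRange_lift m lam) ⟨C, h lam h0 h1⟩ f

lemma matMul_mul_symbJ (m : ℕ) {lam : ℝ} (h0 : 0 ≤ lam) (h1 : lam ≤ 1) {c : ℝ × ℝ → Mat n}
    (hc : IsSmoothPeriodic c) :
    matMul c * symbJ n m lam = symbJ n m lam * intertwiner m lam c hc := by
  refine eq_of_eq_lift (m := m) (lam := lam) fun f => ?_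
  change matMul c (symbJ n m lam _) = symbJ n m lam (intertwiner m lam c hc _)
  rw [intertwiner_lift m h0 h1, symbJ_lift, symbJ_lift, toL2_mulSP]

/-- The differential expression applied to a smooth function. -/
def diffSP (m : ℕ) (lam : ℝ) (c : ℕ → ℕ → ℝ × ℝ → Mat n) (f : SP n) : ℝ × ℝ → Cn n :=
  fun p => ∑ q ∈ multiIdx m, act (c q.1 q.2 p)
    (((lx lam ^ q.1 * ly lam ^ q.2 : Module.End ℂ (SP n)) f : ℝ × ℝ → Cn n) p)

lemma diffT_lift {m : ℕ} {lam : ℝ} {c : ℕ → ℕ → ℝ × ℝ → Mat n}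
    (hc : ∀ q ∈ multiIdx m, Continuous (c q.1 q.2)) (f : SP n) :
    ∀ᵐ p ∂torusMeasure, diffT m lam c (lift m lam f) p = diffSP m lam c f p := by
  have hall := (Finset.eventually_all (multiIdx m) (l := ae torusMeasure)
    (p := fun q p => toL2 ((lx lam ^ q.1 * ly lam ^ q.2 : Module.End ℂ (SP n)) f) p =
      ((lx lam ^ q.1 * ly lam ^ q.2 : Module.End ℂ (SP n)) f : ℝ × ℝ → Cn n) p)).2
    fun q _ => coeFn_toL2 _
  filter_upwards [diffT_apply hc (lift m lam f), hall] with p h1 h2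
  rw [h1]
  refine Finset.sum_congr rfl fun q hq => ?_
  rw [symbG_lift lam (mem_multiIdx.1 hq), h2 q hq]

/-- As `c` commutes with the coefficients pointwise, derivatives fall only on `c`. The constant
depends on the coefficients `a` through their sup norm alone, which is all that is known about the
perturbation uniformly in `λ`. -/
lemma exists_norm_commutator_le (m : ℕ) {c : ℝ × ℝ → Mat n} (hc : IsSmoothPeriodic c) {Γ : ℝ}
    (hΓ : 0 ≤ Γ) : ∃ C, 0 ≤ C ∧ ∀ lam, 0 ≤ lam → lam ≤ 1 → ∀ a : ℕ → ℕ → ℝ × ℝ → Mat n,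
      (∀ q ∈ multiIdx m, Continuous (a q.1 q.2)) → (∀ q ∈ multiIdx m, ∀ p, ‖a q.1 q.2 p‖ ≤ Γ) →
      (∀ q ∈ multiIdx m, ∀ p, Commute (c p) (a q.1 q.2 p)) →
      ‖diffT m lam a * intertwiner m lam c hc - matMul c * diffT m lam a‖ ≤ C * lam := by
  obtain ⟨C, hC, h⟩ := exists_norm_mulSP_le m hc
  refine ⟨Finset.card (multiIdx m) * (Γ * C), by positivity, fun lam h0 h1 a ha haΓ hcomm => ?_⟩
  refine opNorm_le_of_lift (m := m) (lam := lam) (by positivity) fun f => ?_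
  have e : (diffT m lam a * intertwiner m lam c hc - matMul c * diffT m lam a) (lift m lam f) =
      ∑ q ∈ multiIdx m, matMul (a q.1 q.2)
        (toL2 ((lx lam ^ q.1 * ly lam ^ q.2 : Module.End ℂ (SP n)) (mulSP c hc f)) -
        toL2 (mulSP c hc ((lx lam ^ q.1 * ly lam ^ q.2 : Module.End ℂ (SP n)) f))) := by
    have e1 : ∀ w, diffT m lam a w =
        ∑ q ∈ multiIdx m, matMul (a q.1 q.2) (symbG n m lam q.1 q.2 w) := fun w => by
      simp [diffT]
    change diffT m lam a (intertwiner m lam c hc _) - matMul c (diffT m lam a _) = _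
    rw [intertwiner_lift m h0 h1, e1, e1, map_sum, ← Finset.sum_sub_distrib]
    refine Finset.sum_congr rfl fun q hq => ?_
    rw [symbG_lift lam (mem_multiIdx.1 hq), symbG_lift lam (mem_multiIdx.1 hq), map_sub]
    congr 1
    rw [toL2_mulSP]
    refine Lp.ext ?_
    set u := toL2 ((lx lam ^ q.1 * ly lam ^ q.2 : Module.End ℂ (SP n)) f)
    filter_upwards [matMul_apply hc.smooth.continuous (matMul (a q.1 q.2) u),
      matMul_apply (ha q hq) u, matMul_apply (ha q hq) (matMul c u),
      matMul_apply hc.smooth.continuous u] with p g1 g2 g3 g4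
    rw [g1, g2, g3, g4, ← act_mul, ← act_mul, (hcomm q hq p).eq]
  rw [e, mul_assoc (Finset.card (multiIdx m) : ℝ), mul_assoc (Finset.card (multiIdx m) : ℝ),
    ← nsmul_eq_mul, ← Finset.sum_const]
  refine (norm_sum_le _ _).trans (Finset.sum_le_sum fun q hq => ?_)
  refine (norm_matMul_apply_le (ha q hq) (haΓ q hq) _).trans ?_
  refine (mul_le_mul_of_nonneg_left (h lam h0 h1 q hq f) hΓ).trans (le_of_eq ?_)
  ring

end Commutator

/-! ### Locality of differential operators and supports of commutators. -/

section Locality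

open Filter Topology

variable {n : ℕ}

/-- A real function as a function with values in the scalar matrices. -/
def scal (n : ℕ) (χ : ℝ × ℝ → ℝ) (p : ℝ × ℝ) : Mat n := (χ p : ℂ) • (1 : Mat n)

lemma act_scal (χ : ℝ × ℝ → ℝ) (p : ℝ × ℝ) (w : Cn n) : act (scal n χ p) w = (χ p : ℂ) • w := by
  rw [scal, act_smul, act_one]

lemma scal_commute (χ : ℝ × ℝ → ℝ) (p : ℝ × ℝ) (A : Mat n) : Commute (scal n χ p) A :=
  (Commute.one_left A).smul_left _

lemma IsSmoothPeriodic.scal {χ : ℝ × ℝ → ℝ} (h : IsSmoothPeriodic χ) :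
    IsSmoothPeriodic (scal n χ) := by
  refine ⟨?_, fun x y => ?_, fun x y => ?_⟩
  · exact (Complex.ofRealCLM.contDiff.comp h.smooth).smul contDiff_const
  · unfold PeriodicConductivity.scal; rw [h.periodic_x]
  · unfold PeriodicConductivity.scal; rw [h.periodic_y]

lemma mulOp_eq_matMul {χ : ℝ × ℝ → ℝ} (h : IsSmoothPeriodic χ) :
    (mulOp χ : L2T n →L[ℂ] L2T n) = matMul (scal n χ) := by
  refine ContinuousLinearMap.ext fun u => Lp.ext ?_
  filter_upwards [mulOp_apply (n := n) h.smooth.continuous u,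
    matMul_apply (n := n) h.scal.smooth.continuous u] with p h1 h2
  rw [h1, h2, act_scal]

lemma Dx_congr {f g : ℝ × ℝ → Cn n} {p : ℝ × ℝ} (h : f =ᶠ[𝓝 p] g) : Dx f =ᶠ[𝓝 p] Dx g := by
  filter_upwards [h.fderiv (𝕜 := ℝ)] with q hq
  unfold Dx; rw [hq]

lemma Dy_congr {f g : ℝ × ℝ → Cn n} {p : ℝ × ℝ} (h : f =ᶠ[𝓝 p] g) : Dy f =ᶠ[𝓝 p] Dy g := by
  filter_upwards [h.fderiv (𝕜 := ℝ)] with q hq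
  unfold Dy; rw [hq]

lemma DD_congr (i j : ℕ) {f g : ℝ × ℝ → Cn n} {p : ℝ × ℝ} (h : f =ᶠ[𝓝 p] g) :
    DD i j f =ᶠ[𝓝 p] DD i j g := by
  have hy : Dy^[j] f =ᶠ[𝓝 p] Dy^[j] g := by
    induction j with
    | zero => exact h
    | succ j ih => rw [Function.iterate_succ_apply', Function.iterate_succ_apply']; exact Dy_congr ih
  unfold DD
  induction i with
  | zero => exact hy
  | succ i ih => rw [Function.iterate_succ_apply', Function.iterate_succ_apply']; exact Dx_congr ih

lemma coe_lx_ly (lam : ℝ) (i j : ℕ) (f : SP n) :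
    ((lx lam ^ i * ly lam ^ j : Module.End ℂ (SP n)) f : ℝ × ℝ → Cn n) =
      ((lam : ℂ) ^ i * (lam : ℂ) ^ j) • DD i j f := by
  rw [lx_pow_mul_ly_pow, ← coe_dx_pow_dy_pow]; rfl

lemma diffSP_congr {m : ℕ} {lam : ℝ} {c : ℕ → ℕ → ℝ × ℝ → Mat n} {f g : SP n} {p : ℝ × ℝ}
    (h : (f : ℝ × ℝ → Cn n) =ᶠ[𝓝 p] g) : diffSP m lam c f p = diffSP m lam c g p := by
  refine Finset.sum_congr rfl fun q _ => ?_
  rw [coe_lx_ly, coe_lx_ly, Pi.smul_apply, Pi.smul_apply, (DD_congr q.1 q.2 h).eq_of_nhds]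

lemma diffSP_zero {m : ℕ} {lam : ℝ} {c : ℕ → ℕ → ℝ × ℝ → Mat n} (p : ℝ × ℝ) :
    diffSP m lam c 0 p = 0 := by
  refine Finset.sum_eq_zero fun q _ => ?_
  rw [map_zero]
  exact map_zero (actL (c q.1 q.2 p))

lemma diffSP_smul {m : ℕ} {lam : ℝ} {c : ℕ → ℕ → ℝ × ℝ → Mat n} (r : ℂ) (f : SP n) (p : ℝ × ℝ) :
    diffSP m lam c (r • f) p = r • diffSP m lam c f p := by
  unfold diffSP
  rw [Finset.smul_sum]
  refine Finset.sum_congr rfl fun q _ => ?_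
  rw [map_smul]
  exact map_smul (actL (c q.1 q.2 p)) r _

lemma diffSP_eq_zero_of_eventuallyEq {m : ℕ} {lam : ℝ} {c : ℕ → ℕ → ℝ × ℝ → Mat n} {f : SP n}
    {p : ℝ × ℝ} (h : ∀ᶠ q in 𝓝 p, (f : ℝ × ℝ → Cn n) q = 0) : diffSP m lam c f p = 0 :=
  (diffSP_congr (g := 0) h).trans (diffSP_zero p)

/-- `(1 - Q) [A, P]` on the domain of `A`. -/
def edgeOp (m : ℕ) (lam : ℝ) (c : ℕ → ℕ → ℝ × ℝ → Mat n) (P Q : ℝ × ℝ → ℝ)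
    (hP : IsSmoothPeriodic P) : L2T n →L[ℂ] L2T n :=
  (1 - mulOp Q) * (diffT m lam c * intertwiner m lam (scal n P) hP.scal - mulOp P * diffT m lam c)

variable {m : ℕ} {lam : ℝ}

lemma edgeOp_lift (h0 : 0 ≤ lam) (h1 : lam ≤ 1) {c : ℕ → ℕ → ℝ × ℝ → Mat n}
    (hc : ∀ q ∈ multiIdx m, Continuous (c q.1 q.2)) {P Q : ℝ × ℝ → ℝ}
    (hP : IsSmoothPeriodic P) (hQ : IsSmoothPeriodic Q) (f : SP n) :
    ∀ᵐ p ∂torusMeasure, edgeOp m lam c P Q hP (lift m lam f) p =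
      (1 - (Q p : ℂ)) • (diffSP m lam c (mulSP (scal n P) hP.scal f) p -
        (P p : ℂ) • diffSP m lam c f p) := by
  set T := diffT m lam c
  have e : edgeOp m lam c P Q hP (lift m lam f) =
      (T (lift m lam (mulSP (scal n P) hP.scal f)) - mulOp P (T (lift m lam f))) -
      mulOp Q (T (lift m lam (mulSP (scal n P) hP.scal f)) - mulOp P (T (lift m lam f))) := by
    rw [← intertwiner_lift m h0 h1]; rfl
  rw [e]
  set a := T (lift m lam (mulSP (scal n P) hP.scal f))
  set b := T (lift m lam f)
  filter_upwards [Lp.coeFn_sub (a - mulOp P b) (mulOp Q (a - mulOp P b)),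
    Lp.coeFn_sub a (mulOp P b), mulOp_apply hQ.smooth.continuous (a - mulOp P b),
    mulOp_apply hP.smooth.continuous b, diffT_lift hc (mulSP (scal n P) hP.scal f),
    diffT_lift hc f] with p g1 g2 g3 g4 g5 g6
  rw [g1, Pi.sub_apply, g3, g2, Pi.sub_apply, g4]
  change a p = _ at g5
  change b p = _ at g6
  rw [g5, g6, sub_smul, one_smul]

/-- On `g = (χ' - 1) f`, which vanishes near every point where `χ` is nonzero, both `A χ` and `χ A`
give zero. This links consecutive cutoffs of a chain. -/
lemma commutator_mul_intertwiner (h0 : 0 ≤ lam) (h1 : lam ≤ 1) {c : ℕ → ℕ → ℝ × ℝ → Mat n}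
    (hc : ∀ q ∈ multiIdx m, Continuous (c q.1 q.2)) {χ χ' : ℝ × ℝ → ℝ}
    (hχ : IsSmoothPeriodic χ) (hχ' : IsSmoothPeriodic χ')
    (h : ∀ p, χ p ≠ 0 → ∀ᶠ q in 𝓝 p, χ' q = 1) :
    (diffT m lam c * intertwiner m lam (scal n χ) hχ.scal - mulOp χ * diffT m lam c) *
      intertwiner m lam (scal n χ') hχ'.scal =
    diffT m lam c * intertwiner m lam (scal n χ) hχ.scal - mulOp χ * diffT m lam c := by
  refine eq_of_eq_lift (m := m) (lam := lam) fun f => ?_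
  rw [mul_apply_eq_comp, intertwiner_lift m h0 h1, ← sub_eq_zero, ← map_sub, ← map_sub]
  set g := mulSP (scal n χ') hχ'.scal f - f with hg
  have hg0 : ∀ p, χ' p = 1 → (g : ℝ × ℝ → Cn n) p = 0 := fun p hp => by
    change act (scal n χ' p) _ - _ = 0
    rw [act_scal, hp, Complex.ofReal_one, one_smul, sub_self]
  change diffT m lam c (intertwiner m lam (scal n χ) hχ.scal (lift m lam g)) -
    mulOp χ (diffT m lam c (lift m lam g)) = 0
  have e1 : mulSP (scal n χ) hχ.scal g = 0 := by
    ext1; funext p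
    rw [coe_mulSP, act_scal]
    by_cases hp : χ p = 0
    · rw [hp]; simp
    · rw [hg0 p (h p hp).self_of_nhds]; simp
  rw [intertwiner_lift m h0 h1, e1, map_zero, map_zero, zero_sub, neg_eq_zero]
  refine Lp.ext ?_
  filter_upwards [mulOp_apply hχ.smooth.continuous (diffT m lam c (lift m lam g)),
    diffT_lift hc g, Lp.coeFn_zero (Cn n) 2 torusMeasure] with p g1 g2 g3
  rw [g1, g2, g3]
  by_cases hp : χ p = 0
  · rw [hp]; simp
  · rw [diffSP_eq_zero_of_eventuallyEq ((h p hp).mono fun q hq => hg0 q hq)]; simp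

lemma diffSP_mul_of_locally_const {c : ℕ → ℕ → ℝ × ℝ → Mat n} {P : ℝ × ℝ → ℝ}
    (hP : IsSmoothPeriodic P) {p : ℝ × ℝ} (h : ∀ᶠ q in 𝓝 p, P q = P p) (f : SP n) :
    diffSP m lam c (mulSP (scal n P) hP.scal f) p - (P p : ℂ) • diffSP m lam c f p = 0 := by
  rw [sub_eq_zero, ← diffSP_smul]
  refine diffSP_congr ?_
  filter_upwards [h] with q hq
  rw [coe_mulSP, act_scal, hq]
  rfl

/-- Pointwise, `(1 - Q) [A, P] g` vanishes where `Q = 1`, where `P` is locally constant, and where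
`g` vanishes nearby. -/
lemma edgeOp_mul_intertwiner (h0 : 0 ≤ lam) (h1 : lam ≤ 1) {c : ℕ → ℕ → ℝ × ℝ → Mat n}
    (hc : ∀ q ∈ multiIdx m, Continuous (c q.1 q.2)) {P Q χ : ℝ × ℝ → ℝ}
    (hP : IsSmoothPeriodic P) (hQ : IsSmoothPeriodic Q) (hχ : IsSmoothPeriodic χ)
    (h : ∀ p ∈ cell, Q p = 1 ∨ (∀ᶠ q in 𝓝 p, P q = P p) ∨ ∀ᶠ q in 𝓝 p, χ q = 1) :
    edgeOp m lam c P Q hP * intertwiner m lam (scal n χ) hχ.scal = edgeOp m lam c P Q hP := by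
  refine eq_of_eq_lift (m := m) (lam := lam) fun f => ?_
  rw [mul_apply_eq_comp, intertwiner_lift m h0 h1, ← sub_eq_zero, ← map_sub, ← map_sub]
  set g := mulSP (scal n χ) hχ.scal f - f with hg
  have hg0 : ∀ p, χ p = 1 → (g : ℝ × ℝ → Cn n) p = 0 := fun p hp => by
    change act (scal n χ p) _ - _ = 0
    rw [act_scal, hp, Complex.ofReal_one, one_smul, sub_self]
  refine Lp.ext ?_
  filter_upwards [edgeOp_lift h0 h1 hc hP hQ g, Lp.coeFn_zero (Cn n) 2 torusMeasure,
    ae_restrict_mem measurableSet_cell] with p g1 g2 hp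
  rw [g1, g2]
  rcases h p hp with h | h | h
  · rw [h]; simp
  · rw [diffSP_mul_of_locally_const hP h, smul_zero]; rfl
  · have hg' : ∀ᶠ q in 𝓝 p, (g : ℝ × ℝ → Cn n) q = 0 := h.mono fun q hq => hg0 q hq
    rw [diffSP_eq_zero_of_eventuallyEq hg', diffSP_eq_zero_of_eventuallyEq]
    · simp
    · filter_upwards [hg'] with q hq
      rw [coe_mulSP, hq, act_scal, smul_zero]

/-- Only the coefficients on the support of `(1 - Q) P'` enter; hence the perturbation does not
change this operator. -/
lemma edgeOp_congr (h0 : 0 ≤ lam) (h1 : lam ≤ 1) {c c' : ℕ → ℕ → ℝ × ℝ → Mat n}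
    (hc : ∀ q ∈ multiIdx m, Continuous (c q.1 q.2))
    (hc' : ∀ q ∈ multiIdx m, Continuous (c' q.1 q.2)) {P Q : ℝ × ℝ → ℝ}
    (hP : IsSmoothPeriodic P) (hQ : IsSmoothPeriodic Q)
    (h : ∀ p ∈ cell, Q p = 1 ∨ (∀ᶠ q in 𝓝 p, P q = P p) ∨
      ∀ q ∈ multiIdx m, c q.1 q.2 p = c' q.1 q.2 p) :
    edgeOp m lam c P Q hP = edgeOp m lam c' P Q hP := by
  refine eq_of_eq_lift (m := m) (lam := lam) fun f => Lp.ext ?_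
  filter_upwards [edgeOp_lift h0 h1 hc hP hQ f, edgeOp_lift h0 h1 hc' hP hQ f,
    ae_restrict_mem measurableSet_cell] with p g1 g2 hp
  rw [g1, g2]
  rcases h p hp with h | h | h
  · rw [h]; simp
  · rw [diffSP_mul_of_locally_const hP h, diffSP_mul_of_locally_const hP h]
  · have e : ∀ f : SP n, diffSP m lam c f p = diffSP m lam c' f p := fun f =>
      Finset.sum_congr rfl fun q hq => by rw [h q hq]
    rw [e, e]

lemma mulOp_mul_diffT_sub {c c' : ℕ → ℕ → ℝ × ℝ → Mat n}
    (hc : ∀ q ∈ multiIdx m, Continuous (c q.1 q.2))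
    (hc' : ∀ q ∈ multiIdx m, Continuous (c' q.1 q.2)) {χ : ℝ × ℝ → ℝ}
    (hχ : IsSmoothPeriodic χ)
    (h : ∀ p ∈ cell, χ p = 0 ∨ ∀ q ∈ multiIdx m, c q.1 q.2 p = c' q.1 q.2 p) :
    mulOp χ * (diffT m lam c - diffT m lam c') = 0 := by
  refine ContinuousLinearMap.ext fun w => Lp.ext ?_
  change mulOp χ (diffT m lam c w - diffT m lam c' w) =ᵐ[torusMeasure] (0 : L2T n)
  filter_upwards [mulOp_apply hχ.smooth.continuous (diffT m lam c w - diffT m lam c' w),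
    Lp.coeFn_sub (diffT m lam c w) (diffT m lam c' w), diffT_apply hc w, diffT_apply hc' w,
    ae_restrict_mem measurableSet_cell, Lp.coeFn_zero (Cn n) 2 torusMeasure]
    with p g1 g2 g3 g4 hp g6
  rw [g1, g2, Pi.sub_apply, g3, g4, g6]
  rcases h p hp with h | h
  · rw [h]; simp
  · rw [Finset.sum_congr rfl fun q hq => by rw [h q hq], sub_self, smul_zero]; rfl

end Locality

/-! ### Counting the Fourier modes of bounded semiclassical frequency. -/

section LowModes

lemma exists_low_modes (n : ℕ) {m : ℕ} (hm : 1 ≤ m) {lam Λ : ℝ} (hl0 : 0 < lam) (hl1 : lam ≤ 1)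
    (hΛ : 1 ≤ Λ) : ∃ (ι : Type) (_ : Fintype ι) (ev : L2T n →ₗ[ℂ] (ι → ℂ)),
      (∀ w, ev w = 0 → ‖symbJ n m lam w‖ ≤ Λ⁻¹ * ‖w‖) ∧
      (Fintype.card ι : ℝ) ≤ n * ((2 * Λ + 1) / lam) ^ 2 := by
  set K : ℤ := ⌊Λ / lam⌋ with hK
  have hK0 : 0 ≤ K := Int.floor_nonneg.2 (by positivity)
  -- A weight at most `Λ` with `Λ ≥ 1` forces `|λk|, |λl| ≤ Λ`. The square of such modes has side
  -- `2K + 1 ≤ (2Λ + 1) / λ` because `λ ≤ 1`.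
  refine ⟨Finset.Icc (-K) K × Finset.Icc (-K) K × Fin n, inferInstance,
    { toFun := fun w i => inner ℂ (fb n ((i.1 : ℤ), (i.2.1 : ℤ), i.2.2)) w
      map_add' := fun u v => funext fun i => inner_add_right _ _ _
      map_smul' := fun r u => funext fun i => inner_smul_right _ _ _ }, fun w hw => ?_, ?_⟩
  · refine norm_symbJ_le_of_low_modes m lam (by linarith) fun κ hκ => ?_
    have key : ∀ k : ℤ, |lam * k| ^ m ≤ Λ → k ∈ Finset.Icc (-K) K := fun k hk => by
      have h1 : |lam * k| ≤ Λ := by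
        by_contra! hc
        have : |lam * k| ≤ |lam * k| ^ m := le_self_pow₀ (by linarith) (by omega)
        linarith
      rw [abs_mul, abs_of_pos hl0, mul_comm, ← le_div_iff₀ hl0] at h1
      rw [Finset.mem_Icc, ← abs_le, hK, Int.le_floor]
      exact_mod_cast h1
    unfold modeWeight at hκ
    have h1 := key κ.1 (by have : 0 ≤ |lam * κ.2.1| ^ m := by positivity
                           linarith)
    have h2 := key κ.2.1 (by have : 0 ≤ |lam * κ.1| ^ m := by positivity
                             linarith)
    exact congrFun hw (⟨κ.1, h1⟩, ⟨κ.2.1, h2⟩, κ.2.2)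
  · have hc : ((Finset.Icc (-K) K).card : ℝ) ≤ (2 * Λ + 1) / lam := by
      rw [Int.card_Icc]
      have e : (((K + 1 - -K).toNat : ℕ) : ℝ) = 2 * K + 1 := by
        have : (((K + 1 - -K).toNat : ℤ) : ℝ) = ((K + 1 - -K : ℤ) : ℝ) := by
          rw [Int.toNat_of_nonneg (by omega)]
        push_cast at this
        rw [this]; ring
      rw [e, add_div]
      have h1 : (K : ℝ) ≤ Λ / lam := Int.floor_le _
      have h2 : 1 ≤ 1 / lam := by rw [le_div_iff₀ hl0]; linarith
      have h3 : 2 * Λ / lam = 2 * (Λ / lam) := by ring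
      linarith
    simp only [Fintype.card_prod, Fintype.card_coe, Fintype.card_fin]
    push_cast
    have h0 : (0 : ℝ) ≤ (Finset.Icc (-K) K).card := Nat.cast_nonneg _
    calc ((Finset.Icc (-K) K).card : ℝ) * ((Finset.Icc (-K) K).card * n)
        = n * ((Finset.Icc (-K) K).card : ℝ) ^ 2 := by ring
      _ ≤ _ := by gcongr

end LowModes

/-! ### Nested cutoffs separating disjoint closed sets on the torus. -/

section Cutoffs

open Filter Topology

/-- The closed fundamental cell. -/
def closedCell : Set (ℝ × ℝ) := Icc (-Real.pi) Real.pi ×ˢ Icc (-Real.pi) Real.pi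

lemma isCompact_closedCell : IsCompact closedCell := isCompact_Icc.prod isCompact_Icc

lemma cell_subset_closedCell : cell ⊆ closedCell :=
  prod_mono Ico_subset_Icc_self Ico_subset_Icc_self

/-- A smooth substitute for the squared distance on the torus. -/
def torusGap (p q : ℝ × ℝ) : ℝ := 2 - Real.cos (q.1 - p.1) - Real.cos (q.2 - p.2)

lemma isSmoothPeriodic_comp_torusGap (p : ℝ × ℝ) {g : ℝ → ℝ} (hg : ContDiff ℝ ∞ g) :
    IsSmoothPeriodic fun q => g (torusGap p q) := by
  refine ⟨hg.comp ?_, fun x y => ?_, fun x y => ?_⟩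
  · unfold torusGap
    exact (contDiff_const.sub (Real.contDiff_cos.comp (contDiff_fst.sub contDiff_const))).sub
      (Real.contDiff_cos.comp (contDiff_snd.sub contDiff_const))
  · simp only [torusGap]
    rw [show x + 2 * Real.pi - p.1 = x - p.1 + 2 * Real.pi by ring, Real.cos_add_two_pi]
  · simp only [torusGap]
    rw [show y + 2 * Real.pi - p.2 = y - p.2 + 2 * Real.pi by ring, Real.cos_add_two_pi]

lemma continuous_torusGap (p : ℝ × ℝ) : Continuous (torusGap p) :=
  (isSmoothPeriodic_comp_torusGap p contDiff_id).smooth.continuous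

lemma mem_add_int_mul {S : Set ℝ} (h : ∀ x, x + 2 * Real.pi ∈ S ↔ x ∈ S) (k : ℤ) :
    ∀ x, x + k * (2 * Real.pi) ∈ S ↔ x ∈ S := by
  induction k using Int.induction_on with
  | zero => simp
  | succ k ih =>
    intro x
    rw [← ih x, ← h (x + ((k : ℤ) : ℝ) * (2 * Real.pi))]
    push_cast; ring_nf
  | pred k ih =>
    intro x
    rw [← ih x, ← h (x + (-(k : ℤ) - 1 : ℤ) * _)]
    push_cast; ring_nf

/-- The gap vanishes only when `q - p` is a period, and then periodicity of `S` would put `p` in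
`S`. -/
lemma torusGap_pos {S : Set (ℝ × ℝ)}
    (hS : ∀ x y : ℝ, ((x + 2 * Real.pi, y) ∈ S ↔ (x, y) ∈ S) ∧
      ((x, y + 2 * Real.pi) ∈ S ↔ (x, y) ∈ S)) {p q : ℝ × ℝ} (hp : p ∉ S) (hq : q ∈ S) :
    0 < torusGap p q := by
  have h1 := Real.cos_le_one (q.1 - p.1)
  have h2 := Real.cos_le_one (q.2 - p.2)
  by_contra! hc
  unfold torusGap at hc
  obtain ⟨k, hk⟩ := (Real.cos_eq_one_iff _).1 (by linarith : Real.cos (q.1 - p.1) = 1)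
  obtain ⟨l, hl⟩ := (Real.cos_eq_one_iff _).1 (by linarith : Real.cos (q.2 - p.2) = 1)
  have e1 : q.1 = p.1 + k * (2 * Real.pi) := by linarith
  have e2 : q.2 = p.2 + l * (2 * Real.pi) := by linarith
  apply hp
  have g1 := mem_add_int_mul (S := {x | (x, p.2) ∈ S}) (fun x => (hS x p.2).1) k p.1
  have g2 := mem_add_int_mul (S := {y | (q.1, y) ∈ S}) (fun y => (hS q.1 y).2) l p.2
  rw [mem_ofPred_eq, mem_ofPred_eq, ← e1] at g1
  rw [mem_ofPred_eq, mem_ofPred_eq, ← e2] at g2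
  exact g1.1 (g2.1 hq)

/-- Finitely many periodic bumps suffice: the part of `K` in the closed cell is compact, and each
bump is centred at a point of it with radius its gap to `S`. -/
lemma exists_separating_function {K S : Set (ℝ × ℝ)} (hK : IsClosed K) (hS : IsClosed S)
    (hSp : ∀ x y : ℝ, ((x + 2 * Real.pi, y) ∈ S ↔ (x, y) ∈ S) ∧
      ((x, y + 2 * Real.pi) ∈ S ↔ (x, y) ∈ S)) (hKS : Disjoint K S) :
    ∃ ρ : ℝ × ℝ → ℝ, IsSmoothPeriodic ρ ∧ (∀ p ∈ K ∩ closedCell, 1 ≤ ρ p) ∧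
      ∀ p ∈ S ∩ closedCell, ρ p = 0 := by
  have hε : ∀ p : ℝ × ℝ, ∃ ε > 0, p ∉ S → ∀ q ∈ S ∩ closedCell, ε ≤ torusGap p q := by
    intro p
    by_cases hp : p ∈ S
    · exact ⟨1, one_pos, fun h => absurd hp h⟩
    rcases (S ∩ closedCell).eq_empty_or_nonempty with he | hne
    · exact ⟨1, one_pos, fun _ q hq => by rw [he] at hq; exact hq.elim⟩
    · obtain ⟨q₀, hq₀, hmin⟩ := (isCompact_closedCell.inter_left hS).exists_isMinOn hne
        (continuous_torusGap p).continuousOn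
      exact ⟨torusGap p q₀, torusGap_pos hSp hp hq₀.1, fun _ q hq => hmin hq⟩
  choose ε hε0 hεS using hε
  have hself : ∀ p, torusGap p p = 0 := fun p => by unfold torusGap; simp; norm_num
  obtain ⟨t, htK, ht⟩ := (isCompact_closedCell.inter_left hK).elim_nhds_subcover
    (fun p => {q | torusGap p q < ε p / 2}) (fun p _ =>
      (isOpen_lt (continuous_torusGap p) continuous_const).mem_nhds (by
        rw [mem_ofPred_eq, hself]; have := hε0 p; linarith))
  -- This profile is `1` for `d ≤ ε/2` and `0` for `d ≥ ε`.
  have hg : ∀ p, ContDiff ℝ ∞ fun d : ℝ => Real.smoothTransition (2 - 2 * (d / ε p)) := fun p =>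
    Real.smoothTransition.contDiff.comp
      (contDiff_const.sub (contDiff_const.mul (contDiff_id.div_const _)))
  have hβ := fun p => isSmoothPeriodic_comp_torusGap p (hg p)
  refine ⟨fun q => ∑ p ∈ t, Real.smoothTransition (2 - 2 * (torusGap p q / ε p)),
    ⟨ContDiff.sum fun p _ => (hβ p).smooth, fun x y => Finset.sum_congr rfl fun p _ =>
      (hβ p).periodic_x x y, fun x y => Finset.sum_congr rfl fun p _ => (hβ p).periodic_y x y⟩,
    fun q hq => ?_, fun q hq => Finset.sum_eq_zero fun p hp => ?_⟩
  · obtain ⟨p, hp, hpq⟩ := mem_iUnion₂.1 (ht hq)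
    have h1 : Real.smoothTransition (2 - 2 * (torusGap p q / ε p)) = 1 := by
      refine Real.smoothTransition.one_of_one_le ?_
      rw [mem_ofPred_eq] at hpq
      have : torusGap p q / ε p ≤ 1 / 2 := by
        rw [div_le_iff₀ (hε0 p)]; linarith
      linarith
    rw [← h1]
    exact Finset.single_le_sum
      (f := fun p => Real.smoothTransition (2 - 2 * (torusGap p q / ε p)))
      (fun p _ => Real.smoothTransition.nonneg _) hp
  · refine Real.smoothTransition.zero_of_nonpos ?_
    have h1 := hεS p (fun hpS => Set.disjoint_left.1 hKS (htK p hp).1 hpS) q hq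
    have : 1 ≤ torusGap p q / ε p := by rwa [le_div_iff₀ (hε0 p), one_mul]
    linarith

/-- Nested smooth cutoffs that separate two disjoint closed sets on the torus. -/
lemma exists_cutoffs {K S : Set (ℝ × ℝ)} (hK : IsClosed K) (hS : IsClosed S)
    (hSp : ∀ x y : ℝ, ((x + 2 * Real.pi, y) ∈ S ↔ (x, y) ∈ S) ∧
      ((x, y + 2 * Real.pi) ∈ S ↔ (x, y) ∈ S)) (hKS : Disjoint K S) :
    ∃ χ : ℕ → ℝ × ℝ → ℝ, (∀ i, IsSmoothPeriodic (χ i)) ∧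
      (∀ i p, χ i p ≠ 0 → ∀ᶠ q in 𝓝 p, χ (i + 1) q = 1) ∧
      (∀ p ∈ K ∩ closedCell, ∀ᶠ q in 𝓝 p, χ 0 q = 1) ∧
      ∀ i, ∀ p ∈ S ∩ closedCell, χ i p = 0 := by
  obtain ⟨ρ, hρ, hρK, hρS⟩ := exists_separating_function hK hS hSp hKS
  -- Decreasing positive levels below `1`. The cutoff `χ i` rises from `0` to `1` as `ρ` goes from
  -- `b (i + 1)` to `b i`, so `χ (i + 1)` is `1` wherever `χ i` is nonzero, while all of them vanish
  -- where `ρ = 0`.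
  let b : ℕ → ℝ := fun i => 1 / ((i : ℝ) + 2)
  have hb : ∀ i, b (i + 1) < b i := fun i => by
    simp only [b]
    refine one_div_lt_one_div_of_lt (by positivity) ?_
    push_cast; linarith
  have hb0 : ∀ i, 0 < b i := fun i => by simp only [b]; positivity
  let η : ℕ → ℝ → ℝ := fun i t => Real.smoothTransition ((t - b (i + 1)) / (b i - b (i + 1)))
  have hη : ∀ i, ContDiff ℝ ∞ (η i) := fun i =>
    Real.smoothTransition.contDiff.comp ((contDiff_id.sub contDiff_const).div_const _)
  have hη1 : ∀ i t, b i ≤ t → η i t = 1 := fun i t ht => by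
    refine Real.smoothTransition.one_of_one_le ?_
    rw [le_div_iff₀ (sub_pos.2 (hb i))]; linarith
  have hη0 : ∀ i t, t ≤ b (i + 1) → η i t = 0 := fun i t ht =>
    Real.smoothTransition.zero_of_nonpos
      (div_nonpos_of_nonpos_of_nonneg (by linarith) (sub_pos.2 (hb i)).le)
  refine ⟨fun i p => η i (ρ p), fun i => ⟨(hη i).comp hρ.smooth,
    fun x y => congrArg (η i) (hρ.periodic_x x y), fun x y => congrArg (η i) (hρ.periodic_y x y)⟩, fun i p hp => ?_,
    fun p hp => ?_, fun i p hp => ?_⟩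
  · have h1 : b (i + 1) < ρ p := by
      by_contra! hc
      exact hp (hη0 i _ hc)
    filter_upwards [hρ.smooth.continuous.continuousAt.eventually (lt_mem_nhds h1)] with q hq
    exact hη1 _ _ hq.le
  · have h1 : b 0 < ρ p := lt_of_lt_of_le (by simp only [b]; norm_num) (hρK p hp)
    filter_upwards [hρ.smooth.continuous.continuousAt.eventually (lt_mem_nhds h1)] with q hq
    exact hη1 _ _ hq.le
  · change η i (ρ p) = 0
    rw [hρS p hp]
    exact hη0 i _ (hb0 _).le

end Cutoffs

/-! ### Smoothness and derivative bounds of the glued coefficients. -/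

section Gluing

open Filter Topology

variable {F : Type*} [NormedAddCommGroup F] [NormedSpace ℝ F]

lemma iteratedDeriv_comp_affine {f : ℝ → F} (hf : ContDiff ℝ ∞ f) (k : ℕ) (a b d z : ℝ) :
    iteratedDeriv k (fun z => f ((z - b) / a + d)) z =
      a⁻¹ ^ k • iteratedDeriv k f ((z - b) / a + d) := by
  have h1 : (fun z => f ((z - b) / a + d)) = fun z => (fun u => f (a⁻¹ • u + d)) (z - b) := by
    funext z
    simp only [smul_eq_mul, div_eq_inv_mul]
  have h2 : ContDiff ℝ ∞ fun u => f (u + d) := hf.comp (contDiff_id.add contDiff_const)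
  have h3 := iteratedDeriv_comp_const_smul (n := k) (h2.of_le (by exact_mod_cast le_top)) a⁻¹
  have h4 := iteratedDeriv_comp_sub_const k (fun u => f (a⁻¹ • u + d)) b
  rw [h1, h4]
  simp only [smul_eq_mul] at h3 ⊢
  simp only [h3, iteratedDeriv_comp_add_const, div_eq_inv_mul]

/-- Smooth functions that are constant outside a bounded interval have bounded derivatives. -/
lemma exists_bound_iteratedDeriv {f : ℝ → F} (hf : ContDiff ℝ ∞ f) {a b : ℝ} {u v : F}
    (ha : ∀ y ≤ a, f y = u) (hb : ∀ y, b ≤ y → f y = v) (k : ℕ) :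
    ∃ C, ∀ y, ‖iteratedDeriv k f y‖ ≤ C := by
  obtain ⟨C, hC⟩ := (isCompact_Icc (a := a) (b := b)).exists_bound_of_continuousOn
    (hf.continuous_iteratedDeriv k (by exact_mod_cast le_top)).continuousOn
  have hk : ∀ w : F, ‖if k = 0 then w else 0‖ ≤ ‖w‖ := fun w => by split_ifs <;> simp
  refine ⟨max C (max ‖u‖ ‖v‖), fun y => ?_⟩
  rcases lt_or_ge y a with h | h
  · have : f =ᶠ[𝓝 y] fun _ => u := by
      filter_upwards [Iio_mem_nhds h] with z hz using ha z hz.le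
    rw [this.iteratedDeriv_eq, iteratedDeriv_const]
    exact (hk u).trans ((le_max_left _ _).trans (le_max_right _ _))
  rcases lt_or_ge b y with h' | h'
  · have : f =ᶠ[𝓝 y] fun _ => v := by
      filter_upwards [Ioi_mem_nhds h'] with z hz using hb z (le_of_lt hz)
    rw [this.iteratedDeriv_eq, iteratedDeriv_const]
    exact (hk v).trans ((le_max_right _ _).trans (le_max_right _ _))
  · exact (hC y ⟨h, h'⟩).trans (le_max_left _ _)

/-- The `2π`-periodic function that is `f(y/λ)` on `[-π/2, π/2]` and `f'((y-π)/λ + π)` on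
`(π/2, 3π/2)`. -/
def glue (f f' : ℝ → F) (lam y : ℝ) : F :=
  let t := toIcoMod Real.two_pi_pos (-(Real.pi / 2)) y
  if t ≤ Real.pi / 2 then f (t / lam) else f' ((t - Real.pi) / lam + Real.pi)

lemma periodic_glue (f f' : ℝ → F) (lam : ℝ) : Function.Periodic (glue f f' lam) (2 * Real.pi) :=
  fun y => by rw [glue, glue, toIcoMod_add_right]

/-- At each point one of the two rescaled functions sits at the common constant `u`, so the case
distinction becomes the sum `f + f' - u`, which is visibly smooth. -/
lemma glue_eq_add {f f' : ℝ → F} {y₀ lam : ℝ} (hlam : 0 < lam) (hy : lam * y₀ ≤ Real.pi / 2)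
    {u : F} (hf : ∀ y, y₀ ≤ y → f y = u) (hf' : ∀ y ≤ Real.pi - y₀, f' y = u)
    {z : ℝ} (hz : z ∈ Ico (-(Real.pi / 2)) (3 * Real.pi / 2)) :
    glue f f' lam z = f ((z - 0) / lam + 0) + f' ((z - Real.pi) / lam + Real.pi) - u := by
  have ht : toIcoMod Real.two_pi_pos (-(Real.pi / 2)) z = z :=
    (toIcoMod_eq_self Real.two_pi_pos).2 ⟨hz.1, by linarith [hz.2]⟩
  have e : (z - 0) / lam + 0 = z / lam := by simp
  rw [glue, ht, e]
  split_ifs with h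
  · rw [hf' ((z - Real.pi) / lam + Real.pi)]
    · abel
    · have : (z - Real.pi) / lam ≤ -y₀ := by rw [div_le_iff₀ hlam]; linarith
      linarith
  · rw [hf (z / lam)]
    · abel
    · rw [le_div_iff₀ hlam]; linarith

lemma glue_eq_add' {f f' : ℝ → F} {y₀ lam : ℝ} (hlam : 0 < lam) (hy : lam * y₀ ≤ Real.pi / 2)
    {u : F} (hf : ∀ y ≤ -y₀, f y = u) (hf' : ∀ y, Real.pi + y₀ ≤ y → f' y = u)
    {z : ℝ} (hz : z ∈ Ioc (Real.pi / 2) (5 * Real.pi / 2)) :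
    glue f f' lam z =
      f ((z - 2 * Real.pi) / lam + 0) + f' ((z - Real.pi) / lam + Real.pi) - u := by
  rcases lt_or_ge z (3 * Real.pi / 2) with h | h
  · have ht : toIcoMod Real.two_pi_pos (-(Real.pi / 2)) z = z :=
      (toIcoMod_eq_self Real.two_pi_pos).2 ⟨by linarith [hz.1, Real.pi_pos], by linarith [hz.2]⟩
    have h2 : ¬ z ≤ Real.pi / 2 := not_le.2 hz.1
    rw [glue, ht, if_neg h2, hf ((z - 2 * Real.pi) / lam + 0)]
    · abel
    · rw [add_zero, div_le_iff₀ hlam]; linarith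
  · have ht : toIcoMod Real.two_pi_pos (-(Real.pi / 2)) z = z - 2 * Real.pi := by
      rw [← toIcoMod_sub Real.two_pi_pos, toIcoMod_eq_self]
      exact ⟨by linarith, by linarith [hz.2, Real.pi_pos]⟩
    have h2 : z - 2 * Real.pi ≤ Real.pi / 2 := by linarith [hz.2]
    rw [glue, ht, if_pos h2, hf' ((z - Real.pi) / lam + Real.pi), add_zero]
    · abel
    · have : y₀ ≤ (z - Real.pi) / lam := by rw [le_div_iff₀ hlam]; linarith
      linarith

/-- Data for gluing: `f` and `f'` are smooth, agree with `u` where they are joined at `π/2` and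
with `w` where they are joined at `3π/2`. -/
structure IsGluable (y₀ : ℝ) (f f' : ℝ → F) (u w : F) : Prop where
  smooth : ContDiff ℝ ∞ f
  smooth' : ContDiff ℝ ∞ f'
  plus : ∀ y, y₀ ≤ y → f y = u
  minus : ∀ y ≤ -y₀, f y = w
  plus' : ∀ y ≤ Real.pi - y₀, f' y = u
  minus' : ∀ y, Real.pi + y₀ ≤ y → f' y = w

/-- Up to a period, each point lies inside a window where one of the two sum formulas holds. -/
lemma IsGluable.eventuallyEq {y₀ : ℝ} {f f' : ℝ → F} {u w : F} (h : IsGluable y₀ f f' u w)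
    {lam : ℝ} (hlam : 0 < lam) (hy : lam * y₀ ≤ Real.pi / 2) (y : ℝ) :
    ∃ a b : ℝ, ∃ x ∈ ({u, w} : Set F), glue f f' lam =ᶠ[𝓝 y]
      fun z => f ((z - a) / lam + 0) + f' ((z - b) / lam + Real.pi) - x := by
  set t := toIcoMod Real.two_pi_pos (-(Real.pi / 2)) y with ht
  set k := toIcoDiv Real.two_pi_pos (-(Real.pi / 2)) y with hk
  have hyk : y - k • (2 * Real.pi) = t := self_sub_toIcoDiv_zsmul Real.two_pi_pos _ _
  have htm : t ∈ Ico (-(Real.pi / 2)) (-(Real.pi / 2) + 2 * Real.pi) :=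
    toIcoMod_mem_Ico Real.two_pi_pos _ _
  have hcont : ∀ c : ℝ, ContinuousAt (fun z : ℝ => z - k • (2 * Real.pi) + c) y := fun c => by
    fun_prop
  have hper : ∀ z, glue f f' lam (z - k • (2 * Real.pi)) = glue f f' lam z := fun z =>
    (periodic_glue f f' lam).sub_zsmul_eq k
  rcases eq_or_lt_of_le htm.1 with h0 | h0
  -- The left endpoint `-π/2` is the joint at `3π/2`, where both pieces equal `w`; the window is
  -- shifted by one period.
  · refine ⟨k • (2 * Real.pi), k • (2 * Real.pi) - Real.pi, w, by simp, ?_⟩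
    have : ∀ᶠ z in 𝓝 y, z - k • (2 * Real.pi) + 2 * Real.pi ∈
        Ioo (Real.pi / 2) (5 * Real.pi / 2) :=
      (hcont _).eventually (Ioo_mem_nhds (by simp only [hyk]; linarith [Real.pi_pos])
        (by simp only [hyk]; linarith [Real.pi_pos]))
    filter_upwards [this] with z hz
    have h1 := glue_eq_add' hlam hy h.minus h.minus' ⟨hz.1, hz.2.le⟩
    rw [periodic_glue, hper] at h1
    rw [h1]
    congr 3 <;> ring
  · refine ⟨k • (2 * Real.pi), k • (2 * Real.pi) + Real.pi, u, by simp, ?_⟩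
    have : ∀ᶠ z in 𝓝 y, z - k • (2 * Real.pi) + 0 ∈ Ioo (-(Real.pi / 2)) (3 * Real.pi / 2) :=
      (hcont _).eventually (Ioo_mem_nhds (by simp only [hyk]; linarith)
        (by simp only [hyk]; linarith [htm.2]))
    filter_upwards [this] with z hz
    rw [add_zero] at hz
    have h1 := glue_eq_add hlam hy h.plus h.plus' ⟨hz.1.le, hz.2⟩
    rw [hper] at h1
    rw [h1]
    congr 3 <;> ring

lemma contDiff_comp_affine {f : ℝ → F} (hf : ContDiff ℝ ∞ f) (a b d : ℝ) :
    ContDiff ℝ ∞ fun z => f ((z - b) / a + d) :=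
  hf.comp (((contDiff_id.sub contDiff_const).div_const _).add contDiff_const)

lemma IsGluable.contDiff {y₀ : ℝ} {f f' : ℝ → F} {u w : F} (h : IsGluable y₀ f f' u w)
    {lam : ℝ} (hlam : 0 < lam) (hy : lam * y₀ ≤ Real.pi / 2) : ContDiff ℝ ∞ (glue f f' lam) := by
  refine contDiff_iff_contDiffAt.2 fun y => ?_
  obtain ⟨a, b, x, -, hx⟩ := h.eventuallyEq hlam hy y
  exact (((contDiff_comp_affine h.smooth _ _ _).add
    (contDiff_comp_affine h.smooth' _ _ _)).sub contDiff_const).contDiffAt.congr_of_eventuallyEq hx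

/-- Each derivative of a rescaled function costs `λ⁻¹`, which the factor `λ^k` compensates. -/
lemma IsGluable.exists_bound {y₀ : ℝ} {f f' : ℝ → F} {u w : F} (h : IsGluable y₀ f f' u w)
    (k : ℕ) : ∃ C, ∀ lam, 0 < lam → lam * y₀ ≤ Real.pi / 2 → ∀ y,
      ‖lam ^ k • iteratedDeriv k (glue f f' lam) y‖ ≤ C := by
  obtain ⟨C₁, h1⟩ := exists_bound_iteratedDeriv h.smooth h.minus h.plus k
  obtain ⟨C₂, h2⟩ := exists_bound_iteratedDeriv h.smooth' h.plus' h.minus' k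
  refine ⟨C₁ + C₂ + (‖u‖ + ‖w‖), fun lam hlam hy y => ?_⟩
  obtain ⟨a, b, x, hxm, hx⟩ := h.eventuallyEq hlam hy y
  have hxn : lam ^ k * ‖(if k = 0 then x else 0 : F)‖ ≤ ‖u‖ + ‖w‖ := by
    by_cases hk : k = 0
    · subst hk
      rw [if_pos rfl, pow_zero, one_mul]
      rcases hxm with rfl | rfl
      · linarith [norm_nonneg w]
      · linarith [norm_nonneg u]
    · rw [if_neg hk, norm_zero, mul_zero]; positivity
  have c1 : ContDiff ℝ k _ :=
    (contDiff_comp_affine h.smooth lam a 0).of_le (by exact_mod_cast le_top)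
  have c2 : ContDiff ℝ k _ :=
    (contDiff_comp_affine h.smooth' lam b Real.pi).of_le (by exact_mod_cast le_top)
  have e : ∀ v : F, lam ^ k • lam⁻¹ ^ k • v = v := fun v => by
    rw [smul_smul, ← mul_pow, mul_inv_cancel₀ hlam.ne', one_pow, one_smul]
  rw [hx.iteratedDeriv_eq, iteratedDeriv_fun_sub (c1.add c2).contDiffAt contDiffAt_const,
    iteratedDeriv_fun_add c1.contDiffAt c2.contDiffAt, iteratedDeriv_comp_affine h.smooth,
    iteratedDeriv_comp_affine h.smooth', iteratedDeriv_const, smul_sub, smul_add, e, e]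
  refine (norm_sub_le _ _).trans (add_le_add ((norm_add_le _ _).trans (add_le_add (h1 _) (h2 _))) ?_)
  rw [norm_smul, norm_pow, Real.norm_of_nonneg hlam.le]
  exact hxn

end Gluing

/-! ### Symmetry of the Weyl quantization. -/

section WeylSymmetry

variable {n : ℕ}

/-- A function of `y` as a function on the torus. -/
lemma IsSmoothPeriodic.of_snd {F : Type*} [NormedAddCommGroup F] [NormedSpace ℝ F] {g : ℝ → F}
    (hg : ContDiff ℝ ∞ g) (hp : Function.Periodic g (2 * Real.pi)) :
    IsSmoothPeriodic fun p : ℝ × ℝ => g p.2 where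
  smooth := hg.comp contDiff_snd
  periodic_x _ _ := rfl
  periodic_y _ y := hp y

lemma fderiv_snd_apply {F : Type*} [NormedAddCommGroup F] [NormedSpace ℝ F] {g : ℝ → F}
    (hg : ContDiff ℝ ∞ g) (p w : ℝ × ℝ) :
    fderiv ℝ (fun p : ℝ × ℝ => g p.2) p w = w.2 • deriv g p.2 := by
  have h1 : HasFDerivAt (fun p : ℝ × ℝ => p.2) (ContinuousLinearMap.snd ℝ ℝ ℝ) p := hasFDerivAt_snd
  have h2 := ((hg.differentiable (by simp)) p.2).hasDerivAt.hasFDerivAt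
  have h3 := h2.comp p h1
  rw [show (fun p : ℝ × ℝ => g p.2) = g ∘ fun p => p.2 from rfl, h3.fderiv]
  rfl

lemma periodic_iteratedDeriv {F : Type*} [NormedAddCommGroup F] [NormedSpace ℝ F] {g : ℝ → F}
    {T : ℝ} (hp : Function.Periodic g T) (k : ℕ) : Function.Periodic (iteratedDeriv k g) T := by
  intro y
  have h := iteratedDeriv_comp_add_const k g T
  rw [show (fun z => g (z + T)) = g from funext hp] at h
  exact (congrFun h y).symm

lemma contDiff_iteratedDeriv {F : Type*} [NormedAddCommGroup F] [NormedSpace ℝ F] {g : ℝ → F}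
    (hg : ContDiff ℝ ∞ g) (k : ℕ) : ContDiff ℝ ∞ (iteratedDeriv k g) := by
  induction k with
  | zero => simpa using hg
  | succ k ih =>
    rw [iteratedDeriv_succ]
    exact (contDiff_infty_iff_deriv.1 ih).2

/-- `S` is symmetric on smooth functions. -/
def IsSymm (S : Module.End ℂ (SP n)) : Prop :=
  ∀ f g : SP n, (inner ℂ (toL2 (S f)) (toL2 g) : ℂ) = inner ℂ (toL2 f) (toL2 (S g))

lemma IsSymm.add {S T : Module.End ℂ (SP n)} (hS : IsSymm S) (hT : IsSymm T) : IsSymm (S + T) :=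
  fun f g => by
    rw [LinearMap.add_apply, LinearMap.add_apply, map_add, map_add, inner_add_left, inner_add_right,
      hS, hT]

lemma IsSymm.sum {ι : Type*} {s : Finset ι} {S : ι → Module.End ℂ (SP n)}
    (h : ∀ i ∈ s, IsSymm (S i)) : IsSymm (∑ i ∈ s, S i) := by
  classical
  induction s using Finset.induction_on with
  | empty => intro f g; simp
  | insert a s ha ih =>
    rw [Finset.sum_insert ha]
    exact (h a (Finset.mem_insert_self _ _)).add
      (ih fun i hi => h i (Finset.mem_insert_of_mem hi))

lemma IsSymm.anticomm {S T : Module.End ℂ (SP n)} (hS : IsSymm S) (hT : IsSymm T) :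
    IsSymm ((1 / 2 : ℂ) • (S * T + T * S)) := fun f g => by
  simp only [LinearMap.smul_apply, LinearMap.add_apply, Module.End.mul_apply, map_smul, map_add,
    inner_smul_left, inner_smul_right, inner_add_left, inner_add_right]
  rw [hS (T f), hT f (S g), hT (S f), hS f (T g)]
  simp only [map_div₀, map_one, map_ofNat]
  ring

lemma IsSymm.mul_of_commute {S T : Module.End ℂ (SP n)} (hS : IsSymm S) (hT : IsSymm T)
    (h : Commute S T) : IsSymm (S * T) := fun f g => by
  rw [Module.End.mul_apply, hS, hT, ← Module.End.mul_apply, h.eq]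

lemma IsSymm.one : IsSymm (1 : Module.End ℂ (SP n)) := fun _ _ => rfl

lemma IsSymm.pow {S : Module.End ℂ (SP n)} (hS : IsSymm S) (k : ℕ) : IsSymm (S ^ k) := by
  induction k with
  | zero => rw [pow_zero]; exact IsSymm.one
  | succ k ih => rw [pow_succ]; exact ih.mul_of_commute hS (Commute.pow_self S k)

lemma IsSymm.mulSP {c : ℝ × ℝ → Mat n} (hc : IsSmoothPeriodic c) (hh : ∀ p, (c p).IsHermitian) :
    IsSymm (mulSP c hc) := fun f g => by
  rw [inner_mulSP_left]
  refine congrArg (fun z => inner ℂ (toL2 f) (toL2 z)) (Subtype.ext (funext fun z => ?_))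
  rw [coe_mulSP, coe_mulSP, (hh z).eq]

/-- `S ↦ (YS + SY)/2`. -/
def symmMul {A : Type*} [Ring A] [Algebra ℂ A] (Y : A) : Module.End ℂ A :=
  (1 / 2 : ℂ) • (LinearMap.mulLeft ℂ Y - LinearMap.mulRight ℂ Y) + LinearMap.mulRight ℂ Y

lemma symmMul_apply {A : Type*} [Ring A] [Algebra ℂ A] (Y S : A) :
    symmMul Y S = (1 / 2 : ℂ) • (Y * S + S * Y) := by
  simp only [symmMul, LinearMap.add_apply, LinearMap.smul_apply, LinearMap.sub_apply,
    LinearMap.mulLeft_apply, LinearMap.mulRight_apply]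
  module

/-- `symmMul Y` is half the commutator with `Y` plus right multiplication by `Y`. These two commute,
so the binomial theorem applies; in the application its right side is the Weyl formula for `g(y)
ζ^j`. -/
lemma symmMul_pow_apply {A : Type*} [Ring A] [Algebra ℂ A] {Y : A} {d : ℕ → A} {r : ℂ}
    (hd : ∀ k, Y * d k - d k * Y = r • d (k + 1)) (j : ℕ) :
    (symmMul Y ^ j) (d 0) = ∑ k ∈ Finset.range (j + 1),
      ((r / 2) ^ k * (j.choose k : ℂ)) • (d k * Y ^ (j - k)) := by
  have hc : Commute ((1 / 2 : ℂ) • (LinearMap.mulLeft ℂ Y - LinearMap.mulRight ℂ Y))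
      (LinearMap.mulRight ℂ Y) :=
    ((LinearMap.commute_mulLeft_right _ _).sub_left (Commute.refl _)).smul_left _
  have hD : ∀ k, (((1 / 2 : ℂ) • (LinearMap.mulLeft ℂ Y - LinearMap.mulRight ℂ Y)) ^ k) (d 0) =
      (r / 2) ^ k • d k := fun k => by
    induction k with
    | zero => simp
    | succ k ih =>
      rw [pow_succ', Module.End.mul_apply, ih, map_smul, LinearMap.smul_apply, LinearMap.sub_apply,
        LinearMap.mulLeft_apply, LinearMap.mulRight_apply, hd, smul_smul, smul_smul]
      congr 1
      ring
  rw [symmMul, hc.add_pow, LinearMap.sum_apply]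
  refine Finset.sum_congr rfl fun k _ => ?_
  rw [(hc.pow_pow k (j - k)).eq, mul_assoc, ← nsmul_eq_mul', Module.End.mul_apply,
    LinearMap.smul_apply, hD, LinearMap.pow_mulRight, LinearMap.mulRight_apply,
    ← Nat.cast_smul_eq_nsmul ℂ, smul_smul, smul_mul_assoc, mul_comm ((j.choose k : ℕ) : ℂ)]

lemma IsSymm.symmMul_pow {Y S : Module.End ℂ (SP n)} (hS : IsSymm S) (hY : IsSymm Y) (j : ℕ) :
    IsSymm ((symmMul Y ^ j) S) := by
  induction j with
  | zero => simpa using hS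
  | succ j ih =>
    rw [pow_succ', Module.End.mul_apply, symmMul_apply]
    exact hY.anticomm ih

lemma commute_symmMul_pow {X Y S : Module.End ℂ (SP n)} (hY : Commute X Y) (hS : Commute X S)
    (j : ℕ) : Commute X ((symmMul Y ^ j) S) := by
  induction j with
  | zero => simpa using hS
  | succ j ih =>
    rw [pow_succ', Module.End.mul_apply, symmMul_apply]
    exact ((hY.mul_right ih).add_right (ih.mul_right hY)).smul_right _

variable (lam : ℝ) {g : ℝ → Mat n} (hg : ContDiff ℝ ∞ g) (hp : Function.Periodic g (2 * Real.pi))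

lemma isSmoothPeriodic_iteratedDeriv {g : ℝ → Mat n} (hg : ContDiff ℝ ∞ g)
    (hp : Function.Periodic g (2 * Real.pi)) (k : ℕ) :
    IsSmoothPeriodic fun p : ℝ × ℝ => iteratedDeriv k g p.2 :=
  IsSmoothPeriodic.of_snd (contDiff_iteratedDeriv hg k) (periodic_iteratedDeriv hp k)

/-- Multiplication by `∂_y^k g`. -/
def mulDeriv (hg : ContDiff ℝ ∞ g) (hp : Function.Periodic g (2 * Real.pi)) (k : ℕ) :
    Module.End ℂ (SP n) :=
  mulSP _ (isSmoothPeriodic_iteratedDeriv hg hp k)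

lemma ly_mul_mulDeriv (k : ℕ) :
    ly lam * mulDeriv hg hp k - mulDeriv hg hp k * ly lam =
      (-(Complex.I * lam)) • mulDeriv hg hp (k + 1) := by
  refine LinearMap.ext fun f => ?_
  rw [LinearMap.sub_apply, Module.End.mul_apply, Module.End.mul_apply, mulDeriv, ly_mulSP,
    add_sub_cancel_left]
  refine Subtype.ext (funext fun p => ?_)
  change act ((-(Complex.I * lam)) • fderiv ℝ (fun p : ℝ × ℝ => iteratedDeriv k g p.2) p (0, 1)) _ =
    (-(Complex.I * lam)) • act (iteratedDeriv (k + 1) g p.2) _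
  rw [fderiv_snd_apply (contDiff_iteratedDeriv hg k), act_smul, one_smul, iteratedDeriv_succ]

lemma lx_commute_mulDeriv (k : ℕ) : Commute (lx lam) (mulDeriv hg hp k) := by
  refine LinearMap.ext fun f => ?_
  rw [Module.End.mul_apply, Module.End.mul_apply, mulDeriv, lx_mulSP]
  refine add_eq_left.2 (Subtype.ext (funext fun p => ?_))
  change act ((-(Complex.I * lam)) • fderiv ℝ (fun p : ℝ × ℝ => iteratedDeriv k g p.2) p (1, 0)) _ =
    0
  rw [fderiv_snd_apply (contDiff_iteratedDeriv hg k), zero_smul, smul_zero, act_zero]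

lemma symmMul_pow_mulDeriv (j : ℕ) :
    (symmMul (ly lam) ^ j) (mulDeriv hg hp 0) = ∑ k ∈ Finset.range (j + 1),
      ((-(Complex.I * lam) / 2) ^ k * (j.choose k : ℂ)) •
        (mulDeriv hg hp k * ly lam ^ (j - k)) :=
  symmMul_pow_apply (ly_mul_mulDeriv lam hg hp) j

/-- Weyl quantization of `g(y) ζ^j` is the `j`-fold symmetrized product with `Y`, which is symmetric
by construction. Multiplying by `X^i` preserves this, since `X` commutes with everything involved.
-/
lemma isSymm_lx_pow_mul (hh : ∀ y, (g y).IsHermitian) (i j : ℕ) :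
    IsSymm (∑ k ∈ Finset.range (j + 1), ((-(Complex.I * lam) / 2) ^ k * (j.choose k : ℂ)) •
      (mulDeriv hg hp k * (lx lam ^ i * ly lam ^ (j - k)))) := by
  have h0 : IsSymm (mulDeriv hg hp 0) := IsSymm.mulSP _ fun p => by
    rw [iteratedDeriv_zero]; exact hh _
  have h1 : IsSymm (lx lam ^ i * (symmMul (ly lam) ^ j) (mulDeriv hg hp 0)) :=
    (IsSymm.pow (inner_lx lam) i).mul_of_commute (h0.symmMul_pow (inner_ly lam) j)
      ((commute_symmMul_pow (lx_comm_ly lam) (lx_commute_mulDeriv lam hg hp 0) j).pow_left i)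
  rw [symmMul_pow_mulDeriv, Finset.mul_sum] at h1
  convert h1 using 3 with k hk
  rw [mul_smul_comm, ← mul_assoc, ← mul_assoc, ((lx_commute_mulDeriv lam hg hp k).pow_left i).eq]

end WeylSymmetry

/-! ### A matrix polynomial determines its coefficients. -/

section Identity

variable {n : ℕ}

lemma eq_zero_of_sum_pow_mul_eq_zero {N : ℕ} {b : ℕ → ℂ}
    (h : ∀ ξ : ℝ, ∑ i ∈ Finset.range N, (ξ : ℂ) ^ i * b i = 0) {i : ℕ} (hi : i < N) : b i = 0 := by
  have hp : (∑ i ∈ Finset.range N, Polynomial.monomial i (b i) : Polynomial ℂ) = 0 := by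
    refine Polynomial.eq_zero_of_infinite_isRoot _
      (Set.Infinite.mono ?_ (Set.infinite_range_of_injective Complex.ofReal_injective))
    rintro _ ⟨ξ, rfl⟩
    change Polynomial.eval _ _ = 0
    rw [Polynomial.eval_finsetSum, ← h ξ]
    exact Finset.sum_congr rfl fun i _ => by rw [Polynomial.eval_monomial, mul_comm]
  have := congrArg (fun p => Polynomial.coeff p i) hp
  simpa [Polynomial.finsetSum_coeff, Polynomial.coeff_monomial, hi] using this

lemma symbol_eq_sum (m : ℕ) (a : ℕ → ℕ → ℝ → Mat n) (y ξ ζ : ℝ) :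
    symbol m a y ξ ζ = ∑ i ∈ Finset.range (m + 1), ∑ j ∈ Finset.range (m + 1),
      ((ξ : ℂ) ^ i * (ζ : ℂ) ^ j) • if i + j ≤ m then a i j y else 0 := by
  rw [symbol, multiIdx, Finset.sum_filter, Finset.sum_product]
  refine Finset.sum_congr rfl fun i _ => Finset.sum_congr rfl fun j _ => ?_
  split_ifs <;> simp

/-- The coefficients of a matrix-valued polynomial are determined by its values. -/
lemma coeff_eq_of_symbol_eq {m : ℕ} {a b : ℕ → ℕ → ℝ → Mat n} {y y' : ℝ}
    (h : ∀ ξ ζ, symbol m a y ξ ζ = symbol m b y' ξ ζ) {q : ℕ × ℕ} (hq : q ∈ multiIdx m) :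
    a q.1 q.2 y = b q.1 q.2 y' := by
  have hq' := mem_multiIdx.1 hq
  refine Matrix.ext fun k l => ?_
  set A : ℕ → ℕ → ℂ := fun i j => if i + j ≤ m then a i j y k l - b i j y' k l else 0 with hA
  have h1 : ∀ ξ ζ : ℝ, ∑ i ∈ Finset.range (m + 1), (ξ : ℂ) ^ i *
      ∑ j ∈ Finset.range (m + 1), (ζ : ℂ) ^ j * A i j = 0 := fun ξ ζ => by
    have h2 := congrFun (congrFun (h ξ ζ) k) l
    rw [symbol_eq_sum, symbol_eq_sum, ← sub_eq_zero] at h2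
    simp only [Matrix.sum_apply, Matrix.smul_apply, smul_eq_mul] at h2
    rw [← h2, ← Finset.sum_sub_distrib]
    refine Finset.sum_congr rfl fun i _ => ?_
    rw [Finset.mul_sum, ← Finset.sum_sub_distrib]
    refine Finset.sum_congr rfl fun j _ => ?_
    simp only [hA]
    split_ifs
    · ring
    · simp
  have h3 := eq_zero_of_sum_pow_mul_eq_zero (fun ζ =>
    eq_zero_of_sum_pow_mul_eq_zero (fun ξ => h1 ξ ζ) (i := q.1) (by omega)) (i := q.2) (by omega)
  simp only [hA, if_pos hq'] at h3
  exact sub_eq_zero.1 h3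

/-- For real `ξ`, `ζ` the adjoint of the symbol has the adjoint coefficients; uniqueness of
coefficients identifies them. -/
lemma isHermitian_of_symbol {m : ℕ} {a : ℕ → ℕ → ℝ → Mat n} {y : ℝ}
    (h : ∀ ξ ζ, (symbol m a y ξ ζ).IsHermitian) {q : ℕ × ℕ} (hq : q ∈ multiIdx m) :
    (a q.1 q.2 y).IsHermitian := by
  refine coeff_eq_of_symbol_eq (a := fun i j y => (a i j y).conjTranspose) (b := a) (fun ξ ζ => ?_) hq
  rw [← (h ξ ζ).eq, symbol, symbol, Matrix.conjTranspose_sum]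
  refine Finset.sum_congr rfl fun q _ => ?_
  rw [Matrix.conjTranspose_smul, Complex.star_def, Complex.conj_ofReal]

end Identity

/-! ### Semiclassical coefficients of the periodic Hamiltonian. -/

section Coefficients

variable {n m : ℕ} {y₀ lam : ℝ} {s s' : ℕ → ℕ → ℝ → Mat n} {sp sm : ℕ → ℕ → Mat n}

/-- The coefficients of the symbol of the periodic Hamiltonian in powers of `λ ξ`, `λ ζ`. -/
def semiSymb (m : ℕ) (s s' : ℕ → ℕ → ℝ → Mat n) (lam : ℝ) (i j : ℕ) : ℝ → Mat n :=
  if i + j ≤ m then glue (s i j) (s' i j) lam else fun _ => 0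

/-- The coefficients of the Weyl quantization of a symbol that depends on `y`, in powers of
`λ D_x`, `λ D_y`. -/
def semiWeyl (m : ℕ) (lam : ℝ) (g : ℕ → ℕ → ℝ → Mat n) (i j : ℕ) (p : ℝ × ℝ) : Mat n :=
  ∑ k ∈ Finset.range (m + 1 - (i + j)), ((-(Complex.I * lam) / 2) ^ k * ((j + k).choose k : ℂ)) •
    iteratedDeriv k (g i (j + k)) p.2

lemma gluedCoeff_eq {i j : ℕ} (h : i + j ≤ m) :
    gluedCoeff s s' lam i j = fun y => ((lam ^ (i + j) : ℝ) : ℂ) • semiSymb m s s' lam i j y := by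
  funext y
  rw [semiSymb, if_pos h, gluedCoeff, glue]
  exact (smul_ite _ _ _ _).symm

/-- The `k`-th Weyl correction uses the symbol coefficient of order `i + j + k`, so a factor `λ^k`
is left over to compensate the `k` derivatives in `y`. -/
lemma weylCoeff_gluedCoeff (q : ℕ × ℕ) (p : ℝ × ℝ) :
    weylCoeff m (gluedCoeff s s' lam) q.1 q.2 p.2 =
      ((lam ^ (q.1 + q.2) : ℝ) : ℂ) • semiWeyl m lam (semiSymb m s s' lam) q.1 q.2 p := by
  rw [weylCoeff, semiWeyl, Finset.smul_sum]
  refine Finset.sum_congr rfl fun k hk => ?_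
  rw [Finset.mem_range] at hk
  rw [gluedCoeff_eq (m := m) (by omega), iteratedDeriv_fun_const_smul_field, smul_smul, smul_smul]
  congr 1
  push_cast
  ring

lemma isGluable (hs : ∀ q ∈ multiIdx m, ContDiff ℝ ∞ (s q.1 q.2))
    (hsp : ∀ q ∈ multiIdx m, ∀ y, y₀ ≤ y → s q.1 q.2 y = sp q.1 q.2)
    (hsm : ∀ q ∈ multiIdx m, ∀ y, y ≤ -y₀ → s q.1 q.2 y = sm q.1 q.2)
    (hs' : IsReversedWall m y₀ s s' sp sm) {q : ℕ × ℕ} (hq : q ∈ multiIdx m) :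
    IsGluable y₀ (s q.1 q.2) (s' q.1 q.2) (sp q.1 q.2) (sm q.1 q.2) :=
  ⟨hs q hq, hs'.smooth q hq, hsp q hq, hsm q hq, hs'.eq_plus q hq, hs'.eq_minus q hq⟩

lemma periodic_semiSymb (i j : ℕ) :
    Function.Periodic (semiSymb m s s' lam i j) (2 * Real.pi) := by
  rw [semiSymb]
  split_ifs
  · exact periodic_glue _ _ _
  · exact fun _ => rfl

lemma contDiff_semiSymb
    (hg : ∀ q ∈ multiIdx m, IsGluable y₀ (s q.1 q.2) (s' q.1 q.2) (sp q.1 q.2) (sm q.1 q.2))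
    (hlam : 0 < lam) (hy : lam * y₀ ≤ Real.pi / 2) (i j : ℕ) :
    ContDiff ℝ ∞ (semiSymb m s s' lam i j) := by
  rw [semiSymb]
  split_ifs with h
  · exact (hg (i, j) (mem_multiIdx.2 h)).contDiff hlam hy
  · exact contDiff_const

/-- The values of the glued symbol are values of the original symbol. -/
lemma exists_semiSymb_eq (hr : ∀ y', ∃ y, ∀ ξ ζ, symbol m s' y' ξ ζ = symbol m s y ξ ζ) (y : ℝ) :
    ∃ y₁, ∀ q ∈ multiIdx m, semiSymb m s s' lam q.1 q.2 y = s q.1 q.2 y₁ := by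
  by_cases h : toIcoMod Real.two_pi_pos (-(Real.pi / 2)) y ≤ Real.pi / 2
  · refine ⟨toIcoMod Real.two_pi_pos (-(Real.pi / 2)) y / lam, fun q hq => ?_⟩
    rw [semiSymb, if_pos (mem_multiIdx.1 hq), glue]
    exact if_pos h
  · obtain ⟨y₁, h1⟩ := hr
      ((toIcoMod Real.two_pi_pos (-(Real.pi / 2)) y - Real.pi) / lam + Real.pi)
    refine ⟨y₁, fun q hq => ?_⟩
    rw [semiSymb, if_pos (mem_multiIdx.1 hq), glue, ← coeff_eq_of_symbol_eq h1 hq]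
    exact if_neg h

lemma exists_bound_semiSymb
    (hg : ∀ q ∈ multiIdx m, IsGluable y₀ (s q.1 q.2) (s' q.1 q.2) (sp q.1 q.2) (sm q.1 q.2))
    (i j k : ℕ) : ∃ C, ∀ lam : ℝ, 0 < lam → lam * y₀ ≤ Real.pi / 2 → ∀ y,
      ‖lam ^ k • iteratedDeriv k (semiSymb m s s' lam i j) y‖ ≤ C := by
  by_cases h : i + j ≤ m
  · obtain ⟨C, hC⟩ := (hg (i, j) (mem_multiIdx.2 h)).exists_bound k
    refine ⟨C, fun lam hlam hy y => ?_⟩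
    rw [semiSymb, if_pos h]
    exact hC lam hlam hy y
  · refine ⟨0, fun lam _ _ y => ?_⟩
    rw [semiSymb, if_neg h, iteratedDeriv_const]
    simp

lemma norm_semi_smul_le (hlam : 0 < lam) (k l : ℕ) (M : Mat n) :
    ‖((-(Complex.I * lam) / 2) ^ k * (l : ℂ)) • M‖ ≤ l * ‖lam ^ k • M‖ := by
  rw [norm_smul, norm_smul, norm_mul, norm_pow, norm_div, norm_neg, norm_mul, Complex.norm_I,
    one_mul, Complex.norm_real, Complex.norm_natCast, norm_pow, Real.norm_of_nonneg hlam.le,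
    Complex.norm_ofNat, mul_right_comm, mul_comm (l : ℝ) (_ * _)]
  gcongr
  linarith

lemma exists_bound_semiWeyl
    (hg : ∀ q ∈ multiIdx m, IsGluable y₀ (s q.1 q.2) (s' q.1 q.2) (sp q.1 q.2) (sm q.1 q.2)) :
    ∃ C, ∀ lam : ℝ, 0 < lam → lam * y₀ ≤ Real.pi / 2 → ∀ q ∈ multiIdx m, ∀ p,
      ‖semiWeyl m lam (semiSymb m s s' lam) q.1 q.2 p‖ ≤ C ∧
      ‖dcoef lam (0, 1) (fun p => semiSymb m s s' lam q.1 q.2 p.2) p‖ ≤ C := by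
  choose B hB using exists_bound_semiSymb hg
  have hB0 : ∀ i j k, 0 ≤ |B i j k| := fun _ _ _ => abs_nonneg _
  have hw : ∀ i j, 0 ≤ ∑ k ∈ Finset.range (m + 1 - (i + j)),
      ((j + k).choose k : ℝ) * |B i (j + k) k| := fun i j =>
    Finset.sum_nonneg fun k _ => mul_nonneg (Nat.cast_nonneg _) (hB0 _ _ _)
  have hq0 : ∀ q : ℕ × ℕ, 0 ≤ (∑ k ∈ Finset.range (m + 1 - (q.1 + q.2)),
      ((q.2 + k).choose k : ℝ) * |B q.1 (q.2 + k) k|) + |B q.1 q.2 1| := fun q =>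
    add_nonneg (hw _ _) (hB0 _ _ _)
  refine ⟨∑ q ∈ multiIdx m, ((∑ k ∈ Finset.range (m + 1 - (q.1 + q.2)),
      ((q.2 + k).choose k : ℝ) * |B q.1 (q.2 + k) k|) + |B q.1 q.2 1|),
    fun lam hlam hy q hq p => ?_⟩
  have hsum := Finset.single_le_sum (fun q _ => hq0 q) hq
  refine ⟨le_trans (le_trans ?_ (le_add_of_nonneg_right (hB0 _ _ _))) hsum,
    le_trans (le_trans ?_ (le_add_of_nonneg_left (hw _ _))) hsum⟩
  · refine norm_sum_le_of_le _ fun k _ => (norm_semi_smul_le hlam _ _ _).trans ?_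
    gcongr
    exact (hB _ _ _ lam hlam hy _).trans (le_abs_self _)
  · have h1 := hB q.1 q.2 1 lam hlam hy p.2
    rw [iteratedDeriv_one, pow_one, norm_smul, Real.norm_of_nonneg hlam.le] at h1
    rw [dcoef, fderiv_snd_apply (contDiff_semiSymb hg hlam hy _ _), one_smul, norm_smul, norm_neg,
      norm_mul, Complex.norm_I, one_mul, Complex.norm_real, Real.norm_of_nonneg hlam.le]
    exact h1.trans (le_abs_self _)

lemma semiWeyl_lead {j : ℕ} (hj : j ≤ m) (g : ℕ → ℕ → ℝ → Mat n) :
    semiWeyl m lam g j (m - j) = fun p => g j (m - j) p.2 := by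
  funext p
  have : m + 1 - (j + (m - j)) = 1 := by omega
  rw [semiWeyl, this, Finset.sum_range_one]
  simp

lemma isSmoothPeriodic_semiWeyl {g : ℕ → ℕ → ℝ → Mat n} (hg : ∀ i j, ContDiff ℝ ∞ (g i j))
    (hp : ∀ i j, Function.Periodic (g i j) (2 * Real.pi)) (i j : ℕ) :
    IsSmoothPeriodic (semiWeyl m lam g i j) := by
  have h : ∀ s : Finset ℕ, IsSmoothPeriodic fun p : ℝ × ℝ => ∑ k ∈ s,
      ((-(Complex.I * lam) / 2) ^ k * ((j + k).choose k : ℂ)) • iteratedDeriv k (g i (j + k)) p.2 := by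
    intro s
    induction s using Finset.induction_on with
    | empty => simpa using IsSmoothPeriodic.const (0 : Mat n)
    | insert a s ha ih =>
      simp only [Finset.sum_insert ha]
      exact ((isSmoothPeriodic_iteratedDeriv (hg _ _) (hp _ _) a).smul _).add ih
  exact h _

/-- The periodic Hamiltonian has the dominant part of the original one. -/
lemma hasDominantPart_semiWeyl {M₀ Mm : Mat n} {Γ : ℝ}
    (hg : ∀ q ∈ multiIdx m, IsGluable y₀ (s q.1 q.2) (s' q.1 q.2) (sp q.1 q.2) (sm q.1 q.2))
    (hr : ∀ y', ∃ y, ∀ ξ ζ, symbol m s' y' ξ ζ = symbol m s y ξ ζ)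
    (hh : ∀ y ξ ζ, (symbol m s y ξ ζ).IsHermitian)
    (hM : ∀ y, ∀ j ≤ m, AnticommCond j M₀ (leadCoeff m M₀ Mm s j y) ∧
      AnticommCond (m + j) Mm (leadCoeff m M₀ Mm s j y))
    (hlam : 0 < lam) (hy : lam * y₀ ≤ Real.pi / 2)
    (hΓ : ∀ q ∈ multiIdx m, ∀ p,
      ‖semiWeyl m lam (semiSymb m s s' lam) q.1 q.2 p‖ ≤ Γ ∧
      ‖dcoef lam (0, 1) (fun p => semiSymb m s s' lam q.1 q.2 p.2) p‖ ≤ Γ) :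
    HasDominantPart m lam M₀ Mm Γ (semiWeyl m lam (semiSymb m s s' lam)) := by
  have hmem : ∀ {j}, j ≤ m → (j, m - j) ∈ multiIdx m := fun {j} hj => mem_multiIdx.2 (by omega)
  refine ⟨fun q _ => isSmoothPeriodic_semiWeyl (contDiff_semiSymb hg hlam hy) periodic_semiSymb _ _,
    fun q hq p => (hΓ q hq p).1, fun j hj p => ?_, fun j hj p => ?_, fun j hj p => ?_,
    fun j hj p => ?_⟩
  · rw [semiWeyl_lead hj, fderiv_snd_apply (contDiff_semiSymb hg hlam hy _ _), zero_smul]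
  · rw [semiWeyl_lead hj]
    exact (hΓ _ (hmem hj) p).2
  · rw [semiWeyl_lead hj]
    obtain ⟨y₁, h1⟩ := exists_semiSymb_eq (lam := lam) hr p.2
    have := h1 _ (hmem hj)
    dsimp only at this ⊢
    rw [this]
    exact isHermitian_of_symbol (hh y₁) (hmem hj)
  · obtain ⟨y₁, h1⟩ := exists_semiSymb_eq (lam := lam) hr p.2
    have := h1 _ (hmem hj)
    dsimp only at this
    have e : remCoef m M₀ Mm (semiWeyl m lam (semiSymb m s s' lam)) j p =
        leadCoeff m M₀ Mm s j y₁ := by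
      simp only [remCoef, leadCoeff, semiWeyl_lead hj, this]
    rw [e]
    exact hM y₁ j hj

/-- Perturbations of lower order do not change the dominant part. -/
lemma HasDominantPart.add_lower {M₀ Mm : Mat n} {Γ Γ' : ℝ} {c d : ℕ → ℕ → ℝ × ℝ → Mat n}
    (h : HasDominantPart m lam M₀ Mm Γ c) (hΓ' : 0 ≤ Γ')
    (hd : ∀ q ∈ multiIdx m, IsSmoothPeriodic (d q.1 q.2))
    (hdb : ∀ q ∈ multiIdx m, ∀ p, ‖d q.1 q.2 p‖ ≤ Γ') (hd0 : ∀ j ≤ m, d j (m - j) = fun _ => 0) :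
    HasDominantPart m lam M₀ Mm (Γ + Γ') (fun i j p => c i j p + d i j p) := by
  have e : ∀ j ≤ m, (fun p => c j (m - j) p + d j (m - j) p) = c j (m - j) := fun j hj => by
    funext p; rw [hd0 j hj, add_zero]
  refine ⟨fun q hq => (h.smooth q hq).add (hd q hq),
    fun q hq p => (norm_add_le _ _).trans (add_le_add (h.bound q hq p) (hdb q hq p)),
    fun j hj p => ?_, fun j hj p => ?_, fun j hj p => ?_, fun j hj p => ?_⟩
  · rw [e j hj]; exact h.lead_x j hj p
  · rw [e j hj]; exact (h.lead_y j hj p).trans (le_add_of_nonneg_right hΓ')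
  · rw [congrFun (e j hj) p]; exact h.lead_herm j hj p
  · have : remCoef m M₀ Mm (fun i j p => c i j p + d i j p) j p = remCoef m M₀ Mm c j p := by
      rw [remCoef, remCoef, congrFun (e j hj) p]
    rw [this]
    exact h.cond j hj p

lemma diffT_of_symbJ_eq {c : ℕ → ℕ → ℝ × ℝ → Mat n} (hc : ∀ i j, IsSmoothPeriodic (c i j))
    {w : L2T n} {f : SP n} (h : symbJ n m lam w = toL2 f) :
    diffT m lam c w = toL2 ((∑ q ∈ multiIdx m,
      mulSP (c q.1 q.2) (hc q.1 q.2) * (lx lam ^ q.1 * ly lam ^ q.2) : Module.End ℂ (SP n)) f) := by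
  rw [diffT, sum_apply, LinearMap.sum_apply, map_sum]
  refine Finset.sum_congr rfl fun q hq => ?_
  rw [ContinuousLinearMap.comp_apply, symbG_of_symbJ_eq h (mem_multiIdx.1 hq), ← toL2_mulSP (hc _ _)]
  rfl

lemma diffT_symm {c : ℕ → ℕ → ℝ × ℝ → Mat n} (hc : ∀ i j, IsSmoothPeriodic (c i j))
    (h : IsSymm (∑ q ∈ multiIdx m,
      mulSP (c q.1 q.2) (hc q.1 q.2) * (lx lam ^ q.1 * ly lam ^ q.2) : Module.End ℂ (SP n)))
    (w w' : L2T n) :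
    (inner ℂ (diffT m lam c w) (symbJ n m lam w') : ℂ) =
      inner ℂ (symbJ n m lam w) (diffT m lam c w') := by
  refine symm_of_smooth (fun f g w w' hf hg => ?_) w w'
  rw [diffT_of_symbJ_eq hc hf, diffT_of_symbJ_eq hc hg, hf, hg]
  exact h f g

/-- The Weyl quantization of a Hermitian symbol that depends on `y` is symmetric. -/
lemma isSymm_semiWeyl {g : ℕ → ℕ → ℝ → Mat n} (hg : ∀ i j, ContDiff ℝ ∞ (g i j))
    (hp : ∀ i j, Function.Periodic (g i j) (2 * Real.pi))
    (hh : ∀ q ∈ multiIdx m, ∀ y, (g q.1 q.2 y).IsHermitian) :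
    IsSymm (∑ q ∈ multiIdx m, mulSP (semiWeyl m lam g q.1 q.2)
      (isSmoothPeriodic_semiWeyl hg hp q.1 q.2) * (lx lam ^ q.1 * ly lam ^ q.2) :
        Module.End ℂ (SP n)) := by
  have h1 : ∀ q : ℕ × ℕ, mulSP (semiWeyl m lam g q.1 q.2)
      (isSmoothPeriodic_semiWeyl hg hp q.1 q.2) = ∑ k ∈ Finset.range (m + 1 - (q.1 + q.2)),
      ((-(Complex.I * lam) / 2) ^ k * ((q.2 + k).choose k : ℂ)) •
        mulDeriv (hg q.1 (q.2 + k)) (hp q.1 (q.2 + k)) k := fun q => by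
    refine LinearMap.ext fun f => Subtype.ext (funext fun p => ?_)
    rw [LinearMap.sum_apply, coe_mulSP, semiWeyl, ← actL_apply, map_sum, sum_apply,
      AddSubmonoidClass.coe_finsetSum, Finset.sum_apply]
    refine Finset.sum_congr rfl fun k _ => ?_
    rw [actL_apply, act_smul]
    rfl
  have h2 : IsSymm (∑ q ∈ multiIdx m, ∑ k ∈ Finset.range (q.2 + 1),
      ((-(Complex.I * lam) / 2) ^ k * (q.2.choose k : ℂ)) •
        (mulDeriv (hg q.1 q.2) (hp q.1 q.2) k * (lx lam ^ q.1 * ly lam ^ (q.2 - k)))) :=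
    IsSymm.sum fun q hq => isSymm_lx_pow_mul lam _ _ (hh q hq) _ _
  convert h2 using 1
  simp only [h1, Finset.sum_mul, smul_mul_assoc]
  rw [Finset.sum_sigma', Finset.sum_sigma']
  -- The sum by order of the resulting `D_y` power is reindexed as a sum by power of `ζ` in the
  -- symbol: `j` becomes `j + k`.
  refine Finset.sum_bij' (fun x _ => ⟨(x.1.1, x.1.2 + x.2), x.2⟩)
    (fun x _ => ⟨(x.1.1, x.1.2 - x.2), x.2⟩) ?_ ?_ ?_ ?_ ?_
  · rintro ⟨⟨i, j⟩, k⟩ h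
    simp only [Finset.mem_sigma, mem_multiIdx, Finset.mem_range] at h ⊢
    omega
  · rintro ⟨⟨i, j⟩, k⟩ h
    simp only [Finset.mem_sigma, mem_multiIdx, Finset.mem_range] at h ⊢
    omega
  · rintro ⟨⟨i, j⟩, k⟩ h
    simp
  · rintro ⟨⟨i, j⟩, k⟩ h
    simp only [Finset.mem_sigma, mem_multiIdx, Finset.mem_range] at h
    have : j - k + k = j := by omega
    simp only [this]
  · rintro ⟨⟨i, j⟩, k⟩ h
    simp only [Nat.add_sub_cancel]

end Coefficients

/-! ### Stability of the conductivity for elliptic realizations. -/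

section Stability

open Filter Topology

variable {n m : ℕ}

/-- `A` is the operator `∑ c_{ij} (λ D_x)^i (λ D_y)^j` with domain the Sobolev space of order `m`,
symmetric and with a dominant part. -/
structure IsEllipticRealization (m : ℕ) (lam : ℝ) (M₀ Mm : Mat n) (Γ : ℝ)
    (c : ℕ → ℕ → ℝ × ℝ → Mat n) (A : L2T n →ₗ.[ℂ] L2T n) : Prop where
  dom : HasDominantPart m lam M₀ Mm Γ c
  symm : ∀ w w' : L2T n, (inner ℂ (diffT m lam c w) (symbJ n m lam w') : ℂ) =
    inner ℂ (symbJ n m lam w) (diffT m lam c w')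
  mem_graph : ∀ u g, (u, g) ∈ A.graph ↔ ∃ w, symbJ n m lam w = u ∧ diffT m lam c w = g

/-- The bound `L` depends on the operator only through `m`, `M₀`, `Mm` and `Γ`, hence neither on `λ`
nor on the perturbation. -/
lemma exists_realization (n : ℕ) {m : ℕ} (hm : 1 ≤ m) {M₀ Mm : Mat n} (hd : IsDominant m M₀ Mm)
    {Γ : ℝ} (hΓ : 0 ≤ Γ) : ∃ L : ℝ, 0 ≤ L ∧ ∀ lam c A, IsEllipticRealization m lam M₀ Mm Γ c A →
      ∃ N N' : L2T n →L[ℂ] L2T n, Realization A (symbJ n m lam) (diffT m lam c) N N' ∧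
        ‖N‖ ≤ L ∧ ‖N'‖ ≤ L := by
  obtain ⟨C, hC, hest⟩ := exists_a_priori_bound n hm hd hΓ
  refine ⟨2 * C, by positivity, fun lam c A h => ?_⟩
  obtain ⟨N, h1, h2, h3⟩ := exists_inverse hC hd (hest lam c h.dom) h.symm (Or.inl rfl)
  obtain ⟨N', h1', h2', h3'⟩ := exists_inverse hC hd (hest lam c h.dom) h.symm (Or.inr rfl)
  exact ⟨N, N', ⟨h.mem_graph, denseRange_symbJ m lam, h.symm, h1, h2, h1', h2'⟩, h3, h3'⟩

lemma norm_diffT_le {lam Γ : ℝ} {c : ℕ → ℕ → ℝ × ℝ → Mat n}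
    (hΓ : 0 ≤ Γ) (hc : ∀ q ∈ multiIdx m, Continuous (c q.1 q.2))
    (hb : ∀ q ∈ multiIdx m, ∀ p, ‖c q.1 q.2 p‖ ≤ Γ) :
    ‖diffT m lam c‖ ≤ (multiIdx m).card * Γ := by
  rw [diffT, ← nsmul_eq_mul]
  refine Finset.sum_const (s := multiIdx m) Γ ▸ norm_sum_le_of_le _ fun q hq => ?_
  refine ContinuousLinearMap.opNorm_le_bound _ hΓ fun w => ?_
  refine (norm_matMul_apply_le (hc q hq) (hb q hq) _).trans ?_
  gcongr
  exact norm_symbG_apply_le lam (mem_multiIdx.1 hq) w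

/-- A real number estimate that collects the constants of the stability theorem. -/
lemma rank_mul_le {ρ n Λ lam X : ℝ} (N : ℕ) (hlam : 0 < lam) (hρ : ρ ≤ n * ((2 * Λ + 1) / lam) ^ 2)
    (hX : 0 ≤ X) :
    2 * ρ * (X * lam ^ (N + 2)) ≤ 2 * n * (2 * Λ + 1) ^ 2 * X * lam ^ N := by
  calc 2 * ρ * (X * lam ^ (N + 2)) ≤
      2 * (n * ((2 * Λ + 1) / lam) ^ 2) * (X * lam ^ (N + 2)) := by gcongr
    _ = _ := by
      rw [div_pow, pow_add]
      field_simp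

/-- The conductivity is well defined for elliptic realizations, and changes by `O(λ^N)` under
perturbations that are separated from the part of the interface where the filter is not `1`. -/
theorem conductivity_stable (hm : 1 ≤ m) {lam₀ : ℝ} (hlam₀ : lam₀ ≤ 1) {M₀ Mm : Mat n}
    (hd : IsDominant m M₀ Mm) {Γ : ℝ} (hΓ : 0 ≤ Γ) {A A' : ℝ → L2T n →ₗ.[ℂ] L2T n}
    {c c' : ℝ → ℕ → ℕ → ℝ × ℝ → Mat n}
    (hA : ∀ lam ∈ Ioc 0 lam₀, IsEllipticRealization m lam M₀ Mm Γ (c lam) (A lam))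
    (hA' : ∀ lam ∈ Ioc 0 lam₀, IsEllipticRealization m lam M₀ Mm Γ (c' lam) (A' lam))
    {φ χ : ℝ → ℝ} (hφ : ContDiff ℝ ∞ (deriv φ)) (hφc : HasCompactSupport (deriv φ))
    (hχ : ContDiff ℝ ∞ χ) (hχc : HasCompactSupport χ) (hχφ : ∀ x, χ x * deriv φ x = deriv φ x)
    {P Q : ℝ × ℝ → ℝ} (hP : IsSmoothPeriodic P) (hQ : IsSmoothPeriodic Q)
    {K S : Set (ℝ × ℝ)} (hK : IsClosed K) (hS : IsClosed S)
    (hSp : ∀ x y : ℝ, ((x + 2 * Real.pi, y) ∈ S ↔ (x, y) ∈ S) ∧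
      ((x, y + 2 * Real.pi) ∈ S ↔ (x, y) ∈ S)) (hKS : Disjoint K S)
    (hPQ : ∀ p, p ∉ K → Q p = 1 ∨ ∀ᶠ q in 𝓝 p, P q = P p)
    (hcc : ∀ lam ∈ Ioc 0 lam₀, ∀ p, p ∉ S → ∀ q ∈ multiIdx m, c lam q.1 q.2 p = c' lam q.1 q.2 p) :
    (∀ lam ∈ Ioc 0 lam₀, ConductivityWellDefined (A lam) P Q φ ∧
      ConductivityWellDefined (A' lam) P Q φ) ∧
    ∀ N : ℕ, ∃ C, ∀ lam ∈ Ioc 0 lam₀,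
      ‖conductivity (A' lam) P Q φ - conductivity (A lam) P Q φ‖ ≤ C * lam ^ N := by
  obtain ⟨L, hL0, hL⟩ := exists_realization n hm hd hΓ
  obtain ⟨M, hM⟩ := (contDiff_resolventWeight hχ).continuous.bounded_above_of_compact_support
    (hasCompactSupport_resolventWeight hχc)
  have hM0 : 0 ≤ M := (norm_nonneg _).trans (hM 0)
  -- On the range in question `‖w‖ ≤ L M ‖J w‖`, while `‖J w‖ ≤ Λ⁻¹ ‖w‖` without modes of weight at
  -- most `Λ`; so `Λ` must exceed `L M`.
  set Λ : ℝ := L * M + 1 with hΛ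
  have hLM : 0 ≤ L * M := mul_nonneg hL0 hM0
  have hΛ1 : 1 ≤ Λ := by rw [hΛ]; linarith
  have hLMΛ : L * M * Λ⁻¹ < 1 := by
    rw [← div_eq_mul_inv, div_lt_one (by linarith)]; linarith
  have hKint : ∀ lam ∈ Ioc 0 lam₀, ∀ {ψ : ℝ × ℝ → ℝ} (hψ : IsSmoothPeriodic ψ),
      (mulOp ψ * symbJ n m lam : L2T n →L[ℂ] L2T n) =
        symbJ n m lam * intertwiner m lam (scal n ψ) hψ.scal := fun lam hlam ψ hψ => by
    rw [mulOp_eq_matMul hψ, matMul_mul_symbJ m hlam.1.le (hlam.2.trans hlam₀) hψ.scal]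
  have hspec : ∀ (A : ℝ → L2T n →ₗ.[ℂ] L2T n) (c : ℝ → ℕ → ℕ → ℝ × ℝ → Mat n),
      (∀ lam ∈ Ioc 0 lam₀, IsEllipticRealization m lam M₀ Mm Γ (c lam) (A lam)) →
      ∀ lam ∈ Ioc 0 lam₀, ∃ N N' : L2T n →L[ℂ] L2T n,
        Realization (A lam) (symbJ n m lam) (diffT m lam (c lam)) N N' ∧ ‖N‖ ≤ L ∧ ‖N'‖ ≤ L ∧
        FiniteRank (N * weightCalc (deriv φ) (symbJ n m lam) N) ∧
        (Module.finrank ℂ (N * weightCalc (deriv φ) (symbJ n m lam) N).range : ℝ) ≤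
          n * ((2 * Λ + 1) / lam) ^ 2 ∧
        ConductivityWellDefined (A lam) P Q φ ∧
        conductivity (A lam) P Q φ = -Complex.I * trace (edgeOp m lam (c lam) P Q hP *
          (N * weightCalc (deriv φ) (symbJ n m lam) N)) := by
    intro A c hA lam hlam
    obtain ⟨N, N', hr, hN, hN'⟩ := hL lam _ _ (hA lam hlam)
    obtain ⟨ι, _, ev, hev, hcard⟩ :=
      exists_low_modes n hm hlam.1 (hlam.2.trans hlam₀) hΛ1
    obtain ⟨h1, h2⟩ := hr.finrank_weightCalc_le hφ hφc hχ hχc hχφ hM0 hM hN hLMΛ ev hev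
    obtain ⟨h3, h4, h5⟩ := hr.conductivity_spec hφ hφc hχ hχc hχφ h1 (Q := mulOp Q)
      (hKint lam hlam hP)
    exact ⟨N, N', hr, hN, hN', h1, le_trans (by exact_mod_cast h2) hcard,
      ⟨hr.isSelfAdjoint, h3, h4⟩, h5⟩
  refine ⟨fun lam hlam => ?_, fun N => ?_⟩
  · obtain ⟨_, _, _, _, _, _, _, h, _⟩ := hspec A c hA lam hlam
    obtain ⟨_, _, _, _, _, _, _, h', _⟩ := hspec A' c' hA' lam hlam
    exact ⟨h, h'⟩
  obtain ⟨ψ, hψ, hψn, hψK, hψS⟩ := exists_cutoffs hK hS hSp hKS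
  choose γ hγ0 hγ using fun i => exists_norm_commutator_le m (hψ i).scal (n := n) hΓ
  obtain ⟨β, hβ0, hβ⟩ := exists_norm_commutator_le m hP.scal (n := n) hΓ
  set κ := ‖(mulOp Q : L2T n →L[ℂ] L2T n)‖
  have hκ0 : 0 ≤ κ := norm_nonneg _
  obtain ⟨a, b, hab, hs⟩ := exists_cayley_series (contDiff_resolventWeight hφ)
    (hasCompactSupport_resolventWeight hφc)
  -- The locality constant at `r = N + 2`; the two extra powers of `λ` pay for the rank.
  set X := (∑' k, (‖a k‖ + ‖b k‖) * (2 * (k : ℝ) + 1) ^ (N + 2 + 1)) *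
    ((1 + κ) * β * L * (∏ s ∈ Finset.range (N + 2), γ s * L) *
      (((multiIdx m).card * Γ + (multiIdx m).card * Γ) * L)) with hX
  have hX0 : 0 ≤ X := by
    have h1 : 0 ≤ ∏ s ∈ Finset.range (N + 2), γ s * L :=
      Finset.prod_nonneg fun s _ => mul_nonneg (hγ0 s) hL0
    have h2 : 0 ≤ ∑' k, (‖a k‖ + ‖b k‖) * (2 * (k : ℝ) + 1) ^ (N + 2 + 1) :=
      tsum_nonneg fun k => by positivity
    rw [hX]
    positivity
  refine ⟨2 * n * (2 * Λ + 1) ^ 2 * X, fun lam hlam => ?_⟩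
  have h0 := hlam.1.le
  have h1 := hlam.2.trans hlam₀
  obtain ⟨N₀, N₀', hr, hN, hN', hf, hrk, -, htr⟩ := hspec A c hA lam hlam
  obtain ⟨N₁, N₁', hr₁, hN₁, hN₁', hf₁, hrk₁, -, htr₁⟩ := hspec A' c' hA' lam hlam
  have hc : ∀ q ∈ multiIdx m, Continuous (c lam q.1 q.2) := fun q hq =>
    ((hA lam hlam).dom.smooth q hq).smooth.continuous
  have hc' : ∀ q ∈ multiIdx m, Continuous (c' lam q.1 q.2) := fun q hq =>
    ((hA' lam hlam).dom.smooth q hq).smooth.continuous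
  have hB : edgeOp m lam (c lam) P Q hP = edgeOp m lam (c' lam) P Q hP := by
    refine edgeOp_congr h0 h1 hc hc' hP hQ fun p _ => ?_
    by_cases hp : p ∈ K
    · exact Or.inr (Or.inr (hcc lam hlam p (Set.disjoint_left.1 hKS hp)))
    · exact (hPQ p hp).imp_right Or.inl
  have hcomm : ∀ (ψ : ℝ × ℝ → ℝ) (a : ℕ → ℕ → ℝ × ℝ → Mat n), ∀ q ∈ multiIdx m, ∀ p,
      Commute (scal n ψ p) (a q.1 q.2 p) := fun ψ a q _ p => scal_commute ψ p _
  -- The commutators are taken with the perturbed operator. The cutoffs depend only on `K` and `S`,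
  -- hence not on `λ`.
  have hch : CutoffChain (symbJ n m lam) (diffT m lam (c' lam))
      (diffT m lam (c' lam) - diffT m lam (c lam)) (edgeOp m lam (c' lam) P Q hP)
      (fun i => mulOp (ψ i)) (fun i => intertwiner m lam (scal n (ψ i)) (hψ i).scal) := by
    refine ⟨fun i => hKint lam hlam (hψ i), ?_, fun i => ?_, fun i => ?_⟩
    · refine edgeOp_mul_intertwiner h0 h1 hc' hP hQ (hψ 0) fun p hp => ?_
      by_cases hpK : p ∈ K
      · exact Or.inr (Or.inr (hψK p ⟨hpK, cell_subset_closedCell hp⟩))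
      · exact (hPQ p hpK).imp_right Or.inl
    · exact commutator_mul_intertwiner h0 h1 hc' (hψ i) (hψ (i + 1)) (hψn i)
    · refine mulOp_mul_diffT_sub hc' hc (hψ i) fun p hp => ?_
      by_cases hpS : p ∈ S
      · exact Or.inl (hψS i p ⟨hpS, cell_subset_closedCell hp⟩)
      · exact Or.inr fun q hq => (hcc lam hlam p hpS q hq).symm
  have hβ' : ‖edgeOp m lam (c' lam) P Q hP‖ ≤ (1 + κ) * β := by
    refine (norm_mul_le _ _).trans (mul_le_mul ?_ ?_ (norm_nonneg _) (by linarith))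
    · exact (norm_sub_le _ _).trans (add_le_add ContinuousLinearMap.norm_id_le le_rfl)
    · rw [mulOp_eq_matMul hP]
      exact (hβ lam h0 h1 _ hc' (hA' lam hlam).dom.bound (hcomm _ _)).trans
        (mul_le_of_le_one_right hβ0 h1)
  have hν : ‖diffT m lam (c' lam) - diffT m lam (c lam)‖ ≤
      (multiIdx m).card * Γ + (multiIdx m).card * Γ :=
    (norm_sub_le _ _).trans (add_le_add (norm_diffT_le hΓ hc' (hA' lam hlam).dom.bound)
      (norm_diffT_le hΓ hc (hA lam hlam).dom.bound))
  have hab0 := hab 0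
  simp only [pow_zero, mul_one] at hab0
  have hdiff := hr₁.norm_mul_weightCalc_sub_le hr hφ hφc hab0 hs (r := N + 2) (hab _) hch
    hN₁ hN₁' hN hN' hν hβ' (γ := γ) (ε := lam) fun i => by
      rw [mulOp_eq_matMul (hψ i)]
      exact hγ i lam h0 h1 _ hc' (hA' lam hlam).dom.bound (hcomm _ _)
  rw [htr, htr₁, hB, ← mul_sub, norm_mul, norm_neg, Complex.norm_I, one_mul]
  refine (norm_trace_sub_le (hf₁.mul_left _) (hf.mul_left _)
    ((Nat.cast_le.2 (finrank_range_mul_le hf₁ _)).trans hrk₁)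
    ((Nat.cast_le.2 (finrank_range_mul_le hf _)).trans hrk)).trans ?_
  -- Ranks of order `λ⁻²` against a norm difference of order `λ^(N + 2)`.
  refine le_trans ?_ (rank_mul_le N hlam.1 le_rfl hX0)
  gcongr

end Stability

/-! ### Adding a perturbation of lower order. -/

section Operators

open Filter Topology

variable {n m : ℕ} {lam : ℝ}

lemma diffT_add_apply {c d : ℕ → ℕ → ℝ × ℝ → Mat n} (hc : ∀ q ∈ multiIdx m, Continuous (c q.1 q.2))
    (hd : ∀ q ∈ multiIdx m, Continuous (d q.1 q.2)) (w : L2T n) :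
    diffT m lam (fun i j p => c i j p + d i j p) w = diffT m lam c w + diffT m lam d w := by
  simp only [diffT, sum_apply, ContinuousLinearMap.comp_apply]
  rw [← Finset.sum_add_distrib]
  exact Finset.sum_congr rfl fun q hq => matMul_add_apply (hc q hq) (hd q hq) _

/-- The coefficients of a differential expression of order `k`, extended by `0`. -/
def lowerCoeff (k : ℕ) (v : ℕ → ℕ → ℝ × ℝ → Mat n) (i j : ℕ) (p : ℝ × ℝ) : Mat n :=
  if i + j ≤ k then v i j p else 0

lemma lowerCoeff_of_mem {k : ℕ} {v : ℕ → ℕ → ℝ × ℝ → Mat n} {q : ℕ × ℕ} (hq : q ∈ multiIdx k) :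
    lowerCoeff k v q.1 q.2 = v q.1 q.2 :=
  funext fun _ => if_pos (mem_multiIdx.1 hq)

lemma lowerCoeff_of_notMem {k : ℕ} {v : ℕ → ℕ → ℝ × ℝ → Mat n} {q : ℕ × ℕ} (hq : q ∉ multiIdx k) :
    lowerCoeff k v q.1 q.2 = fun _ => 0 :=
  funext fun _ => if_neg fun h => hq (mem_multiIdx.2 h)

lemma isSmoothPeriodic_lowerCoeff {k : ℕ} {v : ℕ → ℕ → ℝ × ℝ → Mat n}
    (hv : ∀ q ∈ multiIdx k, IsSmoothPeriodic (v q.1 q.2)) (i j : ℕ) :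
    IsSmoothPeriodic (lowerCoeff k v i j) := by
  by_cases h : (i, j) ∈ multiIdx k
  · rw [show lowerCoeff k v i j = v i j from lowerCoeff_of_mem h]
    exact hv _ h
  · rw [show lowerCoeff k v i j = fun _ => 0 from lowerCoeff_of_notMem h]
    exact IsSmoothPeriodic.const 0

lemma multiIdx_mono {k : ℕ} (h : k ≤ m) : multiIdx k ⊆ multiIdx m := fun _ hq =>
  mem_multiIdx.2 ((mem_multiIdx.1 hq).trans h)

/-- An element of the Sobolev space of order `m` is in the domain of operators of lower order. -/
lemma mem_diffOp_graph_of_le {k : ℕ} (hk : k ≤ m) (hlam : lam ≠ 0) {v : ℕ → ℕ → ℝ × ℝ → Mat n}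
    (hv : ∀ q ∈ multiIdx k, IsSmoothPeriodic (v q.1 q.2)) (w : L2T n) :
    (symbJ n m lam w, diffT m lam (lowerCoeff k v) w) ∈ (diffOp k (scaledCoeff lam v)).graph := by
  have hv' : ∀ q ∈ multiIdx k, Continuous (v q.1 q.2) := fun q hq => (hv q hq).smooth.continuous
  rw [mem_diffOp_graph_iff hlam hv' (fun _ _ _ => rfl),
    ← mem_diffGraph_iff hlam hv' (c := scaledCoeff lam v) (fun _ _ _ => rfl)]
  obtain ⟨d, hd, hg⟩ := (mem_diffGraph_iff hlam
    (fun q _ => (isSmoothPeriodic_lowerCoeff hv q.1 q.2).smooth.continuous)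
    (c := scaledCoeff lam (lowerCoeff k v)) (fun _ _ _ => rfl) _ _).2
    ⟨w, rfl, rfl⟩
  refine ⟨d, fun q hq => hd q (multiIdx_mono hk hq), ?_⟩
  filter_upwards [hg] with p hp
  refine hp.trans ?_
  rw [← Finset.sum_subset (multiIdx_mono hk)]
  · refine Finset.sum_congr rfl fun q hq => ?_
    rw [scaledCoeff, scaledCoeff, lowerCoeff_of_mem hq]
  · intro q _ hq
    rw [scaledCoeff, lowerCoeff_of_notMem hq, smul_zero, act_zero]

/-- The domain of the sum is the intersection of Sobolev spaces of orders `m` and `k ≤ m`, that is,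
the one of order `m`; single-valuedness of the graphs identifies the values. -/
lemma mem_graph_add_iff {k : ℕ} (hk : k ≤ m) (hlam : lam ≠ 0) {A : L2T n →ₗ.[ℂ] L2T n}
    {c v : ℕ → ℕ → ℝ × ℝ → Mat n} (hc : ∀ q ∈ multiIdx m, Continuous (c q.1 q.2))
    (hv : ∀ q ∈ multiIdx k, IsSmoothPeriodic (v q.1 q.2))
    (hA : ∀ u g, (u, g) ∈ A.graph ↔ ∃ w, symbJ n m lam w = u ∧ diffT m lam c w = g) (u g : L2T n) :
    (u, g) ∈ (A + diffOp k (scaledCoeff lam v)).graph ↔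
      ∃ w, symbJ n m lam w = u ∧ diffT m lam (fun i j p => c i j p + lowerCoeff k v i j p) w = g := by
  have hadd := diffT_add_apply (lam := lam) hc
    (fun q _ => (isSmoothPeriodic_lowerCoeff hv q.1 q.2).smooth.continuous)
  constructor
  · intro h
    obtain ⟨x, rfl, rfl⟩ := (LinearPMap.mem_graph_iff _).1 h
    obtain ⟨w, hw, hw'⟩ := (hA _ _).1 (A.mem_graph ⟨x, x.2.1⟩)
    refine ⟨w, hw, ?_⟩
    have h1 := mem_diffOp_graph_of_le hk hlam hv w
    have h2 := LinearPMap.mem_graph_snd_inj _ h1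
      ((diffOp k (scaledCoeff lam v)).mem_graph ⟨x, x.2.2⟩) hw
    rw [hadd, hw', h2]
    rfl
  · rintro ⟨w, rfl, rfl⟩
    have h1 := mem_diffOp_graph_of_le hk hlam hv w
    have h2 := (hA _ _).2 ⟨w, rfl, rfl⟩
    have d1 := LinearPMap.mem_domain_of_mem_graph h1
    have d2 := LinearPMap.mem_domain_of_mem_graph h2
    have e1 := LinearPMap.mem_graph_snd_inj _ h1
      ((diffOp k (scaledCoeff lam v)).mem_graph ⟨_, d1⟩) rfl
    have e2 := LinearPMap.mem_graph_snd_inj _ h2 (A.mem_graph ⟨_, d2⟩) rfl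
    refine (LinearPMap.mem_graph_iff _).2 ⟨⟨_, d2, d1⟩, rfl, ?_⟩
    rw [hadd, e1, e2]
    rfl

/-- The symmetry of an expression of lower order, in terms of `diffT`. -/
lemma diffT_lowerCoeff_symm {k : ℕ} (hk : k ≤ m) {v : ℕ → ℕ → ℝ × ℝ → Mat n}
    (hv : ∀ q ∈ multiIdx k, IsSmoothPeriodic (v q.1 q.2))
    (hs : IsSymmetricDiff k (scaledCoeff lam v)) (w w' : L2T n) :
    (inner ℂ (diffT m lam (lowerCoeff k v) w) (symbJ n m lam w') : ℂ) =
      inner ℂ (symbJ n m lam w) (diffT m lam (lowerCoeff k v) w') := by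
  have hc := isSmoothPeriodic_lowerCoeff hv
  refine diffT_symm hc (fun f g => ?_) w w'
  have e : ∀ f : SP n, (((∑ q ∈ multiIdx m, mulSP (lowerCoeff k v q.1 q.2) (hc q.1 q.2) *
      (lx lam ^ q.1 * ly lam ^ q.2) : Module.End ℂ (SP n)) f : SP n) : ℝ × ℝ → Cn n) =
      diffExpr k (scaledCoeff lam v) f := fun f => by
    funext p
    rw [LinearMap.sum_apply, AddSubmonoidClass.coe_finsetSum, Finset.sum_apply, diffExpr,
      ← Finset.sum_subset (multiIdx_mono hk)]
    · refine Finset.sum_congr rfl fun q hq => ?_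
      rw [Module.End.mul_apply, coe_mulSP, coe_lx_ly, lowerCoeff_of_mem hq, scaledCoeff, act_smul,
        Pi.smul_apply, ← actL_apply, map_smul, actL_apply, ← pow_add, Complex.ofReal_pow]
    · intro q _ hq
      rw [Module.End.mul_apply, coe_mulSP, lowerCoeff_of_notMem hq, act_zero]
  rw [inner_toL2_toL2, inner_toL2_toL2, e, e]
  exact hs f g f.2 g.2

end Operators

/-! ### Switch functions, filters and the support of `(1 - Q) P'`. -/

section Switches

open Filter Topology

lemma IsSwitch.deriv_eq_zero {e₁ e₂ c₁ c₂ : ℝ} {f : ℝ → ℝ} (h : IsSwitch c₁ c₂ e₁ e₂ f) {x : ℝ}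
    (hx : x ∉ Icc e₁ e₂) : deriv f x = 0 := by
  obtain ⟨-, δ, hδ, h1, h2⟩ := h
  by_cases hx1 : x < e₁
  · have : f =ᶠ[𝓝 x] fun _ => c₁ := by
      filter_upwards [Iio_mem_nhds hx1] with z hz
      exact h1 z (by rw [mem_Iio] at hz; linarith)
    rw [this.deriv_eq, deriv_const]
  · have hx2 : e₂ < x := by
      by_contra hcon
      exact hx ⟨not_lt.1 hx1, not_lt.1 hcon⟩
    have : f =ᶠ[𝓝 x] fun _ => c₂ := by
      filter_upwards [Ioi_mem_nhds hx2] with z hz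
      exact h2 z (by rw [mem_Ioi] at hz; linarith)
    rw [this.deriv_eq, deriv_const]

lemma IsSwitch.contDiff_deriv {e₁ e₂ c₁ c₂ : ℝ} {f : ℝ → ℝ} (h : IsSwitch c₁ c₂ e₁ e₂ f) :
    ContDiff ℝ ∞ (deriv f) :=
  (contDiff_infty_iff_deriv.1 h.1).2

lemma IsSwitch.hasCompactSupport_deriv {e₁ e₂ c₁ c₂ : ℝ} {f : ℝ → ℝ}
    (h : IsSwitch c₁ c₂ e₁ e₂ f) : HasCompactSupport (deriv f) :=
  HasCompactSupport.intro isCompact_Icc fun _ hx => h.deriv_eq_zero hx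

/-- A smooth compactly supported function that is `1` on the support of the derivative of a
switch function. -/
lemma IsSwitch.exists_cutoff {e₁ e₂ c₁ c₂ : ℝ} {f : ℝ → ℝ} (h : IsSwitch c₁ c₂ e₁ e₂ f) :
    ∃ χ : ℝ → ℝ, ContDiff ℝ ∞ χ ∧ HasCompactSupport χ ∧ ∀ x, χ x * deriv f x = deriv f x := by
  let g : ContDiffBump (0 : ℝ) := ⟨|e₁| + |e₂| + 1, |e₁| + |e₂| + 2, by positivity, by linarith⟩
  refine ⟨g, g.contDiff, g.hasCompactSupport, fun x => ?_⟩
  by_cases hx : x ∈ Icc e₁ e₂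
  · rw [g.one_of_mem_closedBall, one_mul]
    rw [mem_closedBall_zero_iff, Real.norm_eq_abs]
    change |x| ≤ |e₁| + |e₂| + 1
    rw [abs_le]
    constructor
    · linarith [neg_abs_le e₁, hx.1, abs_nonneg e₂]
    · linarith [le_abs_self e₂, hx.2, abs_nonneg e₁]
  · rw [h.deriv_eq_zero hx, mul_zero]

lemma isSmoothPeriodic_fst {P : ℝ → ℝ} (h : ContDiff ℝ ∞ P)
    (hp : Function.Periodic P (2 * Real.pi)) : IsSmoothPeriodic fun p : ℝ × ℝ => P p.1 where
  smooth := h.comp contDiff_fst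
  periodic_x x _ := hp x
  periodic_y _ _ := rfl

lemma isSmoothPeriodic_fst_mul_snd {f g : ℝ → ℝ} (hf : ContDiff ℝ ∞ f) (hg : ContDiff ℝ ∞ g)
    (hfp : Function.Periodic f (2 * Real.pi)) (hgp : Function.Periodic g (2 * Real.pi)) :
    IsSmoothPeriodic fun p : ℝ × ℝ => f p.1 * g p.2 where
  smooth := (hf.comp contDiff_fst).mul (hg.comp contDiff_snd)
  periodic_x x y := by rw [hfp]
  periodic_y x y := by rw [hgp]

lemma eventually_eq_of_deriv_eq_zero {f : ℝ → ℝ} (hf : Differentiable ℝ f) {x : ℝ}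
    (h : ∀ᶠ z in 𝓝 x, deriv f z = 0) : ∀ᶠ z in 𝓝 x, f z = f x := by
  obtain ⟨ε, hε, hb⟩ := Metric.eventually_nhds_iff_ball.1 h
  filter_upwards [Metric.ball_mem_nhds x hε] with z hz
  exact Metric.isOpen_ball.is_const_of_deriv_eq_zero (convex_ball x ε).isPreconnected
    hf.differentiableOn (fun y hy => hb y hy) hz (Metric.mem_ball_self hε)

/-- Away from the support of `(1 - Q) P'`, either `Q = 1` or `P` is locally constant. -/
lemma eq_one_or_eventually_eq {P : ℝ → ℝ} {Q : ℝ × ℝ → ℝ} (hP : Differentiable ℝ P)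
    (hQ : Continuous Q) {p : ℝ × ℝ}
    (hp : p ∉ tsupport fun p : ℝ × ℝ => (1 - Q p) * deriv P p.1) :
    Q p = 1 ∨ ∀ᶠ q : ℝ × ℝ in 𝓝 p, P q.1 = P p.1 := by
  refine or_iff_not_imp_left.2 fun hQp => ?_
  have h1 := notMem_tsupport_iff_eventuallyEq.1 hp
  have h2 : ∀ᶠ q in 𝓝 p, Q q ≠ 1 := hQ.continuousAt.eventually_ne hQp
  have h3 : ∀ᶠ q : ℝ × ℝ in 𝓝 p, deriv P q.1 = 0 := by
    filter_upwards [h1, h2] with q g1 g2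
    exact (mul_eq_zero.1 g1).resolve_left (sub_ne_zero.2 g2.symm)
  -- Restriction to the horizontal line through `p` gives a statement about `P` in one variable.
  have h4 : Tendsto (fun x : ℝ => (x, p.2)) (𝓝 p.1) (𝓝 p) :=
    (Continuous.prodMk_left p.2).tendsto' _ _ rfl
  exact continuous_fst.continuousAt.eventually (eventually_eq_of_deriv_eq_zero hP (h4.eventually h3))

end Switches

/-! ### The periodic Hamiltonians as elliptic realizations. -/

section PeriodicHamiltonian

variable {m n : ℕ} {E₁ E₂ y₀ lam₀ : ℝ} {s s' : ℕ → ℕ → ℝ → Mat n} {sp sm : ℕ → ℕ → Mat n}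

/-- The periodic Hamiltonian and its perturbations by lower order terms are elliptic realizations
with bounds that are uniform in the semiclassical parameter. -/
lemma exists_isEllipticRealization (hm : 1 ≤ m) (hs : IsBulkHamiltonian m E₁ E₂ y₀ s sp sm)
    (hs' : IsReversedWall m y₀ s s' sp sm) (hy₀ : 0 < y₀) (hglue : lam₀ * y₀ ≤ Real.pi / 2)
    {v : ℝ → ℕ → ℕ → ℝ × ℝ → Mat n}
    (hv_smooth : ∀ lam ∈ Set.Ioc 0 lam₀, ∀ q ∈ multiIdx (m - 1),
      IsSmoothPeriodic (v lam q.1 q.2))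
    (hv_symm : ∀ lam ∈ Set.Ioc 0 lam₀, IsSymmetricDiff (m - 1) (scaledCoeff lam (v lam)))
    {C : ℝ} (hv_bound : ∀ lam ∈ Set.Ioc 0 lam₀, ∀ q ∈ multiIdx (m - 1), ∀ p : ℝ × ℝ,
      ‖v lam q.1 q.2 p‖ ≤ C) :
    ∃ (M₀ Mm : Mat n) (Γ : ℝ), IsDominant m M₀ Mm ∧ 0 ≤ Γ ∧ ∀ lam ∈ Ioc 0 lam₀,
      IsEllipticRealization m lam M₀ Mm Γ (semiWeyl m lam (semiSymb m s s' lam))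
        (periodicH m s s' lam) ∧
      IsEllipticRealization m lam M₀ Mm Γ
        (fun i j p => semiWeyl m lam (semiSymb m s s' lam) i j p + lowerCoeff (m - 1) (v lam) i j p)
        (periodicH m s s' lam + diffOp (m - 1) (scaledCoeff lam (v lam))) := by
  obtain ⟨M₀, Mm, hM₀, hMm, hu₀, hu, hcond, hlead⟩ := hs.leading
  have hg : ∀ q ∈ multiIdx m,
      IsGluable y₀ (s q.1 q.2) (s' q.1 q.2) (sp q.1 q.2) (sm q.1 q.2) :=
    fun q hq => isGluable hs.smooth hs.eq_plus hs.eq_minus hs' hq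
  obtain ⟨Γ, hΓ⟩ := exists_bound_semiWeyl hg
  -- One bound serves both operators, with `|C|` accounting for the perturbation.
  refine ⟨M₀, Mm, |Γ| + |C|, ⟨hM₀, hMm, hu₀, hu, hcond⟩, by positivity, fun lam hlam => ?_⟩
  have hy : lam * y₀ ≤ Real.pi / 2 := (mul_le_mul_of_nonneg_right hlam.2 hy₀.le).trans hglue
  have hdom : ∀ {Γ'}, |Γ| ≤ Γ' →
      HasDominantPart m lam M₀ Mm Γ' (semiWeyl m lam (semiSymb m s s' lam)) := fun {Γ'} h =>
    hasDominantPart_semiWeyl hg hs'.range hs.hermitian hlead hlam.1 hy fun q hq p =>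
      ⟨((hΓ lam hlam.1 hy q hq p).1.trans (le_abs_self _)).trans h,
        ((hΓ lam hlam.1 hy q hq p).2.trans (le_abs_self _)).trans h⟩
  have hherm : ∀ q ∈ multiIdx m, ∀ y, (semiSymb m s s' lam q.1 q.2 y).IsHermitian :=
    fun q hq y => by
      obtain ⟨y₁, h1⟩ := exists_semiSymb_eq (lam := lam) hs'.range y
      rw [h1 q hq]
      exact isHermitian_of_symbol (hs.hermitian y₁) hq
  have hsymm := diffT_symm (lam := lam) _
    (isSymm_semiWeyl (contDiff_semiSymb hg hlam.1 hy) periodic_semiSymb hherm)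
  have hsm : ∀ q ∈ multiIdx m,
      Continuous (semiWeyl m lam (semiSymb m s s' lam) q.1 q.2) := fun q hq =>
    ((hdom le_rfl).smooth q hq).smooth.continuous
  have hgraph : ∀ u g, (u, g) ∈ (periodicH m s s' lam).graph ↔ ∃ w, symbJ n m lam w = u ∧
      diffT m lam (semiWeyl m lam (semiSymb m s s' lam)) w = g :=
    mem_diffOp_graph_iff hlam.1.ne' hsm fun q _ p => weylCoeff_gluedCoeff q p
  have hv := hv_smooth lam hlam
  refine ⟨⟨hdom (le_add_of_nonneg_right (abs_nonneg _)), hsymm, hgraph⟩,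
    (hdom le_rfl).add_lower (abs_nonneg C) (fun q _ => isSmoothPeriodic_lowerCoeff hv _ _)
      (fun q _ p => ?_) (fun j hj => ?_), fun w w' => ?_,
    mem_graph_add_iff (Nat.sub_le m 1) hlam.1.ne' hsm hv hgraph⟩
  · by_cases h : q ∈ multiIdx (m - 1)
    · rw [lowerCoeff_of_mem h]
      exact (hv_bound lam hlam q h p).trans (le_abs_self _)
    · rw [lowerCoeff_of_notMem h, norm_zero]
      exact abs_nonneg _
  · exact lowerCoeff_of_notMem (q := (j, m - j)) fun h => by
      have := mem_multiIdx.1 h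
      omega
  · have hadd := diffT_add_apply (lam := lam) hsm
      (fun q _ => (isSmoothPeriodic_lowerCoeff hv q.1 q.2).smooth.continuous)
    rw [hadd, hadd, inner_add_left, inner_add_right, hsymm,
      diffT_lowerCoeff_symm (Nat.sub_le m 1) hv (hv_symm lam hlam)]

end PeriodicHamiltonian

end PeriodicConductivity

end

/-! ### The theorem. -/

open PeriodicConductivity in
theorem theorem6p1
    (m n : ℕ) (hm : 1 ≤ m) (E₁ E₂ y₀ : ℝ) (hE : E₁ < E₂) (hy₀ : 0 < y₀)
    -- the infinite-space Hamiltonian and the reversed domain wall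
    (s s' : ℕ → ℕ → ℝ → Mat n) (sp sm : ℕ → ℕ → Mat n)
    (hs : IsBulkHamiltonian m E₁ E₂ y₀ s sp sm) (hs' : IsReversedWall m y₀ s s' sp sm)
    (lam₀ : ℝ) (hlam₀ : 0 < lam₀) (hlam₀_le : lam₀ ≤ 1) (hglue : lam₀ * y₀ ≤ Real.pi / 2)
    -- the functions that enter the conductivity
    (φ : ℝ → ℝ) (hφ : IsSwitch 0 1 E₁ E₂ φ)
    (P : ℝ → ℝ) (hP : IsPeriodicSwitch P)
    (δ : ℝ) (hδ : 0 < δ) (hδ_lt : δ < Real.pi / 4)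
    (QX QY : ℝ → ℝ) (hQX : IsFilter δ QX) (hQY : IsFilter δ QY)
    -- the perturbation
    (v : ℝ → ℕ → ℕ → ℝ × ℝ → Mat n)
    (hv_smooth : ∀ lam ∈ Set.Ioc 0 lam₀, ∀ q ∈ multiIdx (m - 1),
      IsSmoothPeriodic (v lam q.1 q.2))
    (hv_symm : ∀ lam ∈ Set.Ioc 0 lam₀, IsSymmetricDiff (m - 1) (scaledCoeff lam (v lam)))
    (C : ℝ) (hv_bound : ∀ lam ∈ Set.Ioc 0 lam₀, ∀ q ∈ multiIdx (m - 1), ∀ p : ℝ × ℝ,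
      ‖v lam q.1 q.2 p‖ ≤ C)
    (S₁ : Set (ℝ × ℝ)) (hS₁ : IsClosed S₁)
    (hS₁_periodic : ∀ x y : ℝ, ((x + 2 * Real.pi, y) ∈ S₁ ↔ (x, y) ∈ S₁) ∧
      ((x, y + 2 * Real.pi) ∈ S₁ ↔ (x, y) ∈ S₁))
    (hv_supp : ∀ lam ∈ Set.Ioc 0 lam₀, ∀ q ∈ multiIdx (m - 1), tsupport (v lam q.1 q.2) ⊆ S₁)
    (hS₁_disj : Disjoint
      (tsupport fun p : ℝ × ℝ => (1 - QX p.1 * QY p.2) * deriv P p.1) S₁) :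
    (∀ lam ∈ Set.Ioc 0 lam₀,
      ConductivityWellDefined (periodicH m s s' lam)
        (fun p => P p.1) (fun p => QX p.1 * QY p.2) φ ∧
      ConductivityWellDefined
        (periodicH m s s' lam + diffOp (m - 1) (scaledCoeff lam (v lam)))
        (fun p => P p.1) (fun p => QX p.1 * QY p.2) φ) ∧
    ∀ N : ℕ, ∃ C_N : ℝ, ∀ lam ∈ Set.Ioc 0 lam₀,
      ‖conductivity (periodicH m s s' lam + diffOp (m - 1) (scaledCoeff lam (v lam)))
          (fun p => P p.1) (fun p => QX p.1 * QY p.2) φ -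
        conductivity (periodicH m s s' lam)
          (fun p => P p.1) (fun p => QX p.1 * QY p.2) φ‖ ≤ C_N * lam ^ N := by
  obtain ⟨M₀, Mm, Γ, hd, hΓ, hreal⟩ :=
    exists_isEllipticRealization hm hs hs' hy₀ hglue hv_smooth hv_symm hv_bound
  obtain ⟨χ, hχ, hχc, hχφ⟩ := hφ.exists_cutoff
  have hQ := isSmoothPeriodic_fst_mul_snd hQX.1 hQY.1 hQX.2.1 hQY.2.1
  -- Stability is applied with `K` the support of `(1 - Q) P'` and `S = S₁`.
  refine conductivity_stable hm hlam₀_le hd hΓ (fun lam hlam => (hreal lam hlam).1)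
    (fun lam hlam => (hreal lam hlam).2) hφ.contDiff_deriv hφ.hasCompactSupport_deriv hχ hχc hχφ
    (isSmoothPeriodic_fst hP.1 hP.2.1) hQ (isClosed_tsupport _) hS₁ hS₁_periodic hS₁_disj
    (fun p hp => eq_one_or_eventually_eq (hP.1.differentiable (by simp)) hQ.smooth.continuous hp)
    fun lam hlam p hp q _ => ?_
  refine (add_eq_left.2 ?_).symm
  by_cases h : q ∈ multiIdx (m - 1)
  · rw [lowerCoeff_of_mem h]
    exact image_eq_zero_of_notMem_tsupport fun hp' => hp (hv_supp lam hlam q h hp')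
  · rw [lowerCoeff_of_notMem h]
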